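/- Let $p$ be a prime, $r\ge 0$, and let $R$ be a complete Noetherian local ring whose residue field is perfect of characteristic $p$. Let $G$ be a $p$-divisible (Barsotti–Tate) group over $R$ with identity component $G_0$, and suppose that $G_0$ has a direct summand $G_0'$ (with projection $\rho:G_0\to G_0'$) whose formal group is one-dimensional, i.e. $\mathcal O_{G_0'}\cong R[[X]]$ as $R$-algebras. (1) There are $p$-divisible groups $G'$ and $G_{et}$ over $R$, with $G_{et}$ étale, and a commutative diagram with exact rows $$\begin{array}{ccccccccc}0&\to& G_0&\to& G&\to& G_{et}&\to& 0\\ &&\downarrow{\scriptstyle\rho}&&\downarrow&&\|&&\\ 0&\to& G_0'&\to& G'&\to& G_{et}&\to& 0\end{array}$$ in which the first row begins with the inclusion of $G_0$ (so that the left square is a pushout). For any such diagram, write ${}_{p^r}(-)$ for $p^r$-torsion, let $G''=G'\times_{G_{et}}{}_{p^r}G_{et}$, an extension of ${}_{p^r}G_{et}$ by $G_0'$ that contains ${}_{p^r}G'$, and let $k=\mathcal O_{{}_{p^r}G'}$. Let $u$ be the tautological $k$-point of $G''$ given by the inclusion ${}_{p^r}G'\to G''$. (2) There is a parameter on $G''$: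 an element $z\in\mathcal O_{G''}$ that generates the ideal of the zero section, so that $\mathcal O_{G''}/(z)=R$. (3) For every parameter $z$ and every $\alpha\in\mathbb Z/p^r$ (identified with the character group of $\mathbb Z/p^r$), let $z_\alpha\in\mathcal O_{G''}\widehat\otimes_R k$ be the translate $z_\alpha(g)=z(g-\alpha u)$ of $z$, and let $B$ be the completion of $\mathcal O_{G''}\widehat\otimes_R k$ at the ideal generated by $\prod_\alpha z_\alpha$. Then $z$ determines a $\mathbb Z/p^r$-equivariant formal group law on $B$ over $k$. That is, there is exactly one such structure on $B$ whose comultiplication is induced by the group structure of $G''$, whose homomorphism $\theta_\alpha:B\to k$ is evaluation at the point $\alpha u$ for every $\alpha$, and whose coordinates $x_\alpha$ are the images of the $z_\alpha$ (so that $x_0$ is the image of $z$). Here a $\mathbb Z/p^r$-equivariant formal group law over $k$ on a ring $B$ with ideal $I$ consists of a continuous comultiplication $B\to B\widehat\otimes_k B$, homomorphisms $\theta_\alpha:B\to k$ and elements $x_\alpha\in B$ ($\alpha\in\mathbb Z/p^r$) such that: $B$ is $I$-adically complete and $I$ is generated by $\prod_\alpha x_\alpha$; $B$ is a commutative, cocommutative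 formal Hopf algebra with counit $\theta_0$; $(\theta_\alpha)_\alpha$ is a homomorphism of Hopf algebras to the algebra of functions $\mathbb Z/p^r\to k$ (the $k$-linear dual of $k[\mathbb Z/p^r]$); each $x_\alpha$ is a nonzerodivisor generating the kernel of $\theta_\alpha$, so that $B/(x_\alpha)\cong k$; and translation by $\theta_\alpha$ carries $x_\beta$ to $x_{\beta-\alpha}$. -/

import Mathlib

open scoped TensorProduct

universe u

noncomputable section

/-! ### Commutative affine group schemes as Hopf algebras

A commutative affine group scheme over `R` is a commutative, cocommutative Hopf algebra `A`; its
group of points in a commutative `R`-algebra `T` is Mathlib's convolution group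
`WithConv (A →ₐ[R] T)`.  A homomorphism of group schemes `X → Y` is a bialgebra homomorphism
`O(Y) →ₐc[R] O(X)`. -/

namespace HopfGroup

variable {R : Type u} [CommRing R]

/-- The ideal cutting out the kernel of the homomorphism of affine group schemes
`Spec A → Spec E` given by `φ : E → A`: it is generated by the image of the augmentation ideal. -/
def kernelIdeal {E A : Type u} [CommRing E] [HopfAlgebra R E] [CommRing A] [HopfAlgebra R A]
    (φ : E →ₐc[R] A) : Ideal A :=
  Ideal.map φ (RingHom.ker (Bialgebra.counitAlgHom R E))

/-- Multiplication by `n` on a commutative group scheme `Spec A` (the `n`-th convolution power of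
the identity). -/
def mulBy (R : Type u) [CommRing R] (A : Type u) [CommRing A] [HopfAlgebra R A]
    [Coalgebra.IsCocomm R A] (n : ℕ) : A →ₐc[R] A :=
  ((WithConv.toConv (BialgHom.id R A)) ^ n).ofConv

section lemmas

variable {E A B : Type u} [CommRing E] [HopfAlgebra R E] [CommRing A] [HopfAlgebra R A]
  [CommRing B] [HopfAlgebra R B]

theorem conv_pow_comp {T : Type u} [CommRing T] [Algebra R T] (f : E →ₐc[R] A)
    (w : WithConv (A →ₐ[R] T)) (n : ℕ) :
    (w ^ n).ofConv.comp (f : E →ₐ[R] A) =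
      ((WithConv.toConv (w.ofConv.comp (f : E →ₐ[R] A))) ^ n).ofConv := by
  induction n with
  | zero =>
    ext a
    simp [AlgHom.convOne_def]
  | succ n ih =>
    rw [pow_succ, AlgHom.convMul_comp_bialgHom_distrib, ih, pow_succ]

theorem comp_conv_pow {T T' : Type u} [CommRing T] [Algebra R T] [CommRing T'] [Algebra R T']
    (h : T →ₐ[R] T') (w : WithConv (A →ₐ[R] T)) (n : ℕ) :
    h.comp (w ^ n).ofConv = ((WithConv.toConv (h.comp w.ofConv)) ^ n).ofConv := by
  induction n with
  | zero =>
    ext a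
    simp [AlgHom.convOne_def]
  | succ n ih =>
    rw [pow_succ, AlgHom.comp_convMul_distrib, ih, pow_succ]

theorem mulBy_toAlgHom [Coalgebra.IsCocomm R A] (n : ℕ) :
    ((mulBy R A n : A →ₐc[R] A) : A →ₐ[R] A) =
      ((WithConv.toConv (AlgHom.id R A)) ^ n).ofConv := by
  have := BialgHom.toAlgHom_convPow (WithConv.toConv (BialgHom.id R A)) n
  exact congrArg WithConv.ofConv this

theorem mulBy_naturality [Coalgebra.IsCocomm R A] [Coalgebra.IsCocomm R B] (f : A →ₐc[R] B)
    (n : ℕ) (a : A) : f (mulBy R A n a) = mulBy R B n (f a) := by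
  have h1 := comp_conv_pow (f : A →ₐ[R] B) (WithConv.toConv (AlgHom.id R A)) n
  have h2 := conv_pow_comp f (WithConv.toConv (AlgHom.id R B)) n
  rw [← mulBy_toAlgHom] at h1 h2
  have h3 := h1.trans (Eq.trans (by simp) h2.symm)
  exact DFunLike.congr_fun h3 a

theorem counit_mulBy [Coalgebra.IsCocomm R A] (n : ℕ) (a : A) :
    Coalgebra.counit (R := R) (mulBy R A n a) = Coalgebra.counit (R := R) a :=
  CoalgHomClass.counit_comp_apply (mulBy R A n) a

/-- The kernel of a homomorphism of group schemes is a closed subgroup scheme. -/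
instance kernelIdeal_isHopfIdeal (φ : E →ₐc[R] A) : (kernelIdeal φ).IsHopfIdeal R := by
  have hφ : ∀ e : E, Coalgebra.counit (R := R) e = 0 →
      (Ideal.Quotient.mkₐ R (kernelIdeal φ)) (φ e) = 0 := fun e he =>
    Ideal.Quotient.eq_zero_iff_mem.2 (Ideal.mem_map_of_mem φ he)
  have hmk : (Ideal.Quotient.mkₐ R (kernelIdeal φ)).comp (φ : E →ₐ[R] A) =
      (Algebra.ofId R _).comp (Bialgebra.counitAlgHom R E) := by
    ext e
    have h := hφ (e - algebraMap R E (Coalgebra.counit (R := R) e)) (by simp)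
    rw [map_sub, map_sub, sub_eq_zero] at h
    refine (show _ = _ from h).trans ?_
    have : φ (algebraMap R E (Coalgebra.counit (R := R) e)) =
      algebraMap R A (Coalgebra.counit (R := R) e) := AlgHomClass.commutes φ _
    rw [this]
    rfl
  have hker : ∀ (B : Type u) [CommRing B] [Algebra R B] (F : A →ₐ[R] B),
      (∀ e : E, Coalgebra.counit (R := R) e = 0 → F (φ e) = 0) →
      ∀ x ∈ kernelIdeal φ, F x = 0 := by
    intro B _ _ F hF x hx
    have : kernelIdeal φ ≤ RingHom.ker F := by
      refine Ideal.map_le_iff_le_comap.2 fun e he => ?_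
      exact hF e he
    exact this hx
  refine { counit_eq_zero := ?_, map_mkQ_comul_eq_zero := ?_, antipode_mem := ?_ }
  · intro x hx
    refine hker R (Bialgebra.counitAlgHom R A) (fun e he => ?_) x hx
    exact (CoalgHomClass.counit_comp_apply φ e).trans he
  · intro x hx
    refine hker _ ((Algebra.TensorProduct.map (Ideal.Quotient.mkₐ R (kernelIdeal φ))
      (Ideal.Quotient.mkₐ R (kernelIdeal φ))).comp (Bialgebra.comulAlgHom R A)) (fun e he => ?_) x hx
    have h1 : ((Algebra.TensorProduct.map (Ideal.Quotient.mkₐ R (kernelIdeal φ))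
        (Ideal.Quotient.mkₐ R (kernelIdeal φ))).comp (Bialgebra.comulAlgHom R A)).comp
          (φ : E →ₐ[R] A) =
        (Algebra.TensorProduct.map ((Ideal.Quotient.mkₐ R (kernelIdeal φ)).comp (φ : E →ₐ[R] A))
          ((Ideal.Quotient.mkₐ R (kernelIdeal φ)).comp (φ : E →ₐ[R] A))).comp
          (Bialgebra.comulAlgHom R E) := by
      rw [Algebra.TensorProduct.map_comp, AlgHom.comp_assoc, AlgHom.comp_assoc]
      congr 1
      ext a
      exact (CoalgHomClass.map_comp_comul_apply φ a).symm
    refine (DFunLike.congr_fun h1 e).trans ?_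
    rw [hmk]
    have h2 : (Algebra.TensorProduct.map
        ((Algebra.ofId R (A ⧸ kernelIdeal φ)).comp (Bialgebra.counitAlgHom R E))
        ((Algebra.ofId R (A ⧸ kernelIdeal φ)).comp (Bialgebra.counitAlgHom R E))).comp
          (Bialgebra.comulAlgHom R E) =
        (Algebra.ofId R _).comp (Bialgebra.counitAlgHom R E) := by
      rw [Algebra.TensorProduct.map_comp, AlgHom.comp_assoc]
      ext a
      have h3 : Algebra.TensorProduct.map (Bialgebra.counitAlgHom R E)
          (Bialgebra.counitAlgHom R E) (Coalgebra.comul (R := R) a) =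
          (1 : R) ⊗ₜ[R] Coalgebra.counit (R := R) a := by
        have h4 := congrArg (LinearMap.lTensor R (Coalgebra.counit (R := R) (A := E)))
          (Coalgebra.rTensor_counit_comul (R := R) a)
        rw [LinearMap.lTensor_tmul] at h4
        rw [← h4, ← LinearMap.comp_apply, LinearMap.lTensor_comp_rTensor]
        rfl
      change Algebra.TensorProduct.map _ _ (Algebra.TensorProduct.map (Bialgebra.counitAlgHom R E)
          (Bialgebra.counitAlgHom R E) (Coalgebra.comul (R := R) a)) = _
      rw [h3, Algebra.TensorProduct.map_tmul, map_one]
      exact (Algebra.TensorProduct.tmul_one_eq_one_tmul _).symm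
    refine (DFunLike.congr_fun h2 e).trans ?_
    simp [he]
  · intro x hx
    refine Ideal.Quotient.eq_zero_iff_mem.1 (hker _ ((Ideal.Quotient.mkₐ R (kernelIdeal φ)).comp
      (HopfAlgebra.antipodeAlgHom R A)) (fun e he => ?_) x hx)
    have hS : ((HopfAlgebra.antipodeAlgHom R A).comp (φ : E →ₐ[R] A)) =
        (φ : E →ₐ[R] A).comp (HopfAlgebra.antipodeAlgHom R E) := by
      have h1 : WithConv.toConv ((HopfAlgebra.antipodeAlgHom R A).comp (φ : E →ₐ[R] A)) *
          WithConv.toConv (φ : E →ₐ[R] A) = 1 := by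
        have h2 := AlgHom.convMul_comp_bialgHom_distrib
          (WithConv.toConv (HopfAlgebra.antipodeAlgHom R A)) (WithConv.toConv (AlgHom.id R A)) φ
        rw [AlgHom.antipode_id_cancel] at h2
        have h3 : (1 : WithConv (A →ₐ[R] A)).ofConv.comp (φ : E →ₐ[R] A) =
            (1 : WithConv (E →ₐ[R] A)).ofConv := by
          ext a
          simp [AlgHom.convOne_def]
        exact WithConv.ofConv_injective (h2.symm.trans h3)
      have h4 := eq_inv_of_mul_eq_one_left h1
      exact congrArg WithConv.ofConv h4
    have h5 : HopfAlgebra.antipodeAlgHom R A (φ e) = φ (HopfAlgebra.antipodeAlgHom R E e) :=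
      DFunLike.congr_fun hS e
    change Ideal.Quotient.mkₐ R (kernelIdeal φ) (HopfAlgebra.antipodeAlgHom R A (φ e)) = 0
    rw [h5]
    refine hφ _ ?_
    have := DFunLike.congr_fun (AlgHom.counitAlgHom_comp_antipodeAlgHom (R := R) (A := E)) e
    exact this.trans he

/-- A homomorphism `f` of Hopf algebras carrying `φ` to `ψ` induces a homomorphism between the
coordinate rings of the kernels. -/
def kernelMap {E' : Type u} [CommRing E'] [HopfAlgebra R E'] (φ : E →ₐc[R] A) (ψ : E' →ₐc[R] B)
    (f : A →ₐc[R] B) (h : kernelIdeal φ ≤ (kernelIdeal ψ).comap f) :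
    A ⧸ kernelIdeal φ →ₐc[R] B ⧸ kernelIdeal ψ :=
  BialgHom.ofAlgHom (Ideal.quotientMapₐ (kernelIdeal ψ) (f : A →ₐ[R] B) h)
    (by
      refine Ideal.Quotient.algHom_ext R (AlgHom.ext fun a => ?_)
      exact CoalgHomClass.counit_comp_apply f a)
    (by
      refine Ideal.Quotient.algHom_ext R ?_
      have h1 : (Bialgebra.comulAlgHom R B).comp (f : A →ₐ[R] B) =
          (Algebra.TensorProduct.map (f : A →ₐ[R] B) (f : A →ₐ[R] B)).comp
            (Bialgebra.comulAlgHom R A) := by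
        ext a
        exact (CoalgHomClass.map_comp_comul_apply f a).symm
      have h2 : (Algebra.TensorProduct.map (Ideal.quotientMapₐ (kernelIdeal ψ) (f : A →ₐ[R] B) h)
          (Ideal.quotientMapₐ (kernelIdeal ψ) (f : A →ₐ[R] B) h)).comp
            (Algebra.TensorProduct.map (Ideal.Quotient.mkₐ R (kernelIdeal φ))
              (Ideal.Quotient.mkₐ R (kernelIdeal φ))) =
          (Algebra.TensorProduct.map (Ideal.Quotient.mkₐ R (kernelIdeal ψ))
              (Ideal.Quotient.mkₐ R (kernelIdeal ψ))).comp
            (Algebra.TensorProduct.map (f : A →ₐ[R] B) (f : A →ₐ[R] B)) := by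
        rw [← Algebra.TensorProduct.map_comp, ← Algebra.TensorProduct.map_comp]
        rfl
      ext a
      have h3 := congrArg (Algebra.TensorProduct.map (Ideal.Quotient.mkₐ R (kernelIdeal ψ))
              (Ideal.Quotient.mkₐ R (kernelIdeal ψ))) (DFunLike.congr_fun h1 a)
      have h4 := DFunLike.congr_fun h2 (Bialgebra.comulAlgHom R A a)
      exact h4.trans h3.symm)

end lemmas

end HopfGroup

/-- The inverse limit of a tower of `k`-algebras. -/
def towerLimit {k : Type u} [CommRing k] (A : ℕ → Type u) [∀ v, CommRing (A v)]
    [∀ v, Algebra k (A v)] (t : ∀ v, A (v + 1) →ₐ[k] A v) : Subalgebra k (∀ v, A v) where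
  carrier := {a | ∀ v, t v (a (v + 1)) = a v}
  mul_mem' ha hb v := by simp [ha v, hb v]
  add_mem' ha hb v := by simp [ha v, hb v]
  algebraMap_mem' r v := by simp

/-! ### `p`-divisible groups -/

/-- A `p`-divisible (Barsotti–Tate) group over a local ring `R`: an inductive system
`G_0 → G_1 → G_2 → ⋯` of finite flat commutative group schemes `G_v = Spec (A v)`, `G_v` of order
`p ^ (v * h)`, such that `G_v → G_{v+1}` is a closed immersion identifying `G_v` with the kernel of
`p ^ v` on `G_{v+1}`.  (Over a local ring finite flat of finite presentation means finite free.) -/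
structure PDivGroup (R : Type u) [CommRing R] (p : ℕ) where
  height : ℕ
  A : ℕ → Type u
  [commRing : ∀ v, CommRing (A v)]
  [hopfAlgebra : ∀ v, HopfAlgebra R (A v)]
  [isCocomm : ∀ v, Coalgebra.IsCocomm R (A v)]
  [finite : ∀ v, Module.Finite R (A v)]
  [free : ∀ v, Module.Free R (A v)]
  finrank_eq : ∀ v, Module.finrank R (A v) = p ^ (v * height)
  trans : ∀ v, A (v + 1) →ₐc[R] A v
  trans_surjective : ∀ v, Function.Surjective (trans v)
  ker_trans : ∀ v, RingHom.ker (trans v) =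
    HopfGroup.kernelIdeal (HopfGroup.mulBy R (A (v + 1)) (p ^ v))

namespace PDivGroup

attribute [instance] commRing hopfAlgebra isCocomm finite free

variable {R : Type u} [CommRing R] {p : ℕ}

/-- A homomorphism `X → Y` of `p`-divisible groups: compatible homomorphisms `X_v → Y_v`, given on
coordinate rings. -/
structure Hom (X Y : PDivGroup R p) where
  app : ∀ v, Y.A v →ₐc[R] X.A v
  comm : ∀ v a, X.trans v (app (v + 1) a) = app v (Y.trans v a)

/-- The coordinate ring `O_G = lim_v O(G_v)` of a `p`-divisible group. -/
def coordRing (G : PDivGroup R p) : Subalgebra R (∀ v, G.A v) :=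
  towerLimit G.A fun v => (G.trans v : G.A (v + 1) →ₐ[R] G.A v)

/-- A (connected) `p`-divisible group is one-dimensional when its formal group is one-dimensional,
that is, its coordinate ring is a power series ring in one variable. -/
def IsOneDimensional (G : PDivGroup R p) : Prop :=
  Nonempty (PowerSeries R ≃ₐ[R] G.coordRing)

/-- `0 → X → Y → Z → 0` is exact: at each level `Y_v → Z_v` is faithfully flat with kernel `X_v`. -/
structure IsShortExact {X Y Z : PDivGroup R p} (i : Hom X Y) (q : Hom Y Z) : Prop where
  surjective : ∀ v, Function.Surjective (i.app v)
  ker_eq : ∀ v, RingHom.ker (i.app v) = HopfGroup.kernelIdeal (q.app v)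
  faithfullyFlat : ∀ v, ((q.app v : Z.A v →ₐ[R] Y.A v) : Z.A v →+* Y.A v).FaithfullyFlat

/-- `ι : G₀ → G` is the identity component of `G` (over a complete local ring): at each level it is
an open and closed immersion (its ideal is generated by an idempotent) and `G₀` is connected (the
spectrum of a local ring). -/
structure IsIdentityComponent {G₀ G : PDivGroup R p} (ι : Hom G₀ G) : Prop where
  surjective : ∀ v, Function.Surjective (ι.app v)
  clopen : ∀ v, ∃ e : G.A v, IsIdempotentElem e ∧ RingHom.ker (ι.app v) = Ideal.span {e}
  isLocalRing : ∀ v, IsLocalRing (G₀.A v)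

/-- `G₀'` is a direct summand of `G₀` with projection `ρ` (in the additive category of
`p`-divisible groups): `ρ` has a section `s`. -/
def IsSummandProj {G₀ G₀' : PDivGroup R p} (ρ : Hom G₀ G₀') : Prop :=
  ∃ s : Hom G₀' G₀, ∀ v a, s.app v (ρ.app v a) = a

section torsion

variable (G : PDivGroup R p)

theorem mulBy_eq (r : ℕ) (a : G.A r) :
    HopfGroup.mulBy R (G.A r) (p ^ r) a = algebraMap R (G.A r) (Coalgebra.counit (R := R) a) := by
  obtain ⟨b, rfl⟩ := G.trans_surjective r a
  have hb : Coalgebra.counit (R := R) (G.trans r b) = Coalgebra.counit (R := R) b :=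
    CoalgHomClass.counit_comp_apply (G.trans r) b
  rw [← HopfGroup.mulBy_naturality, hb]
  have h0 : HopfGroup.mulBy R (G.A (r + 1)) (p ^ r)
      (b - algebraMap R _ (Coalgebra.counit (R := R) b)) ∈ RingHom.ker (G.trans r) := by
    rw [G.ker_trans r]
    refine Ideal.mem_map_of_mem _ ?_
    rw [RingHom.mem_ker]
    simp
  rw [RingHom.mem_ker, map_sub, map_sub, sub_eq_zero] at h0
  rw [h0, AlgHomClass.commutes, AlgHomClass.commutes]

/-- The restriction `O(G_{r+n}) → O(G_r)` to the `p ^ r`-torsion subgroup. -/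
def restrict (r : ℕ) : ∀ n, G.A (r + n) →ₐc[R] G.A r
  | 0 => BialgHom.id R (G.A r)
  | n + 1 => (restrict r n).comp (G.trans (r + n))

end torsion

/-- The diagram attached to the identity component `ι : G₀ → G` and a projection `ρ : G₀ → G₀'`:

    0 → G₀  → G  → Gₑₜ → 0
        ↓ρ    ↓π    ‖
    0 → G₀' → G' → Gₑₜ → 0

with exact rows and `Gₑₜ` étale.  (The left square is then a pushout, so that the diagram is
determined by `ι` and `ρ` up to unique isomorphism.) -/
structure PushoutDiagram {G₀ G G₀' : PDivGroup R p} (ι : Hom G₀ G) (ρ : Hom G₀ G₀') where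
  Get : PDivGroup R p
  etale : ∀ v, Algebra.Etale R (Get.A v)
  q : Hom G Get
  exact : IsShortExact ι q
  G' : PDivGroup R p
  j : Hom G₀' G'
  q' : Hom G' Get
  exact' : IsShortExact j q'
  π : Hom G G'
  comm_left : ∀ v a, ι.app v (π.app v a) = ρ.app v (j.app v a)
  comm_right : ∀ v a, π.app v (q'.app v a) = q.app v a

namespace PushoutDiagram

variable {G₀ G G₀' : PDivGroup R p} {ι : Hom G₀ G} {ρ : Hom G₀ G₀'} (D : PushoutDiagram ι ρ)
  (r : ℕ)

/-- On coordinate rings, the homomorphism `G'_v → (Gₑₜ)_v`, `g ↦ q' (p ^ r g)`. -/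
def torsionHom (v : ℕ) : D.Get.A v →ₐc[R] D.G'.A v :=
  (HopfGroup.mulBy R (D.G'.A v) (p ^ r)).comp (D.q'.app v)

/-- The coordinate ring of the `n`-th level `G''_{r+n} = {g ∈ G'_{r+n} | q' g ∈ Gₑₜ[p ^ r]}` of the
pullback `G'' = G' ×_{Gₑₜ} Gₑₜ[p ^ r]`.  (The levels below `r` are cofinally irrelevant.) -/
abbrev level (n : ℕ) : Type u :=
  D.G'.A (r + n) ⧸ HopfGroup.kernelIdeal (D.torsionHom r (r + n))

/-- The homomorphism of coordinate rings given by the inclusion `G''_{r+n} → G''_{r+n+1}`. -/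
def levelTrans (n : ℕ) : D.level r (n + 1) →ₐc[R] D.level r n :=
  HopfGroup.kernelMap _ _ (D.G'.trans (r + n)) (by
    refine Ideal.map_le_iff_le_comap.2 fun e he => ?_
    change D.G'.trans (r + n) (HopfGroup.mulBy R _ (p ^ r) (D.q'.app (r + n + 1) e)) ∈
      HopfGroup.kernelIdeal (D.torsionHom r (r + n))
    rw [HopfGroup.mulBy_naturality, D.q'.comm]
    refine Ideal.mem_map_of_mem (D.torsionHom r (r + n)) ?_
    rw [RingHom.mem_ker] at he ⊢
    exact (CoalgHomClass.counit_comp_apply (D.Get.trans (r + n)) e).trans he)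

/-- The coordinate ring `O_{G''} = lim_n O(G''_{r+n})`. -/
def coordRing'' : Subalgebra R (∀ n, D.level r n) :=
  towerLimit (D.level r) fun n => (D.levelTrans r n : D.level r (n + 1) →ₐ[R] D.level r n)

/-- The zero section of `G''`, as the augmentation `O_{G''} → R`. -/
def augmentation : D.coordRing'' r →ₐ[R] R :=
  (Bialgebra.counitAlgHom R (D.level r 0)).comp
    ((Pi.evalAlgHom R (D.level r) 0).comp (D.coordRing'' r).val)

/-- `z ∈ O_{G''}` is a parameter: it generates the ideal of the zero section, so that
`O_{G''} / (z) = R`. -/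
def IsParameter (z : D.coordRing'' r) : Prop :=
  RingHom.ker (D.augmentation r) = Ideal.span {z}

/-- The base ring `k = O(G'[p ^ r])`. -/
abbrev base : Type u := D.G'.A r

/-- The tautological point of `G''` over `k = O(G'[p ^ r])`: the inclusion `G'[p ^ r] → G''`. -/
def tautPoint (n : ℕ) : D.level r n →ₐ[R] D.base r :=
  Ideal.Quotient.liftₐ _ ((D.G'.restrict r n : D.G'.A (r + n) →ₐc[R] D.G'.A r) :
      D.G'.A (r + n) →ₐ[R] D.G'.A r) (by
    intro a ha
    have : HopfGroup.kernelIdeal (D.torsionHom r (r + n)) ≤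
        RingHom.ker (D.G'.restrict r n) := by
      refine Ideal.map_le_iff_le_comap.2 fun e he => ?_
      change D.G'.restrict r n (HopfGroup.mulBy R _ (p ^ r) (D.q'.app (r + n) e)) = 0
      rw [HopfGroup.mulBy_naturality, mulBy_eq]
      have h1 : Coalgebra.counit (R := R) (D.G'.restrict r n (D.q'.app (r + n) e)) =
          Coalgebra.counit (R := R) e :=
        (CoalgHomClass.counit_comp_apply (D.G'.restrict r n) _).trans
          (CoalgHomClass.counit_comp_apply (D.q'.app (r + n)) e)
      rw [h1, show Coalgebra.counit (R := R) e = 0 from he, map_zero]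
    exact this ha)

theorem tautPoint_levelTrans (n : ℕ) :
    (D.tautPoint r n).comp (D.levelTrans r n : D.level r (n + 1) →ₐ[R] D.level r n) =
      D.tautPoint r (n + 1) := by
  refine Ideal.Quotient.algHom_ext R (AlgHom.ext fun a => ?_)
  rfl

/-- The completed tensor product `O_{G''} ⊗̂_R k = lim_n O(G''_{r+n}) ⊗_R k`, the coordinate ring of
`G'' × G'[p ^ r]`; it is a `k`-algebra through the second factor of this product. -/
def baseChange : Subalgebra (D.base r) (∀ n, D.base r ⊗[R] D.level r n) :=
  towerLimit (fun n => D.base r ⊗[R] D.level r n) fun n =>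
    Algebra.TensorProduct.map (AlgHom.id (D.base r) (D.base r))
      (D.levelTrans r n : D.level r (n + 1) →ₐ[R] D.level r n)

/-- The underlying ring of `O_{G''} ⊗̂_R k`. -/
def productRing : Type u := D.baseChange r

instance : CommRing (D.productRing r) := inferInstanceAs (CommRing (D.baseChange r))

instance : Algebra (D.base r) (D.productRing r) :=
  inferInstanceAs (Algebra (D.base r) (D.baseChange r))

instance : Algebra R (D.productRing r) := inferInstanceAs (Algebra R (D.baseChange r))

instance : IsScalarTower R (D.base r) (D.productRing r) :=
  inferInstanceAs (IsScalarTower R (D.base r) (D.baseChange r))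

/-- The canonical map `O_{G''} → O_{G''} ⊗̂_R k`. -/
def toProductRing : D.coordRing'' r →ₐ[R] D.productRing r where
  toFun a := ⟨fun n => 1 ⊗ₜ a.1 n, fun n => by
    have := a.2 n
    change Algebra.TensorProduct.map _ _ (1 ⊗ₜ a.1 (n + 1)) = _
    rw [Algebra.TensorProduct.map_tmul, map_one, this]⟩
  map_one' := rfl
  map_mul' a b := by
    refine Subtype.ext (funext fun n => ?_)
    change (1 : D.base r) ⊗ₜ[R] (a.1 n * b.1 n) = (1 ⊗ₜ a.1 n) * (1 ⊗ₜ b.1 n)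
    simp
  map_zero' := by
    refine Subtype.ext (funext fun n => ?_)
    exact TensorProduct.tmul_zero _ _
  map_add' a b := by
    refine Subtype.ext (funext fun n => ?_)
    exact TensorProduct.tmul_add _ _ _
  commutes' c := by
    refine Subtype.ext (funext fun n => ?_)
    exact ((Algebra.TensorProduct.includeRight : D.level r n →ₐ[R] D.base r ⊗[R] D.level r n)).commutes c

/-- Translation by `m` times the tautological point `u`, on coordinate rings: the `k ⊗ O(G''_{r+n})`
valued point `(u, g) ↦ g + m u` of `G''_{r+n}`. -/
def translateHom (m n : ℕ) : D.level r n →ₐ[R] D.base r ⊗[R] D.level r n :=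
  (WithConv.toConv
      (Algebra.TensorProduct.includeRight : D.level r n →ₐ[R] D.base r ⊗[R] D.level r n) *
    WithConv.toConv ((Algebra.TensorProduct.includeLeft :
      D.base r →ₐ[R] D.base r ⊗[R] D.level r n).comp (D.tautPoint r n)) ^ m).ofConv

theorem translateHom_levelTrans (m n : ℕ) (a : D.level r (n + 1)) :
    Algebra.TensorProduct.map (AlgHom.id (D.base r) (D.base r))
      (D.levelTrans r n : D.level r (n + 1) →ₐ[R] D.level r n) (D.translateHom r m (n + 1) a) =
      D.translateHom r m n (D.levelTrans r n a) := by
  have h1 := AlgHom.comp_convMul_distrib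
    ((Algebra.TensorProduct.map (AlgHom.id R (D.base r))
      (D.levelTrans r n : D.level r (n + 1) →ₐ[R] D.level r n)))
    (WithConv.toConv (Algebra.TensorProduct.includeRight :
      D.level r (n + 1) →ₐ[R] D.base r ⊗[R] D.level r (n + 1)))
    (WithConv.toConv ((Algebra.TensorProduct.includeLeft :
      D.base r →ₐ[R] D.base r ⊗[R] D.level r (n + 1)).comp (D.tautPoint r (n + 1))) ^ m)
  have h2 := AlgHom.convMul_comp_bialgHom_distrib
    (WithConv.toConv (Algebra.TensorProduct.includeRight :
      D.level r n →ₐ[R] D.base r ⊗[R] D.level r n))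
    (WithConv.toConv ((Algebra.TensorProduct.includeLeft :
      D.base r →ₐ[R] D.base r ⊗[R] D.level r n).comp (D.tautPoint r n)) ^ m) (D.levelTrans r n)
  rw [HopfGroup.comp_conv_pow] at h1
  rw [HopfGroup.conv_pow_comp] at h2
  refine (DFunLike.congr_fun h1 a).trans (Eq.trans ?_ (DFunLike.congr_fun h2 a).symm)
  have e1 : (Algebra.TensorProduct.map (AlgHom.id R (D.base r))
      (D.levelTrans r n : D.level r (n + 1) →ₐ[R] D.level r n)).comp
        (Algebra.TensorProduct.includeRight :
          D.level r (n + 1) →ₐ[R] D.base r ⊗[R] D.level r (n + 1)) =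
      (Algebra.TensorProduct.includeRight :
          D.level r n →ₐ[R] D.base r ⊗[R] D.level r n).comp
        (D.levelTrans r n : D.level r (n + 1) →ₐ[R] D.level r n) := by
    ext b; simp
  have e2 : (Algebra.TensorProduct.map (AlgHom.id R (D.base r))
      (D.levelTrans r n : D.level r (n + 1) →ₐ[R] D.level r n)).comp
        ((Algebra.TensorProduct.includeLeft :
          D.base r →ₐ[R] D.base r ⊗[R] D.level r (n + 1)).comp (D.tautPoint r (n + 1))) =
      ((Algebra.TensorProduct.includeLeft :
          D.base r →ₐ[R] D.base r ⊗[R] D.level r n).comp (D.tautPoint r n)).comp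
        (D.levelTrans r n : D.level r (n + 1) →ₐ[R] D.level r n) := by
    rw [AlgHom.comp_assoc, tautPoint_levelTrans]
    ext b; simp
  simp only [e1, e2]

/-- The translate `z (g - α u)` of `z`, for a character `α ∈ ℤ/p^r` of `ℤ/p^r`: the function on
`G'' × G'[p ^ r]` whose divisor is the graph of `α` times the inclusion `G'[p ^ r] → G''`. -/
def translate (z : D.coordRing'' r) (α : ZMod (p ^ r)) : D.productRing r :=
  ⟨fun n => D.translateHom r (-α).val n (z.1 n), fun n => by
    have := z.2 n
    refine (D.translateHom_levelTrans r (-α).val n (z.1 (n + 1))).trans ?_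
    exact congrArg _ this⟩

variable [NeZero (p ^ r)]

/-- The ideal of `O_{G''} ⊗̂_R k` generated by the product of the translates of `z` over all
characters. -/
def translateIdeal (z : D.coordRing'' r) : Ideal (D.productRing r) :=
  Ideal.span {∏ α : ZMod (p ^ r), D.translate r z α}

/-- `O_{G''} ⊗̂_R k`, completed at the ideal generated by the product of the translates of `z`: the
ring of the formal completion of `G'' × G'[p ^ r]` along the multiples of the tautological point. -/
abbrev completedRing (z : D.coordRing'' r) : Type u :=
  AdicCompletion (D.translateIdeal r z) (D.productRing r)

/-- The canonical map from `O_{G''} ⊗̂_R k` to its completion. -/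
def complete (z : D.coordRing'' r) : D.productRing r →ₐ[D.productRing r] D.completedRing r z :=
  Algebra.ofId (D.productRing r) (D.completedRing r z)

/-- The ideal of definition of the completion. -/
def definingIdeal (z : D.coordRing'' r) : Ideal (D.completedRing r z) :=
  (D.translateIdeal r z).map (D.complete r z)

end PushoutDiagram

end PDivGroup

/-! ### Equivariant formal group laws -/

namespace FormalHopf

variable (k : Type u) [CommRing k] {B : Type u} [CommRing B] [Algebra k B]

/-- The ideal of definition `I ⊗ B + B ⊗ I` of `B ⊗ B`. -/
def tensorIdeal (I : Ideal B) : Ideal (B ⊗[k] B) :=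
  I.map (Algebra.TensorProduct.includeLeft : B →ₐ[k] B ⊗[k] B) ⊔
    I.map (Algebra.TensorProduct.includeRight : B →ₐ[k] B ⊗[k] B)

/-- The completed tensor product `B ⊗̂_k B` of the `I`-adic ring `B` with itself. -/
abbrev CompletedTensor (I : Ideal B) : Type u := AdicCompletion (tensorIdeal k I) (B ⊗[k] B)

variable {k} {T : Type u} [CommRing T] [Algebra k T]

/-- A `k`-algebra homomorphism from the `I`-adic ring `B` to a discrete ring is continuous when it
kills a power of `I`. -/
def IsContinuous (I : Ideal B) (f : B →ₐ[k] T) : Prop := ∃ n : ℕ, I ^ n ≤ RingHom.ker f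

/-- The homomorphism `f ⊗ g : B ⊗ B → T`. -/
def tensorLift (f g : B →ₐ[k] T) : B ⊗[k] B →ₐ[k] T :=
  Algebra.TensorProduct.lift f g fun _ _ => Commute.all _ _

theorem exists_pow_le_ker {I : Ideal B} {f g : B →ₐ[k] T} (hf : IsContinuous I f)
    (hg : IsContinuous I g) : ∃ n : ℕ, tensorIdeal k I ^ n ≤ RingHom.ker (tensorLift f g) := by
  obtain ⟨n, hn⟩ := hf
  obtain ⟨m, hm⟩ := hg
  refine ⟨n + m, Ideal.sup_pow_add_le_pow_sup_pow.trans (sup_le ?_ ?_)⟩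
  · rw [← Ideal.map_pow, Ideal.map_le_iff_le_comap]
    intro b hb
    have : f b = 0 := hn hb
    simp [tensorLift, this]
  · rw [← Ideal.map_pow, Ideal.map_le_iff_le_comap]
    intro b hb
    have : g b = 0 := hm hb
    simp [tensorLift, this]

theorem lift_evalₐ_eq {S : Type u} [CommRing S] [Algebra k S] (J : Ideal S) (F : S →ₐ[k] T)
    {n m : ℕ} (hnm : n ≤ m) (hn : J ^ n ≤ RingHom.ker F) (hm : J ^ m ≤ RingHom.ker F)
    (y : AdicCompletion J S) :
    Ideal.Quotient.liftₐ (J ^ n) F (fun _ ha => hn ha) (AdicCompletion.evalₐ J n y) =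
      Ideal.Quotient.liftₐ (J ^ m) F (fun _ ha => hm ha) (AdicCompletion.evalₐ J m y) := by
  obtain ⟨s, rfl⟩ := AdicCompletion.mk_surjective J S y
  rw [AdicCompletion.evalₐ_mk, AdicCompletion.evalₐ_mk]
  have h : s.val m - s.val n ∈ J ^ n :=
    Ideal.Quotient.eq.1 (AdicCompletion.Ideal.mk_eq_mk J hnm s)
  have h' : F (s.val m - s.val n) = 0 := hn h
  rw [map_sub, sub_eq_zero] at h'
  exact h'.symm

open Classical in
/-- The convolution product of two continuous homomorphisms `f g : B → T` to a discrete ring with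
respect to `Δ : B → B ⊗̂ B`: the composite of `Δ` with the continuous extension
`B ⊗̂ B → (B ⊗ B) / (I ⊗ B + B ⊗ I) ^ n → T` of `f ⊗ g` (by `conv_eq` any sufficiently large `n`
may be used).  This is the sum of `f` and `g` as `T`-points of the formal scheme `Spf B`. The value
for non-continuous homomorphisms is irrelevant. -/
def conv {I : Ideal B} (Δ : B →ₐ[k] CompletedTensor k I) (f g : B →ₐ[k] T) : B →ₐ[k] T :=
  if h : ∃ n : ℕ, tensorIdeal k I ^ n ≤ RingHom.ker (tensorLift f g) then
    ((Ideal.Quotient.liftₐ (tensorIdeal k I ^ h.choose) (tensorLift f g)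
      (fun _ ha => h.choose_spec ha)).comp
        ((AdicCompletion.evalₐ (tensorIdeal k I) h.choose).restrictScalars k)).comp Δ
  else f

theorem conv_eq {I : Ideal B} (Δ : B →ₐ[k] CompletedTensor k I) (f g : B →ₐ[k] T) (n : ℕ)
    (h : tensorIdeal k I ^ n ≤ RingHom.ker (tensorLift f g)) :
    conv Δ f g = ((Ideal.Quotient.liftₐ (tensorIdeal k I ^ n) (tensorLift f g)
      (fun _ ha => h ha)).comp
        ((AdicCompletion.evalₐ (tensorIdeal k I) n).restrictScalars k)).comp Δ := by
  have hex : ∃ n : ℕ, tensorIdeal k I ^ n ≤ RingHom.ker (tensorLift f g) := ⟨n, h⟩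
  rw [conv, dif_pos hex]
  refine AlgHom.ext fun b => ?_
  rcases le_total hex.choose n with hle | hle
  · exact lift_evalₐ_eq _ _ hle hex.choose_spec h (Δ b)
  · exact (lift_evalₐ_eq _ _ hle h hex.choose_spec (Δ b)).symm

end FormalHopf

open FormalHopf in
/-- A `Γ`-equivariant formal group law over `k` on the `I`-adic `k`-algebra `B`, for a finite abelian
group `Γ` with character group `D` (written additively): a commutative formal Hopf algebra structure
on `B` with a homomorphism `θ` from `B` to the Hopf algebra of functions `D → k` (the dual of the
group ring of `D`), and elements `x α ∈ B` that are regular and generate the kernel of `θ α`, are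
related by translation, and whose product generates the defining ideal `I`.
The identities between maps out of (completed) tensor products are expressed by their values on
arbitrary continuous points of `Spf B`. -/
structure EquivariantFGL (D : Type) [AddCommGroup D] [Fintype D] (k : Type u) [CommRing k]
    {B : Type u} [CommRing B] [Algebra k B] (I : Ideal B) where
  /-- the comultiplication -/
  comul : B →ₐ[k] CompletedTensor k I
  /-- the components of the map to the functions on the characters -/
  θ : D → B →ₐ[k] k
  /-- the coordinates -/
  x : D → B
  isAdicComplete : IsAdicComplete I B
  ideal_eq : I = Ideal.span {∏ α, x α}
  regular : ∀ α, x α ∈ nonZeroDivisors B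
  ker_θ : ∀ α, RingHom.ker (θ α) = Ideal.span {x α}
  continuous_comul : ∀ n : ℕ, ∃ m : ℕ, ∀ b ∈ I ^ m, AdicCompletion.evalₐ (tensorIdeal k I) n (comul b) = 0
  coassoc : ∀ (T : Type u) [CommRing T] [Algebra k T] (f g h : B →ₐ[k] T),
    IsContinuous I f → IsContinuous I g → IsContinuous I h →
      conv comul (conv comul f g) h = conv comul f (conv comul g h)
  cocomm : ∀ (T : Type u) [CommRing T] [Algebra k T] (f g : B →ₐ[k] T),
    IsContinuous I f → IsContinuous I g → conv comul f g = conv comul g f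
  counit : ∀ (T : Type u) [CommRing T] [Algebra k T] (f : B →ₐ[k] T), IsContinuous I f →
    conv comul ((Algebra.ofId k T).comp (θ 0)) f = f
  antipode : ∃ S : B →ₐ[k] B, (∀ n : ℕ, ∃ m : ℕ, I ^ m ≤ (I ^ n).comap S) ∧
    ∀ (T : Type u) [CommRing T] [Algebra k T] (f : B →ₐ[k] T), IsContinuous I f →
      conv comul (f.comp S) f = (Algebra.ofId k T).comp (θ 0)
  θ_add : ∀ α β, conv comul (θ α) (θ β) = θ (α + β)
  x_translate : ∀ (T : Type u) [CommRing T] [Algebra k T] (f : B →ₐ[k] T), IsContinuous I f →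
    ∀ α β, conv comul ((Algebra.ofId k T).comp (θ α)) f (x β) = f (x (β - α))

namespace PDivGroup.PushoutDiagram

open FormalHopf

variable {R : Type u} [CommRing R] {p : ℕ} {G₀ G G₀' : PDivGroup R p} {ι : Hom G₀ G}
  {ρ : Hom G₀ G₀'} (D : PushoutDiagram ι ρ) (r : ℕ) [NeZero (p ^ r)]

/-- The canonical map from `O_{G''}` to the completion of `O_{G''} ⊗̂_R k`. -/
def toCompletedRing (z : D.coordRing'' r) (a : D.coordRing'' r) : D.completedRing r z :=
  D.complete r z (D.toProductRing r a)

/-- The equivariant formal group law `F` is the one given by the group `G''`, the tautological point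
`u` of `G''` over `k = O(G'[p ^ r])`, and the parameter `z`. -/
structure IsInduced {z : D.coordRing'' r}
    (F : EquivariantFGL (ZMod (p ^ r)) (D.base r) (D.definingIdeal r z)) : Prop where
  /-- the comultiplication is that of `G''`: if two points of the formal group restrict to points
  `f`, `g` of `G''_{r+n}`, then their sum restricts to the sum of `f` and `g` -/
  comul_eq : ∀ (T : Type u) [CommRing T] [Algebra (D.base r) T] [Algebra R T]
    [IsScalarTower R (D.base r) T] (f' g' : D.completedRing r z →ₐ[D.base r] T),
    IsContinuous (D.definingIdeal r z) f' → IsContinuous (D.definingIdeal r z) g' →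
    ∀ (n : ℕ) (f g : D.level r n →ₐ[R] T),
      (∀ a, f' (D.toCompletedRing r z a) = f (a.1 n)) →
      (∀ a, g' (D.toCompletedRing r z a) = g (a.1 n)) →
      ∀ a, conv F.comul f' g' (D.toCompletedRing r z a) =
        (WithConv.toConv f * WithConv.toConv g).ofConv (a.1 n)
  /-- `θ α` is evaluation at `α` times the tautological point -/
  θ_eq : ∀ (α : ZMod (p ^ r)) (n : ℕ) (a : D.coordRing'' r),
    F.θ α (D.toCompletedRing r z a) =
      ((WithConv.toConv (D.tautPoint r n)) ^ α.val).ofConv (a.1 n)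
  /-- the coordinates are the translates of `z`, -/
  x_eq : ∀ α, F.x α = D.complete r z (D.translate r z α)
  /-- and the one at the trivial character is `z` itself -/
  x_zero : F.x 0 = D.toCompletedRing r z z

end PDivGroup.PushoutDiagram

end

noncomputable section

/-! ### Finite algebras over a perfect field -/

namespace PerfectAlg

variable (K : Type u) [Field K]

/-! Existence of the diagram. Let `e` be the idempotent endomorphism of G₀ given by the summand
(projection followed by section). G' has to be G modulo the kernel of the projection, so the
functions on its levels are the functions a on G_v with a(g + h) = a(g + e h) for h in G₀, the
equalizer `invariants` of two coactions. It must be shown that this subalgebra is a direct summand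
of the right rank, stable under the Hopf structure, and well behaved under the transition maps. Over
the perfect residue field a finite group scheme is the product of its étale and connected parts,
because reduced finite algebras there are étale (`exists_section`, `retr_tensor`); hence `e` extends
to the endomorphism id × e of the special fibre. The group splitting need not lift to R, but the
coordinates along the étale factor are contractions of the comultiplication with linear functionals,
and linear functionals do lift. Nakayama then gives an R-linear isomorphism O(G_v) ≅ O(G₀_v)^d
commuting with translation by G₀ (`exists_splitting`). It turns invariants into coordinatewise fixed
points of `e` (`exists_projector`). The resulting projector is only linear over R, but it reduces to
a ring homomorphism on the special fibre, so surjectivity and the shape of kernels are read off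
there and lifted by Nakayama. The zero summand gives the étale quotient.

The parameter. As the quotient is étale, G₀' is open and closed in G'', so a function on G'' may be
prescribed separately on and off G₀'. Put 1 off G₀', and on G₀' a generator of the augmentation
ideal of R[[X]]: the zero section sends X to some a in the maximal ideal, and X - a is a generator
by Weierstrass division.

The coordinates. The kernel of evaluation at α u is generated by z_α: for α = 0 this is the
definition of a parameter together with k being finite free over R, and translation gives the other
α.

The comultiplication is built from points. Two facts meet. First, [p^r]^* z vanishes at every α u,
so the product of the z_α divides a power of [p^r]^* z (`divisor_dvd`). Secondly, [p]^* x ≡ p x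
modulo the square of the augmentation ideal, so iterates of [p]^* push that ideal into high powers
of J = (p, [p^r]^* z); and J is topologically nilpotent on each level because [p^r] maps G'' into
the connected group G₀'. Successive approximation then puts every function vanishing on the M-th
level into J^M (`mem_torsionIdeal_pow`). Hence a point with values in an algebra killed by a power
of the maximal ideal of R, on which the product of the z_α is nilpotent, factors through a finite
level (`exists_hat`), and there points can be added.

For values in a finite k-algebra T one adds modulo each power of the maximal ideal and passes to the
limit. The product of the z_α is still nilpotent on a sum: modulo a prime each summand is a multiple
of u, hence so is the sum (`isNilpotent_isSum`). Applied to the two inclusions of B into the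
quotients of B ⊗ B, which are finite over k since B / (z_α) = k, this yields the comultiplication
(`exists_comul`). Continuous points of B have finite image, so every Hopf identity can be tested on
small algebras, where it is an axiom of the groups of points of the levels. The same test shows
uniqueness. -/

theorem etale_of_isReduced [PerfectField K] (N : Type u) [CommRing N] [Algebra K N]
    [Module.Finite K N] [IsReduced N] : Algebra.Etale K N := by
  have : IsArtinianRing N := isArtinian_of_tower K inferInstance
  have hfe : ∀ I : MaximalSpectrum N, Algebra.FormallyEtale K (N ⧸ I.asIdeal) := fun I => by
    let := Ideal.Quotient.field I.asIdeal
    exact Algebra.FormallyEtale.of_isSeparable K (N ⧸ I.asIdeal)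
  have : Algebra.FormallyEtale K (∀ I : MaximalSpectrum N, N ⧸ I.asIdeal) := inferInstance
  have this' := Algebra.FormallyEtale.of_equiv ((IsArtinianRing.equivPi N).symm.restrictScalars K)
  have : Algebra.FinitePresentation K N :=
    (Algebra.FinitePresentation.of_finiteType (R := K)).1 inferInstance
  exact { formallyEtale := this', finitePresentation := inferInstance }

variable (A : Type u) [CommRing A] [Algebra K A] [Module.Finite K A]

theorem isNilpotent_nilradical (K : Type u) [Field K] (A : Type u) [CommRing A] [Algebra K A]
    [Module.Finite K A] : IsNilpotent (nilradical A) := by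
  have : IsNoetherianRing A := IsNoetherianRing.of_finite K A
  exact IsNoetherianRing.isNilpotent_nilradical A

instance isReduced_quotient_nilradical : IsReduced (A ⧸ nilradical A) :=
  (Ideal.isRadical_iff_quotient_reduced _).1 (Ideal.radical_isRadical ⊥)

variable [PerfectField K]

/-- An étale algebra is formally smooth, so the identity of the reduced quotient lifts along the
nilpotent nilradical. This is the source of the connected-étale splitting. -/
theorem exists_section : ∃ q : (A ⧸ nilradical A) →ₐ[K] A, ∀ n,
    Ideal.Quotient.mk (nilradical A) (q n) = n := by
  have := etale_of_isReduced K (A ⧸ nilradical A)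
  obtain ⟨q, hq⟩ := Algebra.FormallySmooth.exists_lift (R := K) (nilradical A)
    (isNilpotent_nilradical K A) (AlgHom.id K (A ⧸ nilradical A))
  exact ⟨q, fun n => DFunLike.congr_fun hq n⟩

/-- The idempotent endomorphism of a finite algebra over a perfect field with image its maximal
étale subalgebra and kernel its nilradical. -/
def retr : A →ₐ[K] A := (exists_section K A).choose.comp (Ideal.Quotient.mkₐ K (nilradical A))

variable {K A}

theorem retr_sub_mem (a : A) : retr K A a - a ∈ nilradical A :=
  Ideal.Quotient.eq.1 ((exists_section K A).choose_spec (Ideal.Quotient.mk _ a))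

theorem retr_eq_zero {a : A} (ha : a ∈ nilradical A) : retr K A a = 0 := by
  have : Ideal.Quotient.mkₐ K (nilradical A) a = 0 := Ideal.Quotient.eq_zero_iff_mem.2 ha
  change (exists_section K A).choose _ = 0
  exact (congrArg _ this).trans (map_zero _)

variable {X : Type u} [CommRing X] [Algebra K X] [Module.Finite K X]

/-- Rigidity: both maps factor through the étale reduced quotient, and formal unramifiedness forbids
two such maps that differ only by nilpotents. All identities for `retr`, including its independence
of the chosen section, come from here. -/
theorem algHom_eq_of_sub_mem (g h : A →ₐ[K] X) (hg : ∀ a ∈ nilradical A, g a = 0)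
    (hh : ∀ a ∈ nilradical A, h a = 0) (hgh : ∀ a, g a - h a ∈ nilradical X) : g = h := by
  have := etale_of_isReduced K (A ⧸ nilradical A)
  have key : Ideal.Quotient.liftₐ (nilradical A) g hg = Ideal.Quotient.liftₐ (nilradical A) h hh := by
    refine Algebra.FormallyUnramified.ext (R := K) (nilradical X) (isNilpotent_nilradical K X) fun x => ?_
    obtain ⟨a, rfl⟩ := Ideal.Quotient.mk_surjective x
    exact Ideal.Quotient.eq.2 (hgh a)
  ext a
  exact DFunLike.congr_fun key (Ideal.Quotient.mk _ a)

theorem map_mem_nilradical {K A X : Type u} [Field K] [CommRing A] [Algebra K A] [CommRing X]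
    [Algebra K X] (g : A →ₐ[K] X) {a : A} (ha : a ∈ nilradical A) :
    g a ∈ nilradical X := by
  rw [mem_nilradical] at ha ⊢
  exact ha.map g

theorem retr_natural (t : A →ₐ[K] X) (a : A) : t (retr K A a) = retr K X (t a) := by
  refine DFunLike.congr_fun (algHom_eq_of_sub_mem (t.comp (retr K A)) ((retr K X).comp t)
    (fun a ha => by simp [retr_eq_zero ha])
    (fun a ha => retr_eq_zero (map_mem_nilradical t ha)) fun a => ?_) a
  have h1 : t (retr K A a - a) ∈ nilradical X := map_mem_nilradical t (retr_sub_mem a)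
  have h2 := sub_mem h1 (retr_sub_mem (K := K) (t a))
  simpa using h2

theorem retr_retr (a : A) : retr K A (retr K A a) = retr K A a := by
  have := retr_eq_zero (K := K) (retr_sub_mem (K := K) a)
  rwa [map_sub, sub_eq_zero] at this

theorem isReduced_range_retr : IsReduced (retr K A).range := by
  refine ⟨?_⟩
  rintro ⟨_, a, rfl⟩ hx
  have h1 : IsNilpotent (retr K A a) := by
    have := hx.map (retr K A).range.val
    exact this
  have h2 := retr_eq_zero (K := K) (mem_nilradical.2 h1)
  refine Subtype.ext ?_
  change retr K A a = 0
  rw [← retr_retr]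
  exact h2

/-- The tensor product of the two reduced quotients is again étale over the field, hence reduced, so
the left side kills nilpotents and rigidity applies. This is what makes `retr` compatible with
comultiplication. -/
theorem retr_tensor (x : A ⊗[K] X) :
    Algebra.TensorProduct.map (retr K A) (retr K X) x = retr K (A ⊗[K] X) x := by
  set E := Algebra.TensorProduct.map (retr K A) (retr K X) with hE
  refine DFunLike.congr_fun (algHom_eq_of_sub_mem E (retr K (A ⊗[K] X)) ?_
    (fun a ha => retr_eq_zero ha) ?_) x
  · intro y hy
    have e1 := etale_of_isReduced K (A ⧸ nilradical A)
    have e2 := etale_of_isReduced K (X ⧸ nilradical X)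
    have e3 : Algebra.Etale K ((A ⧸ nilradical A) ⊗[K] (X ⧸ nilradical X)) :=
      Algebra.Etale.comp K (A ⧸ nilradical A) _
    have hred := Algebra.FormallyUnramified.isReduced_of_field K
      ((A ⧸ nilradical A) ⊗[K] (X ⧸ nilradical X))
    have h1 : E = (Algebra.TensorProduct.map (exists_section K A).choose
        (exists_section K X).choose).comp (Algebra.TensorProduct.map
          (Ideal.Quotient.mkₐ K (nilradical A)) (Ideal.Quotient.mkₐ K (nilradical X))) := by
      rw [← Algebra.TensorProduct.map_comp]
      rfl
    have h2 : Algebra.TensorProduct.map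
          (Ideal.Quotient.mkₐ K (nilradical A)) (Ideal.Quotient.mkₐ K (nilradical X)) y = 0 :=
      (mem_nilradical.1 (map_mem_nilradical _ hy)).eq_zero
    rw [h1, AlgHom.comp_apply, h2, map_zero]
  · have h3 : (Ideal.Quotient.mkₐ K (nilradical (A ⊗[K] X))).comp E =
        Ideal.Quotient.mkₐ K (nilradical (A ⊗[K] X)) := by
      refine Algebra.TensorProduct.ext ?_ ?_
      · ext a
        refine Ideal.Quotient.eq.2 ?_
        have := map_mem_nilradical (Algebra.TensorProduct.includeLeft : A →ₐ[K] A ⊗[K] X)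
          (retr_sub_mem (K := K) a)
        rw [map_sub] at this
        simpa [hE] using this
      · ext a
        refine Ideal.Quotient.eq.2 ?_
        have := map_mem_nilradical (Algebra.TensorProduct.includeRight : X →ₐ[K] A ⊗[K] X)
          (retr_sub_mem (K := K) a)
        rw [map_sub] at this
        simpa [hE] using this
    intro y
    have h4 : E y - y ∈ nilradical _ := Ideal.Quotient.eq.1 (DFunLike.congr_fun h3 y)
    have h5 := sub_mem h4 (retr_sub_mem (K := K) y)
    simpa using h5

end PerfectAlg

/-! ### Functoriality of the group of points -/

namespace HopfGroup

section functoriality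

variable {R : Type u} [CommRing R] {A B X Y : Type u} [CommRing A] [HopfAlgebra R A]
  [CommRing B] [HopfAlgebra R B] [CommRing X] [Algebra R X] [CommRing Y] [Algebra R Y]

/-- The map on points induced by a homomorphism of value rings. -/
def postcomp (h : X →ₐ[R] Y) : WithConv (A →ₐ[R] X) →* WithConv (A →ₐ[R] Y) where
  toFun f := WithConv.toConv (h.comp f.ofConv)
  map_one' := by
    apply WithConv.ofConv_injective
    ext a
    simp [AlgHom.convOne_def]
  map_mul' f g := congrArg WithConv.toConv (AlgHom.comp_convMul_distrib h f g)

/-- The map on points induced by a homomorphism of group schemes. -/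
def precomp (φ : B →ₐc[R] A) : WithConv (A →ₐ[R] X) →* WithConv (B →ₐ[R] X) where
  toFun f := WithConv.toConv (f.ofConv.comp (φ : B →ₐ[R] A))
  map_one' := by
    apply WithConv.ofConv_injective
    ext a
    simp [AlgHom.convOne_def]
  map_mul' f g := congrArg WithConv.toConv (AlgHom.convMul_comp_bialgHom_distrib f g φ)

@[simp] theorem postcomp_apply (h : X →ₐ[R] Y) (f : WithConv (A →ₐ[R] X)) (a : A) :
    (postcomp h f).ofConv a = h (f.ofConv a) := rfl

theorem conv_one_apply (a : A) : (1 : WithConv (A →ₐ[R] X)).ofConv a =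
    algebraMap R X (Coalgebra.counit (R := R) a) := rfl

theorem conv_ext {f g : WithConv (A →ₐ[R] X)} (h : ∀ a, f.ofConv a = g.ofConv a) : f = g :=
  WithConv.ofConv_injective (AlgHom.ext h)

theorem conv_mul_apply (f g : WithConv (A →ₐ[R] X)) (a : A) : (f * g).ofConv a =
    Algebra.TensorProduct.lift f.ofConv g.ofConv (fun _ _ => Commute.all _ _)
      (Coalgebra.comul (R := R) a) :=
  AlgHom.convMul_apply f g a

/-- The two inclusions are the universal pair of points, and their sum is the comultiplication; Hopf
identities can thus be checked by computing in groups of points. -/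
theorem comul_eq_mul : WithConv.toConv (Bialgebra.comulAlgHom R A) =
    WithConv.toConv (Algebra.TensorProduct.includeLeft : A →ₐ[R] A ⊗[R] A) *
      WithConv.toConv (Algebra.TensorProduct.includeRight : A →ₐ[R] A ⊗[R] A) := by
  refine conv_ext fun a => ?_
  rw [conv_mul_apply]
  have : Algebra.TensorProduct.lift (Algebra.TensorProduct.includeLeft : A →ₐ[R] A ⊗[R] A)
      (Algebra.TensorProduct.includeRight : A →ₐ[R] A ⊗[R] A) (fun _ _ => Commute.all _ _) =
      AlgHom.id R _ := by
    ext <;> simp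
  exact (DFunLike.congr_fun this _).symm

theorem map_comul_apply (f : A →ₐ[R] X) (g : A →ₐ[R] Y) (a : A) :
    Algebra.TensorProduct.map f g (Coalgebra.comul (R := R) a) =
    (WithConv.toConv ((Algebra.TensorProduct.includeLeft : X →ₐ[R] X ⊗[R] Y).comp f) *
      WithConv.toConv ((Algebra.TensorProduct.includeRight : Y →ₐ[R] X ⊗[R] Y).comp g)).ofConv a := by
  rw [conv_mul_apply]
  have : Algebra.TensorProduct.map f g = Algebra.TensorProduct.lift
      ((Algebra.TensorProduct.includeLeft : X →ₐ[R] X ⊗[R] Y).comp f)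
      ((Algebra.TensorProduct.includeRight : Y →ₐ[R] X ⊗[R] Y).comp g)
      (fun _ _ => Commute.all _ _) := by
    ext <;> simp
  rw [this]

/-- A homomorphism of algebras compatible with addition of points is one of bialgebras. -/
def bialgHomOfAdd (f : A →ₐ[R] B)
    (h : postcomp (Bialgebra.comulAlgHom R B) (WithConv.toConv f) =
      WithConv.toConv ((Algebra.TensorProduct.includeLeft : B →ₐ[R] B ⊗[R] B).comp f) *
      WithConv.toConv ((Algebra.TensorProduct.includeRight : B →ₐ[R] B ⊗[R] B).comp f)) :
    A →ₐc[R] B :=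
  BialgHom.ofAlgHom f
    (by
      have h1 : postcomp (Bialgebra.counitAlgHom R B) (WithConv.toConv f) *
          postcomp (Bialgebra.counitAlgHom R B) (WithConv.toConv f) =
          postcomp (Bialgebra.counitAlgHom R B) (WithConv.toConv f) := by
        have h2 := congrArg (postcomp (Algebra.TensorProduct.lift (Bialgebra.counitAlgHom R B)
          (Bialgebra.counitAlgHom R B) (fun _ _ => Commute.all _ _))) h
        rw [map_mul] at h2
        have h3 : Algebra.TensorProduct.lift (Bialgebra.counitAlgHom R B)
          (Bialgebra.counitAlgHom R B) (fun _ _ => Commute.all _ _) =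
          (Algebra.TensorProduct.lmul' R).comp (Algebra.TensorProduct.map
            (Bialgebra.counitAlgHom R B) (Bialgebra.counitAlgHom R B)) := by
          ext <;> simp
        refine Eq.trans ?_ (h2.symm.trans ?_)
        · congr 1 <;> refine conv_ext fun a => ?_ <;> simp
        · refine conv_ext fun a => ?_
          have h4 := DFunLike.congr_fun (AlgHom.comp_convMul_distrib (Bialgebra.counitAlgHom R B)
            (1 : WithConv (B →ₐ[R] B)) 1) (f a)
          change Algebra.TensorProduct.lift (Bialgebra.counitAlgHom R B)
            (Bialgebra.counitAlgHom R B) (fun _ _ => Commute.all _ _)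
              (Coalgebra.comul (R := R) (f a)) = Coalgebra.counit (R := R) (f a)
          have h5 := conv_mul_apply (X := R) (WithConv.toConv (Bialgebra.counitAlgHom R B))
            (WithConv.toConv (Bialgebra.counitAlgHom R B)) (f a)
          refine h5.symm.trans ?_
          have h6 : WithConv.toConv (Bialgebra.counitAlgHom R B) =
            (1 : WithConv (B →ₐ[R] R)) := conv_ext fun b => rfl
          rw [h6, mul_one]
          rfl
      -- The image of the counit point is idempotent in a group, hence trivial: compatibility with
      -- counits comes for free.
      have h7 := mul_eq_left.1 h1
      exact congrArg WithConv.ofConv h7)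
    (by
      ext a
      have := DFunLike.congr_fun (congrArg WithConv.ofConv h) a
      exact (map_comul_apply f f a).trans this.symm)

theorem add_of_bialgHom (f : A →ₐc[R] B) :
    postcomp (Bialgebra.comulAlgHom R B) (WithConv.toConv (f : A →ₐ[R] B)) =
      WithConv.toConv ((Algebra.TensorProduct.includeLeft : B →ₐ[R] B ⊗[R] B).comp
        (f : A →ₐ[R] B)) *
      WithConv.toConv ((Algebra.TensorProduct.includeRight : B →ₐ[R] B ⊗[R] B).comp
        (f : A →ₐ[R] B)) := by
  refine conv_ext fun a => ?_
  refine Eq.trans ?_ (map_comul_apply (f : A →ₐ[R] B) (f : A →ₐ[R] B) a)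
  exact (CoalgHomClass.map_comp_comul_apply f a).symm

theorem mul_comp_antipode (f : A →ₐ[R] X) :
    WithConv.toConv f * WithConv.toConv (f.comp (HopfAlgebra.antipodeAlgHom R A)) = 1 := by
  have h := congrArg (postcomp f) (mul_inv_cancel (WithConv.toConv (AlgHom.id R A)))
  rw [map_mul, map_one] at h
  exact h

/-- Inversion on a commutative group scheme. -/
def invHom (R : Type u) [CommRing R] (A : Type u) [CommRing A] [HopfAlgebra R A]
    [Coalgebra.IsCocomm R A] : A →ₐc[R] A :=
  bialgHomOfAdd (HopfAlgebra.antipodeAlgHom R A) (by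
    have h1 := mul_comp_antipode (Bialgebra.comulAlgHom R A)
    have h2 : WithConv.toConv (Bialgebra.comulAlgHom R A) *
        (WithConv.toConv ((Algebra.TensorProduct.includeLeft : A →ₐ[R] A ⊗[R] A).comp
          (HopfAlgebra.antipodeAlgHom R A)) *
        WithConv.toConv ((Algebra.TensorProduct.includeRight : A →ₐ[R] A ⊗[R] A).comp
          (HopfAlgebra.antipodeAlgHom R A))) = 1 := by
      rw [comul_eq_mul, mul_mul_mul_comm, mul_comp_antipode, mul_comp_antipode, one_mul]
    rw [mul_comm] at h1
    exact left_inv_eq_right_inv h1 h2)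

theorem mul_comp_invHom [Coalgebra.IsCocomm R A] (f : A →ₐ[R] X) :
    WithConv.toConv f * WithConv.toConv (f.comp (invHom R A : A →ₐ[R] A)) = 1 :=
  mul_comp_antipode f

/-- A homomorphism of algebras vanishing on the kernel of a surjective one factors through it. -/
def liftAlg {R A B C : Type u} [CommRing R] [CommRing A] [Algebra R A] [CommRing B] [Algebra R B]
    [CommRing C] [Algebra R C] (ι : A →ₐ[R] B) (hι : Function.Surjective ι) (D : A →ₐ[R] C)
    (hD : ∀ a, ι a = 0 → D a = 0) : B →ₐ[R] C :=
  (Ideal.Quotient.liftₐ (RingHom.ker ι) D (fun a ha => hD a ha)).comp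
    (Ideal.quotientKerAlgEquivOfSurjective (f := ι) hι).symm.toAlgHom

theorem liftAlg_apply {R A B C : Type u} [CommRing R] [CommRing A] [Algebra R A] [CommRing B]
    [Algebra R B] [CommRing C] [Algebra R C] (ι : A →ₐ[R] B) (hι : Function.Surjective ι)
    (D : A →ₐ[R] C) (hD : ∀ a, ι a = 0 → D a = 0) (a : A) : liftAlg ι hι D hD (ι a) = D a := by
  have : (Ideal.quotientKerAlgEquivOfSurjective (f := ι) hι).symm (ι a) =
        Ideal.Quotient.mk _ a := by
    rw [AlgEquiv.symm_apply_eq]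
    rfl
  exact (congrArg (Ideal.Quotient.liftₐ (RingHom.ker ι) D (fun a ha => hD a ha)) this).trans rfl

/-- A homomorphism of bialgebras vanishing on the kernel of a surjective one factors through it. -/
def liftOfSurjective {C : Type u} [CommRing C] [HopfAlgebra R C] (ι : A →ₐc[R] B)
    (hι : Function.Surjective ι) (D : A →ₐc[R] C)
    (hD : ∀ a, ι a = 0 → D a = 0) : B →ₐc[R] C :=
  bialgHomOfAdd (liftAlg (ι : A →ₐ[R] B) hι (D : A →ₐ[R] C) hD) (by
    have hf' : (liftAlg (ι : A →ₐ[R] B) hι (D : A →ₐ[R] C) hD).comp (ι : A →ₐ[R] B) =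
        (D : A →ₐ[R] C) := AlgHom.ext (liftAlg_apply (ι : A →ₐ[R] B) hι (D : A →ₐ[R] C) hD)
    have hinj : Function.Injective (precomp (X := C ⊗[R] C) ι) := fun g h hgh => by
      refine conv_ext fun b => ?_
      obtain ⟨a, rfl⟩ := hι b
      exact DFunLike.congr_fun (congrArg WithConv.ofConv hgh) a
    apply hinj
    rw [map_mul]
    refine Eq.trans ?_ ((add_of_bialgHom D).trans ?_)
    · exact congrArg (fun g : A →ₐ[R] C =>
        postcomp (Bialgebra.comulAlgHom R C) (WithConv.toConv g)) hf'
    · exact (congrArg (fun g : A →ₐ[R] C => WithConv.toConv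
        ((Algebra.TensorProduct.includeLeft : C →ₐ[R] C ⊗[R] C).comp g) * WithConv.toConv
        ((Algebra.TensorProduct.includeRight : C →ₐ[R] C ⊗[R] C).comp g)) hf').symm)

theorem liftOfSurjective_apply {C : Type u} [CommRing C] [HopfAlgebra R C] (ι : A →ₐc[R] B)
    (hι : Function.Surjective ι) (D : A →ₐc[R] C) (hD : ∀ a, ι a = 0 → D a = 0) (a : A) :
    liftOfSurjective ι hι D hD (ι a) = D a :=
  liftAlg_apply (ι : A →ₐ[R] B) hι (D : A →ₐ[R] C) hD a

end functoriality

end HopfGroup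

/-! ### The connected-étale splitting over a perfect field -/

namespace PerfectAlg

open HopfGroup WithConv

section splitting

variable {K : Type u} [Field K] [PerfectField K]
  {A A₀ : Type u} [CommRing A] [HopfAlgebra K A] [Coalgebra.IsCocomm K A] [Module.Finite K A]
  [CommRing A₀] [HopfAlgebra K A₀] [Coalgebra.IsCocomm K A₀] [Module.Finite K A₀]

/-- The projection of a finite group scheme over a perfect field onto its étale part. -/
def retrHom (K : Type u) [Field K] [PerfectField K] (A : Type u) [CommRing A] [HopfAlgebra K A]
    [Module.Finite K A] : A →ₐc[K] A :=
  BialgHom.ofAlgHom (retr K A)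
    (by
      ext a
      have h := retr_natural (Bialgebra.counitAlgHom K A) a
      refine h.trans ?_
      have h2 : retr K K = AlgHom.id K K := Subsingleton.elim _ _
      rw [h2]
      rfl)
    (by
      ext a
      refine (retr_tensor (Coalgebra.comul (R := K) a)).trans ?_
      exact (retr_natural (Bialgebra.comulAlgHom K A) a).symm)

omit [Coalgebra.IsCocomm K A] in
theorem retrHom_apply (a : A) : retrHom K A a = retr K A a := rfl

omit [PerfectField K] [Coalgebra.IsCocomm K A₀] in
-- In an Artinian local ring the nilradical is the maximal ideal, and an element with counit zero is
-- not a unit.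
theorem sub_counit_mem_nilradical [IsLocalRing A₀] (x : A₀) :
    x - algebraMap K A₀ (Coalgebra.counit (R := K) x) ∈ nilradical A₀ := by
  have : IsArtinianRing A₀ := isArtinian_of_tower K inferInstance
  rw [mem_nilradical, nilpotent_iff_mem_prime]
  intro P hP
  have : P.IsMaximal := IsArtinianRing.isMaximal_of_isPrime P
  rw [IsLocalRing.eq_maximalIdeal this, IsLocalRing.mem_maximalIdeal]
  intro hu
  have := hu.map (Bialgebra.counitAlgHom K A₀)
  simp at this

omit [Coalgebra.IsCocomm K A] [Coalgebra.IsCocomm K A₀] in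
-- A connected group has trivial étale part: after composing with `ι` both sides agree up to
-- nilpotents, and rigidity makes them equal.
theorem comp_retr_eq_counit [IsLocalRing A₀] (ι : A →ₐ[K] A₀)
    (hε : ∀ a, Coalgebra.counit (R := K) (ι a) = Coalgebra.counit (R := K) a) (a : A) :
    ι (retr K A a) = algebraMap K A₀ (Coalgebra.counit (R := K) a) := by
  have hnil : ∀ a ∈ nilradical A, Coalgebra.counit (R := K) a = 0 := fun a ha =>
    (mem_nilradical.1 (map_mem_nilradical (Bialgebra.counitAlgHom K A) ha)).eq_zero
  refine DFunLike.congr_fun (algHom_eq_of_sub_mem (ι.comp (retr K A))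
    ((Algebra.ofId K A₀).comp (Bialgebra.counitAlgHom K A)) (fun a ha => ?_) (fun a ha => ?_)
    fun a => ?_) a
  · simp [retr_eq_zero ha]
  · simp [hnil a ha]
  · have h1 := sub_counit_mem_nilradical (K := K) (ι (retr K A a))
    have h2 : Coalgebra.counit (R := K) (retr K A a) = Coalgebra.counit (R := K) a := by
      have := hnil _ (retr_sub_mem (K := K) a)
      rwa [map_sub, sub_eq_zero] at this
    rw [hε, h2] at h1
    exact h1

omit [Coalgebra.IsCocomm K A] [Coalgebra.IsCocomm K A₀] [Module.Finite K A₀] in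
-- The kernel of the retraction to the étale part lies in the identity component. Modulo the ideal
-- of that kernel, the idempotent cutting out the complement of the component becomes nilpotent,
-- being congruent to its own difference with its retract, and a nilpotent idempotent is zero.
theorem mem_kernelIdeal_of_map_eq_zero (ι : A →ₐc[K] A₀)
    (hcl : ∃ e : A, IsIdempotentElem e ∧ RingHom.ker ι = Ideal.span {e}) {a : A} (ha : ι a = 0) :
    a ∈ kernelIdeal (retrHom K A) := by
  obtain ⟨e, he, hker⟩ := hcl
  have hιe : ι e = 0 := by
    have : e ∈ RingHom.ker ι := hker ▸ Ideal.mem_span_singleton_self e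
    exact this
  suffices e ∈ kernelIdeal (retrHom K A) by
    have ha' : a ∈ RingHom.ker ι := ha
    rw [hker] at ha'
    exact (Ideal.span_singleton_le_iff_mem _).2 this ha'
  have h1 : retr K A e ∈ kernelIdeal (retrHom K A) := by
    refine Ideal.mem_map_of_mem (retrHom K A) ?_
    have := CoalgHomClass.counit_comp_apply ι e
    rw [hιe, map_zero] at this
    exact this.symm
  have h2 : IsNilpotent (Ideal.Quotient.mk (kernelIdeal (retrHom K A)) e) := by
    have h3 := map_mem_nilradical (Ideal.Quotient.mkₐ K (kernelIdeal (retrHom K A)))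
      (retr_sub_mem (K := K) e)
    rw [map_sub] at h3
    have h4 : Ideal.Quotient.mkₐ K (kernelIdeal (retrHom K A)) (retr K A e) = 0 :=
      Ideal.Quotient.eq_zero_iff_mem.2 h1
    rw [h4, zero_sub, neg_mem_iff] at h3
    exact h3
  obtain ⟨n, hn⟩ := h2
  rw [← Ideal.Quotient.eq_zero_iff_mem]
  rcases n with _ | n
  -- A zero exponent means that the quotient ring is trivial.
  · rw [pow_zero] at hn
    rw [← mul_one (Ideal.Quotient.mk _ e), hn, mul_zero]
  · rwa [← map_pow, he.pow_succ_eq] at hn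

/-- The projection of a finite group scheme over a perfect field onto its connected part,
`g ↦ g - E g`. -/
def connHom (K : Type u) [Field K] [PerfectField K] (A : Type u) [CommRing A] [HopfAlgebra K A]
    [Coalgebra.IsCocomm K A] [Module.Finite K A] : A →ₐc[K] A :=
  (toConv (BialgHom.id K A) * toConv ((retrHom K A).comp (invHom K A))).ofConv

theorem toConv_connHom : toConv ((connHom K A : A →ₐc[K] A) : A →ₐ[K] A) =
    toConv (AlgHom.id K A) * toConv (((retrHom K A : A →ₐc[K] A) : A →ₐ[K] A).comp
      (invHom K A : A →ₐ[K] A)) := rfl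

theorem retrHom_mul_connHom : toConv ((retrHom K A : A →ₐc[K] A) : A →ₐ[K] A) *
    toConv ((connHom K A : A →ₐc[K] A) : A →ₐ[K] A) = toConv (AlgHom.id K A) := by
  rw [toConv_connHom, mul_left_comm, mul_comp_invHom, mul_one]

theorem retrHom_comp_connHom : postcomp ((retrHom K A : A →ₐc[K] A) : A →ₐ[K] A)
    (toConv ((connHom K A : A →ₐc[K] A) : A →ₐ[K] A)) = 1 := by
  rw [toConv_connHom, map_mul]
  refine Eq.trans ?_ (mul_comp_invHom ((retrHom K A : A →ₐc[K] A) : A →ₐ[K] A))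
  congr 1
  exact conv_ext fun a => retr_retr (K := K) (A := A) _

/-- Since `t` commutes with the étale retraction, both sides subtract the same point; uniqueness of
inverses in the group of points replaces any calculation with antipodes. -/
theorem connHom_natural {B : Type u} [CommRing B] [HopfAlgebra K B] [Coalgebra.IsCocomm K B]
    [Module.Finite K B] (t : A →ₐc[K] B) (a : A) :
    t (connHom K A a) = connHom K B (t a) := by
  have h1 : postcomp (t : A →ₐ[K] B) (toConv (AlgHom.id K A)) *
      postcomp (t : A →ₐ[K] B) (toConv (((retrHom K A : A →ₐc[K] A) : A →ₐ[K] A).comp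
      (invHom K A : A →ₐ[K] A))) =
      precomp t (toConv (AlgHom.id K B)) *
        precomp t (toConv (((retrHom K B : B →ₐc[K] B) : B →ₐ[K] B).comp
      (invHom K B : B →ₐ[K] B))) := by
    congr 1
    have h2 : toConv ((retrHom K B : B →ₐ[K] B).comp (t : A →ₐ[K] B)) *
        postcomp (t : A →ₐ[K] B) (toConv (((retrHom K A : A →ₐc[K] A) : A →ₐ[K] A).comp
          (invHom K A : A →ₐ[K] A))) = 1 := by
      have h3 : (retrHom K B : B →ₐ[K] B).comp (t : A →ₐ[K] B) =
          (t : A →ₐ[K] B).comp (retrHom K A : A →ₐ[K] A) :=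
        AlgHom.ext fun a => (retr_natural (K := K) (t : A →ₐ[K] B) a).symm
      rw [h3]
      exact mul_comp_invHom ((t : A →ₐ[K] B).comp (retrHom K A : A →ₐ[K] A))
    have h4 : precomp t (toConv (((retrHom K B : B →ₐc[K] B) : B →ₐ[K] B).comp
      (invHom K B : B →ₐ[K] B))) * toConv ((retrHom K B : B →ₐ[K] B).comp (t : A →ₐ[K] B)) = 1 := by
      have h5 := congrArg (precomp t) (mul_comp_invHom ((retrHom K B : B →ₐc[K] B) : B →ₐ[K] B))
      rw [map_mul, map_one, mul_comm] at h5
      exact h5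
    exact (left_inv_eq_right_inv h4 h2).symm
  rw [← map_mul, ← map_mul, ← toConv_connHom, ← toConv_connHom] at h1
  exact DFunLike.congr_fun (congrArg WithConv.ofConv h1) a

theorem connHom_retrHom (a : A) : connHom K A (retr K A a) =
    algebraMap K A (Coalgebra.counit (R := K) a) := by
  rw [← retrHom_apply, ← connHom_natural]
  exact DFunLike.congr_fun (congrArg WithConv.ofConv (retrHom_comp_connHom (K := K) (A := A))) a

variable (ι : A →ₐc[K] A₀) (hι : Function.Surjective ι)
  (hcl : ∃ e : A, IsIdempotentElem e ∧ RingHom.ker ι = Ideal.span {e})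

omit [Coalgebra.IsCocomm K A₀] [Module.Finite K A₀] in
theorem connHom_eq_zero
    (hcl : ∃ e : A, IsIdempotentElem e ∧ RingHom.ker ι = Ideal.span {e}) (a : A) (ha : ι a = 0) :
    connHom K A a = 0 := by
  have h1 := mem_kernelIdeal_of_map_eq_zero ι hcl ha
  have h2 : kernelIdeal (retrHom K A) ≤ RingHom.ker (connHom K A) := by
    refine Ideal.map_le_iff_le_comap.2 fun b hb => ?_
    have hb' : Coalgebra.counit (R := K) b = 0 := hb
    change connHom K A (retr K A b) = 0
    rw [connHom_retrHom, hb', map_zero]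
  exact h2 h1

/-- The inclusion of the complement of the étale part, through the identity component. -/
def sectionHom : A₀ →ₐc[K] A :=
  liftOfSurjective ι hι (connHom K A) (connHom_eq_zero ι hcl)

omit [Coalgebra.IsCocomm K A₀] [Module.Finite K A₀] in
theorem sectionHom_apply (a : A) : sectionHom ι hι hcl (ι a) = connHom K A a :=
  liftOfSurjective_apply _ _ _ _ _

omit [Coalgebra.IsCocomm K A₀] [Module.Finite K A₀] in
theorem retr_sectionHom (b : A₀) : retr K A (sectionHom ι hι hcl b) =
    algebraMap K A (Coalgebra.counit (R := K) b) := by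
  obtain ⟨a, rfl⟩ := hι b
  rw [sectionHom_apply]
  refine (DFunLike.congr_fun (congrArg WithConv.ofConv
    (retrHom_comp_connHom (K := K) (A := A))) a).trans ?_
  rw [CoalgHomClass.counit_comp_apply]
  rfl

variable [IsLocalRing A₀]

omit [Coalgebra.IsCocomm K A] [Coalgebra.IsCocomm K A₀] in
theorem map_retr (ι : A →ₐc[K] A₀) (a : A) :
    ι (retr K A a) = algebraMap K A₀ (Coalgebra.counit (R := K) a) :=
  comp_retr_eq_counit (ι : A →ₐ[K] A₀) (CoalgHomClass.counit_comp_apply ι) a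

omit [Coalgebra.IsCocomm K A₀] in
theorem map_connHom (ι : A →ₐc[K] A₀) (a : A) : ι (connHom K A a) = ι a := by
  have h := congrArg (postcomp (ι : A →ₐ[K] A₀)) (retrHom_mul_connHom (K := K) (A := A))
  rw [map_mul] at h
  have h1 : postcomp (ι : A →ₐ[K] A₀) (toConv ((retrHom K A : A →ₐc[K] A) : A →ₐ[K] A)) = 1 :=
    conv_ext fun a => map_retr ι a
  rw [h1, one_mul] at h
  exact DFunLike.congr_fun (congrArg WithConv.ofConv h) a

omit [Coalgebra.IsCocomm K A₀] in
theorem map_sectionHom (b : A₀) : ι (sectionHom ι hι hcl b) = b := by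
  obtain ⟨a, rfl⟩ := hι b
  rw [sectionHom_apply, map_connHom]

/-- The endomorphism of a finite group scheme `G` over a perfect field which is the identity on the
étale part and a given endomorphism `e` on the connected part. -/
def extendEnd (e : A₀ →ₐc[K] A₀) : A →ₐc[K] A :=
  (toConv (retrHom K A) * toConv ((sectionHom ι hι hcl).comp (e.comp ι))).ofConv

omit [IsLocalRing A₀] [Coalgebra.IsCocomm K A₀] [Module.Finite K A₀] in
theorem toConv_extendEnd (e : A₀ →ₐc[K] A₀) :
    toConv ((extendEnd ι hι hcl e : A →ₐc[K] A) : A →ₐ[K] A) =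
    toConv ((retrHom K A : A →ₐc[K] A) : A →ₐ[K] A) *
      toConv (((sectionHom ι hι hcl : A₀ →ₐ[K] A)).comp
        ((e : A₀ →ₐ[K] A₀).comp (ι : A →ₐ[K] A₀))) := rfl

omit [Coalgebra.IsCocomm K A₀] in
theorem map_extendEnd (e : A₀ →ₐc[K] A₀) (a : A) : ι (extendEnd ι hι hcl e a) = e (ι a) := by
  have h := congrArg (postcomp (ι : A →ₐ[K] A₀)) (toConv_extendEnd ι hι hcl e)
  rw [map_mul] at h
  have h1 : postcomp (ι : A →ₐ[K] A₀) (toConv ((retrHom K A : A →ₐc[K] A) : A →ₐ[K] A)) = 1 :=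
    conv_ext fun a => map_retr ι a
  rw [h1, one_mul] at h
  exact (DFunLike.congr_fun (congrArg WithConv.ofConv h) a).trans (map_sectionHom ι hι hcl _)

omit [IsLocalRing A₀] [Coalgebra.IsCocomm K A₀] [Module.Finite K A₀] in
theorem retr_extendEnd (e : A₀ →ₐc[K] A₀) (a : A) :
    retr K A (extendEnd ι hι hcl e a) = retr K A a := by
  have h := congrArg (postcomp ((retrHom K A : A →ₐc[K] A) : A →ₐ[K] A))
    (toConv_extendEnd ι hι hcl e)
  rw [map_mul] at h
  have h1 : postcomp ((retrHom K A : A →ₐc[K] A) : A →ₐ[K] A)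
      (toConv (((sectionHom ι hι hcl : A₀ →ₐ[K] A)).comp
        ((e : A₀ →ₐ[K] A₀).comp (ι : A →ₐ[K] A₀)))) = 1 :=
    conv_ext fun a => by
      refine (retr_sectionHom ι hι hcl (e (ι a))).trans ?_
      rw [CoalgHomClass.counit_comp_apply, CoalgHomClass.counit_comp_apply]
      rfl
  rw [h1, mul_one] at h
  exact (DFunLike.congr_fun (congrArg WithConv.ofConv h) a).trans (retr_retr a)

omit [IsLocalRing A₀] [Coalgebra.IsCocomm K A₀] [Module.Finite K A₀] in
theorem extendEnd_natural {B B₀ : Type u} [CommRing B] [HopfAlgebra K B] [Coalgebra.IsCocomm K B]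
    [Module.Finite K B] [CommRing B₀] [HopfAlgebra K B₀] [Coalgebra.IsCocomm K B₀]
    [Module.Finite K B₀] [IsLocalRing B₀] (ι' : B →ₐc[K] B₀) (hι' : Function.Surjective ι')
    (hcl' : ∃ e : B, IsIdempotentElem e ∧ RingHom.ker ι' = Ideal.span {e})
    (t : A →ₐc[K] B) (t₀ : A₀ →ₐc[K] B₀) (ht : ∀ a, ι' (t a) = t₀ (ι a))
    (e : A₀ →ₐc[K] A₀) (e' : B₀ →ₐc[K] B₀) (he : ∀ x, t₀ (e x) = e' (t₀ x)) (a : A) :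
    t (extendEnd ι hι hcl e a) = extendEnd ι' hι' hcl' e' (t a) := by
  have h := congrArg (postcomp (t : A →ₐ[K] B)) (toConv_extendEnd ι hι hcl e)
  have h' := congrArg (precomp t) (toConv_extendEnd ι' hι' hcl' e')
  rw [map_mul] at h h'
  have h1 : postcomp (t : A →ₐ[K] B) (toConv ((retrHom K A : A →ₐc[K] A) : A →ₐ[K] A)) =
      precomp t (toConv ((retrHom K B : B →ₐc[K] B) : B →ₐ[K] B)) :=
    conv_ext fun a => retr_natural (K := K) (t : A →ₐ[K] B) a
  have h2 : ∀ x : A₀, t (sectionHom ι hι hcl x) = sectionHom ι' hι' hcl' (t₀ x) := fun x => by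
    obtain ⟨a, rfl⟩ := hι x
    rw [sectionHom_apply, ← ht, sectionHom_apply, connHom_natural]
  have h3 : postcomp (t : A →ₐ[K] B) (toConv (((sectionHom ι hι hcl : A₀ →ₐ[K] A)).comp
        ((e : A₀ →ₐ[K] A₀).comp (ι : A →ₐ[K] A₀)))) =
      precomp t (toConv (((sectionHom ι' hι' hcl' : B₀ →ₐ[K] B)).comp
        ((e' : B₀ →ₐ[K] B₀).comp (ι' : B →ₐ[K] B₀)))) :=
    conv_ext fun a => by
      change t (sectionHom ι hι hcl (e (ι a))) = sectionHom ι' hι' hcl' (e' (ι' (t a)))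
      rw [h2, he, ht]
  rw [h1, h3, ← h'] at h
  exact DFunLike.congr_fun (congrArg WithConv.ofConv h) a

/-- The product decomposition `G = Gₑₜ × G₀`, on coordinate rings. -/
def splitMap (ι : A →ₐc[K] A₀) : A →ₐ[K] A ⊗[K] A₀ :=
  (Algebra.TensorProduct.map (retr K A) (ι : A →ₐ[K] A₀)).comp (Bialgebra.comulAlgHom K A)

omit [IsLocalRing A₀] [Coalgebra.IsCocomm K A₀] [Module.Finite K A₀] in
-- This is the identity g = E g + (g - E g), with E the étale retraction, read on coordinate rings.
theorem lift_splitMap (a : A) :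
    Algebra.TensorProduct.lift (AlgHom.id K A) (sectionHom ι hι hcl : A₀ →ₐ[K] A)
      (fun _ _ => Commute.all _ _) (splitMap ι a) = a := by
  have h := retrHom_mul_connHom (K := K) (A := A)
  have h1 := DFunLike.congr_fun (congrArg WithConv.ofConv h) a
  refine Eq.trans ?_ h1
  rw [conv_mul_apply]
  have h2 : (Algebra.TensorProduct.lift (AlgHom.id K A) (sectionHom ι hι hcl : A₀ →ₐ[K] A)
      (fun _ _ => Commute.all _ _)).comp (Algebra.TensorProduct.map (retr K A)
        (ι : A →ₐ[K] A₀)) = Algebra.TensorProduct.lift (retr K A)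
          ((connHom K A : A →ₐc[K] A) : A →ₐ[K] A) (fun _ _ => Commute.all _ _) := by
    ext a
    · simp
    · simpa using sectionHom_apply ι hι hcl a
  exact DFunLike.congr_fun h2 _

omit [Coalgebra.IsCocomm K A] [Coalgebra.IsCocomm K A₀] in
theorem splitMap_retr (ι : A →ₐc[K] A₀) (a : A) : splitMap ι (retr K A a) = retr K A a ⊗ₜ 1 := by
  have h := map_comul_apply (R := K) (retr K A) (ι : A →ₐ[K] A₀) (retr K A a)
  refine h.trans ?_
  have h1 : precomp (retrHom K A) (toConv ((Algebra.TensorProduct.includeLeft :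
      A →ₐ[K] A ⊗[K] A₀).comp (retr K A)) * toConv ((Algebra.TensorProduct.includeRight :
      A₀ →ₐ[K] A ⊗[K] A₀).comp (ι : A →ₐ[K] A₀))) =
      toConv ((Algebra.TensorProduct.includeLeft : A →ₐ[K] A ⊗[K] A₀).comp (retr K A)) := by
    rw [map_mul]
    have h2 : precomp (retrHom K A) (toConv ((Algebra.TensorProduct.includeRight :
      A₀ →ₐ[K] A ⊗[K] A₀).comp (ι : A →ₐ[K] A₀))) = 1 := conv_ext fun a => by
        change (1 : A) ⊗ₜ[K] ι (retr K A a) = _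
        rw [map_retr, ← Algebra.TensorProduct.algebraMap_apply']
        rfl
    rw [h2, mul_one]
    refine conv_ext fun a => ?_
    change retr K A (retr K A a) ⊗ₜ[K] (1 : A₀) = retr K A a ⊗ₜ 1
    rw [retr_retr]
  exact DFunLike.congr_fun (congrArg WithConv.ofConv h1) a

omit [Coalgebra.IsCocomm K A₀] in
theorem splitMap_sectionHom (b : A₀) : splitMap ι (sectionHom ι hι hcl b) = 1 ⊗ₜ b := by
  have h := map_comul_apply (R := K) (retr K A) (ι : A →ₐ[K] A₀) (sectionHom ι hι hcl b)
  refine h.trans ?_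
  have h1 : precomp (sectionHom ι hι hcl) (toConv ((Algebra.TensorProduct.includeLeft :
      A →ₐ[K] A ⊗[K] A₀).comp (retr K A)) * toConv ((Algebra.TensorProduct.includeRight :
      A₀ →ₐ[K] A ⊗[K] A₀).comp (ι : A →ₐ[K] A₀))) =
      toConv (Algebra.TensorProduct.includeRight : A₀ →ₐ[K] A ⊗[K] A₀) := by
    rw [map_mul]
    have h2 : precomp (sectionHom ι hι hcl) (toConv ((Algebra.TensorProduct.includeLeft :
      A →ₐ[K] A ⊗[K] A₀).comp (retr K A))) = 1 := conv_ext fun b => by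
        change retr K A (sectionHom ι hι hcl b) ⊗ₜ[K] (1 : A₀) = _
        rw [retr_sectionHom, ← Algebra.TensorProduct.algebraMap_apply]
        rfl
    rw [h2, one_mul]
    refine conv_ext fun b => ?_
    change (1 : A) ⊗ₜ[K] ι (sectionHom ι hι hcl b) = 1 ⊗ₜ b
    rw [map_sectionHom]
  exact DFunLike.congr_fun (congrArg WithConv.ofConv h1) b

omit [IsLocalRing A₀] [Coalgebra.IsCocomm K A₀] [Module.Finite K A₀] in
theorem splitMap_injective (ι : A →ₐc[K] A₀) (hι : Function.Surjective ι)
    (hcl : ∃ e : A, IsIdempotentElem e ∧ RingHom.ker ι = Ideal.span {e}) :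
    Function.Injective (splitMap ι) :=
  Function.LeftInverse.injective (lift_splitMap ι hι hcl)

omit [Coalgebra.IsCocomm K A₀] in
theorem splitMap_mul (a : A) (b : A₀) :
    splitMap ι (retr K A a * sectionHom ι hι hcl b) = retr K A a ⊗ₜ b := by
  rw [map_mul, splitMap_retr, splitMap_sectionHom, Algebra.TensorProduct.tmul_mul_tmul, mul_one,
    one_mul]

omit [Coalgebra.IsCocomm K A₀] in
theorem splitMap_extendEnd (e : A₀ →ₐc[K] A₀) (a : A) :
    splitMap ι (extendEnd ι hι hcl e a) =
      Algebra.TensorProduct.map (AlgHom.id K A) (e : A₀ →ₐ[K] A₀) (splitMap ι a) := by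
  have h := map_comul_apply (R := K) (retr K A) (ι : A →ₐ[K] A₀) (extendEnd ι hι hcl e a)
  refine h.trans ?_
  have h1 : precomp (extendEnd ι hι hcl e) (toConv ((Algebra.TensorProduct.includeLeft :
      A →ₐ[K] A ⊗[K] A₀).comp (retr K A)) * toConv ((Algebra.TensorProduct.includeRight :
      A₀ →ₐ[K] A ⊗[K] A₀).comp (ι : A →ₐ[K] A₀))) =
      toConv ((Algebra.TensorProduct.includeLeft : A →ₐ[K] A ⊗[K] A₀).comp (retr K A)) *
        toConv ((Algebra.TensorProduct.includeRight :
      A₀ →ₐ[K] A ⊗[K] A₀).comp ((e : A₀ →ₐ[K] A₀).comp (ι : A →ₐ[K] A₀))) := by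
    rw [map_mul]
    congr 1
    · refine conv_ext fun a => ?_
      change retr K A (extendEnd ι hι hcl e a) ⊗ₜ[K] (1 : A₀) = retr K A a ⊗ₜ 1
      rw [retr_extendEnd]
    · refine conv_ext fun a => ?_
      change (1 : A) ⊗ₜ[K] ι (extendEnd ι hι hcl e a) = 1 ⊗ₜ e (ι a)
      rw [map_extendEnd]
  refine (DFunLike.congr_fun (congrArg WithConv.ofConv h1) a).trans ?_
  refine (map_comul_apply (R := K) (retr K A) ((e : A₀ →ₐ[K] A₀).comp (ι : A →ₐ[K] A₀)) a).symm.trans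
    ?_
  have h2 : Algebra.TensorProduct.map (retr K A) ((e : A₀ →ₐ[K] A₀).comp (ι : A →ₐ[K] A₀)) =
      (Algebra.TensorProduct.map (AlgHom.id K A) (e : A₀ →ₐ[K] A₀)).comp
        (Algebra.TensorProduct.map (retr K A) (ι : A →ₐ[K] A₀)) := by
    rw [← Algebra.TensorProduct.map_comp]
    rfl
  rw [h2]
  rfl

end splitting

end PerfectAlg

/-! ### Reduction to the residue field -/

namespace ResidueFiber

open IsLocalRing

section modules

variable {R : Type u} [CommRing R] [IsLocalRing R] {M N : Type u} [AddCommGroup M] [Module R M]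
  [AddCommGroup N] [Module R N]

theorem tmul_eq_zero_iff (x : M) : (1 : ResidueField R) ⊗ₜ[R] x = 0 ↔
    x ∈ maximalIdeal R • (⊤ : Submodule R M) := by
  rw [← Submodule.Quotient.mk_eq_zero]
  have h := TensorProduct.quotTensorEquivQuotSMul_mk_tmul (M := M) (maximalIdeal R) 1 x
  rw [one_smul] at h
  rw [← h]
  exact ((TensorProduct.quotTensorEquivQuotSMul M (maximalIdeal R)).map_eq_zero_iff (x := 1 ⊗ₜ x)).symm

theorem tmul_eq_iff (x y : M) : (1 : ResidueField R) ⊗ₜ[R] x = 1 ⊗ₜ[R] y ↔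
    x - y ∈ maximalIdeal R • (⊤ : Submodule R M) := by
  rw [← tmul_eq_zero_iff, TensorProduct.tmul_sub, sub_eq_zero]

theorem exists_tmul_eq (x : ResidueField R ⊗[R] M) : ∃ a : M, 1 ⊗ₜ a = x :=
  TensorProduct.mk_surjective R M (ResidueField R) IsLocalRing.residue_surjective x

/-- Nakayama's lemma, in the form in which statements checked on the special fibre are lifted. -/
theorem eq_top_of_sub_mem [Module.Finite R M] (P : Submodule R M)
    (h : ∀ y, ∃ x ∈ P, y - x ∈ maximalIdeal R • (⊤ : Submodule R M)) : P = ⊤ := by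
  rw [eq_top_iff]
  refine Submodule.le_of_le_smul_of_le_jacobson_bot Module.Finite.fg_top
    (IsLocalRing.maximalIdeal_le_jacobson _) fun y _ => ?_
  obtain ⟨x, hx, hy⟩ := h y
  exact Submodule.mem_sup.2 ⟨x, hx, y - x, hy, by abel⟩

theorem map_mem_smul_top (f : M →ₗ[R] N) {x : M} (hx : x ∈ maximalIdeal R • (⊤ : Submodule R M)) :
    f x ∈ maximalIdeal R • (⊤ : Submodule R N) := by
  have h := Submodule.mem_map_of_mem (f := f) hx
  rw [Submodule.map_smul''] at h
  exact Submodule.smul_mono le_rfl le_top h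

theorem surjective_of_fiber [Module.Finite R N] (f : M →ₗ[R] N)
    (h : ∀ y, ∃ x, y - f x ∈ maximalIdeal R • (⊤ : Submodule R N)) : Function.Surjective f := by
  rw [← LinearMap.range_eq_top]
  refine eq_top_of_sub_mem _ fun y => ?_
  obtain ⟨x, hx⟩ := h y
  exact ⟨f x, ⟨x, rfl⟩, hx⟩

/-- For a split surjection, elements of the kernel divisible by `𝔪` are divisible in the kernel. -/
theorem mem_smul_ker (f : M →ₗ[R] N) (hf : Function.Surjective f) [Module.Projective R N]
    {x : M} (hx : x ∈ maximalIdeal R • (⊤ : Submodule R M)) (hfx : f x = 0) :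
    x ∈ maximalIdeal R • LinearMap.ker f := by
  obtain ⟨g, hg⟩ := Module.projective_lifting_property f LinearMap.id hf
  have h := Submodule.mem_map_of_mem (f := LinearMap.id - g ∘ₗ f) hx
  rw [Submodule.map_smul''] at h
  have h2 : (LinearMap.id - g ∘ₗ f : M →ₗ[R] M) x = x := by simp [hfx]
  rw [h2] at h
  refine Submodule.smul_mono le_rfl ?_ h
  rintro _ ⟨y, -, rfl⟩
  have := LinearMap.congr_fun hg (f y)
  simp only [LinearMap.comp_apply, LinearMap.id_apply] at this
  simp [this]

theorem pi_mem_smul_top {d : ℕ} {y : Fin d → M}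
    (h : ∀ i, y i ∈ maximalIdeal R • (⊤ : Submodule R M)) :
    y ∈ maximalIdeal R • (⊤ : Submodule R (Fin d → M)) := by
  have : y = ∑ i, LinearMap.single R (fun _ : Fin d => M) i (y i) := by
    ext j
    simp [Finset.sum_apply, Pi.single_apply]
  rw [this]
  exact Submodule.sum_mem _ fun i _ => map_mem_smul_top _ (h i)

end modules

/-! ### Base change of Hopf algebras to the residue field. -/

section hopf

variable {R : Type u} [CommRing R] [IsLocalRing R] {A B : Type u} [CommRing A] [HopfAlgebra R A]
  [CommRing B] [HopfAlgebra R B]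

variable (R) in
/-- Base change of a homomorphism of group schemes to the residue field. -/
def fiberHom (f : A →ₐc[R] B) : ResidueField R ⊗[R] A →ₐc[ResidueField R] ResidueField R ⊗[R] B :=
  Bialgebra.TensorProduct.map (BialgHom.id (ResidueField R) (ResidueField R)) f

@[simp] theorem fiberHom_tmul (f : A →ₐc[R] B) (c : ResidueField R) (a : A) :
    fiberHom R f (c ⊗ₜ a) = c ⊗ₜ f a := rfl

theorem fiberHom_surjective (f : A →ₐc[R] B) (hf : Function.Surjective f) :
    Function.Surjective (fiberHom R f) := fun y => by
  obtain ⟨b, rfl⟩ := exists_tmul_eq y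
  obtain ⟨a, rfl⟩ := hf b
  exact ⟨1 ⊗ₜ a, rfl⟩

theorem fiberHom_ker (f : A →ₐc[R] B) (hf : Function.Surjective f) [Module.Projective R B]
    (hcl : ∃ e : A, IsIdempotentElem e ∧ RingHom.ker f = Ideal.span {e}) :
    ∃ e : ResidueField R ⊗[R] A, IsIdempotentElem e ∧ RingHom.ker (fiberHom R f) = Ideal.span {e} := by
  obtain ⟨e, he, hk⟩ := hcl
  have hfe : f e = 0 := by
    have : e ∈ RingHom.ker f := hk ▸ Ideal.mem_span_singleton_self e
    exact this
  refine ⟨1 ⊗ₜ e, ?_, le_antisymm (fun x hx => ?_) ?_⟩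
  · rw [IsIdempotentElem, Algebra.TensorProduct.tmul_mul_tmul, he.eq, one_mul]
  · obtain ⟨a, rfl⟩ := exists_tmul_eq x
    have hx' : (1 : ResidueField R) ⊗ₜ[R] f a = 0 := hx
    rw [tmul_eq_zero_iff] at hx'
    have h2 : f (a - e * a) = f a := by simp [hfe]
    -- A linear section of `f` corrects `a` by a multiple of the maximal ideal so that it lies in
    -- the kernel of `f` itself, and not just modulo the maximal ideal.
    obtain ⟨g, hg⟩ := Module.projective_lifting_property (f : A →ₗ[R] B) LinearMap.id hf
    have h3 : f (a - g (f a)) = 0 := by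
      rw [map_sub, sub_eq_zero]
      exact (LinearMap.congr_fun hg (f a)).symm
    have h4 : a - g (f a) ∈ RingHom.ker f := h3
    rw [hk, Ideal.mem_span_singleton] at h4
    obtain ⟨c, hc⟩ := h4
    have h5 : (1 : ResidueField R) ⊗ₜ[R] a = 1 ⊗ₜ (e * c) := by
      rw [tmul_eq_iff, ← hc, sub_sub_cancel]
      exact map_mem_smul_top g hx'
    rw [h5, Ideal.mem_span_singleton]
    exact ⟨1 ⊗ₜ c, by rw [Algebra.TensorProduct.tmul_mul_tmul, one_mul]⟩
  · rw [Ideal.span_singleton_le_iff_mem]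
    change (1 : ResidueField R) ⊗ₜ[R] f e = 0
    rw [hfe, TensorProduct.tmul_zero]

theorem fiber_isLocalRing (A : Type u) [CommRing A] [Algebra R A] [Module.Finite R A] [IsLocalRing A]
    [Module.Free R A] :
    IsLocalRing (ResidueField R ⊗[R] A) := by
  have : Nontrivial (ResidueField R ⊗[R] A) := by
    rw [← not_subsingleton_iff_nontrivial, IsLocalRing.subsingleton_tensorProduct]
    exact not_subsingleton A
  exact IsLocalRing.of_surjective' (Algebra.TensorProduct.includeRight :
    A →ₐ[R] ResidueField R ⊗[R] A).toRingHom exists_tmul_eq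

theorem fiber_counit (a : A) : Coalgebra.counit (R := ResidueField R)
    ((1 : ResidueField R) ⊗ₜ[R] a) = residue R (Coalgebra.counit (R := R) a) := by
  rw [TensorProduct.counit_tmul]
  simp [Algebra.smul_def]

/-- Contraction of the comultiplication with a functional on the first factor. -/
def contract {R : Type u} [CommRing R] {A B : Type u} [CommRing A] [HopfAlgebra R A]
    [CommRing B] [HopfAlgebra R B] (l : A →ₗ[R] R) (ι : A →ₐc[R] B) : A →ₗ[R] B :=
  (TensorProduct.lid R B).toLinearMap ∘ₗ TensorProduct.map l (ι : A →ₗ[R] B) ∘ₗ Coalgebra.comul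

theorem fiber_contract (l : A →ₗ[R] R) (L : ResidueField R ⊗[R] A →ₗ[ResidueField R] ResidueField R)
    (hL : ∀ a, L (1 ⊗ₜ a) = residue R (l a)) (ι : A →ₐc[R] B) (a : A) :
    contract L (fiberHom R ι) (1 ⊗ₜ a) = 1 ⊗ₜ contract l ι a := by
  have hc := TensorProduct.comul_tmul (R := R) (S := ResidueField R) (1 : ResidueField R) a
  simp only [contract, LinearMap.comp_apply, hc]
  induction Coalgebra.comul (R := R) a using TensorProduct.induction_on with
  | zero => simp
  | add x y hx hy =>
    simp only [TensorProduct.tmul_add, map_add, hx, hy]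
  | tmul x y =>
    simp only [CommSemiring.comul_apply]
    change (TensorProduct.lid (ResidueField R) _) (L (1 ⊗ₜ[R] x) ⊗ₜ[ResidueField R]
      fiberHom R ι (1 ⊗ₜ y)) = _
    rw [hL]
    simp only [fiberHom_tmul, TensorProduct.lid_tmul, TensorProduct.map_tmul,
      LinearEquiv.coe_coe, TensorProduct.tmul_smul]
    rw [TensorProduct.smul_tmul', TensorProduct.smul_tmul', smul_eq_mul, mul_one,
      Algebra.smul_def, mul_one]
    rfl

end hopf

end ResidueFiber

/-! ### Splitting a finite flat group scheme along its identity component -/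

namespace PerfectAlg

open HopfGroup ResidueFiber

/-- On the special fibre O(G) = O(Gₑₜ) ⊗ O(G₀), and the coordinates with respect to a basis of
O(Gₑₜ) are contractions of the comultiplication with functionals. This description uses no group
splitting, so it can be lifted to the base ring. An endomorphism of G₀, extended by the identity on
the étale part, acts coordinatewise. -/
theorem exists_contract_bijective {K : Type u} [Field K] [PerfectField K]
    {A A₀ : Type u} [CommRing A] [HopfAlgebra K A] [Coalgebra.IsCocomm K A] [Module.Finite K A]
    [CommRing A₀] [HopfAlgebra K A₀] [Coalgebra.IsCocomm K A₀] [Module.Finite K A₀] [IsLocalRing A₀]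
    (ι : A →ₐc[K] A₀) (hι : Function.Surjective ι)
    (hcl : ∃ e : A, IsIdempotentElem e ∧ RingHom.ker ι = Ideal.span {e}) :
    ∃ (d : ℕ) (f : Fin d → A →ₗ[K] K),
      Function.Bijective (fun a i => contract (f i) ι a : A → Fin d → A₀) ∧
      ∀ (e : A₀ →ₐc[K] A₀) (a : A) (i : Fin d),
        contract (f i) ι (extendEnd ι hι hcl e a) = e (contract (f i) ι a) := by
  let b := Module.finBasis K (retr K A).range
  -- The image of `retr` is the coordinate ring of the étale part; precomposing its coordinate
  -- functions with `retr` makes them functionals on all of `A`.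
  let f := fun i => b.coord i ∘ₗ (retr K A).rangeRestrict.toLinearMap
  have hf : ∀ i a, contract (f i) ι a =
      TensorProduct.lid K A₀ (TensorProduct.map (f i) LinearMap.id (splitMap ι a)) := fun i a => by
    have h : TensorProduct.map (f i) (ι : A →ₗ[K] A₀) =
        TensorProduct.map (f i) LinearMap.id ∘ₗ
          (Algebra.TensorProduct.map (retr K A) (ι : A →ₐ[K] A₀)).toLinearMap := by
      refine TensorProduct.ext' fun x y => ?_
      have : (retr K A).rangeRestrict (retr K A x) = (retr K A).rangeRestrict x :=
        Subtype.ext (retr_retr x)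
      change b.coord i ((retr K A).rangeRestrict x) ⊗ₜ[K] ι y =
        b.coord i ((retr K A).rangeRestrict (retr K A x)) ⊗ₜ[K] ι y
      rw [this]
    exact congrArg (TensorProduct.lid K A₀) (LinearMap.congr_fun h _)
  have hb : ∀ i, retr K A (b i) = b i := fun i => by
    obtain ⟨x, hx⟩ := (b i).2
    change retr K A x = b i at hx
    rw [← hx, retr_retr]
  refine ⟨_, f, ⟨fun x y hxy => ?_, fun y => ?_⟩, fun e a i => ?_⟩
  · apply splitMap_injective ι hι hcl
    have h1 : ∀ t : A ⊗[K] A₀, ∑ i, (b i : A) ⊗ₜ[K]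
        (TensorProduct.lid K A₀ (TensorProduct.map (f i) LinearMap.id t)) =
        Algebra.TensorProduct.map (retr K A) (AlgHom.id K A₀) t := fun t => by
      induction t using TensorProduct.induction_on with
      | zero => simp
      | add x y hx hy => simp only [map_add, TensorProduct.tmul_add, Finset.sum_add_distrib, hx, hy]
      | tmul x y =>
        have h2 := congrArg Subtype.val (b.sum_repr ((retr K A).rangeRestrict x))
        simp only [AddSubmonoidClass.coe_finsetSum, SetLike.val_smul] at h2
        change _ = retr K A x ⊗ₜ[K] y
        change _ = retr K A x at h2
        rw [← h2, TensorProduct.sum_tmul]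
        refine Finset.sum_congr rfl fun i _ => ?_
        rw [TensorProduct.smul_tmul]
        rfl
    have h3 : ∀ a, Algebra.TensorProduct.map (retr K A) (AlgHom.id K A₀) (splitMap ι a) =
        splitMap ι a := fun a => by
      have : (Algebra.TensorProduct.map (retr K A) (AlgHom.id K A₀)).comp
          (Algebra.TensorProduct.map (retr K A) (ι : A →ₐ[K] A₀)) =
          Algebra.TensorProduct.map (retr K A) (ι : A →ₐ[K] A₀) := by
        rw [← Algebra.TensorProduct.map_comp]
        congr 1
        exact AlgHom.ext fun a => retr_retr a
      exact DFunLike.congr_fun this _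
    rw [← h3 x, ← h3 y, ← h1, ← h1]
    refine Finset.sum_congr rfl fun i _ => ?_
    have := congrFun hxy i
    simp only [hf] at this
    rw [this]
  · refine ⟨∑ i, (b i : A) * sectionHom ι hι hcl (y i), funext fun j => ?_⟩
    simp only [hf]
    have h4 : splitMap ι (∑ i, (b i : A) * sectionHom ι hι hcl (y i)) =
        ∑ i, (b i : A) ⊗ₜ y i := by
      rw [map_sum]
      refine Finset.sum_congr rfl fun i _ => ?_
      have := splitMap_mul ι hι hcl (b i : A) (y i)
      rwa [hb] at this
    rw [h4]
    simp only [map_sum, TensorProduct.map_tmul, TensorProduct.lid_tmul, LinearMap.id_apply]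
    have h5 : ∀ i, f j (b i) = if i = j then 1 else 0 := fun i => by
      have : (retr K A).rangeRestrict (b i : A) = b i := Subtype.ext (hb i)
      change b.coord j ((retr K A).rangeRestrict (b i : A)) = _
      rw [this, Module.Basis.coord_apply, Module.Basis.repr_self, Finsupp.single_apply]
    simp [h5]
  · rw [hf, hf, splitMap_extendEnd]
    induction splitMap ι a using TensorProduct.induction_on with
    | zero => simp
    | add x y hx hy => simp only [map_add, hx, hy]
    | tmul x y =>
      simp

end PerfectAlg

/-! ### Coactions of the identity component and their contractions. -/

namespace HopfGroup

section act

variable {R : Type u} [CommRing R] {A C : Type u} [CommRing A] [HopfAlgebra R A]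
  [CommRing C] [HopfAlgebra R C]

/-- The coaction `O(G) → O(G) ⊗ O(H)` attached to a homomorphism `H → G`. -/
def act (φ : A →ₐc[R] C) : A →ₐ[R] A ⊗[R] C :=
  (Algebra.TensorProduct.map (AlgHom.id R A) (φ : A →ₐ[R] C)).comp (Bialgebra.comulAlgHom R A)

theorem act_natural {B E : Type u} [CommRing B] [HopfAlgebra R B] [CommRing E] [HopfAlgebra R E]
    (φ : A →ₐc[R] C) (ψ : B →ₐc[R] E) (t : A →ₐc[R] B) (s : C →ₐc[R] E)
    (h : ∀ a, s (φ a) = ψ (t a)) (a : A) :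
    act ψ (t a) = Algebra.TensorProduct.map (t : A →ₐ[R] B) (s : C →ₐ[R] E) (act φ a) := by
  change Algebra.TensorProduct.map _ _ (Coalgebra.comul (R := R) (t a)) = _
  rw [← CoalgHomClass.map_comp_comul_apply]
  have : (Algebra.TensorProduct.map (AlgHom.id R B) (ψ : B →ₐ[R] E)).comp
      (Algebra.TensorProduct.map (t : A →ₐ[R] B) (t : A →ₐ[R] B)) =
      (Algebra.TensorProduct.map (t : A →ₐ[R] B) (s : C →ₐ[R] E)).comp
        (Algebra.TensorProduct.map (AlgHom.id R A) (φ : A →ₐ[R] C)) := by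
    rw [← Algebra.TensorProduct.map_comp, ← Algebra.TensorProduct.map_comp]
    congr 1
    exact AlgHom.ext fun a => (h a).symm
  exact DFunLike.congr_fun this _

/-- Coassociativity, saying that translations on the two sides commute. It makes the invariants
stable under comultiplication. -/
theorem lTensor_act_comul (φ : A →ₐc[R] C) (a : A) :
    LinearMap.lTensor A (act φ).toLinearMap (Coalgebra.comul (R := R) a) =
      TensorProduct.assoc R A A C (LinearMap.rTensor C Coalgebra.comul (act φ a)) := by
  have h1 := Coalgebra.coassoc_apply (R := R) a
  have h2 : LinearMap.lTensor A (act φ).toLinearMap =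
      LinearMap.lTensor A (LinearMap.lTensor A (φ : A →ₗ[R] C)) ∘ₗ
        LinearMap.lTensor A (Coalgebra.comul (R := R) (A := A)) := by
    rw [← LinearMap.lTensor_comp]
    rfl
  rw [h2, LinearMap.comp_apply, ← h1]
  have h3 : LinearMap.lTensor A (LinearMap.lTensor A (φ : A →ₗ[R] C)) ∘ₗ
      (TensorProduct.assoc R A A A).toLinearMap =
      (TensorProduct.assoc R A A C).toLinearMap ∘ₗ LinearMap.lTensor (A ⊗[R] A) (φ : A →ₗ[R] C) := by
    ext; rfl
  have h4 := LinearMap.congr_fun h3 (LinearMap.rTensor A Coalgebra.comul (Coalgebra.comul (R := R) a))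
  refine h4.trans ?_
  change TensorProduct.assoc R A A C _ = TensorProduct.assoc R A A C
    (LinearMap.rTensor C Coalgebra.comul (LinearMap.lTensor A (φ : A →ₗ[R] C)
      (Coalgebra.comul (R := R) a)))
  rw [← LinearMap.comp_apply (LinearMap.rTensor C _), LinearMap.rTensor_comp_lTensor,
    ← LinearMap.lTensor_comp_rTensor]
  rfl

open ResidueFiber in
theorem contract_eq_act (l : A →ₗ[R] R) (φ : A →ₐc[R] C) (a : A) :
    contract l φ a = TensorProduct.lid R C (LinearMap.rTensor C l (act φ a)) := by
  change _ = TensorProduct.lid R C (LinearMap.rTensor C l (LinearMap.lTensor A (φ : A →ₗ[R] C)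
    (Coalgebra.comul (R := R) a)))
  rw [← LinearMap.comp_apply (LinearMap.rTensor C l), LinearMap.rTensor_comp_lTensor]
  rfl

open ResidueFiber in
-- Contraction in the first variable commutes with translation by G₀ in the last one, again by
-- coassociativity. So coordinates given by contractions intertwine the coaction on O(G) with the
-- comultiplication of O(G₀).
theorem rTensor_contract_act (l : A →ₗ[R] R) (φ : A →ₐc[R] C) (a : A) :
    LinearMap.rTensor C (contract l φ) (act φ a) = Coalgebra.comul (R := R) (contract l φ a) := by
  let L : A ⊗[R] (A ⊗[R] A) →ₗ[R] C ⊗[R] C := (TensorProduct.lid R (C ⊗[R] C)).toLinearMap ∘ₗ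
    TensorProduct.map l (TensorProduct.map (φ : A →ₗ[R] C) (φ : A →ₗ[R] C))
  have h1 := congrArg L (Coalgebra.coassoc_apply (R := R) a)
  have h2 : ∀ t : A ⊗[R] A, TensorProduct.map (contract l φ) (φ : A →ₗ[R] C) t =
      L (TensorProduct.assoc R A A A (LinearMap.rTensor A Coalgebra.comul t)) := fun t => by
    induction t using TensorProduct.induction_on with
    | zero => simp
    | add x y hx hy => simp only [map_add, hx, hy]
    | tmul x y =>
      simp only [contract, TensorProduct.map_tmul, LinearMap.rTensor_tmul, LinearMap.comp_apply]
      induction Coalgebra.comul (R := R) x using TensorProduct.induction_on with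
      | zero => simp
      | add u v hu hv => simp only [map_add, TensorProduct.add_tmul, hu, hv]
      | tmul u v => simp [L, TensorProduct.smul_tmul']
  have h3 : ∀ t : A ⊗[R] A, L (LinearMap.lTensor A Coalgebra.comul t) =
      Coalgebra.comul (R := R) (TensorProduct.lid R C (TensorProduct.map l (φ : A →ₗ[R] C) t)) :=
    fun t => by
    induction t using TensorProduct.induction_on with
    | zero => simp
    | add x y hx hy => simp only [map_add, hx, hy]
    | tmul x y =>
      simp only [L, LinearMap.lTensor_tmul, LinearMap.comp_apply, TensorProduct.map_tmul,
        LinearEquiv.coe_coe, TensorProduct.lid_tmul, map_smul]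
      congr 1
      exact CoalgHomClass.map_comp_comul_apply φ y
  rw [← h2, h3] at h1
  refine Eq.trans ?_ h1
  change LinearMap.rTensor C (contract l φ) (LinearMap.lTensor A (φ : A →ₗ[R] C)
    (Coalgebra.comul (R := R) a)) = _
  rw [← LinearMap.comp_apply, LinearMap.rTensor_comp_lTensor]

/-- Contraction along an endomorphism of the identity component. -/
theorem contract_comp (l : A →ₗ[R] R) (φ : A →ₐc[R] C) (e : C →ₐc[R] C) (a : A) :
    ResidueFiber.contract l (e.comp φ) a = e (ResidueFiber.contract l φ a) := by
  simp only [ResidueFiber.contract, LinearMap.comp_apply]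
  induction Coalgebra.comul (R := R) a using TensorProduct.induction_on with
  | zero => simp
  | add x y hx hy => simp only [map_add, hx, hy]
  | tmul x y => simp

end act

end HopfGroup

/-! ### Lifting the splitting and its projectors from the special fibre to R. -/

namespace ResidueFiber

open HopfGroup PerfectAlg IsLocalRing

variable {R : Type u} [CommRing R] [IsLocalRing R] [PerfectField (ResidueField R)]
  {A A₀ : Type u} [CommRing A] [HopfAlgebra R A] [Coalgebra.IsCocomm R A] [Module.Finite R A]
  [Module.Free R A] [CommRing A₀] [HopfAlgebra R A₀] [Coalgebra.IsCocomm R A₀]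
  [Module.Finite R A₀] [Module.Free R A₀] [IsLocalRing A₀]

/-- The extension to the special fibre of `G` of an endomorphism of the identity component. -/
def fiberEnd (ι : A →ₐc[R] A₀) (hι : Function.Surjective ι)
    (hcl : ∃ e : A, IsIdempotentElem e ∧ RingHom.ker ι = Ideal.span {e}) (e : A₀ →ₐc[R] A₀) :
    ResidueField R ⊗[R] A →ₐc[ResidueField R] ResidueField R ⊗[R] A :=
  extendEnd (fiberHom R ι) (fiberHom_surjective ι hι) (fiberHom_ker ι hι hcl) (fiberHom R e)

/-- The splitting data: `G` is, as a scheme, a product of its identity component with a finite flat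
scheme, and projectors on the identity component extend. -/
theorem exists_splitting (ι : A →ₐc[R] A₀) (hι : Function.Surjective ι)
    (hcl : ∃ e : A, IsIdempotentElem e ∧ RingHom.ker ι = Ideal.span {e}) :
    ∃ (d : ℕ) (l : Fin d → A →ₗ[R] R) (Φ : A ≃ₗ[R] (Fin d → A₀)),
      (∀ a i, Φ a i = contract (l i) ι a) ∧
      ∀ (e : A₀ →ₐc[R] A₀) (a : A), (1 : ResidueField R) ⊗ₜ[R] (Φ.symm fun i => e (Φ a i)) =
        fiberEnd ι hι hcl e (1 ⊗ₜ a) := by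
  have := fiber_isLocalRing (R := R) A₀
  obtain ⟨d, f, hbij, hf⟩ := exists_contract_bijective (fiberHom R ι) (fiberHom_surjective ι hι)
    (fiberHom_ker ι hι hcl)
  -- Freeness of `A` lifts each functional on the special fibre to an R-valued one.
  have hl : ∀ i, ∃ l : A →ₗ[R] R, ∀ a, f i (1 ⊗ₜ a) = residue R (l a) := fun i => by
    obtain ⟨l, hl⟩ := Module.projective_lifting_property
      (Algebra.linearMap R (ResidueField R)) ((f i).restrictScalars R ∘ₗ
        (TensorProduct.mk R (ResidueField R) A 1)) IsLocalRing.residue_surjective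
    exact ⟨l, fun a => (LinearMap.congr_fun hl a).symm⟩
  choose l hl using hl
  let Φ : A →ₗ[R] (Fin d → A₀) := LinearMap.pi fun i => contract (l i) ι
  have hΦ : ∀ a i, contract (f i) (fiberHom R ι) (1 ⊗ₜ a) = 1 ⊗ₜ Φ a i := fun a i =>
    fiber_contract (l i) (f i) (hl i) ι a
  have hsurj : Function.Surjective Φ := surjective_of_fiber _ fun y => by
    obtain ⟨x, hx⟩ := hbij.2 fun i => 1 ⊗ₜ y i
    obtain ⟨a, rfl⟩ := exists_tmul_eq x
    refine ⟨a, pi_mem_smul_top fun i => ?_⟩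
    rw [Pi.sub_apply, ← tmul_eq_iff, ← hΦ]
    exact (congrFun hx i).symm
  -- Ranks are computed on the special fibre, where the map is bijective; a surjection of finite
  -- free modules of equal rank is then injective.
  have hrank : Module.finrank R A = Module.finrank R (Fin d → A₀) := by
    let Ψ : ResidueField R ⊗[R] A →ₗ[ResidueField R] (Fin d → ResidueField R ⊗[R] A₀) :=
      LinearMap.pi fun i => contract (f i) (fiberHom R ι)
    have h := (LinearEquiv.ofBijective Ψ hbij).finrank_eq
    rw [Module.finrank_baseChange] at h
    rw [h, Module.finrank_pi_fintype, Module.finrank_pi_fintype]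
    simp
  have hinj : Function.Injective Φ := by
    let E := LinearEquiv.ofFinrankEq A (Fin d → A₀) hrank
    have h : Function.Injective (E.symm.toLinearMap ∘ₗ Φ) :=
      OrzechProperty.injective_of_surjective_endomorphism _ (E.symm.surjective.comp hsurj)
    exact Function.Injective.of_comp h
  refine ⟨d, l, LinearEquiv.ofBijective Φ ⟨hinj, hsurj⟩, fun a i => rfl, fun e a => ?_⟩
  apply hbij.1
  funext i
  have h1 := hf (fiberHom R e) (1 ⊗ₜ a) i
  have h2 : Φ ((LinearEquiv.ofBijective Φ ⟨hinj, hsurj⟩).symm fun i => e (Φ a i)) =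
    fun i => e (Φ a i) :=
    (LinearEquiv.ofBijective Φ ⟨hinj, hsurj⟩).apply_symm_apply _
  rw [hΦ] at h1
  exact ((hΦ _ i).trans
    (congrArg (fun y : Fin d → A₀ => (1 : ResidueField R) ⊗ₜ[R] y i) h2)).trans h1.symm

/-- The difference of two coactions. -/
def actSub {R : Type u} [CommRing R] {A C : Type u} [CommRing A] [HopfAlgebra R A]
    [CommRing C] [HopfAlgebra R C] (φ ψ : A →ₐc[R] C) : A →ₗ[R] A ⊗[R] C :=
  (act φ).toLinearMap - (act ψ).toLinearMap

/-- In the coordinates of the splitting, applying `e` coordinatewise is a projector onto the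
invariants, whose image is `d` copies of the image of `e`. The shape identity plus Θ after the
difference of coactions makes it evident that invariants are fixed, and this persists after
tensoring. The number `d` is chosen before `e`, so that the ranks of all quotients of G can be
compared. -/
theorem exists_projector (ι : A →ₐc[R] A₀) (hι : Function.Surjective ι)
    (hcl : ∃ e : A, IsIdempotentElem e ∧ RingHom.ker ι = Ideal.span {e}) :
    ∃ d : ℕ, d * Module.finrank R A₀ = Module.finrank R A ∧
      ∀ (e : A₀ →ₐc[R] A₀), (∀ x, e (e x) = e x) →
      ∃ Θ : A ⊗[R] A₀ →ₗ[R] A, 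
        (∀ a, actSub ι (e.comp ι) (a + Θ (actSub ι (e.comp ι) a)) = 0) ∧
        (∀ a, (1 : ResidueField R) ⊗ₜ[R] (a + Θ (actSub ι (e.comp ι) a)) =
          fiberEnd ι hι hcl e (1 ⊗ₜ a)) ∧
        ∀ (C : Type u) [CommRing C] [HopfAlgebra R C] [Module.Finite R C] [Module.Free R C]
          (j : C →ₐc[R] A₀) (s : A₀ →ₐc[R] C), (∀ x, s (j x) = x) → e = j.comp s →
          Nonempty (LinearMap.ker (actSub ι (e.comp ι)) ≃ₗ[R] (Fin d → C)) := by
  obtain ⟨d, l, Φ, hΦ, hfib⟩ := exists_splitting ι hι hcl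
  refine ⟨d, ?_, fun e he => ?_⟩
  · rw [Φ.finrank_eq, Module.finrank_pi_fintype]
    simp
  -- With this sign, Θ applied to the difference of coactions has coordinates `e (Φ a i) - Φ a i`.
  let Θ : A ⊗[R] A₀ →ₗ[R] A := Φ.symm.toLinearMap ∘ₗ LinearMap.pi fun i =>
    -((TensorProduct.lid R A₀).toLinearMap ∘ₗ LinearMap.rTensor A₀ (l i))
  have h1 : ∀ a, a + Θ (actSub ι (e.comp ι) a) = Φ.symm fun i => e (Φ a i) := fun a => by
    rw [LinearEquiv.eq_symm_apply, map_add]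
    funext i
    simp only [Θ, LinearMap.comp_apply, LinearEquiv.coe_coe, LinearEquiv.apply_symm_apply,
      Pi.add_apply, LinearMap.pi_apply, LinearMap.neg_apply]
    rw [hΦ, ← contract_comp, contract_eq_act _ ι, contract_eq_act]
    simp only [actSub, LinearMap.sub_apply, map_sub, AlgHom.toLinearMap_apply]
    abel
  have h2 : ∀ a, (∀ i, e (Φ a i) = Φ a i) → actSub ι (e.comp ι) a = 0 := fun a ha => by
    -- A tensor is recovered from its contractions in the first factor, so equality of two coactions
    -- can be tested after contraction, where it becomes a statement about comultiplication in
    -- O(G₀).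
    have hid : ∀ t : A ⊗[R] A₀, t = ∑ i, LinearMap.rTensor A₀
        (Φ.symm.toLinearMap ∘ₗ LinearMap.single R (fun _ => A₀) i)
          (LinearMap.rTensor A₀ (contract (l i) ι) t) := fun t => by
      have h3 : LinearMap.id = ∑ i, (Φ.symm.toLinearMap ∘ₗ LinearMap.single R (fun _ => A₀) i) ∘ₗ
          contract (l i) ι := by
        refine LinearMap.ext fun a => ?_
        rw [LinearMap.sum_apply]
        simp only [LinearMap.comp_apply, ← hΦ, LinearEquiv.coe_coe]
        rw [← map_sum]
        have h3 : ∑ i, LinearMap.single R (fun _ => A₀) i (Φ a i) = Φ a := by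
          ext j
          simp [Finset.sum_apply, Pi.single_apply]
        rw [h3, LinearEquiv.symm_apply_apply]
        rfl
      have h4 := LinearMap.congr_fun (congrArg (LinearMap.rTensor A₀) h3) t
      rw [LinearMap.rTensor_id, LinearMap.id_apply] at h4
      refine h4.trans ?_
      change LinearMap.rTensorHom A₀ _ t = _
      rw [map_sum, LinearMap.sum_apply]
      refine Finset.sum_congr rfl fun i _ => ?_
      rw [LinearMap.coe_rTensorHom, LinearMap.rTensor_comp]
      rfl
    have hact : act (e.comp ι) a = LinearMap.lTensor A (e : A₀ →ₗ[R] A₀) (act ι a) := by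
      change Algebra.TensorProduct.map _ _ _ = _
      have : Algebra.TensorProduct.map (AlgHom.id R A) ((e.comp ι : A →ₐc[R] A₀) : A →ₐ[R] A₀) =
        (Algebra.TensorProduct.map (AlgHom.id R A) (e : A₀ →ₐ[R] A₀)).comp
          (Algebra.TensorProduct.map (AlgHom.id R A) (ι : A →ₐ[R] A₀)) := by
        rw [← Algebra.TensorProduct.map_comp]
        rfl
      rw [this]
      rfl
    have h5 : ∀ i, LinearMap.rTensor A₀ (contract (l i) ι) (act (e.comp ι) a) =
        LinearMap.rTensor A₀ (contract (l i) ι) (act ι a) := fun i => by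
      rw [hact, ← LinearMap.comp_apply, LinearMap.rTensor_comp_lTensor,
        ← LinearMap.lTensor_comp_rTensor, LinearMap.comp_apply, rTensor_contract_act, ← hΦ, ← ha,
        ← CoalgHomClass.map_comp_comul_apply]
      have h6 : LinearMap.lTensor A₀ (e : A₀ →ₗ[R] A₀) ∘ₗ
          TensorProduct.map (e : A₀ →ₗ[R] A₀) (e : A₀ →ₗ[R] A₀) =
          TensorProduct.map (e : A₀ →ₗ[R] A₀) (e : A₀ →ₗ[R] A₀) := by
        ext x y
        change e x ⊗ₜ[R] e (e y) = e x ⊗ₜ[R] e y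
        rw [he]
      exact LinearMap.congr_fun h6 _
    change act ι a - act (e.comp ι) a = 0
    rw [hid (act ι a), hid (act (e.comp ι) a), sub_eq_zero]
    exact Finset.sum_congr rfl fun i _ => by rw [h5]
  refine ⟨Θ, fun a => ?_, fun a => ?_, ?_⟩
  · apply h2
    intro i
    rw [h1, LinearEquiv.apply_symm_apply, he]
  · rw [h1, hfib]
  · intro C _ _ _ _ j s hs hes
    subst hes
    have h7 : ∀ a, a ∈ LinearMap.ker (actSub ι ((j.comp s).comp ι)) ↔ ∀ i, j (s (Φ a i)) = Φ a i :=
      fun a => by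
        refine ⟨fun ha i => ?_, fun ha => h2 a ha⟩
        have h8 := h1 a
        rw [LinearMap.mem_ker.1 ha, map_zero, add_zero, LinearEquiv.eq_symm_apply] at h8
        exact (congrFun h8 i).symm
    refine ⟨LinearEquiv.ofLinearMap
      ((LinearMap.compLeft (s : A₀ →ₗ[R] C) (Fin d) ∘ₗ Φ.toLinearMap) ∘ₗ Submodule.subtype _)
      (LinearMap.codRestrict _ (Φ.symm.toLinearMap ∘ₗ LinearMap.compLeft (j : C →ₗ[R] A₀) (Fin d))
        fun c => ?_) ?_ ?_⟩
    · rw [h7]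
      intro i
      simp [hs]
    · ext c i
      simp [hs]
    · refine LinearMap.ext fun a => Subtype.ext ?_
      simp only [LinearMap.comp_apply, LinearMap.codRestrict_apply, LinearEquiv.coe_coe,
        LinearMap.id_apply, Submodule.subtype_apply]
      rw [LinearEquiv.symm_apply_eq]
      funext i
      exact (h7 a.1).1 a.2 i

end ResidueFiber

/-! ### Quotient group schemes as sub-Hopf algebras -/

namespace HopfGroup

section sub

variable {R : Type u} [CommRing R] {A : Type u} [CommRing A] [HopfAlgebra R A]

/-- A subalgebra of a Hopf algebra that is a direct summand and stable under the structure maps. -/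
class IsHopfSub (B : Subalgebra R A) : Prop where
  exists_retraction : ∃ q : A →ₗ[R] B, (∀ b : B, q b = b) ∧
    ∀ b : B, TensorProduct.map (B.val.toLinearMap ∘ₗ q) (B.val.toLinearMap ∘ₗ q)
      (Coalgebra.comul (R := R) (b : A)) = Coalgebra.comul (R := R) (b : A)
  antipode_mem : ∀ b : B, HopfAlgebra.antipode R (b : A) ∈ B

variable (B : Subalgebra R A) [hB : IsHopfSub B]

namespace IsHopfSub

/-- A linear retraction of `A` onto a sub-Hopf algebra. -/
def retraction : A →ₗ[R] B := hB.exists_retraction.choose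

theorem retraction_apply (b : B) : retraction B b = b := hB.exists_retraction.choose_spec.1 b

/-- `B ⊗ B → A ⊗ A`. -/
abbrev incl : B ⊗[R] B →ₐ[R] A ⊗[R] A := Algebra.TensorProduct.map B.val B.val

/-- The retraction splits the inclusion and remains a splitting after tensoring, so the Hopf axioms
of `B` may be verified inside those of `A`. -/
theorem incl_injective : Function.Injective (incl B) := by
  refine Function.LeftInverse.injective
    (g := TensorProduct.map (retraction B) (retraction B)) fun t => ?_
  induction t using TensorProduct.induction_on with
  | zero => simp
  | add x y hx hy => simp only [map_add, hx, hy]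
  | tmul x y =>
    change retraction B x ⊗ₜ[R] retraction B y = _
    rw [retraction_apply, retraction_apply]

theorem incl₃_injective : Function.Injective
    (Algebra.TensorProduct.map B.val (Algebra.TensorProduct.map B.val B.val) :
      B ⊗[R] (B ⊗[R] B) →ₐ[R] A ⊗[R] (A ⊗[R] A)) := by
  refine Function.LeftInverse.injective (g := TensorProduct.map (retraction B)
    (TensorProduct.map (retraction B) (retraction B))) fun t => ?_
  have : TensorProduct.map (retraction B) (TensorProduct.map (retraction B) (retraction B)) ∘ₗ
      (Algebra.TensorProduct.map B.val (Algebra.TensorProduct.map B.val B.val) :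
      B ⊗[R] (B ⊗[R] B) →ₐ[R] A ⊗[R] (A ⊗[R] A)).toLinearMap = LinearMap.id := by
    ext x y z
    change retraction B x ⊗ₜ[R] (retraction B y ⊗ₜ[R] retraction B z) = x ⊗ₜ[R] (y ⊗ₜ[R] z)
    rw [retraction_apply, retraction_apply, retraction_apply]
  exact LinearMap.congr_fun this t

/-- The comultiplication, as a linear map. -/
def comulLin : B →ₗ[R] B ⊗[R] B :=
  TensorProduct.map (retraction B) (retraction B) ∘ₗ Coalgebra.comul ∘ₗ B.val.toLinearMap

theorem incl_comulLin (b : B) : incl B (comulLin B b) = Coalgebra.comul (R := R) (b : A) := by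
  refine Eq.trans ?_ (hB.exists_retraction.choose_spec.2 b)
  rw [TensorProduct.map_comp]
  rfl

/-- The comultiplication, as a homomorphism of algebras. -/
def comulAlg : B →ₐ[R] B ⊗[R] B :=
  AlgHom.ofLinearMap (comulLin B)
    (incl_injective B (by rw [incl_comulLin, map_one]; exact Bialgebra.comul_one))
    (fun x y => incl_injective B (by
      rw [map_mul (incl B), incl_comulLin, incl_comulLin, incl_comulLin]
      exact Bialgebra.comul_mul _ _))

theorem incl_comulAlg (b : B) : incl B (comulAlg B b) = Coalgebra.comul (R := R) (b : A) :=
  incl_comulLin B b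

theorem incl_comp_comulAlg : (incl B).comp (comulAlg B) = (Bialgebra.comulAlgHom R A).comp B.val :=
  AlgHom.ext (incl_comulAlg B)

/-- The counit. -/
def counitAlg : B →ₐ[R] R := (Bialgebra.counitAlgHom R A).comp B.val

instance bialgebra : Bialgebra R B :=
  Bialgebra.ofAlgHom (comulAlg B) (counitAlg B)
    (by
      refine AlgHom.ext fun b => incl₃_injective B ?_
      have h1 : ((Algebra.TensorProduct.map B.val (Algebra.TensorProduct.map B.val B.val)).comp
          (Algebra.TensorProduct.assoc R R R B B B).toAlgHom).comp
            (Algebra.TensorProduct.map (comulAlg B) (.id R B)) =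
          ((Algebra.TensorProduct.assoc R R R A A A).toAlgHom.comp
            (Algebra.TensorProduct.map (Bialgebra.comulAlgHom R A) (.id R A))).comp (incl B) := by
        have h2 : (Algebra.TensorProduct.map B.val (Algebra.TensorProduct.map B.val B.val)).comp
            (Algebra.TensorProduct.assoc R R R B B B).toAlgHom =
            (Algebra.TensorProduct.assoc R R R A A A).toAlgHom.comp
              (Algebra.TensorProduct.map (incl B) B.val) := by ext <;> rfl
        rw [h2, AlgHom.comp_assoc, AlgHom.comp_assoc, ← Algebra.TensorProduct.map_comp,
          ← Algebra.TensorProduct.map_comp, incl_comp_comulAlg]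
        rfl
      have h3 : (Algebra.TensorProduct.map B.val (Algebra.TensorProduct.map B.val B.val)).comp
          (Algebra.TensorProduct.map (.id R B) (comulAlg B)) =
          (Algebra.TensorProduct.map (.id R A) (Bialgebra.comulAlgHom R A)).comp (incl B) := by
        rw [← Algebra.TensorProduct.map_comp, ← Algebra.TensorProduct.map_comp, incl_comp_comulAlg]
        rfl
      refine (DFunLike.congr_fun h1 (comulAlg B b)).trans
        (Eq.trans ?_ (DFunLike.congr_fun h3 (comulAlg B b)).symm)
      have h4 := Coalgebra.coassoc_apply (R := R) (b : A)
      simp only [AlgHom.comp_apply, incl_comulAlg]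
      exact h4)
    (by
      refine AlgHom.ext fun b => ?_
      have hinj : Function.Injective (LinearMap.lTensor R B.val.toLinearMap) :=
        Function.LeftInverse.injective (g := LinearMap.lTensor R (retraction B)) fun t => by
          have : LinearMap.lTensor R (retraction B) ∘ₗ LinearMap.lTensor R B.val.toLinearMap =
              LinearMap.id := by
            rw [← LinearMap.lTensor_comp]
            ext b
            change (1 : R) ⊗ₜ[R] retraction B b = 1 ⊗ₜ b
            rw [retraction_apply]
          exact LinearMap.congr_fun this t
      apply hinj
      have h1 : (Algebra.TensorProduct.map (.id R R) B.val).comp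
          (Algebra.TensorProduct.map (counitAlg B) (.id R B)) =
          (Algebra.TensorProduct.map (Bialgebra.counitAlgHom R A) (.id R A)).comp (incl B) := by
        rw [← Algebra.TensorProduct.map_comp, ← Algebra.TensorProduct.map_comp]
        rfl
      refine (DFunLike.congr_fun h1 (comulAlg B b)).trans ?_
      rw [AlgHom.comp_apply, incl_comulAlg]
      exact Coalgebra.rTensor_counit_comul (R := R) (b : A))
    (by
      refine AlgHom.ext fun b => ?_
      have hinj : Function.Injective (LinearMap.rTensor R B.val.toLinearMap) :=
        Function.LeftInverse.injective (g := LinearMap.rTensor R (retraction B)) fun t => by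
          have : LinearMap.rTensor R (retraction B) ∘ₗ LinearMap.rTensor R B.val.toLinearMap =
              LinearMap.id := by
            rw [← LinearMap.rTensor_comp]
            ext b
            change retraction B b ⊗ₜ[R] (1 : R) = b ⊗ₜ 1
            rw [retraction_apply]
          exact LinearMap.congr_fun this t
      apply hinj
      have h1 : (Algebra.TensorProduct.map B.val (.id R R)).comp
          (Algebra.TensorProduct.map (.id R B) (counitAlg B)) =
          (Algebra.TensorProduct.map (.id R A) (Bialgebra.counitAlgHom R A)).comp (incl B) := by
        rw [← Algebra.TensorProduct.map_comp, ← Algebra.TensorProduct.map_comp]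
        rfl
      refine (DFunLike.congr_fun h1 (comulAlg B b)).trans ?_
      rw [AlgHom.comp_apply, incl_comulAlg]
      exact Coalgebra.lTensor_counit_comul (R := R) (b : A))

theorem incl_comul (b : B) : incl B (Coalgebra.comul (R := R) b) = Coalgebra.comul (R := R) (b : A) :=
  incl_comulAlg B b

/-- The antipode. -/
def antipodeAlg : B →ₐ[R] B :=
  ((HopfAlgebra.antipodeAlgHom R A).comp B.val).codRestrict B hB.antipode_mem

instance hopfAlgebra : HopfAlgebra R B :=
  HopfAlgebra.ofAlgHom (antipodeAlg B)
    (by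
      refine AlgHom.ext fun b => Subtype.val_injective ?_
      have h1 : B.val.comp (Algebra.TensorProduct.lift (antipodeAlg B) (.id R B)
          fun _ => Commute.all _) = (Algebra.TensorProduct.lift (HopfAlgebra.antipodeAlgHom R A)
            (.id R A) fun _ => Commute.all _).comp (incl B) := by
        exact Algebra.TensorProduct.ext' fun x y => rfl
      refine (DFunLike.congr_fun h1 (Coalgebra.comul (R := R) b)).trans ?_
      rw [AlgHom.comp_apply, incl_comul]
      have h2 := AlgHom.antipode_id_cancel (R := R) (A := A)
      have h3 := DFunLike.congr_fun (congrArg WithConv.ofConv h2) (b : A)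
      rw [conv_mul_apply] at h3
      exact h3)
    (by
      refine AlgHom.ext fun b => Subtype.val_injective ?_
      have h1 : B.val.comp (Algebra.TensorProduct.lift (.id R B) (antipodeAlg B)
          fun _ _ => Commute.all _ _) = (Algebra.TensorProduct.lift (.id R A)
            (HopfAlgebra.antipodeAlgHom R A) fun _ _ => Commute.all _ _).comp (incl B) := by
        exact Algebra.TensorProduct.ext' fun x y => rfl
      refine (DFunLike.congr_fun h1 (Coalgebra.comul (R := R) b)).trans ?_
      rw [AlgHom.comp_apply, incl_comul]
      have h2 := mul_comp_antipode (AlgHom.id R A)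
      have h3 := DFunLike.congr_fun (congrArg WithConv.ofConv h2) (b : A)
      rw [conv_mul_apply] at h3
      exact h3)

/-- The inclusion of a sub-Hopf algebra. -/
def valHom : B →ₐc[R] A :=
  BialgHom.ofAlgHom B.val rfl (incl_comp_comulAlg B)

@[simp] theorem valHom_apply (b : B) : valHom B b = b := rfl

instance isCocomm [Coalgebra.IsCocomm R A] : Coalgebra.IsCocomm R B where
  comm_comp_comul := by
    refine LinearMap.ext fun b => incl_injective B ?_
    have h1 : (incl B).toLinearMap ∘ₗ (TensorProduct.comm R B B).toLinearMap =
        (TensorProduct.comm R A A).toLinearMap ∘ₗ (incl B).toLinearMap := by ext; rfl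
    refine (LinearMap.congr_fun h1 (Coalgebra.comul (R := R) b)).trans ?_
    rw [LinearMap.comp_apply]
    change TensorProduct.comm R A A (incl B (Coalgebra.comul (R := R) b)) = _
    rw [incl_comul]
    exact Coalgebra.comm_comul R (b : A)

theorem retraction_surjective : Function.Surjective (retraction B) :=
  fun b => ⟨b, retraction_apply B b⟩

theorem finite [Module.Finite R A] : Module.Finite R B :=
  Module.Finite.of_surjective _ (retraction_surjective B)

theorem projective [Module.Projective R A] : Module.Projective R B :=
  Module.Projective.of_split B.val.toLinearMap (retraction B)
    (LinearMap.ext fun b => retraction_apply B b)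

theorem mem_smul_top {I : Ideal R} {b : B} (h : (b : A) ∈ I • (⊤ : Submodule R A)) :
    b ∈ I • (⊤ : Submodule R B) := by
  have h1 := Submodule.mem_map_of_mem (f := retraction B) h
  rw [Submodule.map_smul'', retraction_apply] at h1
  exact Submodule.smul_mono le_rfl le_top h1

/-- A homomorphism of Hopf algebras restricts to sub-Hopf algebras. -/
def restrictHom {A' : Type u} [CommRing A'] [HopfAlgebra R A'] (B' : Subalgebra R A') [IsHopfSub B']
    (f : A →ₐc[R] A') (hf : ∀ b ∈ B, f b ∈ B') : B →ₐc[R] B' :=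
  BialgHom.ofAlgHom (((f : A →ₐ[R] A').comp B.val).codRestrict B' fun b => hf b b.2)
    (by
      ext b
      exact CoalgHomClass.counit_comp_apply f (b : A))
    (by
      refine AlgHom.ext fun b => incl_injective B' ?_
      have h1 : (incl B').comp (Algebra.TensorProduct.map
          (((f : A →ₐ[R] A').comp B.val).codRestrict B' fun b => hf b b.2)
          (((f : A →ₐ[R] A').comp B.val).codRestrict B' fun b => hf b b.2)) =
          (Algebra.TensorProduct.map (f : A →ₐ[R] A') (f : A →ₐ[R] A')).comp (incl B) := by
        rw [← Algebra.TensorProduct.map_comp, ← Algebra.TensorProduct.map_comp]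
        rfl
      refine (DFunLike.congr_fun h1 (Coalgebra.comul (R := R) b)).trans ?_
      rw [AlgHom.comp_apply, incl_comul]
      refine Eq.trans ?_ (incl_comul B' _).symm
      exact CoalgHomClass.map_comp_comul_apply f (b : A))

theorem restrictHom_injective {A' : Type u} [CommRing A'] [HopfAlgebra R A']
    (B' : Subalgebra R A') [IsHopfSub B'] (f : A →ₐc[R] A') (hf) (h : Function.Injective f) :
    Function.Injective (restrictHom B B' f hf) := fun _ _ hxy =>
  Subtype.ext (h (congrArg Subtype.val hxy))

theorem restrictHom_id_comm {A' : Type u} [CommRing A'] [HopfAlgebra R A']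
    (B₁ : Subalgebra R A) [IsHopfSub B₁] (C C₁ : Subalgebra R A') [IsHopfSub C] [IsHopfSub C₁]
    (f : A →ₐc[R] A') (h₁ : ∀ b ∈ B, BialgHom.id R A b ∈ B₁) (h₂ : ∀ b ∈ B₁, f b ∈ C₁)
    (h₃ : ∀ b ∈ B, f b ∈ C) (h₄ : ∀ c ∈ C, BialgHom.id R A' c ∈ C₁) (b : B) :
    restrictHom B₁ C₁ f h₂ (restrictHom B B₁ (BialgHom.id R A) h₁ b) =
      restrictHom C C₁ (BialgHom.id R A') h₄ (restrictHom B C f h₃ b) :=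
  rfl

theorem valHom_restrictHom_id (B₁ : Subalgebra R A) [IsHopfSub B₁]
    (h₁ : ∀ b ∈ B, BialgHom.id R A b ∈ B₁) (b : B) :
    valHom B₁ (restrictHom B B₁ (BialgHom.id R A) h₁ b) = valHom B b := rfl

end IsHopfSub

end sub

/-! ### Invariants as sub-Hopf algebras. -/

section equalizer

/-- The functions on which two coactions agree. -/
def invariants {R : Type u} [CommRing R] {A C : Type u} [CommRing A] [HopfAlgebra R A]
    [CommRing C] [HopfAlgebra R C] (φ ψ : A →ₐc[R] C) : Subalgebra R A := AlgHom.equalizer (act φ) (act ψ)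

theorem mem_invariants {R : Type u} [CommRing R] {A C : Type u} [CommRing A] [HopfAlgebra R A]
    [CommRing C] [HopfAlgebra R C] {φ ψ : A →ₐc[R] C} {a : A} : a ∈ invariants φ ψ ↔ act φ a = act ψ a := Iff.rfl

variable {R : Type u} [CommRing R] {A C : Type u} [CommRing A] [HopfAlgebra R A]
  [CommRing C] [HopfAlgebra R C]

theorem map_mem_invariants {B E : Type u} [CommRing B] [HopfAlgebra R B] [CommRing E]
    [HopfAlgebra R E]
    {φ φ' : A →ₐc[R] C} {ψ ψ' : B →ₐc[R] E} (t : A →ₐc[R] B) (s : C →ₐc[R] E)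
    (h : ∀ a, s (φ a) = ψ (t a)) (h' : ∀ a, s (φ' a) = ψ' (t a)) {a : A}
    (ha : a ∈ invariants φ φ') : t a ∈ invariants ψ ψ' := by
  rw [mem_invariants] at ha ⊢
  rw [act_natural φ ψ t s h, act_natural φ' ψ' t s h', ha]

/-- Evaluate the invariance a(g + φ h) = a(g + ψ h) at g = 0, that is, apply the counit to the first
factor. -/
theorem eq_of_mem_invariants {φ ψ : A →ₐc[R] C} {a : A} (ha : a ∈ invariants φ ψ) : φ a = ψ a := by
  have key : ∀ φ : A →ₐc[R] C, TensorProduct.lid R C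
      (LinearMap.rTensor C (Coalgebra.counit (R := R) (A := A)) (act φ a)) = φ a := fun φ => by
    change TensorProduct.lid R C (LinearMap.rTensor C (Coalgebra.counit (R := R) (A := A))
      (LinearMap.lTensor A (φ : A →ₗ[R] C) (Coalgebra.comul (R := R) a))) = _
    rw [← LinearMap.comp_apply (LinearMap.rTensor C _), LinearMap.rTensor_comp_lTensor,
      ← LinearMap.lTensor_comp_rTensor, LinearMap.comp_apply, Coalgebra.rTensor_counit_comul]
    simp
  rw [← key φ, ← key ψ, mem_invariants.1 ha]

variable [Coalgebra.IsCocomm R A] [Coalgebra.IsCocomm R C]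

theorem invHom_natural {B : Type u} [CommRing B] [HopfAlgebra R B] [Coalgebra.IsCocomm R B]
    (f : A →ₐc[R] B) (a : A) : f (invHom R A a) = invHom R B (f a) := by
  have h1 := mul_comp_invHom (f : A →ₐ[R] B)
  have h2 := congrArg (precomp f) (mul_comp_invHom (AlgHom.id R B))
  rw [map_mul, map_one, mul_comm] at h2
  have h3 := left_inv_eq_right_inv h2 h1
  exact (DFunLike.congr_fun (congrArg WithConv.ofConv h3) a).symm

open ResidueFiber in
-- For an invariant b, the function b(g + g') is invariant in g', hence fixed by the projector in
-- the second variable; cocommutativity gives the same in the first. Thus the comultiplication of b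
-- lies in the tensor square of the invariants.
theorem isHopfSub_invariants (φ ψ : A →ₐc[R] C)
    (h : ∃ Θ : A ⊗[R] C →ₗ[R] A, ∀ a, actSub φ ψ (a + Θ (actSub φ ψ a)) = 0) :
    IsHopfSub (invariants φ ψ) := by
  obtain ⟨Θ, hΘ⟩ := h
  have hq : ∃ q : A →ₗ[R] invariants φ ψ,
      (invariants φ ψ).val.toLinearMap ∘ₗ q = LinearMap.id + Θ ∘ₗ actSub φ ψ :=
    ⟨LinearMap.codRestrict (Subalgebra.toSubmodule (invariants φ ψ))
      (LinearMap.id + Θ ∘ₗ actSub φ ψ) fun a => by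
        have h1 := hΘ a
        rw [actSub, LinearMap.sub_apply, sub_eq_zero] at h1
        exact h1, LinearMap.ext fun a => rfl⟩
  obtain ⟨q, hq⟩ := hq
  refine ⟨⟨q, fun b => ?_, fun b => ?_⟩, fun b => ?_⟩
  · have h1 : actSub φ ψ b = 0 := sub_eq_zero.2 b.2
    refine Subtype.ext ((LinearMap.congr_fun hq b).trans ?_)
    rw [LinearMap.add_apply, LinearMap.comp_apply, h1, map_zero, add_zero, LinearMap.id_apply]
  · have h1 : LinearMap.lTensor A (actSub φ ψ) (Coalgebra.comul (R := R) (b : A)) = 0 := by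
      rw [actSub, LinearMap.lTensor_sub, LinearMap.sub_apply, lTensor_act_comul, lTensor_act_comul,
        sub_eq_zero]
      exact congrArg _ (congrArg _ b.2)
    rw [hq]
    have h2 : LinearMap.lTensor A (LinearMap.id + Θ ∘ₗ actSub φ ψ)
        (Coalgebra.comul (R := R) (b : A)) = Coalgebra.comul (R := R) (b : A) := by
      rw [LinearMap.lTensor_add, LinearMap.lTensor_comp, LinearMap.add_apply, LinearMap.comp_apply,
        h1, map_zero, add_zero, LinearMap.lTensor_id_apply]
    have h3 : LinearMap.rTensor A (LinearMap.id + Θ ∘ₗ actSub φ ψ)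
        (Coalgebra.comul (R := R) (b : A)) = Coalgebra.comul (R := R) (b : A) := by
      have h4 := congrArg (TensorProduct.comm R A A) h2
      rw [Coalgebra.comm_comul] at h4
      rw [← h4]
      have h5 : LinearMap.rTensor A (LinearMap.id + Θ ∘ₗ actSub φ ψ) ∘ₗ
          (TensorProduct.comm R A A).toLinearMap = (TensorProduct.comm R A A).toLinearMap ∘ₗ
            LinearMap.lTensor A (LinearMap.id + Θ ∘ₗ actSub φ ψ) := by ext; rfl
      rw [h4]
      conv_lhs => rw [← Coalgebra.comm_comul R (b : A)]
      exact (LinearMap.congr_fun h5 _).trans h4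
    rw [← LinearMap.rTensor_comp_lTensor, LinearMap.comp_apply, h2, h3]
  · exact map_mem_invariants (invHom R A) (invHom R C) (fun a => (invHom_natural φ a).symm)
      (fun a => (invHom_natural ψ a).symm) b.2

end equalizer

end HopfGroup

/-! ### Extensions obtained by modifying the identity component, at a finite level -/

namespace PerfectAlg

open HopfGroup WithConv

theorem extendEnd_trivial {K : Type u} [Field K] [PerfectField K]
    {A A₀ : Type u} [CommRing A] [HopfAlgebra K A] [Coalgebra.IsCocomm K A] [Module.Finite K A]
    [CommRing A₀] [HopfAlgebra K A₀] [Coalgebra.IsCocomm K A₀] [Module.Finite K A₀] [IsLocalRing A₀]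
    (ι : A →ₐc[K] A₀) (hι : Function.Surjective ι)
    (hcl : ∃ e : A, IsIdempotentElem e ∧ RingHom.ker ι = Ideal.span {e}) (e : A₀ →ₐc[K] A₀)
    (he : ∀ x, e x = algebraMap K A₀ (Coalgebra.counit (R := K) x)) (a : A) :
    extendEnd ι hι hcl e a = retr K A a := by
  have h1 : toConv (((sectionHom ι hι hcl : A₀ →ₐ[K] A)).comp
        ((e : A₀ →ₐ[K] A₀).comp (ι : A →ₐ[K] A₀))) = 1 := conv_ext fun a => by
    change sectionHom ι hι hcl (e (ι a)) = _
    rw [he, AlgHomClass.commutes, CoalgHomClass.counit_comp_apply]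
    rfl
  have h2 := toConv_extendEnd ι hι hcl e
  rw [h1, mul_one] at h2
  exact DFunLike.congr_fun (congrArg WithConv.ofConv h2) a

end PerfectAlg

namespace ResidueFiber

open HopfGroup PerfectAlg IsLocalRing IsHopfSub

/-! ### Nakayama arguments and étale algebras over a local base. -/

section general

variable {R : Type u} [CommRing R] [IsLocalRing R]

theorem le_of_sub_mem_smul [IsNoetherianRing R] {M : Type u} [AddCommGroup M] [Module R M]
    [Module.Finite R M] (N P : Submodule R M)
    (h : ∀ x ∈ N, ∃ k ∈ P, x - k ∈ maximalIdeal R • N) : N ≤ P := by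
  refine Submodule.le_of_le_smul_of_le_jacobson_bot (IsNoetherian.noetherian N)
    (IsLocalRing.maximalIdeal_le_jacobson _) fun x hx => ?_
  obtain ⟨k, hk, hxk⟩ := h x hx
  exact Submodule.mem_sup.2 ⟨k, hk, x - k, hxk, by abel⟩

/-- An idempotent congruent to `0` modulo the maximal ideal of the base vanishes. -/
theorem idempotent_eq_zero {S : Type u} [CommRing S] [Algebra R S] [Module.Finite R S] {e : S}
    (he : IsIdempotentElem e) (hm : e ∈ maximalIdeal R • (⊤ : Submodule R S)) : e = 0 := by
  -- Nakayama is applied to eS, which is contained in 𝔪 eS because e = e².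
  have h1 : Submodule.span R {e} * ⊤ ≤ (⊥ : Submodule R S) := by
    refine Submodule.le_of_le_smul_of_le_jacobson_bot (I := maximalIdeal R) ?_
      (IsLocalRing.maximalIdeal_le_jacobson _) ?_
    · exact (Submodule.fg_span_singleton e).mul Module.Finite.fg_top
    · rw [bot_sup_eq, Submodule.mul_le]
      intro x hx y _
      obtain ⟨c, rfl⟩ := Submodule.mem_span_singleton.1 hx
      have h2 : ∀ z ∈ maximalIdeal R • (⊤ : Submodule R S),
          e * z ∈ maximalIdeal R • (Submodule.span R {e} * (⊤ : Submodule R S)) := fun z hz => by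
        refine Submodule.smul_induction_on hz (fun r hr n _ => ?_) fun x y hx hy => ?_
        · rw [mul_smul_comm]
          exact Submodule.smul_mem_smul hr
            (Submodule.mul_mem_mul (Submodule.mem_span_singleton_self e) trivial)
        · rw [mul_add]
          exact add_mem hx hy
      have h3 := h2 (e * (c • y)) (map_mem_smul_top (LinearMap.mulRight R (c • y)) hm)
      rw [← mul_assoc, he.eq, mul_smul_comm] at h3
      rw [smul_mul_assoc]
      exact h3
  have h4 : e * 1 ∈ (⊥ : Submodule R S) :=
    h1 (Submodule.mul_mem_mul (Submodule.mem_span_singleton_self e) trivial)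
  simpa using h4

/-- A reduced special fibre is étale since the residue field is perfect, so the differentials vanish
there and then over `R` by Nakayama; unramified, flat and of finite presentation is étale. -/
theorem etale_of_isReduced_fiber [PerfectField (ResidueField R)] [IsNoetherianRing R]
    (S : Type u) [CommRing S] [Algebra R S] [Module.Finite R S] [Module.Free R S]
    [IsReduced (ResidueField R ⊗[R] S)] : Algebra.Etale R S := by
  have := PerfectAlg.etale_of_isReduced (ResidueField R) (ResidueField R ⊗[R] S)
  have h1 : Module.Finite R Ω[S⁄R] := Module.Finite.trans S _
  let _ : Algebra S (ResidueField R ⊗[R] S) := Algebra.TensorProduct.rightAlgebra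
  have h2 : Subsingleton (ResidueField R ⊗[R] Ω[S⁄R]) :=
    (KaehlerDifferential.tensorKaehlerEquivBase R (ResidueField R) S
      (ResidueField R ⊗[R] S)).toEquiv.subsingleton
  rw [IsLocalRing.subsingleton_tensorProduct] at h2
  have : Algebra.FormallyUnramified R S := ⟨h2⟩
  have : Algebra.FinitePresentation R S := Algebra.FinitePresentation.of_finiteType.1 inferInstance
  exact Algebra.Etale.of_formallyUnramified_of_flat

omit [IsLocalRing R] in
-- An `R`-flat algebra is flat over any unramified subextension, and an integral injective map is
-- surjective on spectra.
theorem faithfullyFlat_of_etale {S A : Type u} [CommRing S] [CommRing A] [Algebra R S] [Algebra R A]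
    [Algebra.Etale R S] [Module.Finite R A] [Module.Free R A] (f : S →ₐ[R] A)
    (hf : Function.Injective f) : (f : S →+* A).FaithfullyFlat := by
  algebraize [(f : S →+* A)]
  have : IsScalarTower R S A := IsScalarTower.of_algebraMap_eq' f.comp_algebraMap.symm
  rw [RingHom.FaithfullyFlat.iff_flat_and_comap_surjective]
  refine ⟨Algebra.FormallyUnramified.flat_of_restrictScalars R S A, ?_⟩
  have : Module.Finite S A := Module.Finite.of_restrictScalars_finite R S A
  have hint : (f : S →+* A).IsIntegral := by
    have := Algebra.IsIntegral.isIntegral (R := S) (A := A)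
    exact this
  exact hint.comap_surjective hf

omit [IsLocalRing R] in
/-- The augmentation ideal of an étale group scheme is generated by an idempotent. -/
theorem exists_idempotent_counit {S : Type u} [CommRing S] [HopfAlgebra R S] [IsNoetherianRing R]
    [Algebra.Etale R S] [Module.Finite R S] :
    ∃ e : S, IsIdempotentElem e ∧ Coalgebra.counit (R := R) e = 1 ∧
      ∀ c, Coalgebra.counit (R := R) c = 0 → e * c = 0 := by
  let I : Ideal S := RingHom.ker (Bialgebra.counitAlgHom R S)
  have hS : IsNoetherianRing S := IsNoetherianRing.of_finite R S
  have hI : I ≤ I ^ 2 := fun c hc => by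
    -- The projection S → S/I² and the map through the zero section agree modulo the square-zero
    -- ideal I/I²; unramifiedness makes them equal, so I = I², and a finitely generated idempotent
    -- ideal is generated by an idempotent.
    have h1 : ∀ x, (Ideal.Quotient.mkₐ R (I ^ 2)) x -
        ((Ideal.Quotient.mkₐ R (I ^ 2)).comp ((Algebra.ofId R S).comp
          (Bialgebra.counitAlgHom R S))) x ∈ I.map (Ideal.Quotient.mkₐ R (I ^ 2)) := fun x => by
      refine Ideal.mem_map_of_mem (Ideal.Quotient.mkₐ R (I ^ 2))
        (x := x - algebraMap R S (Coalgebra.counit (R := R) x)) ?_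
      change Coalgebra.counit (R := R) _ = 0
      simp
    have h2 : (I.map (Ideal.Quotient.mkₐ R (I ^ 2))) ^ 2 = ⊥ := by
      rw [← Ideal.map_pow]
      exact Ideal.map_quotient_self _
    have h3 := Algebra.FormallyUnramified.ext (R := R) _ ⟨2, h2⟩
      (g₁ := Ideal.Quotient.mkₐ R (I ^ 2)) (g₂ := (Ideal.Quotient.mkₐ R (I ^ 2)).comp
        ((Algebra.ofId R S).comp (Bialgebra.counitAlgHom R S)))
      fun x => Ideal.Quotient.eq.2 (h1 x)
    have h4 := DFunLike.congr_fun h3 c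
    have hc' : Coalgebra.counit (R := R) c = 0 := hc
    rw [← Ideal.Quotient.eq_zero_iff_mem]
    refine h4.trans ?_
    change Ideal.Quotient.mk _ (algebraMap R S (Coalgebra.counit (R := R) c)) = 0
    rw [hc', map_zero, map_zero]
  have hI2 : IsIdempotentElem I := le_antisymm Ideal.mul_le_right ((pow_two I) ▸ hI)
  obtain ⟨e, he, hIe⟩ := (Ideal.isIdempotentElem_iff_of_fg I (IsNoetherian.noetherian I)).1 hI2
  refine ⟨1 - e, he.one_sub, ?_, fun c hc => ?_⟩
  · have h5 : e ∈ I := hIe ▸ Submodule.mem_span_singleton_self e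
    have h6 : Coalgebra.counit (R := R) e = 0 := h5
    rw [map_sub, h6, Bialgebra.counit_one, sub_zero]
  · have h7 : c ∈ I := hc
    rw [hIe, Ideal.submodule_span_eq, Ideal.mem_span_singleton] at h7
    obtain ⟨d, rfl⟩ := h7
    rw [sub_mul, one_mul, ← mul_assoc, he.eq, sub_self]

end general

/-! ### The quotient by the kernel of a projector at one level. -/

section level

variable {R : Type u} [CommRing R] [IsLocalRing R] [PerfectField (ResidueField R)]
  {A A₀ : Type u} [CommRing A] [HopfAlgebra R A] [Coalgebra.IsCocomm R A] [Module.Finite R A]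
  [Module.Free R A] [CommRing A₀] [HopfAlgebra R A₀] [Coalgebra.IsCocomm R A₀]
  [Module.Finite R A₀] [Module.Free R A₀] [IsLocalRing A₀]
  (ι : A →ₐc[R] A₀) (hι : Function.Surjective ι)
  (hcl : ∃ e : A, IsIdempotentElem e ∧ RingHom.ker ι = Ideal.span {e})
  (e : A₀ →ₐc[R] A₀) (he : ∀ x, e (e x) = e x)

/-- The coordinate ring of the quotient of `G` by the kernel of a projector of `G₀`. -/
abbrev quotientAlg {R : Type u} [CommRing R] {A A₀ : Type u} [CommRing A] [HopfAlgebra R A]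
    [CommRing A₀] [HopfAlgebra R A₀] (ι : A →ₐc[R] A₀) (e : A₀ →ₐc[R] A₀) : Subalgebra R A :=
  invariants ι (e.comp ι)

include hι hcl he in
theorem isHopfSub_quotientAlg : IsHopfSub (quotientAlg ι e) := by
  obtain ⟨d, -, h⟩ := exists_projector ι hι hcl
  obtain ⟨Θ, hΘ, -⟩ := h e he
  exact isHopfSub_invariants _ _ ⟨Θ, hΘ⟩

include he in
-- The projector is merely linear over `R`, but on the special fibre it is the homomorphism
-- `fiberEnd`, which is multiplicative and natural. Later claims about the quotient are therefore
-- decided modulo the maximal ideal.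
theorem exists_projection : ∃ q : A →ₗ[R] quotientAlg ι e,
    (∀ b : quotientAlg ι e, q b = b) ∧
    ∀ a, (1 : ResidueField R) ⊗ₜ[R] (q a : A) = fiberEnd ι hι hcl e (1 ⊗ₜ a) := by
  obtain ⟨d, -, h⟩ := exists_projector ι hι hcl
  obtain ⟨Θ, hΘ, hfib, -⟩ := h e he
  have hq : ∃ q : A →ₗ[R] quotientAlg ι e,
      (quotientAlg ι e).val.toLinearMap ∘ₗ q = LinearMap.id + Θ ∘ₗ actSub ι (e.comp ι) :=
    ⟨LinearMap.codRestrict (Subalgebra.toSubmodule (quotientAlg ι e))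
      (LinearMap.id + Θ ∘ₗ actSub ι (e.comp ι)) fun a => by
        have h1 := hΘ a
        rw [actSub, LinearMap.sub_apply, sub_eq_zero] at h1
        exact h1, LinearMap.ext fun a => rfl⟩
  obtain ⟨q, hq⟩ := hq
  refine ⟨q, fun b => ?_, fun a => ?_⟩
  · have h1 : actSub ι (e.comp ι) b = 0 := sub_eq_zero.2 b.2
    refine Subtype.ext ((LinearMap.congr_fun hq b).trans ?_)
    rw [LinearMap.add_apply, LinearMap.comp_apply, h1, map_zero, add_zero, LinearMap.id_apply]
  · have h1 : (q a : A) = a + Θ (actSub ι (e.comp ι) a) := LinearMap.congr_fun hq a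
    rw [h1, hfib]

theorem fiberEnd_coe (hι : Function.Surjective ι)
    (hcl : ∃ e : A, IsIdempotentElem e ∧ RingHom.ker ι = Ideal.span {e})
    (he : ∀ x, e (e x) = e x) (b : quotientAlg ι e) :
    fiberEnd ι hι hcl e (1 ⊗ₜ (b : A)) = 1 ⊗ₜ (b : A) := by
  obtain ⟨q, hq, hfib⟩ := exists_projection ι hι hcl e he
  rw [← hfib, hq]

variable {B B₀ : Type u} [CommRing B] [HopfAlgebra R B] [Coalgebra.IsCocomm R B] [Module.Finite R B]
  [Module.Free R B] [CommRing B₀] [HopfAlgebra R B₀] [Coalgebra.IsCocomm R B₀]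
  [Module.Finite R B₀] [Module.Free R B₀] [IsLocalRing B₀]
  (κ : B →ₐc[R] B₀) (hκ : Function.Surjective κ)
  (hcl' : ∃ e : B, IsIdempotentElem e ∧ RingHom.ker κ = Ideal.span {e})
  (e' : B₀ →ₐc[R] B₀) (he' : ∀ x, e' (e' x) = e' x)
  (t : A →ₐc[R] B) (t₀ : A₀ →ₐc[R] B₀) (ht : ∀ a, κ (t a) = t₀ (ι a))
  (hte : ∀ x, t₀ (e x) = e' (t₀ x))

omit [Module.Free R A] [Module.Free R B] [Coalgebra.IsCocomm R A₀] in
theorem fiberEnd_natural (ht : ∀ a, κ (t a) = t₀ (ι a)) (hte : ∀ x, t₀ (e x) = e' (t₀ x))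
    (x : ResidueField R ⊗[R] A) :
    fiberHom R t (fiberEnd ι hι hcl e x) = fiberEnd κ hκ hcl' e' (fiberHom R t x) := by
  have := fiber_isLocalRing (R := R) A₀
  have := fiber_isLocalRing (R := R) B₀
  refine extendEnd_natural _ _ _ _ _ _ (fiberHom R t) (fiberHom R t₀) (fun a => ?_) _ _
    (fun a => ?_) x
  · obtain ⟨a, rfl⟩ := exists_tmul_eq a
    simp only [fiberHom_tmul, ht]
  · obtain ⟨a, rfl⟩ := exists_tmul_eq a
    simp only [fiberHom_tmul, hte]

theorem map_mem_quotientAlg {R : Type u} [CommRing R] {A A₀ B B₀ : Type u}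
    [CommRing A] [HopfAlgebra R A] [CommRing A₀] [HopfAlgebra R A₀] [CommRing B] [HopfAlgebra R B]
    [CommRing B₀] [HopfAlgebra R B₀] (ι : A →ₐc[R] A₀) (e : A₀ →ₐc[R] A₀) (κ : B →ₐc[R] B₀)
    (e' : B₀ →ₐc[R] B₀) (t : A →ₐc[R] B) (t₀ : A₀ →ₐc[R] B₀) (ht : ∀ a, κ (t a) = t₀ (ι a))
    (hte : ∀ x, t₀ (e x) = e' (t₀ x)) : ∀ a ∈ quotientAlg ι e, t a ∈ quotientAlg κ e' :=
  fun _ ha => map_mem_invariants t t₀ (fun a => (ht a).symm)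
    (fun a => (hte _).trans (congrArg e' (ht a).symm)) ha

include hι hcl hκ hcl' he he' in
-- Project an arbitrary preimage in `A` to the subalgebra: by naturality on the special fibre the
-- result still maps to the given element modulo the maximal ideal, and Nakayama finishes.
theorem quotientAlg_surjective [IsHopfSub (quotientAlg ι e)] [IsHopfSub (quotientAlg κ e')]
    (ht : ∀ a, κ (t a) = t₀ (ι a)) (hte : ∀ x, t₀ (e x) = e' (t₀ x))
    (hsurj : Function.Surjective t) :
    Function.Surjective (restrictHom (quotientAlg ι e) (quotientAlg κ e') t
      (map_mem_quotientAlg ι e κ e' t t₀ ht hte)) := by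
  have := IsHopfSub.finite (quotientAlg κ e')
  obtain ⟨q, hq, hfib⟩ := exists_projection ι hι hcl e he
  refine surjective_of_fiber ((restrictHom (quotientAlg ι e) (quotientAlg κ e') t
      (map_mem_quotientAlg ι e κ e' t t₀ ht hte)) : quotientAlg ι e →ₗ[R] quotientAlg κ e')
      fun y => ?_
  obtain ⟨a, ha⟩ := hsurj y
  refine ⟨q a, IsHopfSub.mem_smul_top _ ?_⟩
  change (y : B) - t (q a) ∈ _
  rw [← tmul_eq_iff]
  have h1 := fiberEnd_natural ι hι hcl e κ hκ hcl' e' t t₀ ht hte (1 ⊗ₜ a)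
  rw [← hfib, fiberHom_tmul, fiberHom_tmul, ha, fiberEnd_coe κ e' hκ hcl' he'] at h1
  exact h1.symm

include hι hcl he in
-- On the special fibre the projector is a ring homomorphism commuting with multiplication by `n`,
-- so it carries generators of the large kernel ideal to generators of the small one.
theorem exists_mem_kernelIdeal [IsHopfSub (quotientAlg ι e)] (n : ℕ) {x : A}
    (hx : x ∈ kernelIdeal (mulBy R A n)) :
    ∃ k ∈ kernelIdeal (mulBy R (quotientAlg ι e) n),
      (1 : ResidueField R) ⊗ₜ[R] (k : A) = fiberEnd ι hι hcl e (1 ⊗ₜ x) := by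
  obtain ⟨q, hq, hfib⟩ := exists_projection ι hι hcl e he
  refine Submodule.span_induction (fun x hx => ?_) ?_ (fun x y _ _ hx hy => ?_)
    (fun c x _ hx => ?_) hx
  · obtain ⟨a, ha, rfl⟩ := hx
    have ha' : Coalgebra.counit (R := R) a = 0 := ha
    have h1 := fiberEnd_natural ι hι hcl e ι hι hcl e (mulBy R A n) (mulBy R A₀ n)
      (mulBy_naturality ι n) (fun x => (mulBy_naturality e n x).symm) (1 ⊗ₜ a)
    rw [← hfib, fiberHom_tmul, fiberHom_tmul] at h1
    -- The linear map `q` preserves the augmentation ideal only modulo the maximal ideal; the counit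
    -- is subtracted to land in it exactly, without changing the reduction.
    refine ⟨mulBy R (quotientAlg ι e) n (q a - algebraMap R _ (Coalgebra.counit (R := R) (q a))),
      Ideal.mem_map_of_mem (mulBy R (quotientAlg ι e) n) ?_, ?_⟩
    · rw [RingHom.mem_ker]
      simp
    · refine Eq.trans ?_ h1
      have h2 := mulBy_naturality (valHom (quotientAlg ι e)) n
        (q a - algebraMap R _ (Coalgebra.counit (R := R) (q a)))
      rw [valHom_apply] at h2
      rw [h2, map_sub, map_sub, valHom_apply, TensorProduct.tmul_sub, sub_eq_self,
        AlgHomClass.commutes, AlgHomClass.commutes]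
      have h3 : residue R (Coalgebra.counit (R := R) (q a : A)) = 0 := by
        rw [← fiber_counit, hfib, CoalgHomClass.counit_comp_apply, fiber_counit, ha', map_zero]
      rw [Algebra.algebraMap_eq_smul_one, TensorProduct.tmul_smul, TensorProduct.smul_tmul',
        Algebra.smul_def]
      change (residue R (Coalgebra.counit (R := R) (q a : A)) * 1) ⊗ₜ[R] (1 : A) = 0
      rw [h3, zero_mul, TensorProduct.zero_tmul]
  · exact ⟨0, zero_mem _, by simp⟩
  · obtain ⟨k, hk, hk'⟩ := hx
    obtain ⟨l, hl, hl'⟩ := hy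
    refine ⟨k + l, add_mem hk hl, ?_⟩
    rw [TensorProduct.tmul_add, map_add, ← hk', ← hl', ← TensorProduct.tmul_add]
    rfl
  · obtain ⟨k, hk, hk'⟩ := hx
    refine ⟨q c * k, Ideal.mul_mem_left _ _ hk, ?_⟩
    have h1 : (1 : ResidueField R) ⊗ₜ[R] (c • x) = (1 ⊗ₜ c) * (1 ⊗ₜ x) := by
      rw [Algebra.TensorProduct.tmul_mul_tmul, one_mul, smul_eq_mul]
    rw [h1, map_mul, ← hk', ← hfib, Algebra.TensorProduct.tmul_mul_tmul, one_mul]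
    rfl

omit [IsLocalRing R] [PerfectField (ResidueField R)] [Module.Finite R B] [Module.Free R B]
  [Coalgebra.IsCocomm R B₀] [Module.Finite R B₀] [Module.Free R B₀] [IsLocalRing B₀] in
theorem mulBy_quotientAlg [IsHopfSub (quotientAlg κ e')] (n : ℕ)
    (hn : ∀ a, mulBy R B n a = algebraMap R B (Coalgebra.counit (R := R) a)) (b : quotientAlg κ e') :
    mulBy R (quotientAlg κ e') n b = algebraMap R _ (Coalgebra.counit (R := R) b) := by
  refine Subtype.ext ?_
  have h := mulBy_naturality (valHom (quotientAlg κ e')) n b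
  rw [valHom_apply, valHom_apply, hn] at h
  exact h

include hι hcl hκ hcl' he he' in
-- An element of the kernel is fixed by the projector, so its reduction comes from the ideal of the
-- n-torsion of the quotient. Because the restriction map splits linearly, the error is divisible by
-- the maximal ideal inside the kernel itself, and Nakayama applies to the kernel.
theorem ker_quotientAlg [IsNoetherianRing R] [IsHopfSub (quotientAlg ι e)]
    [IsHopfSub (quotientAlg κ e')] (ht : ∀ a, κ (t a) = t₀ (ι a))
    (hte : ∀ x, t₀ (e x) = e' (t₀ x)) (hsurj : Function.Surjective t) (n : ℕ)
    (hker : RingHom.ker t = kernelIdeal (mulBy R A n))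
    (hn : ∀ a, mulBy R B n a = algebraMap R B (Coalgebra.counit (R := R) a)) :
    RingHom.ker (restrictHom (quotientAlg ι e) (quotientAlg κ e') t
      (map_mem_quotientAlg ι e κ e' t t₀ ht hte)) =
      kernelIdeal (mulBy R (quotientAlg ι e) n) := by
  have := IsHopfSub.finite (quotientAlg ι e)
  have := IsHopfSub.projective (quotientAlg κ e')
  have hs := quotientAlg_surjective ι hι hcl e he κ hκ hcl' e' he' t t₀ ht hte hsurj
  set f := restrictHom (quotientAlg ι e) (quotientAlg κ e') t
    (map_mem_quotientAlg ι e κ e' t t₀ ht hte) with hf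
  have h1 : kernelIdeal (mulBy R (quotientAlg ι e) n) ≤ RingHom.ker f := by
    refine Ideal.map_le_iff_le_comap.2 fun b hb => ?_
    have hb' : Coalgebra.counit (R := R) b = 0 := hb
    change f (mulBy R (quotientAlg ι e) n b) = 0
    rw [mulBy_naturality, mulBy_quotientAlg κ e' n hn, CoalgHomClass.counit_comp_apply, hb',
      map_zero]
  refine le_antisymm (fun x hx => ?_) h1
  refine le_of_sub_mem_smul (LinearMap.ker (f : quotientAlg ι e →ₗ[R] quotientAlg κ e'))
    ((kernelIdeal (mulBy R (quotientAlg ι e) n)).restrictScalars R) (fun x hx => ?_) hx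
  have hx' : (x : A) ∈ RingHom.ker t := congrArg Subtype.val (LinearMap.mem_ker.1 hx)
  rw [hker] at hx'
  obtain ⟨k, hk, hkx⟩ := exists_mem_kernelIdeal ι hι hcl e he n hx'
  rw [fiberEnd_coe ι e hι hcl he] at hkx
  refine ⟨k, hk, mem_smul_ker (f : quotientAlg ι e →ₗ[R] quotientAlg κ e') hs
    (IsHopfSub.mem_smul_top _ ?_) ?_⟩
  · exact (tmul_eq_iff _ _).1 hkx.symm
  · have hk0 : f k = 0 := h1 hk
    have hx0 : f x = 0 := hx
    change f (x - k) = 0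
    rw [map_sub, hx0, hk0, sub_zero]

end level

/-! ### The trivial projector and the étale quotient. -/

section trivial

variable {R : Type u} [CommRing R] [IsLocalRing R] [PerfectField (ResidueField R)]
  {A A₀ : Type u} [CommRing A] [HopfAlgebra R A] [Coalgebra.IsCocomm R A] [Module.Finite R A]
  [Module.Free R A] [CommRing A₀] [HopfAlgebra R A₀] [Coalgebra.IsCocomm R A₀]
  [Module.Finite R A₀] [Module.Free R A₀] [IsLocalRing A₀]
  (ι : A →ₐc[R] A₀) (hι : Function.Surjective ι)
  (hcl : ∃ e : A, IsIdempotentElem e ∧ RingHom.ker ι = Ideal.span {e})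
  (e : A₀ →ₐc[R] A₀) (he : ∀ x, e x = algebraMap R A₀ (Coalgebra.counit (R := R) x))

theorem idem_of_trivial {R A₀ : Type u} [CommRing R] [CommRing A₀] [HopfAlgebra R A₀]
    {e : A₀ →ₐc[R] A₀} (he : ∀ x, e x = algebraMap R A₀ (Coalgebra.counit (R := R) x)) (x : A₀) :
    e (e x) = e x := by
  rw [he, CoalgHomClass.counit_comp_apply, ← he]

include he in
omit [Module.Free R A] in
theorem fiberEnd_trivial (x : ResidueField R ⊗[R] A) :
    fiberEnd ι hι hcl e x = retr (ResidueField R) _ x := by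
  refine extendEnd_trivial _ _ _ _ (fun x => ?_) x
  obtain ⟨x, rfl⟩ := exists_tmul_eq x
  rw [fiberHom_tmul, he, fiber_counit, Algebra.algebraMap_eq_smul_one, TensorProduct.tmul_smul,
    TensorProduct.smul_tmul', Algebra.smul_def, mul_one]
  rfl

include hι hcl he in
-- For the trivial projector the special fibre of the quotient embeds in the image of the étale
-- retraction, which is reduced.
theorem etale_quotientAlg [IsNoetherianRing R] [IsHopfSub (quotientAlg ι e)] :
    Algebra.Etale R (quotientAlg ι e) := by
  have := IsHopfSub.finite (quotientAlg ι e)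
  have := IsHopfSub.projective (quotientAlg ι e)
  have : Module.Free R (quotientAlg ι e) := Module.free_of_flat_of_isLocalRing
  have hred := isReduced_range_retr (K := ResidueField R) (A := ResidueField R ⊗[R] A)
  let f : ResidueField R ⊗[R] quotientAlg ι e →ₐ[ResidueField R] ResidueField R ⊗[R] A :=
    Algebra.TensorProduct.map (AlgHom.id _ _) (quotientAlg ι e).val
  have hf : Function.Injective f :=
    Function.LeftInverse.injective
      (g := LinearMap.lTensor (ResidueField R) (retraction (quotientAlg ι e))) fun x => by
        obtain ⟨x, rfl⟩ := exists_tmul_eq x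
        change (1 : ResidueField R) ⊗ₜ[R] retraction (quotientAlg ι e) (x : A) = _
        rw [retraction_apply]
  have hfr : ∀ x, f x ∈ (retr (ResidueField R) (ResidueField R ⊗[R] A)).range := fun x => by
    obtain ⟨x, rfl⟩ := exists_tmul_eq x
    change (1 : ResidueField R) ⊗ₜ[R] (x : A) ∈ _
    rw [← fiberEnd_coe ι e hι hcl (idem_of_trivial he) x, fiberEnd_trivial ι hι hcl e he]
    exact ⟨_, rfl⟩
  have : IsReduced (ResidueField R ⊗[R] quotientAlg ι e) :=
    isReduced_of_injective (f.codRestrict _ hfr) fun x y h => hf (congrArg Subtype.val h)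
  exact etale_of_isReduced_fiber _

include hι hcl he in
-- The idempotent generating the kernel of `ι` lies in the ideal on the special fibre. Over `R` its
-- class in the quotient is an idempotent divisible by the maximal ideal, hence zero.
theorem ker_eq_kernelIdeal_val [IsHopfSub (quotientAlg ι e)] :
    RingHom.ker ι = kernelIdeal (valHom (quotientAlg ι e)) := by
  refine le_antisymm ?_ (Ideal.map_le_iff_le_comap.2 fun b hb => ?_)
  · have hloc := fiber_isLocalRing (R := R) A₀
    obtain ⟨e₀, he₀, hk⟩ := id hcl
    rw [hk, Ideal.span_singleton_le_iff_mem]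
    obtain ⟨q, hq, hfib⟩ := exists_projection ι hι hcl e (idem_of_trivial he)
    have h0 : ι e₀ = 0 := by
      have : e₀ ∈ RingHom.ker ι := hk ▸ Ideal.mem_span_singleton_self e₀
      exact this
    have h1 : (1 : ResidueField R) ⊗ₜ[R] e₀ ∈
        kernelIdeal (retrHom (ResidueField R) (ResidueField R ⊗[R] A)) :=
      mem_kernelIdeal_of_map_eq_zero (fiberHom R ι) (fiberHom_ker ι hι hcl) (by
        rw [fiberHom_tmul, h0, TensorProduct.tmul_zero])
    have h2 : ∀ x ∈ kernelIdeal (retrHom (ResidueField R) (ResidueField R ⊗[R] A)),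
        ∃ k ∈ kernelIdeal (valHom (quotientAlg ι e)), (1 : ResidueField R) ⊗ₜ[R] k = x :=
      fun x hx => by
      refine Submodule.span_induction (fun x hx => ?_) ?_ (fun x y _ _ hx hy => ?_)
        (fun c x _ hx => ?_) hx
      · obtain ⟨a, ha, rfl⟩ := hx
        obtain ⟨a, rfl⟩ := exists_tmul_eq a
        have ha' : Coalgebra.counit (R := ResidueField R) ((1 : ResidueField R) ⊗ₜ[R] a) = 0 := ha
        refine ⟨valHom (quotientAlg ι e) (q a - algebraMap R _ (Coalgebra.counit (R := R) (q a))),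
          Ideal.mem_map_of_mem (valHom (quotientAlg ι e)) ?_, ?_⟩
        · rw [RingHom.mem_ker]
          simp
        · have h3 : residue R (Coalgebra.counit (R := R) (q a : A)) = 0 := by
            rw [← fiber_counit, hfib, CoalgHomClass.counit_comp_apply, ha']
          change _ = retr (ResidueField R) _ _
          rw [map_sub, valHom_apply, TensorProduct.tmul_sub, hfib, fiberEnd_trivial ι hι hcl e he,
            sub_eq_self, AlgHomClass.commutes, Algebra.algebraMap_eq_smul_one,
            TensorProduct.tmul_smul, TensorProduct.smul_tmul', Algebra.smul_def]
          change (residue R (Coalgebra.counit (R := R) (q a : A)) * 1) ⊗ₜ[R] (1 : A) = 0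
          rw [h3, zero_mul, TensorProduct.zero_tmul]
      · exact ⟨0, zero_mem _, by simp⟩
      · obtain ⟨k, hk, rfl⟩ := hx
        obtain ⟨l, hl, rfl⟩ := hy
        exact ⟨k + l, add_mem hk hl, TensorProduct.tmul_add _ _ _⟩
      · obtain ⟨k, hk, rfl⟩ := hx
        obtain ⟨c, rfl⟩ := exists_tmul_eq c
        exact ⟨c * k, Ideal.mul_mem_left _ _ hk, by
          rw [smul_eq_mul, Algebra.TensorProduct.tmul_mul_tmul, one_mul]⟩
    obtain ⟨k, hk, hke⟩ := h2 _ h1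
    rw [← Ideal.Quotient.eq_zero_iff_mem]
    refine idempotent_eq_zero (R := R) (he₀.map _) ?_
    have h3 := map_mem_smul_top (Ideal.Quotient.mkₐ R (kernelIdeal
      (valHom (quotientAlg ι e)))).toLinearMap ((tmul_eq_iff _ _).1 hke.symm)
    have h4 : Ideal.Quotient.mk (kernelIdeal (valHom (quotientAlg ι e))) k = 0 :=
      Ideal.Quotient.eq_zero_iff_mem.2 hk
    have h5 : (Ideal.Quotient.mkₐ R (kernelIdeal (valHom (quotientAlg ι e)))).toLinearMap (e₀ - k) =
        Ideal.Quotient.mk _ e₀ := by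
      change Ideal.Quotient.mk _ (e₀ - k) = _
      rw [map_sub, h4, sub_zero]
    rwa [h5] at h3
  · have hb' : Coalgebra.counit (R := R) (b : A) = 0 := hb
    have h1 : ι b = e (ι b) := eq_of_mem_invariants b.2
    change ι b = 0
    rw [h1, he, CoalgHomClass.counit_comp_apply, hb', map_zero]

end trivial

end ResidueFiber

/-! ### Existence of the pushout diagram -/

namespace ResidueFiber

open HopfGroup PerfectAlg IsLocalRing IsHopfSub

section summand

/-- The hypothesis says that the kernel of the projector `e` of G₀ is contained in that of `e₀`, and
invariance under a larger group is the stronger condition. -/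
theorem quotientAlg_mono {R : Type u} [CommRing R] {A A₀ : Type u} [CommRing A] [HopfAlgebra R A]
    [CommRing A₀] [HopfAlgebra R A₀] (ι : A →ₐc[R] A₀) (e₀ e : A₀ →ₐc[R] A₀)
    (h : ∀ x, e (e₀ x) = e₀ x) : quotientAlg ι e₀ ≤ quotientAlg ι e := fun a ha => by
  have h1 : act ι a = act (e₀.comp ι) a := ha
  have h2 := act_natural ι (e.comp ι) (BialgHom.id R A) e (fun _ => rfl) a
  have h3 := act_natural (e₀.comp ι) (e₀.comp ι) (BialgHom.id R A) e (fun x => h (ι x)) a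
  change act ι a = act (e.comp ι) a
  refine h1.trans (h3.trans (Eq.trans ?_ h2.symm))
  rw [h1]

variable {R : Type u} [CommRing R] [IsLocalRing R] [PerfectField (ResidueField R)]
  {A A₀ C : Type u} [CommRing A] [HopfAlgebra R A] [Coalgebra.IsCocomm R A] [Module.Finite R A]
  [Module.Free R A] [CommRing A₀] [HopfAlgebra R A₀] [Coalgebra.IsCocomm R A₀]
  [Module.Finite R A₀] [Module.Free R A₀] [IsLocalRing A₀]
  [CommRing C] [HopfAlgebra R C] [Module.Finite R C] [Module.Free R C]

theorem finrank_quotientAlg (ι : A →ₐc[R] A₀) (hι : Function.Surjective ι)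
    (hcl : ∃ e : A, IsIdempotentElem e ∧ RingHom.ker ι = Ideal.span {e}) :
    ∃ d : ℕ, d * Module.finrank R A₀ = Module.finrank R A ∧
      ∀ (C : Type u) [CommRing C] [HopfAlgebra R C] [Module.Finite R C] [Module.Free R C]
        (ρ : C →ₐc[R] A₀) (s : A₀ →ₐc[R] C), (∀ x, s (ρ x) = x) →
        Module.finrank R (quotientAlg ι (ρ.comp s)) = d * Module.finrank R C := by
  obtain ⟨d, hd, h⟩ := exists_projector ι hι hcl
  refine ⟨d, hd, fun C _ _ _ _ ρ s hs => ?_⟩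
  obtain ⟨Θ, -, -, hC⟩ := h (ρ.comp s) fun x => congrArg ρ (hs _)
  obtain ⟨E⟩ := hC C ρ s hs rfl
  have h1 : Subalgebra.toSubmodule (quotientAlg ι (ρ.comp s)) =
      LinearMap.ker (actSub ι ((ρ.comp s).comp ι)) := by
    ext a
    rw [LinearMap.mem_ker, actSub, LinearMap.sub_apply, sub_eq_zero]
    rfl
  rw [← Subalgebra.finrank_toSubmodule, h1, E.finrank_eq, Module.finrank_pi_fintype]
  simp

omit [Module.Free R C] in
-- Lift `ρ y` to `A` and project it to the invariants; on the special fibre the projector restricts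
-- to the given idempotent on G₀, so the result maps to `y` there.
theorem summandMap_surjective (ι : A →ₐc[R] A₀) (hι : Function.Surjective ι)
    (hcl : ∃ e : A, IsIdempotentElem e ∧ RingHom.ker ι = Ideal.span {e})
    (ρ : C →ₐc[R] A₀) (s : A₀ →ₐc[R] C) (hs : ∀ x, s (ρ x) = x) (y : C) :
    ∃ b : quotientAlg ι (ρ.comp s), s (ι b) = y := by
  have hloc := fiber_isLocalRing (R := R) A₀
  obtain ⟨q, hq, hfib⟩ := exists_projection ι hι hcl (ρ.comp s) fun x => congrArg ρ (hs _)
  refine surjective_of_fiber ((s : A₀ →ₗ[R] C) ∘ₗ (ι : A →ₗ[R] A₀) ∘ₗ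
    (quotientAlg ι (ρ.comp s)).val.toLinearMap) (fun y => ?_) y
  obtain ⟨a, ha⟩ := hι (ρ y)
  refine ⟨q a, ?_⟩
  rw [← tmul_eq_iff]
  have h1 := congrArg (fiberHom R ι) (hfib a)
  have h2 : fiberHom R ι (fiberEnd ι hι hcl (ρ.comp s) (1 ⊗ₜ a)) =
      fiberHom R (ρ.comp s) (fiberHom R ι (1 ⊗ₜ a)) := map_extendEnd _ _ _ _ _
  rw [h2, fiberHom_tmul, fiberHom_tmul, fiberHom_tmul, ha] at h1
  have h3 := congrArg (fiberHom R s) h1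
  rw [fiberHom_tmul, fiberHom_tmul] at h3
  refine Eq.trans ?_ h3.symm
  change _ = (1 : ResidueField R) ⊗ₜ[R] s (ρ (s (ρ y)))
  rw [hs, hs]

omit [Module.Finite R C] [Module.Free R C] in
-- An invariant `b` killed by `s ∘ ι` is killed by `ι`, since `ι b` is fixed by the projector. Then
-- `b` lies in the ideal of `A` spanned by the étale augmentation ideal; the point is to get this
-- inside the subalgebra. The idempotent `c` at the étale zero section annihilates that ideal, so `b
-- = (1 - c) b` with `1 - c` in the étale augmentation ideal.
theorem ker_summandMap [IsNoetherianRing R] (ι : A →ₐc[R] A₀) (hι : Function.Surjective ι)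
    (hcl : ∃ e : A, IsIdempotentElem e ∧ RingHom.ker ι = Ideal.span {e})
    (ρ : C →ₐc[R] A₀) (s : A₀ →ₐc[R] C)
    (e₀ : A₀ →ₐc[R] A₀) (he₀ : ∀ x, e₀ x = algebraMap R A₀ (Coalgebra.counit (R := R) x))
    [IsHopfSub (quotientAlg ι e₀)] [IsHopfSub (quotientAlg ι (ρ.comp s))]
    (i : quotientAlg ι e₀ →ₐc[R] quotientAlg ι (ρ.comp s)) (hi : ∀ b, (i b : A) = b)
    (b : quotientAlg ι (ρ.comp s)) : s (ι b) = 0 ↔ b ∈ kernelIdeal i := by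
  refine ⟨fun hb => ?_, fun hb => ?_⟩
  · have := etale_quotientAlg ι hι hcl e₀ he₀
    have := IsHopfSub.finite (quotientAlg ι e₀)
    obtain ⟨c, hc, hc1, hc0⟩ := exists_idempotent_counit (R := R) (S := quotientAlg ι e₀)
    have h1 : ι (b : A) = 0 := by
      have h2 : ι (b : A) = ρ (s (ι b)) := eq_of_mem_invariants b.2
      rw [h2, hb, map_zero]
    have h2 : (b : A) ∈ kernelIdeal (valHom (quotientAlg ι e₀)) := by
      rw [← ker_eq_kernelIdeal_val ι hι hcl e₀ he₀]
      exact h1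
    have h3 : ∀ x ∈ kernelIdeal (valHom (quotientAlg ι e₀)), (c : A) * x = 0 := fun x hx => by
      refine Submodule.span_induction (fun x hx => ?_) (mul_zero _) (fun x y _ _ hx hy => ?_)
        (fun d x _ hx => ?_) hx
      · obtain ⟨y, hy, rfl⟩ := hx
        exact congrArg Subtype.val (hc0 y hy)
      · rw [mul_add, hx, hy, add_zero]
      · rw [smul_eq_mul, mul_left_comm, hx, mul_zero]
    have h4 : b = i (1 - c) * b := by
      refine Subtype.ext ?_
      change (b : A) = (i (1 - c) : A) * b
      rw [hi]
      change (b : A) = (1 - (c : A)) * b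
      rw [sub_mul, one_mul, h3 b h2, sub_zero]
    rw [h4]
    refine Ideal.mul_mem_right _ _ (Ideal.mem_map_of_mem i ?_)
    change Coalgebra.counit (R := R) (1 - c) = 0
    rw [map_sub, hc1, Bialgebra.counit_one, sub_self]
  · refine Submodule.span_induction (fun x hx => ?_) (by simp) (fun x y _ _ hx hy => ?_)
        (fun d x _ hx => ?_) hb
    · obtain ⟨y, hy, rfl⟩ := hx
      have hy' : Coalgebra.counit (R := R) (y : A) = 0 := hy
      rw [hi]
      have h1 : ι (y : A) = e₀ (ι y) := eq_of_mem_invariants y.2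
      rw [h1, he₀, CoalgHomClass.counit_comp_apply, hy', map_zero, map_zero]
    · change s (ι ((x : A) + (y : A))) = 0
      rw [map_add, map_add, hx, hy, add_zero]
    · change s (ι ((d : A) * (x : A))) = 0
      rw [map_mul, map_mul, hx, mul_zero]

end summand

end ResidueFiber

/-! ### Assembling the levels into p-divisible groups. -/

namespace PDivGroup

open HopfGroup ResidueFiber IsLocalRing IsHopfSub

variable {R : Type u} [CommRing R] {p : ℕ}

/-- The zero group. -/
def zero (R : Type u) [CommRing R] [Nontrivial R] (p : ℕ) : PDivGroup R p where
  height := 0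
  A _ := R
  finrank_eq v := by rw [mul_zero, pow_zero, Module.finrank_self]
  trans _ := BialgHom.id R R
  trans_surjective _ := Function.surjective_id
  ker_trans v := by
    have h : RingHom.ker (Bialgebra.counitAlgHom R R) = ⊥ :=
      (RingHom.injective_iff_ker_eq_bot _).1 fun x y hxy => hxy
    rw [kernelIdeal, h, Ideal.map_bot]
    exact (RingHom.injective_iff_ker_eq_bot _).1 fun x y hxy => hxy

/-- The homomorphism to the zero group. -/
def toZero [Nontrivial R] (G : PDivGroup R p) : Hom G (zero R p) where
  app v := Bialgebra.unitBialgHom R (G.A v)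
  comm v a := AlgHomClass.commutes (G.trans v) a

/-- The homomorphism from the zero group. -/
def ofZero [Nontrivial R] (G : PDivGroup R p) : Hom (zero R p) G where
  app v := Bialgebra.counitBialgHom R (G.A v)
  comm v a := (CoalgHomClass.counit_comp_apply (G.trans v) a).symm

theorem ofZero_toZero [Nontrivial R] (G : PDivGroup R p) (v : ℕ) (a : (zero R p).A v) :
    G.ofZero.app v (G.toZero.app v a) = a :=
  (Bialgebra.counitAlgHom R (G.A v)).commutes a

section quotient

variable [IsLocalRing R] [IsNoetherianRing R] [PerfectField (ResidueField R)] [Fact p.Prime]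
  {G G₀ H : PDivGroup R p} {ι : Hom G₀ G} (hι : IsIdentityComponent ι) (ρ : Hom G₀ H) (s : Hom H G₀)
  (hs : ∀ v a, s.app v (ρ.app v a) = a)

include hι hs in
omit [IsNoetherianRing R] [Fact (Nat.Prime p)] in
theorem isHopfSub_level (v : ℕ) :
    IsHopfSub (quotientAlg (ι.app v) ((ρ.app v).comp (s.app v))) := by
  have := hι.isLocalRing v
  exact isHopfSub_quotientAlg _ (hι.surjective v) (hι.clopen v) _ fun x =>
    congrArg (ρ.app v) (hs v _)

include hι in
omit [IsNoetherianRing R] in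
-- The rank of the étale factor of G_v is the quotient of the ranks of G_v and of its identity
-- component, a power of `p` with exponent linear in v; this gives the quotient group a height.
theorem finrank_level :
    ∃ c : ℕ, ∀ v (C : Type u) [CommRing C] [HopfAlgebra R C] [Module.Finite R C] [Module.Free R C]
        (ρ : C →ₐc[R] G₀.A v) (s : G₀.A v →ₐc[R] C), (∀ x, s (ρ x) = x) →
        Module.finrank R (quotientAlg (ι.app v) (ρ.comp s)) = p ^ (v * c) * Module.finrank R C := by
  have hp := (Fact.out : p.Prime)
  -- Level one already shows that the subtraction of heights below is not truncated.
  have hle : G₀.height ≤ G.height := by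
    have := hι.isLocalRing 1
    obtain ⟨d, hd, -⟩ := finrank_quotientAlg (ι.app 1) (hι.surjective 1) (hι.clopen 1)
    rw [G₀.finrank_eq, G.finrank_eq, one_mul, one_mul] at hd
    have hd0 : 0 < d := Nat.pos_of_ne_zero fun h => by
      rw [h, zero_mul] at hd
      exact (pow_pos hp.pos _).ne hd
    exact (Nat.pow_le_pow_iff_right hp.one_lt).1 (hd ▸ Nat.le_mul_of_pos_left _ hd0)
  refine ⟨G.height - G₀.height, fun v C _ _ _ _ ρ s hs => ?_⟩
  have := hι.isLocalRing v
  obtain ⟨d, hd, h⟩ := finrank_quotientAlg (ι.app v) (hι.surjective v) (hι.clopen v)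
  rw [h C ρ s hs]
  congr 1
  rw [G₀.finrank_eq, G.finrank_eq] at hd
  refine Nat.eq_of_mul_eq_mul_right (pow_pos hp.pos (v * G₀.height)) ?_
  rw [hd, ← pow_add, ← mul_add, Nat.sub_add_cancel hle]

omit [IsLocalRing R] [IsNoetherianRing R] [PerfectField (ResidueField R)] [Fact (Nat.Prime p)] in
theorem trans_comm_level {G G₀ : PDivGroup R p} (ι : Hom G₀ G) (v : ℕ) (a : G.A (v + 1)) :
    ι.app v (G.trans v a) = G₀.trans v (ι.app (v + 1) a) := (ι.comm v a).symm

omit [IsLocalRing R] [IsNoetherianRing R] [PerfectField (ResidueField R)] [Fact (Nat.Prime p)] in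
theorem trans_projector {G₀ H : PDivGroup R p} (ρ : Hom G₀ H) (s : Hom H G₀) (v : ℕ)
    (x : G₀.A (v + 1)) : G₀.trans v (((ρ.app (v + 1)).comp (s.app (v + 1))) x) =
      ((ρ.app v).comp (s.app v)) (G₀.trans v x) := by
  change G₀.trans v (ρ.app (v + 1) (s.app (v + 1) x)) = ρ.app v (s.app v (G₀.trans v x))
  rw [ρ.comm, s.comm]

omit [IsLocalRing R] [IsNoetherianRing R] [PerfectField (ResidueField R)] [Fact (Nat.Prime p)] in
theorem trans_mem_level {G G₀ H : PDivGroup R p} (ι : Hom G₀ G) (ρ : Hom G₀ H) (s : Hom H G₀)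
    (v : ℕ) : ∀ a ∈ quotientAlg (ι.app (v + 1)) ((ρ.app (v + 1)).comp (s.app (v + 1))),
      G.trans v a ∈ quotientAlg (ι.app v) ((ρ.app v).comp (s.app v)) :=
  map_mem_quotientAlg _ _ _ _ (G.trans v) (G₀.trans v) (trans_comm_level ι v)
    (trans_projector ρ s v)

theorem trivial_comp_apply {R : Type u} [CommRing R] [Nontrivial R] {p : ℕ}
    (G₀ : PDivGroup R p) (v : ℕ) (x : G₀.A v) :
    ((G₀.toZero.app v).comp (G₀.ofZero.app v)) x =
      algebraMap R (G₀.A v) (Coalgebra.counit (R := R) x) := rfl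

theorem etale_le_level {R : Type u} [CommRing R] [Nontrivial R] {p : ℕ} {G G₀ H : PDivGroup R p}
    (ι : Hom G₀ G) (ρ : Hom G₀ H) (s : Hom H G₀) (v : ℕ) :
    ∀ a ∈ quotientAlg (ι.app v) ((G₀.toZero.app v).comp (G₀.ofZero.app v)),
      BialgHom.id R (G.A v) a ∈ quotientAlg (ι.app v) ((ρ.app v).comp (s.app v)) :=
  quotientAlg_mono _ _ _ fun x => by
    rw [trivial_comp_apply]
    exact AlgHomClass.commutes _ _

/-- The quotient of `G` by the kernel of a split projection of its identity component. -/
def quotientGroup : PDivGroup R p where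
  height := (finrank_level hι).choose + H.height
  A v := quotientAlg (ι.app v) ((ρ.app v).comp (s.app v))
  hopfAlgebra v := @IsHopfSub.hopfAlgebra _ _ _ _ _ _ (isHopfSub_level hι ρ s hs v)
  isCocomm v := @IsHopfSub.isCocomm _ _ _ _ _ _ (isHopfSub_level hι ρ s hs v) _
  finite v := @IsHopfSub.finite _ _ _ _ _ _ (isHopfSub_level hι ρ s hs v) _
  free v := by
    have := isHopfSub_level hι ρ s hs v
    have := IsHopfSub.finite (quotientAlg (ι.app v) ((ρ.app v).comp (s.app v)))
    have := IsHopfSub.projective (quotientAlg (ι.app v) ((ρ.app v).comp (s.app v)))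
    exact Module.free_of_flat_of_isLocalRing
  finrank_eq v := by
    refine ((finrank_level hι).choose_spec v (H.A v) (ρ.app v) (s.app v) (hs v)).trans ?_
    rw [H.finrank_eq, ← pow_add, mul_add]
  trans v := @restrictHom _ _ _ _ _ _ (isHopfSub_level hι ρ s hs (v + 1)) _ _ _ _
    (isHopfSub_level hι ρ s hs v) (G.trans v)
    (trans_mem_level ι ρ s v)
  trans_surjective v := by
    have := hι.isLocalRing v
    have := hι.isLocalRing (v + 1)
    have := isHopfSub_level hι ρ s hs v
    have := isHopfSub_level hι ρ s hs (v + 1)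
    exact quotientAlg_surjective _ (hι.surjective _) (hι.clopen _) _
      (fun x => congrArg (ρ.app (v + 1)) (hs _ _)) _ (hι.surjective _) (hι.clopen _) _
      (fun x => congrArg (ρ.app v) (hs _ _)) _ (G₀.trans v) (trans_comm_level ι v)
      (trans_projector ρ s v) (G.trans_surjective v)
  ker_trans v := by
    have := hι.isLocalRing v
    have := hι.isLocalRing (v + 1)
    have := isHopfSub_level hι ρ s hs v
    have := isHopfSub_level hι ρ s hs (v + 1)
    exact ker_quotientAlg _ (hι.surjective _) (hι.clopen _) _
      (fun x => congrArg (ρ.app (v + 1)) (hs _ _)) _ (hι.surjective _) (hι.clopen _) _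
      (fun x => congrArg (ρ.app v) (hs _ _)) _ (G₀.trans v) (trans_comm_level ι v)
      (trans_projector ρ s v) (G.trans_surjective v) _
      (G.ker_trans v) (G.mulBy_eq v)

/-- The projection of `G` onto `quotientGroup`. -/
def toQuotientGroup : Hom G (quotientGroup hι ρ s hs) where
  app v := @valHom _ _ _ _ _ _ (isHopfSub_level hι ρ s hs v)
  comm _ _ := rfl

/-- The projection of `quotientGroup` onto the étale quotient of `G`. -/
def quotientGroupToEtale : Hom (quotientGroup hι ρ s hs)
    (quotientGroup hι G₀.toZero G₀.ofZero G₀.ofZero_toZero) where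
  app v := @restrictHom _ _ _ _ _ _ (isHopfSub_level hι _ _ G₀.ofZero_toZero v) _ _ _ _
    (isHopfSub_level hι ρ s hs v) (BialgHom.id R (G.A v))
    (etale_le_level ι ρ s v)
  comm v a := by
    have := isHopfSub_level hι _ _ G₀.ofZero_toZero v
    have := isHopfSub_level hι _ _ G₀.ofZero_toZero (v + 1)
    have := isHopfSub_level hι ρ s hs v
    have := isHopfSub_level hι ρ s hs (v + 1)
    exact restrictHom_id_comm _ _ _ _ _ (etale_le_level ι ρ s (v + 1)) (trans_mem_level ι ρ s v)
      (trans_mem_level ι _ _ v) (etale_le_level ι ρ s v) a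

/-- The summand of the identity component in `quotientGroup`. -/
def summandToQuotientGroup : Hom H (quotientGroup hι ρ s hs) where
  app v := ((s.app v).comp (ι.app v)).comp (@valHom _ _ _ _ _ _ (isHopfSub_level hι ρ s hs v))
  comm v a := by
    change H.trans v (s.app (v + 1) (ι.app (v + 1) a.1)) = _
    rw [s.comm, ι.comm]
    rfl

omit [IsNoetherianRing R] [PerfectField (ResidueField R)] [Fact (Nat.Prime p)] [IsLocalRing R] in
theorem Hom.faithfullyFlat {X Z : PDivGroup R p} (q : Hom X Z) (v : ℕ)
    (hZ : Algebra.Etale R (Z.A v)) (h : Function.Injective (q.app v)) :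
    ((q.app v : Z.A v →ₐ[R] X.A v) : Z.A v →+* X.A v).FaithfullyFlat :=
  faithfullyFlat_of_etale (q.app v : Z.A v →ₐ[R] X.A v) h

theorem etale_quotientGroup (v : ℕ) :
    Algebra.Etale R ((quotientGroup hι G₀.toZero G₀.ofZero G₀.ofZero_toZero).A v) := by
  have := hι.isLocalRing v
  have := isHopfSub_level hι _ _ G₀.ofZero_toZero v
  exact etale_quotientAlg _ (hι.surjective v) (hι.clopen v) _ fun x => rfl

theorem isShortExact_etale :
    IsShortExact ι (toQuotientGroup hι G₀.toZero G₀.ofZero G₀.ofZero_toZero) where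
  surjective := hι.surjective
  ker_eq v := by
    have := hι.isLocalRing v
    have := isHopfSub_level hι _ _ G₀.ofZero_toZero v
    exact ker_eq_kernelIdeal_val _ (hι.surjective v) (hι.clopen v) _ fun x => rfl
  faithfullyFlat v := Hom.faithfullyFlat _ v (etale_quotientGroup hι v) Subtype.val_injective

theorem isShortExact_quotientGroup :
    IsShortExact (summandToQuotientGroup hι ρ s hs) (quotientGroupToEtale hι ρ s hs) where
  surjective v := by
    have := hι.isLocalRing v
    exact summandMap_surjective _ (hι.surjective v) (hι.clopen v) (ρ.app v) (s.app v) (hs v)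
  ker_eq v := by
    have := hι.isLocalRing v
    have := isHopfSub_level hι _ _ G₀.ofZero_toZero v
    have := isHopfSub_level hι ρ s hs v
    ext b
    exact ker_summandMap _ (hι.surjective v) (hι.clopen v) (ρ.app v) (s.app v)
      ((G₀.toZero.app v).comp (G₀.ofZero.app v)) (fun x => rfl) _ (fun b => rfl) b
  faithfullyFlat v := Hom.faithfullyFlat _ v (etale_quotientGroup hι v) (by
    have := isHopfSub_level hι _ _ G₀.ofZero_toZero v
    have := isHopfSub_level hι ρ s hs v
    exact restrictHom_injective _ _ (BialgHom.id R (G.A v)) (etale_le_level ι ρ s v) fun _ _ h => h)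

/-- The pushout diagram attached to a direct summand of the identity component. -/
def pushoutDiagram : PushoutDiagram ι ρ where
  Get := quotientGroup hι G₀.toZero G₀.ofZero G₀.ofZero_toZero
  etale := etale_quotientGroup hι
  q := toQuotientGroup hι _ _ _
  exact := isShortExact_etale hι
  G' := quotientGroup hι ρ s hs
  j := summandToQuotientGroup hι ρ s hs
  q' := quotientGroupToEtale hι ρ s hs
  exact' := isShortExact_quotientGroup hι ρ s hs
  π := toQuotientGroup hι ρ s hs
  comm_left _ a := eq_of_mem_invariants a.2
  comm_right v a := by
    have := isHopfSub_level hι _ _ G₀.ofZero_toZero v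
    have := isHopfSub_level hι ρ s hs v
    exact valHom_restrictHom_id _ _ (etale_le_level ι ρ s v) a

end quotient

end PDivGroup

/-! ### Inverse limits of towers -/

namespace Tower

section basic

variable {k : Type u} [CommRing k] {A : ℕ → Type u} [∀ v, CommRing (A v)] [∀ v, Algebra k (A v)]
  (t : ∀ v, A (v + 1) →ₐ[k] A v)

/-- The projection of the limit to a level. -/
def ev (v : ℕ) : towerLimit A t →ₐ[k] A v := (Pi.evalAlgHom k A v).comp (towerLimit A t).val

@[simp] theorem ev_apply (v : ℕ) (x : towerLimit A t) : ev t v x = x.1 v := rfl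

theorem t_ev (v : ℕ) (x : towerLimit A t) : t v (ev t (v + 1) x) = ev t v x := x.2 v

/-- The transition map between two levels. -/
def down {v m : ℕ} (h : v ≤ m) : A m →ₐ[k] A v :=
  Nat.leRec (motive := fun m _ => A m →ₐ[k] A v) (AlgHom.id k (A v)) (fun m _ f => f.comp (t m)) h

theorem down_self (v : ℕ) (a : A v) : down t le_rfl a = a := by
  rw [down, Nat.leRec_self]
  rfl

theorem down_succ {v m : ℕ} (h : v ≤ m) (a : A (m + 1)) :
    down t (Nat.le_succ_of_le h) a = down t h (t m a) := by
  rw [down, Nat.leRec_succ]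
  rfl

theorem t_down {v m : ℕ} (h : v + 1 ≤ m) (a : A m) :
    t v (down t h a) = down t (Nat.le_of_succ_le h) a := by
  induction m, h using Nat.le_induction with
  | base =>
    rw [down_self, down_succ t le_rfl, down_self]
  | succ m hm ih =>
    rw [down_succ t hm, ih, down_succ t (Nat.le_of_succ_le hm)]

theorem down_ev {v m : ℕ} (h : v ≤ m) (x : towerLimit A t) : down t h (ev t m x) = ev t v x := by
  induction m, h using Nat.le_induction with
  | base => rw [down_self]
  | succ m hm ih => rw [down_succ t hm, t_ev, ih]

/-- A compatible family on the levels above `r` extends uniquely to all levels. -/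
theorem exists_extension (r : ℕ) (y : ∀ n, A (r + n)) (hy : ∀ n, t (r + n) (y (n + 1)) = y n) :
    ∃ x : towerLimit A t, ∀ n, x.1 (r + n) = y n := by
  have key : ∀ {v m n : ℕ} (h : v ≤ r + m) (hmn : m ≤ n),
      down t (h.trans (Nat.add_le_add_left hmn r)) (y n) = down t h (y m) := fun {v m n} h hmn => by
    induction n, hmn using Nat.le_induction with
    | base => rfl
    | succ n hmn ih =>
      rw [← ih]
      have := down_succ t (h.trans (Nat.add_le_add_left hmn r)) (y (n + 1))
      rw [hy n] at this
      exact this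
  refine ⟨⟨fun v => down t (Nat.le_add_left v r) (y v), fun v => ?_⟩, fun n => ?_⟩
  · exact (t_down t _ _).trans (key (Nat.le_add_left v r) (Nat.le_succ v))
  · refine (key (m := n) (n := r + n) le_rfl (Nat.le_add_left n r)).trans (down_self t _ _)

theorem ev_surjective (ht : ∀ v, Function.Surjective (t v)) (v : ℕ) :
    Function.Surjective (ev t v) := fun a => by
  choose g hg using ht
  let y : ∀ n, A (v + n) := fun n => Nat.rec (motive := fun n => A (v + n)) a
    (fun n b => g (v + n) b) n
  obtain ⟨x, hx⟩ := exists_extension t v y fun n => hg _ _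
  exact ⟨x, hx 0⟩

end basic

/-! ### Convergent series and closedness of finitely generated ideals. -/

section complete

variable {R : Type u} [CommRing R] (I : Ideal R)

theorem exists_sum {M : Type u} [AddCommGroup M] [Module R M] [IsAdicComplete I M] (d : ℕ → M)
    (hd : ∀ j, ∃ N, ∀ i, N ≤ i → d i ∈ I ^ j • (⊤ : Submodule R M)) :
    ∃ c, ∀ j, ∃ N, ∀ n, N ≤ n → c - ∑ i ∈ Finset.range n, d i ∈ I ^ j • (⊤ : Submodule R M) := by
  choose N hN using hd
  -- Partial sums of the given bounds are monotone and dominate them, which makes the chosen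
  -- subsequence of partial sums Cauchy.
  let N' : ℕ → ℕ := fun j => ∑ i ∈ Finset.range (j + 1), N i
  have hmono : Monotone N' := fun a b hab =>
    Finset.sum_le_sum_of_subset (Finset.range_mono (Nat.succ_le_succ hab))
  have hle : ∀ j, N j ≤ N' j := fun j =>
    Finset.single_le_sum (f := N) (fun _ _ => Nat.zero_le _) (Finset.self_mem_range_succ j)
  have htail : ∀ j a b, N j ≤ a → a ≤ b → ∑ i ∈ Finset.range b, d i - ∑ i ∈ Finset.range a, d i ∈
      I ^ j • (⊤ : Submodule R M) := fun j a b ha hab => by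
    rw [← Finset.sum_Ico_eq_sub _ hab]
    exact Submodule.sum_mem _ fun i hi => hN j i (ha.trans (Finset.mem_Ico.1 hi).1)
  obtain ⟨c, hc⟩ := IsPrecomplete.prec (I := I) (M := M) inferInstance
    (f := fun j => ∑ i ∈ Finset.range (N' j), d i) fun {a b} hab => by
      rw [SModEq.sub_mem, ← neg_mem_iff, neg_sub]
      exact htail a _ _ (hle a) (hmono hab)
  refine ⟨c, fun j => ⟨N' j, fun n hn => ?_⟩⟩
  have h1 := hc j
  rw [SModEq.sub_mem, ← neg_mem_iff, neg_sub] at h1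
  have h2 := htail j _ _ (hle j) hn
  have h3 := sub_mem h1 h2
  rwa [sub_sub_sub_cancel_right] at h3

variable {A : ℕ → Type u} [∀ v, CommRing (A v)] [∀ v, Algebra R (A v)]
  (t : ∀ v, A (v + 1) →ₐ[R] A v) [∀ v, IsAdicComplete I (A v)]

theorem eq_zero_of_forall_mem {M : Type u} [AddCommGroup M] [Module R M] [IsHausdorff I M] {x : M}
    (h : ∀ j, x ∈ I ^ j • (⊤ : Submodule R M)) : x = 0 :=
  IsHausdorff.haus (I := I) inferInstance x fun j => by
    rw [SModEq.zero]
    exact h j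

/-- Convergent series in the limit of a tower. -/
theorem exists_tower_sum (d : ℕ → towerLimit A t)
    (hd : ∀ v j, ∃ N, ∀ i, N ≤ i → (d i).1 v ∈ I ^ j • (⊤ : Submodule R (A v))) :
    ∃ c : towerLimit A t, ∀ v j, ∃ N, ∀ n, N ≤ n →
      c.1 v - ∑ i ∈ Finset.range n, (d i).1 v ∈ I ^ j • (⊤ : Submodule R (A v)) := by
  choose c hc using fun v => exists_sum I (fun i => (d i).1 v) (hd v)
  refine ⟨⟨c, fun v => ?_⟩, hc⟩
  rw [← sub_eq_zero]
  refine eq_zero_of_forall_mem I fun j => ?_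
  obtain ⟨N₁, h₁⟩ := hc (v + 1) j
  obtain ⟨N₂, h₂⟩ := hc v j
  have h3 := Submodule.mem_map_of_mem (f := (t v).toLinearMap) (h₁ (max N₁ N₂) (le_max_left _ _))
  rw [Submodule.map_smul''] at h3
  have h4 := Submodule.smul_mono (le_refl (I ^ j)) (le_top (a := Submodule.map (t v).toLinearMap ⊤)) h3
  have h5 := h₂ (max N₁ N₂) (le_max_right _ _)
  have h6 := sub_mem h4 h5
  rw [AlgHom.toLinearMap_apply, map_sub, map_sum] at h6
  have h7 : ∀ i, t v ((d i).1 (v + 1)) = (d i).1 v := fun i => (d i).2 v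
  simp only [h7, sub_sub_sub_cancel_right] at h6
  exact h6

/-- A finitely generated ideal is closed: approximation by elements of the ideal with coefficients
tending to `0`. -/
theorem mem_span_of_approx {s : ℕ} (g : Fin s → towerLimit A t) (x : towerLimit A t)
    (d : ℕ → Fin s → towerLimit A t)
    (hd : ∀ a v j, ∃ N, ∀ i, N ≤ i → (d i a).1 v ∈ I ^ j • (⊤ : Submodule R (A v)))
    (hx : ∀ v, ∃ N, ∀ n, N ≤ n → (x - ∑ i ∈ Finset.range n, ∑ a, d i a * g a).1 v = 0) :
    x ∈ Ideal.span (Set.range g) := by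
  choose c hc using fun a => exists_tower_sum I t (fun i => d i a) (hd a)
  rw [Ideal.mem_span_range_iff_exists_fun]
  refine ⟨c, Subtype.ext (funext fun v => ?_)⟩
  rw [← sub_eq_zero]
  refine eq_zero_of_forall_mem I fun j => ?_
  choose N hN using fun a => hc a v j
  obtain ⟨N₀, hN₀⟩ := hx v
  let n := max N₀ (∑ a, N a)
  have h1 := hN₀ n (le_max_left _ _)
  have h2 : x.1 v = ∑ a, (∑ i ∈ Finset.range n, (d i a).1 v) * (g a).1 v := by
    have h3 : (x - ∑ i ∈ Finset.range n, ∑ a, d i a * g a).1 v =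
      ev t v (x - ∑ i ∈ Finset.range n, ∑ a, d i a * g a) := rfl
    rw [h3, map_sub, sub_eq_zero, map_sum] at h1
    refine (h1 : x.1 v = _).trans ?_
    simp only [map_sum, map_mul, ev_apply, Finset.sum_mul]
    exact Finset.sum_comm
  have h4 : (∑ a, c a * g a : towerLimit A t).1 v = ∑ a, (c a).1 v * (g a).1 v := by
    change ev t v _ = _
    simp
  rw [h4, h2, ← Finset.sum_sub_distrib]
  refine Submodule.sum_mem _ fun a _ => ?_
  rw [← sub_mul]
  have h5 := hN a n (le_trans (Finset.single_le_sum (f := N) (fun _ _ => Nat.zero_le _)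
    (Finset.mem_univ a)) (le_max_right _ _))
  have h6 := Submodule.mem_map_of_mem (f := LinearMap.mulRight R ((g a).1 v)) h5
  rw [Submodule.map_smul''] at h6
  exact Submodule.smul_mono le_rfl le_top h6

end complete

end Tower

/-! ### Multiplication by powers of `p` and the augmentation ideal -/

namespace HopfGroup

section numerics

variable {R : Type u} [CommRing R] {A : Type u} [CommRing A] [HopfAlgebra R A]
  {T : Type u} [CommRing T] [Algebra R T]

/-- The augmentation ideal. -/
abbrev augIdeal (R : Type u) [CommRing R] (A : Type u) [CommRing A] [HopfAlgebra R A] : Ideal A :=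
  RingHom.ker (Bialgebra.counitAlgHom R A)

theorem mem_augIdeal {a : A} : a ∈ augIdeal R A ↔ Coalgebra.counit (R := R) a = 0 := Iff.rfl

theorem sub_counit_mem_augIdeal (a : A) :
    a - algebraMap R A (Coalgebra.counit (R := R) a) ∈ augIdeal R A := by
  rw [RingHom.mem_ker]
  simp

/-- The group law is x + y modulo products: on a pure tensor a ⊗ b the four terms combine to (f a -
ε a)(g b - ε b). -/
theorem conv_mul_sub_mem (f g : WithConv (A →ₐ[R] T)) (a : A) :
    (f * g).ofConv a - f.ofConv a - g.ofConv a +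
        algebraMap R T (Coalgebra.counit (R := R) a) ∈
      (augIdeal R A).map f.ofConv * (augIdeal R A).map g.ofConv := by
  have key : ∀ x : A ⊗[R] A,
      Algebra.TensorProduct.lift f.ofConv g.ofConv (fun _ _ => Commute.all _ _) x -
      Algebra.TensorProduct.lift f.ofConv (1 : WithConv (A →ₐ[R] T)).ofConv
        (fun _ _ => Commute.all _ _) x -
      Algebra.TensorProduct.lift (1 : WithConv (A →ₐ[R] T)).ofConv g.ofConv
        (fun _ _ => Commute.all _ _) x +
      Algebra.TensorProduct.lift (1 : WithConv (A →ₐ[R] T)).ofConv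
        (1 : WithConv (A →ₐ[R] T)).ofConv (fun _ _ => Commute.all _ _) x ∈
      (augIdeal R A).map f.ofConv * (augIdeal R A).map g.ofConv := by
    intro x
    induction x with
    | zero => simp
    | add x y hx hy =>
      simp only [map_add]
      convert add_mem hx hy using 1
      ring
    | tmul a b =>
      have h := Ideal.mul_mem_mul (Ideal.mem_map_of_mem f.ofConv (sub_counit_mem_augIdeal (R := R) a))
        (Ideal.mem_map_of_mem g.ofConv (sub_counit_mem_augIdeal (R := R) b))
      simp only [map_sub, AlgHom.commutes] at h
      simp only [Algebra.TensorProduct.lift_tmul, conv_one_apply]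
      convert h using 1
      ring
  have := key (Coalgebra.comul (R := R) a)
  simp only [← conv_mul_apply, mul_one, one_mul] at this
  exact this

variable [Coalgebra.IsCocomm R A]

theorem mulBy_mul (m n : ℕ) (a : A) : mulBy R A (m * n) a = mulBy R A m (mulBy R A n a) := by
  have h1 := conv_pow_comp (mulBy R A n) (WithConv.toConv (AlgHom.id R A)) m
  have h2 : (AlgHom.id R A).comp (mulBy R A n : A →ₐ[R] A) =
    ((WithConv.toConv (AlgHom.id R A)) ^ n).ofConv := (mulBy_toAlgHom n)
  have h3 : ((WithConv.toConv ((AlgHom.id R A).comp (mulBy R A n : A →ₐ[R] A))) ^ m).ofConv =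
      (mulBy R A (m * n) : A →ₐ[R] A) := by
    rw [h2, mulBy_toAlgHom, mul_comm, pow_mul]
  have h4 : ((WithConv.toConv (AlgHom.id R A)) ^ m).ofConv = (mulBy R A m : A →ₐ[R] A) :=
    (mulBy_toAlgHom m).symm
  rw [h3, h4] at h1
  exact (DFunLike.congr_fun h1 a).symm

theorem mulBy_mem_augIdeal (n : ℕ) {a : A} (ha : a ∈ augIdeal R A) :
    mulBy R A n a ∈ augIdeal R A := by
  rw [mem_augIdeal] at ha ⊢
  rw [counit_mulBy, ha]

theorem mulBy_sub_mem (n : ℕ) {a : A} (ha : a ∈ augIdeal R A) :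
    mulBy R A n a - n * a ∈ augIdeal R A ^ 2 := by
  have hid : ∀ n, (mulBy R A n : A →ₐ[R] A) = ((WithConv.toConv (AlgHom.id R A)) ^ n).ofConv :=
    mulBy_toAlgHom
  induction n with
  | zero =>
    have h : mulBy R A 0 a = algebraMap R A (Coalgebra.counit (R := R) a) := by
      refine (DFunLike.congr_fun (hid 0) a).trans ?_
      rw [pow_zero, conv_one_apply]
    rw [h, mem_augIdeal.1 ha]
    simp
  | succ n ih =>
    have h1 := conv_mul_sub_mem (WithConv.toConv (mulBy R A n : A →ₐ[R] A))
      (WithConv.toConv (AlgHom.id R A)) a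
    have h2 : (WithConv.toConv (mulBy R A n : A →ₐ[R] A) *
        WithConv.toConv (AlgHom.id R A)).ofConv a = mulBy R A (n + 1) a := by
      refine Eq.trans ?_ (DFunLike.congr_fun (hid (n + 1)) a).symm
      rw [hid, pow_succ]
    rw [h2, mem_augIdeal.1 ha, map_zero, add_zero] at h1
    have h3 : (augIdeal R A).map (WithConv.toConv (mulBy R A n : A →ₐ[R] A)).ofConv *
        (augIdeal R A).map (WithConv.toConv (AlgHom.id R A)).ofConv ≤ augIdeal R A ^ 2 := by
      rw [sq]
      refine Ideal.mul_mono (Ideal.map_le_iff_le_comap.2 fun b hb => mulBy_mem_augIdeal n hb)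
        (Ideal.map_le_iff_le_comap.2 fun b hb => hb)
    have h4 := add_mem (h3 h1) ih
    convert h4 using 1
    change _ = mulBy R A (n + 1) a - mulBy R A n a - a + (mulBy R A n a - n * a)
    push_cast
    ring

/-- The ideal generated by `p` and the augmentation ideal. -/
def augIdealWith (R : Type u) [CommRing R] (A : Type u) [CommRing A] [HopfAlgebra R A] (p : ℕ) :
    Ideal A := Ideal.span {(p : A)} ⊔ augIdeal R A

theorem map_mulBy_augIdeal (p : ℕ) :
    (augIdeal R A).map (mulBy R A p) ≤ augIdealWith R A p * augIdeal R A := by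
  refine Ideal.map_le_iff_le_comap.2 fun a ha => ?_
  have h1 := mulBy_sub_mem p ha
  have h2 : augIdeal R A ^ 2 ≤ augIdealWith R A p * augIdeal R A := by
    rw [sq]
    exact Ideal.mul_mono_left le_sup_right
  have h3 : (p : A) * a ∈ augIdealWith R A p * augIdeal R A :=
    Ideal.mul_mem_mul (Ideal.mem_sup_left (Ideal.mem_span_singleton_self _)) ha
  have h4 := add_mem (h2 h1) h3
  rwa [sub_add_cancel] at h4

/-- Each application of [p]^* gains a factor from (p, I), since [p]^* x ≡ p x modulo I² and [p]^*
preserves (p, I). -/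
theorem map_mulBy_pow_augIdeal (p m : ℕ) :
    (augIdeal R A).map (mulBy R A (p ^ m)) ≤ augIdealWith R A p ^ m * augIdeal R A := by
  induction m with
  | zero =>
    refine Ideal.map_le_iff_le_comap.2 fun a ha => ?_
    rw [pow_zero, pow_zero, Ideal.one_eq_top, Ideal.top_mul]
    exact mulBy_mem_augIdeal 1 ha
  | succ m ih =>
    have hJ : (augIdealWith R A p).map (mulBy R A p) ≤ augIdealWith R A p := by
      rw [augIdealWith, Ideal.map_sup, Ideal.map_span, Set.image_singleton, map_natCast]
      refine sup_le le_sup_left (le_sup_of_le_right ?_)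
      exact Ideal.map_le_iff_le_comap.2 fun a ha => mulBy_mem_augIdeal p ha
    refine Ideal.map_le_iff_le_comap.2 fun a ha => ?_
    rw [Ideal.mem_comap, show p ^ (m + 1) = p * p ^ m from pow_succ' _ _, mulBy_mul]
    have h1 := Ideal.mem_map_of_mem (mulBy R A p) (ih (Ideal.mem_map_of_mem _ ha))
    rw [Ideal.map_mul, Ideal.map_pow] at h1
    have h2 := Ideal.mul_mono (Ideal.pow_right_mono hJ m) (map_mulBy_augIdeal p) h1
    rwa [← mul_assoc, ← pow_succ] at h2

/-- The previous estimate is pulled back along multiplication by p^s. This replaces the augmentation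
ideal, which need not be topologically nilpotent off the identity component, by the ideal generated
by the pullback of the parameter. -/
theorem mulBy_pow_add_mem (p s m : ℕ) {z a : A} (hz : augIdeal R A = Ideal.span {z})
    (ha : a ∈ augIdeal R A) :
    mulBy R A (p ^ (s + m)) a ∈ Ideal.span {(p : A), mulBy R A (p ^ s) z} ^ m := by
  rw [pow_add, mulBy_mul]
  have h1 := Ideal.mem_map_of_mem (mulBy R A (p ^ s))
    (map_mulBy_pow_augIdeal p m (Ideal.mem_map_of_mem _ ha))
  rw [Ideal.map_mul, Ideal.map_pow] at h1
  have h2 := Ideal.mul_le_left h1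
  have h3 : (augIdealWith R A p).map (mulBy R A (p ^ s)) =
      Ideal.span {(p : A), mulBy R A (p ^ s) z} := by
    rw [augIdealWith, hz, ← Ideal.span_insert, Ideal.map_span, Set.image_insert_eq,
      Set.image_singleton, map_natCast]
  rwa [h3] at h2

end numerics

end HopfGroup

/-! ### The levels of `G''` -/

/-- Over a Noetherian ring the completion of a finite module is its tensor product with the
completed ring, here the ring itself; separatedness is Krull's theorem. -/
theorem isAdicComplete_of_finite {R : Type u} [CommRing R] [IsNoetherianRing R] (I : Ideal R)
    [IsAdicComplete I R] (M : Type u) [AddCommGroup M] [Module R M] [Module.Finite R M] :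
    IsAdicComplete I M := by
  have h1 : IsHausdorff I M := IsHausdorff.of_le_jacobson I M (IsAdicComplete.le_jacobson_bot I)
  have h2 : IsPrecomplete I M := by
    rw [← AdicCompletion.of_surjective_iff]
    intro x
    obtain ⟨y, rfl⟩ := (AdicCompletion.ofTensorProduct_bijective_of_finite_of_isNoetherian I M).2 x
    have hR := (AdicCompletion.of_bijective_iff (I := I) (M := R)).2 inferInstance
    induction y with
    | zero => exact ⟨0, by simp⟩
    | add a b ha hb =>
      obtain ⟨a', ha⟩ := ha
      obtain ⟨b', hb⟩ := hb
      exact ⟨a' + b', by rw [map_add, ha, hb, map_add]⟩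
    | tmul c m =>
      obtain ⟨c', rfl⟩ := hR.2 c
      refine ⟨c' • m, ?_⟩
      rw [AdicCompletion.ofTensorProduct_tmul, map_smul]
      ext n
      rfl
  exact { }

namespace HopfGroup

instance isCocomm_quotient {R A : Type u} [CommRing R] [CommRing A] [HopfAlgebra R A]
    [Coalgebra.IsCocomm R A] (I : Ideal A) [I.IsHopfIdeal R] : Coalgebra.IsCocomm R (A ⧸ I) where
  comm_comp_comul := by
    refine LinearMap.ext fun x => ?_
    obtain ⟨a, rfl⟩ := Ideal.Quotient.mk_surjective x
    have h : Coalgebra.comul (R := R) (Ideal.Quotient.mk I a) =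
      TensorProduct.map (Ideal.Quotient.mkₐ R I).toLinearMap (Ideal.Quotient.mkₐ R I).toLinearMap
        (Coalgebra.comul (R := R) a) := rfl
    change TensorProduct.comm R _ _ (Coalgebra.comul (R := R) (Ideal.Quotient.mk I a)) =
      Coalgebra.comul (R := R) (Ideal.Quotient.mk I a)
    rw [h, ← TensorProduct.map_comm, Coalgebra.comm_comul]

/-- The projection of a group scheme's coordinate ring to that of a closed subgroup scheme. -/
def quotientHom {R A : Type u} [CommRing R] [CommRing A] [HopfAlgebra R A] (I : Ideal A)
    [I.IsHopfIdeal R] : A →ₐc[R] A ⧸ I :=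
  BialgHom.ofAlgHom (Ideal.Quotient.mkₐ R I) (AlgHom.ext fun _ => rfl) (AlgHom.ext fun _ => rfl)

theorem quotientHom_apply {R A : Type u} [CommRing R] [CommRing A] [HopfAlgebra R A] (I : Ideal A)
    [I.IsHopfIdeal R] (a : A) : quotientHom (R := R) I a = Ideal.Quotient.mk I a := rfl

theorem quotientHom_surjective {R A : Type u} [CommRing R] [CommRing A] [HopfAlgebra R A]
    (I : Ideal A) [I.IsHopfIdeal R] : Function.Surjective (quotientHom (R := R) I) :=
  Ideal.Quotient.mk_surjective

end HopfGroup

namespace PDivGroup.PushoutDiagram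

open HopfGroup IsLocalRing

section levels

variable {R : Type u} [CommRing R] {p : ℕ} {G₀ G G₀' : PDivGroup R p} {ι : Hom G₀ G}
  {ρ : Hom G₀ G₀'} (D : PushoutDiagram ι ρ) (r : ℕ)

theorem levelTrans_mk (n : ℕ) (a : D.G'.A (r + n + 1)) :
    D.levelTrans r n (Ideal.Quotient.mk _ a) = Ideal.Quotient.mk _ (D.G'.trans (r + n) a) := rfl

theorem levelTrans_surjective (n : ℕ) : Function.Surjective (D.levelTrans r n) := fun x => by
  obtain ⟨a, rfl⟩ := Ideal.Quotient.mk_surjective x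
  obtain ⟨b, rfl⟩ := D.G'.trans_surjective _ a
  exact ⟨Ideal.Quotient.mk _ b, rfl⟩

/-- The torsion condition defining a level already comes from the next one, because the étale
transition maps are surjective on coordinate rings. -/
theorem kernelIdeal_torsionHom_le (n : ℕ) :
    kernelIdeal (D.torsionHom r (r + n)) ≤
      (kernelIdeal (D.torsionHom r (r + n + 1))).map (D.G'.trans (r + n)) := by
  refine Ideal.map_le_iff_le_comap.2 fun c hc => ?_
  obtain ⟨c, rfl⟩ := D.Get.trans_surjective _ c
  have h : D.torsionHom r (r + n) (D.Get.trans (r + n) c) =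
      D.G'.trans (r + n) (D.torsionHom r (r + n + 1) c) := by
    change mulBy R _ (p ^ r) (D.q'.app (r + n) (D.Get.trans (r + n) c)) =
      D.G'.trans (r + n) (mulBy R _ (p ^ r) (D.q'.app (r + n + 1) c))
    rw [mulBy_naturality, D.q'.comm]
  rw [Ideal.mem_comap, h]
  refine Ideal.mem_map_of_mem _ (Ideal.mem_map_of_mem (D.torsionHom r (r + n + 1)) ?_)
  rw [mem_augIdeal] at hc ⊢
  exact (CoalgHomClass.counit_comp_apply (D.Get.trans (r + n)) c).symm.trans hc

/-- A level is the p^(r+n)-torsion of the next one, as is true for the levels of G' that contain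
them. -/
theorem ker_levelTrans_le (n : ℕ) : RingHom.ker (D.levelTrans r n) ≤
    (augIdeal R (D.level r (n + 1))).map (mulBy R (D.level r (n + 1)) (p ^ (r + n))) := by
  intro x hx
  obtain ⟨a, rfl⟩ := Ideal.Quotient.mk_surjective x
  have h1 : D.G'.trans (r + n) a ∈ kernelIdeal (D.torsionHom r (r + n)) :=
    Ideal.Quotient.eq_zero_iff_mem.1 hx
  obtain ⟨b, hb, hba⟩ := (Ideal.mem_map_iff_of_surjective (D.G'.trans (r + n))
    (D.G'.trans_surjective _)).1 (D.kernelIdeal_torsionHom_le r n h1)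
  have h2 : a - b ∈ RingHom.ker (D.G'.trans (r + n)) := by
    rw [RingHom.mem_ker, map_sub, hba, sub_self]
  rw [D.G'.ker_trans, kernelIdeal] at h2
  have h3 := Ideal.mem_map_of_mem
    (quotientHom (R := R) (kernelIdeal (D.torsionHom r (r + n + 1)))) h2
  have h4 : quotientHom (R := R) (kernelIdeal (D.torsionHom r (r + n + 1))) (a - b) =
      Ideal.Quotient.mk _ a := by
    rw [quotientHom_apply, map_sub, Ideal.Quotient.eq_zero_iff_mem.2 hb, sub_zero]
  rw [h4] at h3
  refine (Ideal.map_le_iff_le_comap.2 ?_ : Ideal.map (quotientHom (R := R) _) _ ≤ _) h3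
  refine Ideal.map_le_iff_le_comap.2 fun c hc => ?_
  rw [Ideal.mem_comap, Ideal.mem_comap, mulBy_naturality]
  refine Ideal.mem_map_of_mem _ ?_
  rw [mem_augIdeal] at hc ⊢
  exact (CoalgHomClass.counit_comp_apply (quotientHom (R := R) _) c).trans hc

/-- The projection of `O_{G''}` to a level. -/
abbrev ev (n : ℕ) : D.coordRing'' r →ₐ[R] D.level r n :=
  Tower.ev (fun n => (D.levelTrans r n : D.level r (n + 1) →ₐ[R] D.level r n)) n

theorem ev_surjective (n : ℕ) : Function.Surjective (D.ev r n) :=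
  Tower.ev_surjective _ (D.levelTrans_surjective r) n

theorem levelTrans_ev (n : ℕ) (x : D.coordRing'' r) : 
    D.levelTrans r n (D.ev r (n + 1) x) = D.ev r n x := x.2 n

theorem augmentation_eq (n : ℕ) (x : D.coordRing'' r) :
    D.augmentation r x = Coalgebra.counit (R := R) (D.ev r n x) := by
  induction n with
  | zero => rfl
  | succ n ih =>
    rw [ih, ← levelTrans_ev]
    exact CoalgHomClass.counit_comp_apply (D.levelTrans r n) _

variable {D r} {z : D.coordRing'' r}

theorem IsParameter.augIdeal_level (hz : D.IsParameter r z) (n : ℕ) :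
    augIdeal R (D.level r n) = Ideal.span {D.ev r n z} := by
  refine le_antisymm (fun a ha => ?_) ?_
  · obtain ⟨x, rfl⟩ := D.ev_surjective r n a
    have h1 : x ∈ RingHom.ker (D.augmentation r) := (D.augmentation_eq r n x).trans ha
    rw [hz] at h1
    obtain ⟨y, rfl⟩ := Ideal.mem_span_singleton.1 h1
    rw [map_mul]
    exact Ideal.mul_mem_right _ _ (Ideal.mem_span_singleton_self _)
  · rw [Ideal.span_singleton_le_iff_mem, mem_augIdeal, ← augmentation_eq]
    have h1 : z ∈ RingHom.ker (D.augmentation r) := by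
      rw [hz]
      exact Ideal.mem_span_singleton_self _
    exact h1

variable (D r) in
/-- Multiplication by `n` on `O_{G''}`. -/
def mulOn (m : ℕ) : D.coordRing'' r →ₐ[R] D.coordRing'' r where
  toFun x := ⟨fun n => mulBy R (D.level r n) m (x.1 n), fun n => by
    have h := x.2 n
    refine (mulBy_naturality (D.levelTrans r n) m (x.1 (n + 1))).trans ?_
    exact congrArg _ h⟩
  map_one' := Subtype.ext (funext fun n => map_one _)
  map_mul' x y := Subtype.ext (funext fun n => map_mul _ _ _)
  map_zero' := Subtype.ext (funext fun n => map_zero _)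
  map_add' x y := Subtype.ext (funext fun n => map_add _ _ _)
  commutes' c := Subtype.ext (funext fun n =>
    AlgHomClass.commutes (mulBy R (D.level r n) m) c)

theorem ev_mulOn (m n : ℕ) (x : D.coordRing'' r) :
    D.ev r n (mulOn D r m x) = mulBy R (D.level r n) m (D.ev r n x) := rfl

/-- Level 0 is contained in the p^r-torsion of G', where multiplication by p^r is trivial. -/
theorem ev_zero_mulOn (x : D.coordRing'' r) (hx : D.augmentation r x = 0) :
    D.ev r 0 (mulOn D r (p ^ r) x) = 0 := by
  rw [ev_mulOn]
  have h0 : Coalgebra.counit (R := R) (D.ev r 0 x) = 0 := hx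
  obtain ⟨a, ha⟩ := Ideal.Quotient.mk_surjective (D.ev r 0 x)
  rw [← ha] at h0 ⊢
  have h1 := mulBy_naturality (quotientHom (R := R) (kernelIdeal (D.torsionHom r (r + 0)))) (p ^ r) a
  refine h1.symm.trans ?_
  have h2 : mulBy R (D.G'.A (r + 0)) (p ^ r) a = algebraMap R _ (Coalgebra.counit (R := R) a) :=
    D.G'.mulBy_eq r a
  have h3 : Coalgebra.counit (R := R) a = 0 := h0
  rw [h2, h3, map_zero, map_zero]

end levels

end PDivGroup.PushoutDiagram

/-! ### The topology of the levels of `G''` -/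

/-- Modulo the maximal ideal of the base, a finite algebra is Artinian. -/
theorem exists_maximalIdeal_pow_le_map {R A : Type u} [CommRing R] [IsLocalRing R] [CommRing A]
    [IsLocalRing A] [Algebra R A] [Module.Finite R A] :
    ∃ K, IsLocalRing.maximalIdeal A ^ K ≤ (IsLocalRing.maximalIdeal R).map (algebraMap R A) := by
  let _ : Field (R ⧸ IsLocalRing.maximalIdeal R) := Ideal.Quotient.field _
  have : Module.Finite (R ⧸ IsLocalRing.maximalIdeal R)
      (A ⧸ (IsLocalRing.maximalIdeal R).map (algebraMap R A)) :=
    Module.Finite.of_restrictScalars_finite R _ _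
  have := IsArtinianRing.of_finite (R ⧸ IsLocalRing.maximalIdeal R)
    (A ⧸ (IsLocalRing.maximalIdeal R).map (algebraMap R A))
  exact IsLocalRing.exists_maximalIdeal_pow_le_of_isArtinianRing_quotient _

namespace PDivGroup.PushoutDiagram

open HopfGroup IsLocalRing

/-! ### The open and closed subgroup G₀' of the levels of G''. -/

section idempotents

variable {R : Type u} [CommRing R] [IsLocalRing R] [IsNoetherianRing R] {p : ℕ}
  {G₀ G G₀' : PDivGroup R p} {ι : Hom G₀ G} {ρ : Hom G₀ G₀'} (D : PushoutDiagram ι ρ) (r : ℕ)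

omit [IsLocalRing R] in
theorem exists_idem (v : ℕ) : ∃ e : D.Get.A v, IsIdempotentElem e ∧
    Coalgebra.counit (R := R) e = 1 ∧ ∀ c, Coalgebra.counit (R := R) c = 0 → e * c = 0 := by
  have := D.etale v
  exact ResidueFiber.exists_idempotent_counit

/-- The idempotent of the étale quotient supported at the zero section. -/
def idem (v : ℕ) : D.Get.A v := (D.exists_idem v).choose

omit [IsLocalRing R] in
theorem isIdempotentElem_idem (v : ℕ) : IsIdempotentElem (D.idem v) :=
  (D.exists_idem v).choose_spec.1

omit [IsLocalRing R] in
theorem counit_idem (v : ℕ) : Coalgebra.counit (R := R) (D.idem v) = 1 :=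
  (D.exists_idem v).choose_spec.2.1

omit [IsLocalRing R] in
theorem idem_mul (v : ℕ) {c : D.Get.A v} (hc : Coalgebra.counit (R := R) c = 0) :
    D.idem v * c = 0 :=
  (D.exists_idem v).choose_spec.2.2 c hc

omit [IsLocalRing R] in
theorem trans_idem (v : ℕ) : D.Get.trans v (D.idem (v + 1)) = D.idem v := by
  have h1 : Coalgebra.counit (R := R) (D.Get.trans v (D.idem (v + 1))) = 1 :=
    (CoalgHomClass.counit_comp_apply (D.Get.trans v) _).trans (D.counit_idem _)
  have h2 : D.idem v * (1 - D.Get.trans v (D.idem (v + 1))) = 0 :=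
    D.idem_mul v (by simp [h1])
  have h3 : D.Get.trans v (D.idem (v + 1)) * (1 - D.idem v) = 0 := by
    obtain ⟨c, hc⟩ := D.Get.trans_surjective v (1 - D.idem v)
    have h4 : Coalgebra.counit (R := R) c = 0 := by
      refine (CoalgHomClass.counit_comp_apply (D.Get.trans v) c).symm.trans ?_
      rw [hc]
      simp [counit_idem]
    rw [← hc, ← map_mul, D.idem_mul _ h4, map_zero]
  linear_combination h3 - h2

omit [IsLocalRing R] in
-- The zero section of the étale quotient is open and closed, and its preimage in G' is G₀'.
theorem ker_j (v : ℕ) : RingHom.ker (D.j.app v) = Ideal.span {1 - D.q'.app v (D.idem v)} := by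
  rw [D.exact'.ker_eq v]
  refine le_antisymm (Ideal.map_le_iff_le_comap.2 fun c hc => ?_) ?_
  · have h1 : c = c * (1 - D.idem v) := by
      linear_combination D.idem_mul v hc
    rw [Ideal.mem_comap, h1, map_mul, map_sub, map_one]
    exact Ideal.mul_mem_left _ _ (Ideal.mem_span_singleton_self _)
  · rw [Ideal.span_singleton_le_iff_mem]
    have h1 : 1 - D.idem v ∈ augIdeal R (D.Get.A v) := by
      rw [mem_augIdeal]
      simp [counit_idem]
    have h2 := Ideal.mem_map_of_mem (D.q'.app v) h1
    rwa [map_sub, map_one] at h2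

omit [IsLocalRing R] [IsNoetherianRing R] in
theorem kernelIdeal_torsionHom_le_ker_j (n : ℕ) :
    kernelIdeal (D.torsionHom r (r + n)) ≤ RingHom.ker (D.j.app (r + n)) := by
  refine Ideal.map_le_iff_le_comap.2 fun c hc => ?_
  change D.j.app (r + n) (mulBy R _ (p ^ r) (D.q'.app (r + n) c)) = 0
  have h1 : D.q'.app (r + n) c ∈ RingHom.ker (D.j.app (r + n)) := by
    rw [D.exact'.ker_eq]
    exact Ideal.mem_map_of_mem _ hc
  rw [mulBy_naturality, RingHom.mem_ker.1 h1, map_zero]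

/-- The restriction of functions on a level of `G''` to `G₀'`. -/
def toSummand (n : ℕ) : D.level r n →ₐc[R] G₀'.A (r + n) :=
  liftOfSurjective (quotientHom _) (quotientHom_surjective _) (D.j.app (r + n)) fun _ ha =>
    D.kernelIdeal_torsionHom_le_ker_j r n (Ideal.Quotient.eq_zero_iff_mem.1 ha)

omit [IsLocalRing R] [IsNoetherianRing R] in
theorem toSummand_mk (n : ℕ) (a : D.G'.A (r + n)) :
    D.toSummand r n (Ideal.Quotient.mk _ a) = D.j.app (r + n) a :=
  liftOfSurjective_apply (quotientHom (R := R) (kernelIdeal (D.torsionHom r (r + n))))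
    (quotientHom_surjective _) (D.j.app (r + n)) _ a

omit [IsLocalRing R] [IsNoetherianRing R] in
theorem toSummand_surjective (n : ℕ) : Function.Surjective (D.toSummand r n) := fun a => by
  obtain ⟨b, rfl⟩ := D.exact'.surjective (r + n) a
  exact ⟨_, D.toSummand_mk r n b⟩

omit [IsLocalRing R] [IsNoetherianRing R] in
theorem trans_toSummand (n : ℕ) (x : D.level r (n + 1)) :
    G₀'.trans (r + n) (D.toSummand r (n + 1) x) = D.toSummand r n (D.levelTrans r n x) := by
  obtain ⟨a, rfl⟩ := Ideal.Quotient.mk_surjective x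
  rw [levelTrans_mk]
  exact (congrArg (G₀'.trans (r + n)) (D.toSummand_mk r (n + 1) a)).trans
    ((D.j.comm (r + n) a).trans (D.toSummand_mk r n _).symm)

/-- The idempotent of `G''_{r+n}` supported on `G₀'`. -/
def levelIdem (n : ℕ) : D.level r n := Ideal.Quotient.mk _ (D.q'.app (r + n) (D.idem (r + n)))

omit [IsLocalRing R] in
theorem isIdempotentElem_levelIdem (n : ℕ) : IsIdempotentElem (D.levelIdem r n) :=
  ((D.isIdempotentElem_idem (r + n)).map (D.q'.app (r + n))).map (Ideal.Quotient.mk _)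

omit [IsLocalRing R] in
theorem levelTrans_levelIdem (n : ℕ) : D.levelTrans r n (D.levelIdem r (n + 1)) = D.levelIdem r n := by
  have h1 : D.G'.trans (r + n) (D.q'.app (r + n + 1) (D.idem (r + n + 1))) =
      D.q'.app (r + n) (D.idem (r + n)) := by
    rw [D.q'.comm, trans_idem]
  exact congrArg (Ideal.Quotient.mk _) h1

omit [IsLocalRing R] in
theorem ker_toSummand (n : ℕ) : RingHom.ker (D.toSummand r n) = Ideal.span {1 - D.levelIdem r n} := by
  refine le_antisymm (fun x hx => ?_) ?_
  · obtain ⟨a, rfl⟩ := Ideal.Quotient.mk_surjective x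
    rw [RingHom.mem_ker, toSummand_mk, ← RingHom.mem_ker, ker_j, Ideal.mem_span_singleton] at hx
    have h1 := map_dvd (Ideal.Quotient.mk (kernelIdeal (D.torsionHom r (r + n)))) hx
    rw [map_sub, map_one] at h1
    exact Ideal.mem_span_singleton.2 h1
  · rw [Ideal.span_singleton_le_iff_mem, RingHom.mem_ker]
    have h1 : D.toSummand r n (1 - D.levelIdem r n) =
      D.j.app (r + n) (1 - D.q'.app (r + n) (D.idem (r + n))) := by
      rw [← toSummand_mk, map_sub (Ideal.Quotient.mk _), map_one (Ideal.Quotient.mk _)]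
      rfl
    rw [h1, ← RingHom.mem_ker, ker_j]
    exact Ideal.mem_span_singleton_self _

omit [IsLocalRing R] in
-- Multiplication by p^r kills the étale quotient of G'', so it maps G'' into G₀'.
theorem mulBy_one_sub_levelIdem (n : ℕ) :
    mulBy R (D.level r n) (p ^ r) (1 - D.levelIdem r n) = 0 := by
  have h1 := mulBy_naturality (quotientHom (R := R) (kernelIdeal (D.torsionHom r (r + n)))) (p ^ r)
    (D.q'.app (r + n) (1 - D.idem (r + n)))
  have h2 : quotientHom (R := R) (kernelIdeal (D.torsionHom r (r + n)))
      (D.q'.app (r + n) (1 - D.idem (r + n))) = 1 - D.levelIdem r n := by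
    rw [map_sub, map_one, map_sub, map_one]
    rfl
  rw [h2] at h1
  rw [← h1, quotientHom_apply, Ideal.Quotient.eq_zero_iff_mem]
  refine Ideal.mem_map_of_mem (D.torsionHom r (r + n)) ?_
  rw [mem_augIdeal]
  simp [counit_idem]

/-- Since multiplication by p^r lands in G₀', the pulled back function comes from the local ring
O(G₀'). There the augmentation ideal lies in the maximal ideal, which is nilpotent modulo that of
`R`. -/
theorem exists_mulBy_pow_mem (n : ℕ) [IsLocalRing (G₀'.A (r + n))] {x : D.level r n}
    (hx : x ∈ augIdeal R (D.level r n)) : ∃ K, mulBy R (D.level r n) (p ^ r) x ^ K ∈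
      (maximalIdeal R).map (algebraMap R (D.level r n)) := by
  let g : G₀'.A (r + n) →ₐ[R] D.level r n :=
    liftAlg (D.toSummand r n : D.level r n →ₐ[R] G₀'.A (r + n)) (D.toSummand_surjective r n)
      (mulBy R (D.level r n) (p ^ r) : D.level r n →ₐ[R] D.level r n) fun a ha => by
        have h1 : a ∈ RingHom.ker (D.toSummand r n) := ha
        rw [ker_toSummand] at h1
        obtain ⟨b, rfl⟩ := Ideal.mem_span_singleton.1 h1
        change mulBy R (D.level r n) (p ^ r) _ = 0
        rw [map_mul, mulBy_one_sub_levelIdem, zero_mul]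
  have hg : g (D.toSummand r n x) = mulBy R (D.level r n) (p ^ r) x := liftAlg_apply _ _ _ _ _
  have h1 : D.toSummand r n x ∈ maximalIdeal (G₀'.A (r + n)) := by
    have h2 : augIdeal R (G₀'.A (r + n)) ≤ maximalIdeal _ :=
      le_maximalIdeal (RingHom.ker_ne_top _)
    refine h2 ?_
    rw [mem_augIdeal] at hx ⊢
    exact (CoalgHomClass.counit_comp_apply (D.toSummand r n) x).trans hx
  obtain ⟨K, hK⟩ := exists_maximalIdeal_pow_le_map (R := R) (A := G₀'.A (r + n))
  refine ⟨K, ?_⟩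
  rw [← hg, ← map_pow]
  have h3 : (maximalIdeal R).map (algebraMap R (G₀'.A (r + n))) ≤
      ((maximalIdeal R).map (algebraMap R (D.level r n))).comap g :=
    Ideal.map_le_iff_le_comap.2 fun c hc => by
      rw [Ideal.mem_comap, Ideal.mem_comap, AlgHom.commutes]
      exact Ideal.mem_map_of_mem _ hc
  exact h3 (hK (Ideal.pow_mem_pow h1 K))

end idempotents

/-! ### The ideal (p, [p^r]^* z) and the filtration by levels. -/

section topology

variable {R : Type u} [CommRing R] [IsLocalRing R] [IsNoetherianRing R] {p : ℕ}
  {G₀ G G₀' : PDivGroup R p} {ι : Hom G₀ G} {ρ : Hom G₀ G₀'} {D : PushoutDiagram ι ρ} {r : ℕ}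
  [∀ v, IsLocalRing (G₀'.A v)]
  {z : D.coordRing'' r}

/-- The ideal of `O_{G''}` generated by `p` and the pullback of `z` under multiplication by `p ^ r`. -/
def torsionIdeal (D : PushoutDiagram ι ρ) (r : ℕ) (z : D.coordRing'' r) : Ideal (D.coordRing'' r) :=
  Ideal.span {(p : D.coordRing'' r), mulOn D r (p ^ r) z}

omit [IsLocalRing R] [IsNoetherianRing R] [∀ (v : ℕ), IsLocalRing (G₀'.A v)] in
theorem map_torsionIdeal (n : ℕ) : (torsionIdeal D r z).map (D.ev r n) =
    Ideal.span {(p : D.level r n), mulBy R (D.level r n) (p ^ r) (D.ev r n z)} := by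
  rw [torsionIdeal, Ideal.map_span, Set.image_insert_eq, Set.image_singleton, map_natCast, ev_mulOn]

/-- Both generators are nilpotent at each level modulo the maximal ideal; this makes series with
coefficients in growing powers of the ideal converge. -/
theorem IsParameter.exists_torsionIdeal_pow_le (hz : D.IsParameter r z)
    (hp : (p : R) ∈ maximalIdeal R) (n j : ℕ) : ∃ K, ∀ i, K ≤ i → ∀ x ∈ torsionIdeal D r z ^ i,
      D.ev r n x ∈ maximalIdeal R ^ j • (⊤ : Submodule R (D.level r n)) := by
  have hz' : D.ev r n z ∈ augIdeal R (D.level r n) := by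
    rw [hz.augIdeal_level]
    exact Ideal.mem_span_singleton_self _
  obtain ⟨K, hK⟩ := D.exists_mulBy_pow_mem r n hz'
  have h1 : ((torsionIdeal D r z).map (D.ev r n)) ^ (1 + K) ≤
      (maximalIdeal R).map (algebraMap R (D.level r n)) := by
    rw [map_torsionIdeal, Ideal.span_insert]
    refine Ideal.sup_pow_add_le_pow_sup_pow.trans (sup_le ?_ ?_)
    · rw [pow_one, Ideal.span_singleton_le_iff_mem, ← map_natCast (algebraMap R (D.level r n))]
      exact Ideal.mem_map_of_mem _ hp
    · rwa [Ideal.span_singleton_pow, Ideal.span_singleton_le_iff_mem]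
  refine ⟨(1 + K) * j, fun i hi x hx => ?_⟩
  have h2 := Ideal.mem_map_of_mem (D.ev r n) (Ideal.pow_le_pow_right hi hx)
  rw [Ideal.map_pow, pow_mul] at h2
  have h3 := Ideal.pow_right_mono h1 j h2
  rw [← Ideal.map_pow] at h3
  rw [Ideal.smul_top_eq_map]
  exact h3

omit [IsLocalRing R] [IsNoetherianRing R] [∀ (v : ℕ), IsLocalRing (G₀'.A v)] in
theorem IsParameter.exists_approx (hz : D.IsParameter r z) (n : ℕ) {x : D.coordRing'' r}
    (hx : D.ev r n x = 0) : ∃ y ∈ torsionIdeal D r z ^ n, D.ev r (n + 1) (x - y) = 0 := by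
  have h1 : D.ev r (n + 1) x ∈ RingHom.ker (D.levelTrans r n) := by
    rw [RingHom.mem_ker, levelTrans_ev, hx]
  have h2 : Ideal.map (mulBy R (D.level r (n + 1)) (p ^ (r + n))) (augIdeal R (D.level r (n + 1))) ≤
      Ideal.map (D.ev r (n + 1)) (torsionIdeal D r z ^ n) := by
    rw [Ideal.map_pow, map_torsionIdeal]
    refine Ideal.map_le_iff_le_comap.2 fun a ha => ?_
    exact mulBy_pow_add_mem p r n (hz.augIdeal_level (n + 1)) ha
  obtain ⟨y, hy, hyx⟩ := (Ideal.mem_map_iff_of_surjective _ (D.ev_surjective r (n + 1))).1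
    (h2 (D.ker_levelTrans_le r n h1))
  exact ⟨y, hy, by rw [map_sub, hyx, sub_self]⟩

/-- Successive approximation: a function vanishing at level M + i is corrected by an element of
J^(M+i) so as to vanish at level M + i + 1. The corrections form a convergent series, and J^M is
closed, being finitely generated. -/
theorem IsParameter.mem_torsionIdeal_pow [IsAdicComplete (maximalIdeal R) R]
    (hz : D.IsParameter r z) (hp : (p : R) ∈ maximalIdeal R)
    (M : ℕ) {x : D.coordRing'' r} (hx : D.ev r M x = 0) : x ∈ torsionIdeal D r z ^ M := by
  have hadic : ∀ n, IsAdicComplete (maximalIdeal R) (D.level r n) := fun n =>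
    isAdicComplete_of_finite _ _
  classical
  have hfg : (torsionIdeal D r z ^ M).FG :=
    Ideal.FG.pow ⟨{(p : D.coordRing'' r), mulOn D r (p ^ r) z}, by simp [torsionIdeal]⟩
  obtain ⟨s, g, hg⟩ := Submodule.fg_iff_exists_fin_generating_family.1 hfg
  have step : ∀ i (ξ : D.coordRing'' r), D.ev r (M + i) ξ = 0 → ∃ d : Fin s → D.coordRing'' r,
      (∀ a, d a ∈ torsionIdeal D r z ^ i) ∧ D.ev r (M + (i + 1)) (ξ - ∑ a, d a * g a) = 0 := by
    intro i ξ hξ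
    obtain ⟨y, hy, hξy⟩ := hz.exists_approx (M + i) hξ
    -- J^(M+i) = J^i J^M, so the correction has coefficients in J^i with respect to fixed generators
    -- of J^M.
    rw [add_comm, pow_add, ← hg, ← smul_eq_mul, Submodule.mem_ideal_smul_span_iff_exists_sum] at hy
    obtain ⟨c, hc, rfl⟩ := hy
    refine ⟨c, hc, ?_⟩
    rw [Finsupp.sum_fintype _ _ (by simp)] at hξy
    exact hξy
  choose d hd hdξ using step
  let ξ : ∀ i : ℕ, {ξ : D.coordRing'' r // D.ev r (M + i) ξ = 0} := fun i =>
    Nat.rec (motive := fun i => {ξ : D.coordRing'' r // D.ev r (M + i) ξ = 0}) ⟨x, hx⟩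
      (fun i ξ => ⟨ξ.1 - ∑ a, d i ξ.1 ξ.2 a * g a, hdξ i ξ.1 ξ.2⟩) i
  have hξ : ∀ n, (ξ n).1 = x - ∑ i ∈ Finset.range n, ∑ a, d i (ξ i).1 (ξ i).2 a * g a := by
    intro n
    induction n with
    | zero => simp [ξ]
    | succ n ih =>
      rw [Finset.sum_range_succ, ← sub_sub, ← ih]
  rw [← hg]
  refine Tower.mem_span_of_approx (maximalIdeal R) _ g x (fun i => d i (ξ i).1 (ξ i).2) ?_ ?_
  · intro a v j
    obtain ⟨K, hK⟩ := hz.exists_torsionIdeal_pow_le hp v j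
    exact ⟨K, fun i hi => hK i hi _ (hd i _ _ a)⟩
  · intro v
    refine ⟨v, fun n hn => ?_⟩
    refine (congrArg (D.ev r v) (hξ n).symm).trans ?_
    have h1 := Tower.down_ev (fun n => (D.levelTrans r n : D.level r (n + 1) →ₐ[R] D.level r n))
      (hn.trans (Nat.le_add_left n M)) (ξ n).1
    exact h1.symm.trans ((congrArg _ (ξ n).2).trans (map_zero _))

end topology

end PDivGroup.PushoutDiagram

/-! ### Parameters -/

/-- The generator is X - a with a the image of X. It reduces to X, so Weierstrass division by it
leaves a constant remainder, which is the value of ε; uniqueness of the division gives regularity.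
-/
theorem PowerSeries.exists_regular_generator {R : Type u} [CommRing R] [IsLocalRing R]
    [IsAdicComplete (IsLocalRing.maximalIdeal R) R] {S : Type u} [CommRing S] [Algebra R S]
    (φ : PowerSeries R ≃ₐ[R] S) (ε : S →ₐ[R] R) :
    ∃ t : S, RingHom.ker ε = Ideal.span {t} ∧ ∀ y, t * y = 0 → y = 0 := by
  let a : R := ε (φ PowerSeries.X)
  let g : PowerSeries R := PowerSeries.X - PowerSeries.C a
  have hC : ∀ c : R, ε (φ (PowerSeries.C c)) = c := fun c => by
    have h1 : PowerSeries.C c = algebraMap R (PowerSeries R) c := rfl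
    rw [h1, AlgEquiv.commutes, AlgHom.commutes]
    rfl
  have hg : ε (φ g) = 0 := by
    rw [map_sub, map_sub, hC, sub_self]
  -- No continuity of ε is assumed: were a unit, X - a would be a unit in the kernel of ε.
  have ha : a ∈ IsLocalRing.maximalIdeal R := by
    rw [IsLocalRing.mem_maximalIdeal, mem_nonunits_iff]
    intro hu
    have h1 : IsUnit g := by
      rw [PowerSeries.isUnit_iff_constantCoeff]
      simpa [g] using hu
    have h2 := (h1.map φ).map ε
    rw [hg] at h2
    exact not_isUnit_zero h2
  have hgX : g.map (IsLocalRing.residue R) = PowerSeries.X := by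
    rw [map_sub, PowerSeries.map_X, PowerSeries.map_C,
      (IsLocalRing.residue_eq_zero_iff a).2 ha, map_zero, sub_zero]
  have hg0 : g.map (IsLocalRing.residue R) ≠ 0 := by
    rw [hgX]
    exact PowerSeries.X_ne_zero
  refine ⟨φ g, le_antisymm (fun y hy => ?_) ?_, fun y hy => ?_⟩
  · obtain ⟨F, rfl⟩ := φ.surjective y
    obtain ⟨q, s, hs, hF⟩ := PowerSeries.exists_isWeierstrassDivision F hg0
    change s.degree < ((g.map (IsLocalRing.residue R)).order.toNat : WithBot ℕ) at hs
    rw [hgX, PowerSeries.order_X] at hs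
    have hs' : s.degree ≤ 0 := Nat.WithBot.lt_one_iff_le_zero.1 (by simpa using hs)
    rw [Polynomial.eq_C_of_degree_le_zero hs', Polynomial.coe_C] at hF
    have h1 := congrArg (fun x => ε (φ x)) hF
    simp only [map_add, map_mul, hg, zero_mul, zero_add, hC] at h1
    rw [RingHom.mem_ker.1 hy] at h1
    rw [← h1, map_zero, add_zero] at hF
    rw [hF, map_mul]
    exact Ideal.mul_mem_right _ _ (Ideal.mem_span_singleton_self _)
  · rw [Ideal.span_singleton_le_iff_mem]
    exact hg
  · obtain ⟨q, rfl⟩ := φ.surjective y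
    rw [← map_mul, EmbeddingLike.map_eq_zero_iff] at hy
    have h1 : PowerSeries.IsWeierstrassDivision 0 g q 0 :=
      ⟨by rw [Polynomial.degree_zero]; exact WithBot.bot_lt_coe _, by simp [hy]⟩
    rw [(h1.eq_zero hg0).1, map_zero]

theorem Tower.ext_of_add {k : Type u} [CommRing k] {A : ℕ → Type u} [∀ v, CommRing (A v)]
    [∀ v, Algebra k (A v)] (t : ∀ v, A (v + 1) →ₐ[k] A v) (r : ℕ) {x y : towerLimit A t}
    (h : ∀ n, x.1 (r + n) = y.1 (r + n)) : x = y := by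
  refine Subtype.ext (funext fun v => ?_)
  have h1 := Tower.down_ev t (Nat.le_add_left v r) x
  have h2 := Tower.down_ev t (Nat.le_add_left v r) y
  exact h1.symm.trans ((congrArg _ (h v)).trans h2)

namespace PDivGroup.PushoutDiagram

open HopfGroup IsLocalRing

section parameter

variable {R : Type u} [CommRing R] [IsLocalRing R] [IsNoetherianRing R] {p : ℕ}
  {G₀ G G₀' : PDivGroup R p} {ι : Hom G₀ G} {ρ : Hom G₀ G₀'} (D : PushoutDiagram ι ρ) (r : ℕ)

/-- The splitting `O(G₀'_{r+n}) → O(G''_{r+n})`, extending functions by zero. -/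
def extendZero (n : ℕ) (y : G₀'.A (r + n)) : D.level r n :=
  D.levelIdem r n * (D.toSummand_surjective r n y).choose

omit [IsLocalRing R] in
theorem extendZero_toSummand (n : ℕ) (x : D.level r n) :
    D.extendZero r n (D.toSummand r n x) = D.levelIdem r n * x := by
  have h1 := (D.toSummand_surjective r n (D.toSummand r n x)).choose_spec
  have h2 : (D.toSummand_surjective r n (D.toSummand r n x)).choose - x ∈
      RingHom.ker (D.toSummand r n) := by
    rw [RingHom.mem_ker, map_sub, h1, sub_self]
  rw [ker_toSummand] at h2
  obtain ⟨b, hb⟩ := Ideal.mem_span_singleton.1 h2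
  have h3 := D.isIdempotentElem_levelIdem r n
  rw [extendZero, ← sub_eq_zero, ← mul_sub, hb]
  linear_combination -b * h3.eq

omit [IsLocalRing R] in
theorem extendZero_mul (n : ℕ) (y y' : G₀'.A (r + n)) :
    D.extendZero r n y * D.extendZero r n y' = D.extendZero r n (y * y') := by
  obtain ⟨x, rfl⟩ := D.toSummand_surjective r n y
  obtain ⟨x', rfl⟩ := D.toSummand_surjective r n y'
  rw [← map_mul, extendZero_toSummand, extendZero_toSummand, extendZero_toSummand]
  linear_combination (x * x') * (D.isIdempotentElem_levelIdem r n).eq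

omit [IsLocalRing R] in
theorem levelIdem_mul_extendZero (n : ℕ) (y : G₀'.A (r + n)) :
    D.levelIdem r n * D.extendZero r n y = D.extendZero r n y := by
  rw [extendZero, ← mul_assoc, (D.isIdempotentElem_levelIdem r n).eq]

omit [IsLocalRing R] in
theorem levelTrans_extendZero (n : ℕ) (y : G₀'.A (r + n + 1)) :
    D.levelTrans r n (D.extendZero r (n + 1) y) = D.extendZero r n (G₀'.trans (r + n) y) := by
  obtain ⟨x, rfl⟩ := D.toSummand_surjective r (n + 1) y
  rw [extendZero_toSummand]
  have h := D.trans_toSummand r n x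
  refine Eq.trans ?_ (congrArg (D.extendZero r n) h).symm
  rw [extendZero_toSummand, map_mul, levelTrans_levelIdem]

omit [IsLocalRing R] in
theorem toSummand_levelIdem (n : ℕ) : D.toSummand r n (D.levelIdem r n) = 1 := by
  have h1 : 1 - D.levelIdem r n ∈ RingHom.ker (D.toSummand r n) := by
    rw [ker_toSummand]
    exact Ideal.mem_span_singleton_self _
  rw [RingHom.mem_ker, map_sub, map_one, sub_eq_zero] at h1
  exact h1.symm

omit [IsLocalRing R] in
theorem toSummand_extendZero (n : ℕ) (y : G₀'.A (r + n)) :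
    D.toSummand r n (D.extendZero r n y) = y := by
  obtain ⟨x, rfl⟩ := D.toSummand_surjective r n y
  rw [extendZero_toSummand, map_mul, toSummand_levelIdem, one_mul]

omit [IsLocalRing R] [IsNoetherianRing R] in
theorem counit_toSummand (n : ℕ) (x : D.level r n) :
    Coalgebra.counit (R := R) (D.toSummand r n x) = Coalgebra.counit (R := R) x :=
  CoalgHomClass.counit_comp_apply (D.toSummand r n) x

/-- Extension by zero of a function `t` on `G₀'`, plus a given function away from `G₀'`. -/
def glue (t : G₀'.coordRing) (x : D.coordRing'' r) : D.coordRing'' r :=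
  ⟨fun n => D.extendZero r n (t.1 (r + n)) + (1 - D.levelIdem r n) * x.1 n, fun n => by
    have h1 := D.levelTrans_extendZero r n (t.1 (r + n + 1))
    have h2 := x.2 n
    have h3 := t.2 (r + n)
    change D.levelTrans r n (D.extendZero r (n + 1) (t.1 (r + n + 1)) +
      (1 - D.levelIdem r (n + 1)) * x.1 (n + 1)) = _
    rw [map_add, map_mul, map_sub, map_one, levelTrans_levelIdem]
    refine congrArg₂ (· + ·) (h1.trans (congrArg _ h3)) (congrArg _ h2)⟩

omit [IsLocalRing R] in
theorem glue_mul (t t' : G₀'.coordRing) (x x' : D.coordRing'' r) :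
    D.glue r t x * D.glue r t' x' = D.glue r (t * t') (x * x') := by
  refine Subtype.ext (funext fun n => ?_)
  change (D.extendZero r n (t.1 (r + n)) + (1 - D.levelIdem r n) * x.1 n) *
    (D.extendZero r n (t'.1 (r + n)) + (1 - D.levelIdem r n) * x'.1 n) =
    D.extendZero r n (t.1 (r + n) * t'.1 (r + n)) + (1 - D.levelIdem r n) * (x.1 n * x'.1 n)
  rw [← extendZero_mul]
  have h1 := D.levelIdem_mul_extendZero r n (t.1 (r + n))
  have h2 := D.levelIdem_mul_extendZero r n (t'.1 (r + n))
  have h3 := (D.isIdempotentElem_levelIdem r n).eq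
  linear_combination - x'.1 n * h1 - x.1 n * h2 + (x.1 n * x'.1 n) * h3

omit [IsLocalRing R] [IsNoetherianRing R] in
/-- The restriction of functions on `G''` to `G₀'`. -/
theorem exists_restriction (x : D.coordRing'' r) :
    ∃ y : G₀'.coordRing, ∀ n, y.1 (r + n) = D.toSummand r n (x.1 n) :=
  Tower.exists_extension _ r (fun n => D.toSummand r n (x.1 n)) fun n =>
    (D.trans_toSummand r n (x.1 (n + 1))).trans (congrArg _ (x.2 n))

omit [IsLocalRing R] in
theorem glue_restriction {x : D.coordRing'' r} {y : G₀'.coordRing}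
    (h : ∀ n, y.1 (r + n) = D.toSummand r n (x.1 n)) : D.glue r y x = x := by
  refine Subtype.ext (funext fun n => ?_)
  change D.extendZero r n (y.1 (r + n)) + (1 - D.levelIdem r n) * x.1 n = x.1 n
  rw [h, extendZero_toSummand]
  ring

/-- The zero section of `G₀'`. -/
def summandCounit (H : PDivGroup R p) : H.coordRing →ₐ[R] R :=
  (Bialgebra.counitAlgHom R (H.A 0)).comp ((Pi.evalAlgHom R H.A 0).comp H.coordRing.val)

omit [IsLocalRing R] [IsNoetherianRing R] in
theorem summandCounit_eq (H : PDivGroup R p) (v : ℕ) (y : H.coordRing) :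
    summandCounit H y = Coalgebra.counit (R := R) (y.1 v) := by
  induction v with
  | zero => rfl
  | succ n ih =>
    have h1 : H.trans n (y.1 (n + 1)) = y.1 n := y.2 n
    rw [ih, ← h1]
    exact CoalgHomClass.counit_comp_apply (H.trans n) _

omit [IsLocalRing R] in
theorem augmentation_glue (t : G₀'.coordRing) (x : D.coordRing'' r) :
    D.augmentation r (D.glue r t x) = summandCounit G₀' t := by
  rw [summandCounit_eq G₀' (r + 0)]
  have h1 : D.toSummand r 0 ((D.glue r t x).1 0) = t.1 (r + 0) := by
    change D.toSummand r 0 (D.extendZero r 0 (t.1 (r + 0)) + (1 - D.levelIdem r 0) * x.1 0) = _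
    rw [map_add, map_mul, map_sub, map_one, toSummand_levelIdem, toSummand_extendZero, sub_self,
      zero_mul]
    exact add_zero _
  rw [← h1, counit_toSummand]
  rfl

variable [IsAdicComplete (maximalIdeal R) R]

/-- G'' is the disjoint union of G₀' and its complement, and the zero section lies in G₀'. So a
regular generator on G₀', continued by 1, generates the augmentation ideal of G''. -/
theorem exists_parameter (h : G₀'.IsOneDimensional) : ∃ (t : G₀'.coordRing),
    (∀ y, t * y = 0 → y = 0) ∧ D.IsParameter r (D.glue r t 1) := by
  obtain ⟨φ⟩ := h
  obtain ⟨t, ht, hreg⟩ := PowerSeries.exists_regular_generator φ (summandCounit G₀')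
  refine ⟨t, hreg, le_antisymm (fun x hx => ?_) ?_⟩
  · obtain ⟨y, hy⟩ := D.exists_restriction r x
    have h1 : y ∈ RingHom.ker (summandCounit G₀') := by
      rw [RingHom.mem_ker, ← D.augmentation_glue r y x, glue_restriction D r hy]
      exact hx
    rw [ht] at h1
    obtain ⟨w, rfl⟩ := Ideal.mem_span_singleton.1 h1
    refine Ideal.mem_span_singleton.2 ⟨D.glue r w x, ?_⟩
    rw [glue_mul, one_mul, glue_restriction D r hy]
  · rw [Ideal.span_singleton_le_iff_mem, RingHom.mem_ker, augmentation_glue, ← RingHom.mem_ker, ht]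
    exact Ideal.mem_span_singleton_self _

variable {D r} in
-- Two parameters generate the same ideal, so whatever `z` annihilates is annihilated by the glued
-- parameter as well, and that one is regular on each of the two pieces.
theorem IsParameter.regular (h : G₀'.IsOneDimensional) {z : D.coordRing'' r}
    (hz : D.IsParameter r z) {x : D.coordRing'' r} (hx : z * x = 0) : x = 0 := by
  obtain ⟨t, hreg, ht⟩ := D.exists_parameter r h
  have h1 : D.glue r t 1 ∈ RingHom.ker (D.augmentation r) := by
    rw [ht]
    exact Ideal.mem_span_singleton_self _
  rw [hz] at h1
  obtain ⟨u, hu⟩ := Ideal.mem_span_singleton.1 h1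
  have h2 : D.glue r t 1 * x = 0 := by
    rw [hu, mul_right_comm, hx, zero_mul]
  obtain ⟨y, hy⟩ := D.exists_restriction r x
  have h3 : D.glue r (t * y) x = 0 := by
    rw [← one_mul x, ← glue_mul, glue_restriction D r hy, h2]
  have h4 : ∀ n, D.extendZero r n ((t * y).1 (r + n)) + (1 - D.levelIdem r n) * x.1 n = 0 :=
    fun n => congrFun (congrArg Subtype.val h3) n
  have h5 : t * y = 0 := by
    refine Tower.ext_of_add _ r fun n => ?_
    have h6 := congrArg (D.toSummand r n) (h4 n)
    rw [map_add, map_mul, map_sub, map_one, toSummand_levelIdem, toSummand_extendZero, sub_self,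
      zero_mul, add_zero, map_zero] at h6
    exact h6
  have h6 := hreg y h5
  rw [h6, mul_zero] at h3
  rw [← glue_restriction D r hy, h6, h3]

end parameter

end PDivGroup.PushoutDiagram

/-! ### The ring `O_{G''} ⊗̂ k` -/

namespace PDivGroup.PushoutDiagram

open HopfGroup IsLocalRing

section product

variable {R : Type u} [CommRing R] {p : ℕ} {G₀ G G₀' : PDivGroup R p} {ι : Hom G₀ G}
  {ρ : Hom G₀ G₀'} (D : PushoutDiagram ι ρ) (r : ℕ)

/-- The projection of `O_{G''} ⊗̂ k` to a level. -/
def evProd (n : ℕ) : D.productRing r →ₐ[D.base r] D.base r ⊗[R] D.level r n :=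
  (Tower.ev _ n : D.baseChange r →ₐ[D.base r] D.base r ⊗[R] D.level r n)

theorem evProd_toProductRing (n : ℕ) (x : D.coordRing'' r) :
    D.evProd r n (D.toProductRing r x) = 1 ⊗ₜ D.ev r n x := rfl

variable {D r} in
theorem productRing_ext {x y : D.productRing r} (h : ∀ n, D.evProd r n x = D.evProd r n y) : x = y :=
  Subtype.ext (funext h)

theorem levelTrans_evProd (n : ℕ) (x : D.productRing r) :
    Algebra.TensorProduct.map (AlgHom.id (D.base r) (D.base r))
      (D.levelTrans r n : D.level r (n + 1) →ₐ[R] D.level r n) (D.evProd r (n + 1) x) =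
    D.evProd r n x := x.2 n

/-- An `R`-basis of `k`. -/
abbrev basis := Module.Free.chooseBasis R (D.base r)

/-- The coordinates on a level with respect to a basis of `k`. -/
def levelCoord (i : Module.Free.ChooseBasisIndex R (D.base r)) (n : ℕ) :
    D.base r ⊗[R] D.level r n →ₗ[R] D.level r n :=
  (TensorProduct.lid R (D.level r n)).toLinearMap ∘ₗ
    LinearMap.rTensor (D.level r n) ((D.basis r).coord i)

theorem levelCoord_tmul (i) (n : ℕ) (c : D.base r) (x : D.level r n) :
    D.levelCoord r i n (c ⊗ₜ x) = (D.basis r).repr c i • x := rfl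

theorem levelTrans_levelCoord (i) (n : ℕ) (x : D.base r ⊗[R] D.level r (n + 1)) :
    D.levelTrans r n (D.levelCoord r i (n + 1) x) = D.levelCoord r i n
      (Algebra.TensorProduct.map (AlgHom.id (D.base r) (D.base r))
      (D.levelTrans r n : D.level r (n + 1) →ₐ[R] D.level r n) x) := by
  induction x with
  | zero => simp
  | add x y hx hy => rw [map_add, map_add, map_add, map_add, hx, hy]
  | tmul c x =>
    rw [levelCoord_tmul, Algebra.TensorProduct.map_tmul, levelCoord_tmul]
    exact map_smul (D.levelTrans r n) _ _

theorem sum_levelCoord (n : ℕ) (x : D.base r ⊗[R] D.level r n) :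
    ∑ i, D.basis r i • ((1 : D.base r) ⊗ₜ[R] D.levelCoord r i n x) = x := by
  induction x with
  | zero => simp
  | add x y hx hy =>
    conv_rhs => rw [← hx, ← hy]
    simp only [map_add, TensorProduct.tmul_add, smul_add, Finset.sum_add_distrib]
  | tmul c x =>
    conv_rhs => rw [← (D.basis r).sum_repr c, TensorProduct.sum_tmul]
    refine Finset.sum_congr rfl fun i _ => ?_
    rw [levelCoord_tmul, TensorProduct.smul_tmul', smul_eq_mul, mul_one, TensorProduct.smul_tmul]

theorem levelCoord_mul (i) (n : ℕ) (x : D.base r ⊗[R] D.level r n) (y : D.level r n) :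
    D.levelCoord r i n (x * (1 ⊗ₜ y)) = D.levelCoord r i n x * y := by
  induction x with
  | zero => simp
  | add x x' hx hx' => rw [add_mul, map_add, map_add, add_mul, hx, hx']
  | tmul c x =>
    rw [Algebra.TensorProduct.tmul_mul_tmul, mul_one, levelCoord_tmul, levelCoord_tmul,
      smul_mul_assoc]

/-- The coordinates of an element of `O_{G''} ⊗̂ k` with respect to a basis of `k`. -/
def coord (i : Module.Free.ChooseBasisIndex R (D.base r)) (x : D.productRing r) : D.coordRing'' r :=
  ⟨fun n => D.levelCoord r i n (D.evProd r n x), fun n => by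
    refine (D.levelTrans_levelCoord r i n _).trans ?_
    rw [levelTrans_evProd]⟩

theorem sum_coord (x : D.productRing r) :
    ∑ i, D.basis r i • D.toProductRing r (D.coord r i x) = x := by
  refine productRing_ext fun n => ?_
  rw [map_sum]
  simp only [map_smul, evProd_toProductRing]
  exact D.sum_levelCoord r n (D.evProd r n x)

theorem coord_mul (i) (x : D.productRing r) (y : D.coordRing'' r) :
    D.coord r i (x * D.toProductRing r y) = D.coord r i x * y := by
  refine Subtype.ext (funext fun n => ?_)
  change D.levelCoord r i n (D.evProd r n (x * D.toProductRing r y)) =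
    D.levelCoord r i n (D.evProd r n x) * y.1 n
  rw [map_mul, evProd_toProductRing, levelCoord_mul]
  rfl

theorem coord_zero (i) : D.coord r i 0 = 0 :=
  Subtype.ext (funext fun _ => (congrArg _ (map_zero _)).trans (map_zero _))

variable {T : Type u} [CommRing T] [Algebra (D.base r) T]

variable {D r} in
-- As k is finite free over R, the completed tensor product is spanned over k by the image of
-- O_{G''}.
theorem productRing_hom_ext {h h' : D.productRing r →ₐ[D.base r] T}
    (H : ∀ x, h (D.toProductRing r x) = h' (D.toProductRing r x)) : h = h' := by
  refine AlgHom.ext fun x => ?_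
  rw [← D.sum_coord r x, map_sum, map_sum]
  simp only [map_smul, H]

variable [Algebra R T] [IsScalarTower R (D.base r) T]

/-- The point of `G'' × G'[p ^ r]` over `k` given by a point of `G''_{r+n}`. -/
def hat (n : ℕ) (a : D.level r n →ₐ[R] T) : D.productRing r →ₐ[D.base r] T :=
  (Algebra.TensorProduct.lift (Algebra.ofId (D.base r) T) a fun _ _ => Commute.all _ _).comp
    (D.evProd r n)

theorem hat_toProductRing (n : ℕ) (a : D.level r n →ₐ[R] T) (x : D.coordRing'' r) :
    D.hat r n a (D.toProductRing r x) = a (D.ev r n x) := by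
  rw [hat, AlgHom.comp_apply, evProd_toProductRing, Algebra.TensorProduct.lift_tmul, map_one,
    one_mul]

theorem comp_hat {T' : Type u} [CommRing T'] [Algebra (D.base r) T'] [Algebra R T']
    [IsScalarTower R (D.base r) T'] (φ : T →ₐ[D.base r] T') (n : ℕ) (a : D.level r n →ₐ[R] T) :
    φ.comp (D.hat r n a) = D.hat r n ((φ.restrictScalars R).comp a) := by
  refine productRing_hom_ext fun x => ?_
  rw [AlgHom.comp_apply, hat_toProductRing, hat_toProductRing]
  rfl

theorem evProd_eq_hat (n : ℕ) : D.evProd r n = D.hat r n Algebra.TensorProduct.includeRight := by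
  refine productRing_hom_ext fun x => ?_
  rw [hat_toProductRing]
  rfl

variable {D r} in
theorem hat_injective {n : ℕ} {a a' : D.level r n →ₐ[R] T} (h : D.hat r n a = D.hat r n a') :
    a = a' := by
  refine AlgHom.ext fun y => ?_
  obtain ⟨x, rfl⟩ := D.ev_surjective r n y
  rw [← hat_toProductRing, h, hat_toProductRing]

theorem hat_levelTrans (n : ℕ) (a : D.level r n →ₐ[R] T) :
    D.hat r (n + 1) (a.comp (D.levelTrans r n : D.level r (n + 1) →ₐ[R] D.level r n)) =
      D.hat r n a := by
  refine productRing_hom_ext fun x => ?_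
  rw [hat_toProductRing, hat_toProductRing, ← D.levelTrans_ev r n x]
  rfl

variable {D r} in
-- The sum of two points does not depend on the level at which it is formed: a point of a higher
-- level that comes from a lower one factors through the transition maps, which are homomorphisms.
theorem hat_mul_unique {n m : ℕ} (hnm : n ≤ m) {a b : WithConv (D.level r n →ₐ[R] T)}
    {a' b' : WithConv (D.level r m →ₐ[R] T)} (ha : D.hat r n a.ofConv = D.hat r m a'.ofConv)
    (hb : D.hat r n b.ofConv = D.hat r m b'.ofConv) :
    D.hat r n (a * b).ofConv = D.hat r m (a' * b').ofConv := by
  induction m, hnm using Nat.le_induction with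
  | base =>
    rw [WithConv.ofConv_injective (hat_injective ha), WithConv.ofConv_injective (hat_injective hb)]
  | succ m hm ih =>
    have h : ∀ (c : WithConv (D.level r n →ₐ[R] T)) (c' : WithConv (D.level r (m + 1) →ₐ[R] T)),
        D.hat r n c.ofConv = D.hat r (m + 1) c'.ofConv →
        ∃ c'', D.hat r n c.ofConv = D.hat r m (WithConv.ofConv c'') ∧
          c' = precomp (D.levelTrans r m) c'' := by
      intro c c' hc
      have key : ∀ l, ∃ c'', D.hat r n c.ofConv = D.hat r (n + l) c'' := fun l => by
        induction l with
        | zero => exact ⟨c.ofConv, rfl⟩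
        | succ l ih =>
          obtain ⟨c'', hc''⟩ := ih
          exact ⟨_, hc''.trans (D.hat_levelTrans r (n + l) c'').symm⟩
      obtain ⟨l, rfl⟩ := Nat.exists_eq_add_of_le hm
      obtain ⟨c'', hc''⟩ := key l
      refine ⟨WithConv.toConv c'', hc'', ?_⟩
      apply WithConv.ofConv_injective
      apply hat_injective
      rw [← hc, hc'']
      exact (D.hat_levelTrans r (n + l) c'').symm
    obtain ⟨a'', ha1, rfl⟩ := h a a' ha
    obtain ⟨b'', hb1, rfl⟩ := h b b' hb
    rw [ih ha1 hb1, ← map_mul]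
    exact (D.hat_levelTrans r m _).symm

/-- The endomorphism of `O_{G''} ⊗̂ k` given by a compatible family of points of the levels. -/
def ofLevels (a : ∀ n, D.level r n →ₐ[R] D.base r ⊗[R] D.level r n)
    (ha : ∀ n x, Algebra.TensorProduct.map (AlgHom.id (D.base r) (D.base r))
      (D.levelTrans r n : D.level r (n + 1) →ₐ[R] D.level r n) (a (n + 1) x) =
        a n (D.levelTrans r n x)) : D.productRing r →ₐ[D.base r] D.productRing r :=
  (AlgHom.codRestrict (AlgHom.pi fun n => D.hat r n (a n)) (D.baseChange r) fun x n => by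
    have H : (Algebra.TensorProduct.map (AlgHom.id (D.base r) (D.base r))
        (D.levelTrans r n : D.level r (n + 1) →ₐ[R] D.level r n)).comp
          (D.hat r (n + 1) (a (n + 1))) = D.hat r n (a n) := by
      refine productRing_hom_ext fun x => ?_
      rw [AlgHom.comp_apply, hat_toProductRing, hat_toProductRing, ← D.levelTrans_ev r n x]
      exact ha n _
    exact DFunLike.congr_fun H x : D.productRing r →ₐ[D.base r] D.baseChange r)

theorem evProd_ofLevels (a) (ha) (n : ℕ) :
    (D.evProd r n).comp (D.ofLevels r a ha) = D.hat r n (a n) := rfl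

theorem hat_comp_ofLevels (a) (ha) (n : ℕ) (b : D.level r n →ₐ[R] T) :
    (D.hat r n b).comp (D.ofLevels r a ha) = D.hat r n (((Algebra.TensorProduct.lift
      (Algebra.ofId (D.base r) T) b fun _ _ => Commute.all _ _).restrictScalars R).comp (a n)) := by
  rw [← comp_hat, ← evProd_ofLevels D r a ha, ← AlgHom.comp_assoc]
  rfl

end product

end PDivGroup.PushoutDiagram

/-! ### Translations and evaluation at the multiples of the tautological point -/

namespace PDivGroup.PushoutDiagram

open HopfGroup IsLocalRing

section translation

variable {R : Type u} [CommRing R] {p : ℕ} {G₀ G G₀' : PDivGroup R p} {ι : Hom G₀ G}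
  {ρ : Hom G₀ G₀'} (D : PushoutDiagram ι ρ) (r : ℕ)

section charPoint

variable (T : Type u) [CommRing T] [Algebra (D.base r) T] [Algebra R T]
  [IsScalarTower R (D.base r) T]

/-- The tautological point over a `k`-algebra. -/
def tautIn (n : ℕ) : WithConv (D.level r n →ₐ[R] T) :=
  postcomp ((Algebra.ofId (D.base r) T).restrictScalars R) (WithConv.toConv (D.tautPoint r n))

theorem tautPoint_mulBy (n : ℕ) (x : D.level r n) :
    D.tautPoint r n (mulBy R (D.level r n) (p ^ r) x) =
      algebraMap R (D.base r) (Coalgebra.counit (R := R) x) := by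
  obtain ⟨a, rfl⟩ := Ideal.Quotient.mk_surjective x
  have h1 := mulBy_naturality (quotientHom (R := R) (kernelIdeal (D.torsionHom r (r + n)))) (p ^ r) a
  rw [quotientHom_apply, quotientHom_apply] at h1
  rw [← h1]
  change D.G'.restrict r n (mulBy R (D.G'.A (r + n)) (p ^ r) a) = _
  rw [mulBy_naturality, mulBy_eq]
  exact congrArg _ (CoalgHomClass.counit_comp_apply (D.G'.restrict r n) a)

theorem tautPoint_pow (n : ℕ) : WithConv.toConv (D.tautPoint r n) ^ p ^ r = 1 := by
  have h1 := comp_conv_pow (D.tautPoint r n) (WithConv.toConv (AlgHom.id R (D.level r n))) (p ^ r)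
  rw [← mulBy_toAlgHom] at h1
  refine conv_ext fun x => ?_
  rw [conv_one_apply, ← tautPoint_mulBy]
  exact (DFunLike.congr_fun h1 x).symm

/-- The multiples of the tautological point. -/
def charPoint (α : ZMod (p ^ r)) (n : ℕ) : WithConv (D.level r n →ₐ[R] T) :=
  D.tautIn r T n ^ α.val

theorem tautIn_levelTrans (n : ℕ) :
    precomp (D.levelTrans r n) (D.tautIn r T n) = D.tautIn r T (n + 1) := by
  rw [tautIn, tautIn, ← tautPoint_levelTrans]
  rfl

theorem charPoint_levelTrans (α : ZMod (p ^ r)) (n : ℕ) :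
    precomp (D.levelTrans r n) (D.charPoint r T α n) = D.charPoint r T α (n + 1) := by
  rw [charPoint, map_pow, tautIn_levelTrans]
  rfl

theorem hat_charPoint (α : ZMod (p ^ r)) (n : ℕ) :
    D.hat r n (D.charPoint r T α n).ofConv = D.hat r 0 (D.charPoint r T α 0).ofConv := by
  induction n with
  | zero => rfl
  | succ n ih =>
    rw [← ih, ← charPoint_levelTrans]
    exact D.hat_levelTrans r n _

theorem charPoint_zero (n : ℕ) : D.charPoint r T 0 n = 1 := by
  rw [charPoint, ZMod.val_zero, pow_zero]

variable {T} in
theorem postcomp_charPoint {T' : Type u} [CommRing T'] [Algebra (D.base r) T'] [Algebra R T']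
    [IsScalarTower R (D.base r) T'] (φ : T →ₐ[D.base r] T') (α : ZMod (p ^ r)) (n : ℕ) :
    postcomp (φ.restrictScalars R) (D.charPoint r T α n) = D.charPoint r T' α n := by
  rw [charPoint, charPoint, map_pow]
  congr 1
  refine conv_ext fun x => ?_
  exact φ.commutes _

variable [NeZero (p ^ r)]

theorem charPoint_add (α β : ZMod (p ^ r)) (n : ℕ) :
    D.charPoint r T (α + β) n = D.charPoint r T α n * D.charPoint r T β n := by
  have h1 : D.tautIn r T n ^ p ^ r = 1 := by
    rw [tautIn, ← map_pow, tautPoint_pow, map_one]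
  rw [charPoint, charPoint, charPoint, ← pow_add, ZMod.val_add]
  exact (pow_eq_pow_mod _ h1).symm

end charPoint

/-- Evaluation at a multiple of the tautological point. -/
def evalAt (α : ZMod (p ^ r)) : D.productRing r →ₐ[D.base r] D.base r :=
  D.hat r 0 (D.charPoint r (D.base r) α 0).ofConv

theorem ofId_comp_evalAt (T : Type u) [CommRing T] [Algebra (D.base r) T] [Algebra R T]
    [IsScalarTower R (D.base r) T] (α : ZMod (p ^ r)) (n : ℕ) :
    (Algebra.ofId (D.base r) T).comp (D.evalAt r α) = D.hat r n (D.charPoint r T α n).ofConv := by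
  rw [hat_charPoint, evalAt, comp_hat, ← D.postcomp_charPoint r (Algebra.ofId (D.base r) T) α 0]
  rfl

theorem evalAt_eq (α : ZMod (p ^ r)) (n : ℕ) :
    D.evalAt r α = D.hat r n (D.charPoint r (D.base r) α n).ofConv :=
  (D.hat_charPoint r (D.base r) α n).symm

theorem evalAt_toProductRing (α : ZMod (p ^ r)) (n : ℕ) (x : D.coordRing'' r) :
    D.evalAt r α (D.toProductRing r x) =
      ((WithConv.toConv (D.tautPoint r n)) ^ α.val).ofConv (D.ev r n x) := by
  rw [evalAt_eq D r α n, hat_toProductRing]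
  rfl

/-- Translation by a multiple of the tautological point. -/
def shift (α : ZMod (p ^ r)) : D.productRing r →ₐ[D.base r] D.productRing r :=
  D.ofLevels r (fun n => D.translateHom r α.val n) fun n x => D.translateHom_levelTrans r α.val n x

theorem hat_comp_shift {T : Type u} [CommRing T] [Algebra (D.base r) T] [Algebra R T]
    [IsScalarTower R (D.base r) T] (α : ZMod (p ^ r)) (n : ℕ)
    (b : WithConv (D.level r n →ₐ[R] T)) : (D.hat r n b.ofConv).comp (D.shift r α) =
      D.hat r n (b * D.charPoint r T α n).ofConv := by
  rw [shift, hat_comp_ofLevels]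
  congr 1
  let P := postcomp (A := D.level r n) ((Algebra.TensorProduct.lift
    (Algebra.ofId (D.base r) T) b.ofConv fun _ _ => Commute.all _ _).restrictScalars R)
  have h := map_mul P
    (WithConv.toConv
      (Algebra.TensorProduct.includeRight : D.level r n →ₐ[R] D.base r ⊗[R] D.level r n))
    (WithConv.toConv ((Algebra.TensorProduct.includeLeft :
      D.base r →ₐ[R] D.base r ⊗[R] D.level r n).comp (D.tautPoint r n)) ^ α.val)
  refine (congrArg WithConv.ofConv (h.trans (congrArg (P _ * ·) (map_pow P _ _)))).trans ?_
  rw [charPoint]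
  congr 3
  · refine conv_ext fun x => ?_
    rw [postcomp_apply]
    simp
  · refine conv_ext fun x => ?_
    rw [postcomp_apply]
    change (Algebra.TensorProduct.lift (Algebra.ofId (D.base r) T) b.ofConv
      (fun _ _ => Commute.all _ _)) (D.tautPoint r n x ⊗ₜ[R] 1) = algebraMap (D.base r) T (D.tautPoint r n x)
    simp [Algebra.ofId_apply]

theorem shift_toProductRing [NeZero (p ^ r)] (z : D.coordRing'' r) (α : ZMod (p ^ r)) :
    D.translate r z α = D.shift r (-α) (D.toProductRing r z) := by
  refine productRing_ext fun n => ?_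
  exact (D.hat_toProductRing r n (D.translateHom r (-α).val n) z).symm

theorem hat_comp_shift_zero {T : Type u} [CommRing T] [Algebra (D.base r) T] [Algebra R T]
    [IsScalarTower R (D.base r) T] (n : ℕ) (b : D.level r n →ₐ[R] T) :
    (D.hat r n b).comp (D.shift r 0) = D.hat r n b := by
  have h := D.hat_comp_shift r 0 n (WithConv.toConv b)
  rwa [charPoint_zero, mul_one] at h

theorem shift_zero : D.shift r 0 = AlgHom.id _ _ := by
  refine AlgHom.ext fun x => productRing_ext fun n => ?_
  rw [evProd_eq_hat]
  exact DFunLike.congr_fun (D.hat_comp_shift_zero r n _) x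

theorem hat_shift_shift [NeZero (p ^ r)] {T : Type u} [CommRing T] [Algebra (D.base r) T]
    [Algebra R T] [IsScalarTower R (D.base r) T] (n : ℕ) (b : D.level r n →ₐ[R] T)
    (α β : ZMod (p ^ r)) : ((D.hat r n b).comp (D.shift r α)).comp (D.shift r β) =
      (D.hat r n b).comp (D.shift r (α + β)) := by
  have h := D.hat_comp_shift r α n (WithConv.toConv b)
  have h' := D.hat_comp_shift r (α + β) n (WithConv.toConv b)
  rw [charPoint_add, ← mul_assoc, ← hat_comp_shift, ← h] at h'
  exact h'.symm

theorem shift_shift [NeZero (p ^ r)] (α β : ZMod (p ^ r)) (x : D.productRing r) :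
    D.shift r α (D.shift r β x) = D.shift r (α + β) x := by
  refine productRing_ext fun n => ?_
  rw [evProd_eq_hat]
  exact DFunLike.congr_fun (D.hat_shift_shift r n _ α β) x

theorem evalAt_shift [NeZero (p ^ r)] (α β : ZMod (p ^ r)) (x : D.productRing r) :
    D.evalAt r α (D.shift r β x) = D.evalAt r (α + β) x := by
  have h := D.hat_comp_shift r β 0 (D.charPoint r (D.base r) α 0)
  rw [← charPoint_add] at h
  exact DFunLike.congr_fun h x

variable {D r} {z : D.coordRing'' r}

/-- Evaluation at zero acts on the coordinates with respect to a basis of k as the augmentation, so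
it vanishes exactly when every coordinate is divisible by z. -/
theorem IsParameter.evalAt_zero_eq_zero_iff (hz : D.IsParameter r z) (x : D.productRing r) :
    D.evalAt r 0 x = 0 ↔ D.toProductRing r z ∣ x := by
  have h0 : ∀ y, D.evalAt r 0 (D.toProductRing r y) = algebraMap R (D.base r) (D.augmentation r y) := by
    intro y
    rw [D.evalAt_toProductRing r 0 0, ZMod.val_zero, pow_zero, conv_one_apply, ← augmentation_eq]
  constructor
  · intro h
    have h1 : ∀ i, z ∣ D.coord r i x := by
      rw [← D.sum_coord r x, map_sum] at h
      simp only [map_smul, h0, smul_eq_mul, mul_comm _ (algebraMap R (D.base r) _),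
        ← Algebra.smul_def] at h
      intro i
      have h2 := Fintype.linearIndependent_iff.1 (D.basis r).linearIndependent _ h i
      have h3 : D.coord r i x ∈ RingHom.ker (D.augmentation r) := h2
      rw [hz] at h3
      exact Ideal.mem_span_singleton.1 h3
    rw [← D.sum_coord r x]
    refine Finset.dvd_sum fun i _ => ?_
    rw [Algebra.smul_def]
    exact Dvd.dvd.mul_left (map_dvd _ (h1 i)) _
  · rintro ⟨y, rfl⟩
    have hz' : z ∈ RingHom.ker (D.augmentation r) := by
      rw [hz]
      exact Ideal.mem_span_singleton_self _
    rw [map_mul, h0, RingHom.mem_ker.1 hz', map_zero, zero_mul]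

variable [NeZero (p ^ r)]

/-- Translation by α u is invertible and carries evaluation at 0 to evaluation at α u. -/
theorem IsParameter.evalAt_eq_zero_iff (hz : D.IsParameter r z) (α : ZMod (p ^ r))
    (x : D.productRing r) : D.evalAt r α x = 0 ↔ D.translate r z α ∣ x := by
  have h : D.evalAt r α x = D.evalAt r 0 (D.shift r α x) := by
    rw [evalAt_shift, zero_add]
  rw [h, hz.evalAt_zero_eq_zero_iff, shift_toProductRing]
  constructor
  · intro h
    have h1 := map_dvd (D.shift r (-α)) h
    rwa [shift_shift, neg_add_cancel, shift_zero] at h1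
  · intro h
    have h1 := map_dvd (D.shift r α) h
    rwa [shift_shift, add_neg_cancel, shift_zero] at h1

theorem IsParameter.evalAt_translate (hz : D.IsParameter r z) (α : ZMod (p ^ r)) :
    D.evalAt r α (D.translate r z α) = 0 := (hz.evalAt_eq_zero_iff α _).2 dvd_rfl

theorem IsParameter.translate_regular [IsLocalRing R] [IsNoetherianRing R]
    [IsAdicComplete (maximalIdeal R) R] (hdim : G₀'.IsOneDimensional) (hz : D.IsParameter r z)
    (α : ZMod (p ^ r)) {x : D.productRing r} (hx : D.translate r z α * x = 0) : x = 0 := by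
  have h1 := congrArg (D.shift r α) hx
  rw [map_mul, map_zero, shift_toProductRing, shift_shift, add_neg_cancel, shift_zero] at h1
  have h2 : D.shift r α x = 0 := by
    rw [← D.sum_coord r (D.shift r α x)]
    refine Finset.sum_eq_zero fun i _ => ?_
    have h3 := D.coord_mul r i (D.shift r α x) z
    rw [mul_comm, AlgHom.id_apply] at h1
    rw [h1, coord_zero, mul_comm] at h3
    rw [hz.regular hdim h3.symm, map_zero, smul_zero]
  have h3 := congrArg (D.shift r (-α)) h2
  rwa [shift_shift, neg_add_cancel, shift_zero, map_zero] at h3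

variable (D r) in
/-- The product of the translates of `z`. -/
def divisor (z : D.coordRing'' r) : D.productRing r := ∏ α : ZMod (p ^ r), D.translate r z α

theorem translate_dvd_divisor (α : ZMod (p ^ r)) : D.translate r z α ∣ divisor D r z :=
  Finset.dvd_prod_of_mem _ (Finset.mem_univ α)

theorem IsParameter.evalAt_divisor (hz : D.IsParameter r z) (α : ZMod (p ^ r)) :
    D.evalAt r α (divisor D r z) = 0 := (hz.evalAt_eq_zero_iff α _).2 (translate_dvd_divisor α)

/-- Each α u is p^r-torsion, so [p^r]^* z vanishes there and is divisible by every translate;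
multiplying these divisibilities produces the exponent p^r and needs no coprimality of the
translates. -/
theorem IsParameter.divisor_dvd (hz : D.IsParameter r z) :
    divisor D r z ∣ D.toProductRing r (mulOn D r (p ^ r) z) ^ p ^ r := by
  have h1 : ∀ α : ZMod (p ^ r), D.translate r z α ∣ D.toProductRing r (mulOn D r (p ^ r) z) := by
    intro α
    rw [← hz.evalAt_eq_zero_iff, D.evalAt_toProductRing r α 0, ev_zero_mulOn, map_zero]
    have hz' : z ∈ RingHom.ker (D.augmentation r) := by
      rw [hz]
      exact Ideal.mem_span_singleton_self _
    exact hz'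
  have h2 := Finset.prod_dvd_prod_of_dvd (s := Finset.univ) _ _ fun α _ => h1 α
  rwa [Finset.prod_const, Finset.card_univ, ZMod.card] at h2

end translation

end PDivGroup.PushoutDiagram

/-! ### Completions at finitely generated ideals -/

namespace AdicCompletion

section points

variable {k S T : Type u} [CommRing k] [CommRing S] [Algebra k S] [CommRing T] [Algebra k T]
  (J : Ideal S)

/-- The canonical map to the completion. -/
def toCompletion (k : Type u) [CommRing k] [Algebra k S] : S →ₐ[k] AdicCompletion J S :=
  (Algebra.ofId S (AdicCompletion J S)).restrictScalars k

/-- The ideal of definition of the completion. -/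
abbrev extendedIdeal : Ideal (AdicCompletion J S) := J.map (algebraMap S (AdicCompletion J S))

theorem evalₐ_toCompletion (n : ℕ) (s : S) :
    evalₐ J n (toCompletion J k s) = Ideal.Quotient.mk (J ^ n) s :=
  (evalₐ J n).commutes s

/-- Finite generation makes the powers of the extended ideal coincide with the kernels of the
evaluation maps. -/
theorem mem_extendedIdeal_pow (hJ : J.FG) (n : ℕ) (b : AdicCompletion J S) :
    b ∈ extendedIdeal J ^ n ↔ evalₐ J n b = 0 := by
  have h1 := pow_smul_top_eq_ker_eval (M := S) (n := n) hJ
  have h2 : b ∈ extendedIdeal J ^ n ↔ b ∈ (J ^ n • ⊤ : Submodule S (AdicCompletion J S)) := by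
    rw [Ideal.smul_top_eq_map, ← Ideal.map_pow]
    rfl
  rw [h2, h1, LinearMap.mem_ker]
  obtain ⟨s, rfl⟩ := AdicCompletion.mk_surjective J S b
  rw [evalₐ_mk, Ideal.Quotient.eq_zero_iff_mem]
  change Submodule.Quotient.mk (s.val n) = 0 ↔ _
  rw [Submodule.Quotient.mk_eq_zero]
  simp

theorem exists_sub_mem (hJ : J.FG) (n : ℕ) (b : AdicCompletion J S) :
    ∃ s : S, b - toCompletion J k s ∈ extendedIdeal J ^ n := by
  obtain ⟨s, hs⟩ := Ideal.Quotient.mk_surjective (evalₐ J n b)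
  refine ⟨s, (mem_extendedIdeal_pow J hJ n _).2 ?_⟩
  rw [map_sub, evalₐ_toCompletion, hs, sub_self]

theorem isAdicComplete_extendedIdeal (hJ : J.FG) :
    IsAdicComplete (extendedIdeal J) (AdicCompletion J S) :=
  (IsAdicComplete.map_algebraMap_iff _ _).2 (AdicCompletion.isAdicComplete hJ)

/-- The continuous extension of a homomorphism to the completion. -/
def extend (h : S →ₐ[k] T) (n : ℕ) (hn : J ^ n ≤ RingHom.ker h) : AdicCompletion J S →ₐ[k] T :=
  (Ideal.Quotient.liftₐ (J ^ n) h fun _ ha => hn ha).comp ((evalₐ J n).restrictScalars k)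

theorem extend_toCompletion (h : S →ₐ[k] T) (n : ℕ) (hn : J ^ n ≤ RingHom.ker h) (s : S) :
    extend J h n hn (toCompletion J k s) = h s := by
  change Ideal.Quotient.liftₐ (J ^ n) h (fun _ ha => hn ha) (evalₐ J n (toCompletion J k s)) = h s
  rw [evalₐ_toCompletion]
  rfl

theorem extend_comp (h : S →ₐ[k] T) (n : ℕ) (hn : J ^ n ≤ RingHom.ker h) :
    (extend J h n hn).comp (toCompletion J k) = h :=
  AlgHom.ext (extend_toCompletion J h n hn)

theorem isContinuous_extend (hJ : J.FG) (h : S →ₐ[k] T) (n : ℕ) (hn : J ^ n ≤ RingHom.ker h) :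
    FormalHopf.IsContinuous (extendedIdeal J) (extend J h n hn) := by
  refine ⟨n, fun b hb => ?_⟩
  rw [mem_extendedIdeal_pow J hJ] at hb
  exact (congrArg (Ideal.Quotient.liftₐ (J ^ n) h fun _ ha => hn ha) hb).trans
    (_root_.map_zero _)

variable {J} in
theorem hom_ext_of_isContinuous (hJ : J.FG) {f g : AdicCompletion J S →ₐ[k] T}
    (hf : FormalHopf.IsContinuous (extendedIdeal J) f)
    (hg : FormalHopf.IsContinuous (extendedIdeal J) g)
    (h : f.comp (toCompletion J k) = g.comp (toCompletion J k)) : f = g := by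
  obtain ⟨n, hn⟩ := hf
  obtain ⟨m, hm⟩ := hg
  refine AlgHom.ext fun b => ?_
  obtain ⟨s, hs⟩ := exists_sub_mem (k := k) J hJ (max n m) b
  have h1 : f (b - toCompletion J k s) = 0 := hn (Ideal.pow_le_pow_right (le_max_left _ _) hs)
  have h2 : g (b - toCompletion J k s) = 0 := hm (Ideal.pow_le_pow_right (le_max_right _ _) hs)
  rw [map_sub, sub_eq_zero] at h1 h2
  rw [h1, h2]
  exact DFunLike.congr_fun h s

variable {J} in
theorem exists_pow_le_ker_comp {f : AdicCompletion J S →ₐ[k] T}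
    (hf : FormalHopf.IsContinuous (extendedIdeal J) f) :
    ∃ n, J ^ n ≤ RingHom.ker (f.comp (toCompletion J k)) := by
  obtain ⟨n, hn⟩ := hf
  refine ⟨n, fun s hs => hn ?_⟩
  rw [← Ideal.map_pow]
  exact Ideal.mem_map_of_mem _ hs

end points

end AdicCompletion

/-! ### Functoriality and continuity of convolution. -/

namespace FormalHopf

section conv

variable {k B T T' : Type u} [CommRing k] [CommRing B] [Algebra k B] [CommRing T] [Algebra k T]
  [CommRing T'] [Algebra k T'] {I : Ideal B}

theorem IsContinuous.comp {f : B →ₐ[k] T} (hf : IsContinuous I f) (φ : T →ₐ[k] T') :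
    IsContinuous I (φ.comp f) := by
  obtain ⟨n, hn⟩ := hf
  refine ⟨n, fun b hb => ?_⟩
  have : f b = 0 := hn hb
  rw [RingHom.mem_ker, AlgHom.comp_apply, this, map_zero]

theorem IsContinuous.of_comp {f : B →ₐ[k] T} {φ : T →ₐ[k] T'} (hφ : Function.Injective φ)
    (hf : IsContinuous I (φ.comp f)) : IsContinuous I f := by
  obtain ⟨n, hn⟩ := hf
  refine ⟨n, fun b hb => ?_⟩
  have : φ (f b) = 0 := hn hb
  exact (map_eq_zero_iff φ hφ).1 this

theorem comp_conv (Δ : B →ₐ[k] CompletedTensor k I) {f g : B →ₐ[k] T} (hf : IsContinuous I f)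
    (hg : IsContinuous I g) (φ : T →ₐ[k] T') :
    φ.comp (conv Δ f g) = conv Δ (φ.comp f) (φ.comp g) := by
  obtain ⟨n, hn⟩ := exists_pow_le_ker hf hg
  have h1 : tensorLift (φ.comp f) (φ.comp g) = φ.comp (tensorLift f g) := by
    ext <;> simp [tensorLift]
  have hn' : tensorIdeal k I ^ n ≤ RingHom.ker (tensorLift (φ.comp f) (φ.comp g)) := fun x hx => by
    rw [h1, RingHom.mem_ker, AlgHom.comp_apply, RingHom.mem_ker.1 (hn hx), map_zero]
  rw [conv_eq Δ f g n hn, conv_eq Δ _ _ n hn', ← AlgHom.comp_assoc, ← AlgHom.comp_assoc]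
  congr 2
  refine Ideal.Quotient.algHom_ext k ?_
  exact h1.symm

theorem isContinuous_conv {Δ : B →ₐ[k] CompletedTensor k I}
    (hΔ : ∀ n : ℕ, ∃ m : ℕ, ∀ b ∈ I ^ m, AdicCompletion.evalₐ (tensorIdeal k I) n (Δ b) = 0)
    {f g : B →ₐ[k] T} (hf : IsContinuous I f) (hg : IsContinuous I g) :
    IsContinuous I (conv Δ f g) := by
  obtain ⟨n, hn⟩ := exists_pow_le_ker hf hg
  obtain ⟨m, hm⟩ := hΔ n
  refine ⟨m, fun b hb => ?_⟩
  rw [RingHom.mem_ker, conv_eq Δ f g n hn]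
  change Ideal.Quotient.liftₐ _ (tensorLift f g) (fun _ ha => hn ha) (AdicCompletion.evalₐ (tensorIdeal k I) n (Δ b)) = 0
  rw [hm b hb, map_zero]

end conv

end FormalHopf

/-! ### Points over algebras killed by a power of the maximal ideal -/

section small

variable (R : Type u) [CommRing R] [IsLocalRing R] (T : Type u) [CommRing T] [Algebra R T]

/-- `T` is killed by a power of the maximal ideal. -/
def IsSmall : Prop := ∃ j, ∀ c ∈ IsLocalRing.maximalIdeal R ^ j, algebraMap R T c = 0

/-- The ideal generated by a power of the maximal ideal. -/
abbrev maximalPow (j : ℕ) : Ideal T := (IsLocalRing.maximalIdeal R).map (algebraMap R T) ^ j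

theorem isSmall_quotient (j : ℕ) : IsSmall R (T ⧸ maximalPow R T j) :=
  ⟨j, fun c hc => Ideal.Quotient.eq_zero_iff_mem.2 (by
    rw [maximalPow, ← Ideal.map_pow]
    exact Ideal.mem_map_of_mem _ hc)⟩

variable {R T}

theorem eq_of_forall_quotient [IsNoetherianRing R] [IsAdicComplete (IsLocalRing.maximalIdeal R) R]
    [Module.Finite R T] {x y : T}
    (h : ∀ j, Ideal.Quotient.mk (maximalPow R T j) x = Ideal.Quotient.mk (maximalPow R T j) y) :
    x = y := by
  have := isAdicComplete_of_finite (IsLocalRing.maximalIdeal R) T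
  rw [← sub_eq_zero]
  refine Tower.eq_zero_of_forall_mem (IsLocalRing.maximalIdeal R) fun j => ?_
  rw [Ideal.smul_top_eq_map, Ideal.map_pow]
  exact Ideal.Quotient.eq.1 (h j)

end small

/-- `S` is generated modulo `a` by finitely many elements over `k`. -/
def FiniteModulo (k : Type u) [CommRing k] {S : Type u} [CommRing S] [Algebra k S] (a : S) : Prop :=
  ∃ N : Submodule k S, N.FG ∧ ∀ x, ∃ y ∈ N, a ∣ x - y

section finiteModulo

variable {k : Type u} [CommRing k] {S : Type u} [CommRing S] [Algebra k S]

theorem FiniteModulo.one : FiniteModulo k (1 : S) :=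
  ⟨⊥, Submodule.fg_bot, fun _ => ⟨0, Submodule.zero_mem _, one_dvd _⟩⟩

/-- Multiplication by `a` maps S/b onto aS/abS, so S/ab is an extension of S/a by a quotient of S/b.
-/
theorem FiniteModulo.mul {a b : S} (ha : FiniteModulo k a) (hb : FiniteModulo k b) :
    FiniteModulo k (a * b) := by
  obtain ⟨N, hN, h⟩ := ha
  obtain ⟨N', hN', h'⟩ := hb
  refine ⟨N ⊔ N'.map (LinearMap.mulLeft k a), hN.sup (hN'.map _), fun x => ?_⟩
  obtain ⟨y, hy, u, hu⟩ := h x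
  obtain ⟨y', hy', v, hv⟩ := h' u
  refine ⟨y + a * y', Submodule.add_mem_sup hy (Submodule.mem_map_of_mem hy'), v, ?_⟩
  linear_combination hu + a * hv

theorem FiniteModulo.prod {ι : Type*} (s : Finset ι) {a : ι → S}
    (h : ∀ i ∈ s, FiniteModulo k (a i)) : FiniteModulo k (∏ i ∈ s, a i) :=
  Finset.prod_induction _ (FiniteModulo k) (fun _ _ => FiniteModulo.mul) FiniteModulo.one h

theorem FiniteModulo.pow {a : S} (h : FiniteModulo k a) (n : ℕ) : FiniteModulo k (a ^ n) := by
  induction n with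
  | zero => exact pow_zero a ▸ FiniteModulo.one
  | succ n ih => exact pow_succ a n ▸ ih.mul h

theorem FiniteModulo.of_ker {a : S} (θ : S →ₐ[k] k) (h : ∀ x, θ x = 0 → a ∣ x) :
    FiniteModulo k a := by
  refine ⟨Submodule.span k {1}, Submodule.fg_span_singleton _, fun x => ⟨θ x • 1,
    Submodule.smul_mem _ _ (Submodule.mem_span_singleton_self _), h _ ?_⟩⟩
  simp

theorem FiniteModulo.finite_range {a : S} (ha : FiniteModulo k a) {T : Type u} [CommRing T]
    [Algebra k T] (h : S →ₐ[k] T) (h0 : h a = 0) : Module.Finite k h.range := by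
  obtain ⟨N, hN, hx⟩ := ha
  have h1 : Subalgebra.toSubmodule h.range = N.map h.toLinearMap := by
    refine le_antisymm ?_ ?_
    · rintro _ ⟨x, rfl⟩
      obtain ⟨y, hy, u, hu⟩ := hx x
      refine ⟨y, hy, ?_⟩
      have h2 := congrArg h hu
      rw [map_mul, h0, zero_mul, map_sub, sub_eq_zero] at h2
      exact h2.symm
    · rintro _ ⟨y, -, rfl⟩
      exact ⟨y, rfl⟩
  have h2 : (Subalgebra.toSubmodule h.range).FG := h1 ▸ hN.map _
  exact Module.Finite.iff_fg.2 h2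

end finiteModulo

/-! ### Continuous points come from finite levels. -/

namespace PDivGroup.PushoutDiagram

open HopfGroup IsLocalRing FormalHopf AdicCompletion

section smallPoints

variable {R : Type u} [CommRing R] {p : ℕ} {G₀ G G₀' : PDivGroup R p} {ι : Hom G₀ G}
  {ρ : Hom G₀ G₀'} {D : PushoutDiagram ι ρ} {r : ℕ} {z : D.coordRing'' r}

/-- In a small algebra p is nilpotent, and [p^r]^* z becomes nilpotent because a power of it is
divisible by the divisor. So the point kills a power of J = (p, [p^r]^* z), hence all functions
vanishing on a sufficiently high level. All large levels are allowed, so that several points can be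
placed at one level. -/
theorem IsParameter.exists_hat [IsLocalRing R] [IsNoetherianRing R]
    [IsAdicComplete (maximalIdeal R) R] [∀ v, IsLocalRing (G₀'.A v)] [NeZero (p ^ r)]
    (hz : D.IsParameter r z) (hp : (p : R) ∈ maximalIdeal R)
    {T : Type u} [CommRing T] [Algebra (D.base r) T] [Algebra R T]
    [IsScalarTower R (D.base r) T] (hT : IsSmall R T) (h : D.productRing r →ₐ[D.base r] T)
    (hn : IsNilpotent (h (divisor D r z))) :
    ∃ M₀, ∀ M, M₀ ≤ M → ∃ a : D.level r M →ₐ[R] T, h = D.hat r M a := by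
  let h' : D.coordRing'' r →ₐ[R] T := (h.restrictScalars R).comp (D.toProductRing r)
  have hw : IsNilpotent (h' (mulOn D r (p ^ r) z)) := by
    obtain ⟨g, hg⟩ := hz.divisor_dvd
    have h1 := congrArg h hg
    rw [map_pow, map_mul] at h1
    have h2 : IsNilpotent (h (D.toProductRing r (mulOn D r (p ^ r) z)) ^ p ^ r) := by
      rw [h1]
      exact Commute.isNilpotent_mul_right (Commute.all _ _) hn
    exact (IsNilpotent.pow_iff_pos (NeZero.ne _)).1 h2
  have hp' : IsNilpotent (h' (p : D.coordRing'' r)) := by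
    obtain ⟨j, hj⟩ := hT
    refine ⟨j, ?_⟩
    have h1 := hj _ (Ideal.pow_mem_pow hp j)
    rwa [map_pow, map_natCast, ← map_natCast h'] at h1
  obtain ⟨K, hK⟩ := hw
  obtain ⟨j, hj⟩ := hp'
  have h1 : (torsionIdeal D r z ^ (j + K)) ≤ RingHom.ker h' := by
    rw [torsionIdeal, Ideal.span_insert]
    refine Ideal.sup_pow_add_le_pow_sup_pow.trans (sup_le ?_ ?_)
    · rw [Ideal.span_singleton_pow, Ideal.span_singleton_le_iff_mem, RingHom.mem_ker, map_pow, hj]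
    · rw [Ideal.span_singleton_pow, Ideal.span_singleton_le_iff_mem, RingHom.mem_ker, map_pow, hK]
  have h2 : ∀ M, j + K ≤ M → ∀ x, D.ev r M x = 0 → h' x = 0 := fun M hM x hx =>
    h1 (Ideal.pow_le_pow_right hM (hz.mem_torsionIdeal_pow hp M hx))
  refine ⟨j + K, fun M hM => ⟨liftAlg (D.ev r M) (D.ev_surjective r M) h' (h2 M hM), ?_⟩⟩
  refine productRing_hom_ext fun x => ?_
  rw [hat_toProductRing, liftAlg_apply]
  rfl

variable [NeZero (p ^ r)]

theorem fg_translateIdeal : (D.translateIdeal r z).FG := ⟨{divisor D r z}, by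
  rw [Finset.coe_singleton]; rfl⟩

theorem mem_translateIdeal_pow {n : ℕ} {x : D.productRing r} :
    x ∈ D.translateIdeal r z ^ n ↔ divisor D r z ^ n ∣ x := by
  have h : D.translateIdeal r z = Ideal.span {divisor D r z} := rfl
  rw [h, Ideal.span_singleton_pow, Ideal.mem_span_singleton]

theorem translateIdeal_pow_le_ker_iff {T : Type u} [CommRing T] [Algebra (D.base r) T]
    (h : D.productRing r →ₐ[D.base r] T) (n : ℕ) :
    D.translateIdeal r z ^ n ≤ RingHom.ker h ↔ h (divisor D r z) ^ n = 0 := by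
  have h1 : D.translateIdeal r z = Ideal.span {divisor D r z} := rfl
  rw [h1, Ideal.span_singleton_pow, Ideal.span_singleton_le_iff_mem, RingHom.mem_ker, map_pow]

theorem IsParameter.finiteModulo (hz : D.IsParameter r z) (n : ℕ) :
    FiniteModulo (D.base r) (divisor D r z ^ n) :=
  (FiniteModulo.prod _ fun α _ => FiniteModulo.of_ker (D.evalAt r α) fun x hx =>
    (hz.evalAt_eq_zero_iff α x).1 hx).pow n

variable (D r z) in
/-- The canonical map to the completion. -/
abbrev toCompl : D.productRing r →ₐ[D.base r] D.completedRing r z :=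
  toCompletion (D.translateIdeal r z) (D.base r)

theorem isNilpotent_divisor {T : Type u} [CommRing T] [Algebra (D.base r) T]
    {f : D.completedRing r z →ₐ[D.base r] T} (hf : IsContinuous (D.definingIdeal r z) f) :
    IsNilpotent (f.comp (toCompl D r z) (divisor D r z)) := by
  obtain ⟨n, hn⟩ := exists_pow_le_ker_comp hf
  exact ⟨n, (translateIdeal_pow_le_ker_iff _ n).1 hn⟩

/-- A continuous point factors through the quotient by a power of the product of the translates, and
that quotient is finite over k because the kernel of each evaluation to k is generated by a
translate. -/
theorem IsParameter.finite_range (hz : D.IsParameter r z) {T : Type u} [CommRing T]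
    [Algebra (D.base r) T] {f : D.completedRing r z →ₐ[D.base r] T}
    (hf : IsContinuous (D.definingIdeal r z) f) : Module.Finite (D.base r) f.range := by
  have h1 : f.range = (f.comp (toCompl D r z)).range := by
    refine le_antisymm ?_ ?_
    · rintro _ ⟨b, rfl⟩
      obtain ⟨n, hn⟩ := hf
      obtain ⟨s, hs⟩ := exists_sub_mem (k := D.base r) (D.translateIdeal r z) fg_translateIdeal n b
      have h2 : f (b - toCompl D r z s) = 0 := hn hs
      rw [map_sub, sub_eq_zero] at h2
      exact ⟨s, h2.symm⟩
    · rintro _ ⟨s, rfl⟩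
      exact ⟨_, rfl⟩
  rw [h1]
  obtain ⟨n, hn⟩ := isNilpotent_divisor hf
  exact (hz.finiteModulo n).finite_range _ (by rw [map_pow, hn])

theorem compl_hom_ext {T : Type u} [CommRing T] [Algebra (D.base r) T]
    {f g : D.completedRing r z →ₐ[D.base r] T} (hf : IsContinuous (D.definingIdeal r z) f)
    (hg : IsContinuous (D.definingIdeal r z) g)
    (h : f.comp (toCompl D r z) = g.comp (toCompl D r z)) : f = g :=
  hom_ext_of_isContinuous fg_translateIdeal hf hg h

theorem IsParameter.exists_hat_compl [IsLocalRing R] [IsNoetherianRing R]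
    [IsAdicComplete (maximalIdeal R) R] [∀ v, IsLocalRing (G₀'.A v)]
    (hz : D.IsParameter r z) (hp : (p : R) ∈ maximalIdeal R)
    {T : Type u} [CommRing T] [Algebra (D.base r) T] [Algebra R T]
    [IsScalarTower R (D.base r) T] (hT : IsSmall R T) {f : D.completedRing r z →ₐ[D.base r] T}
    (hf : IsContinuous (D.definingIdeal r z) f) :
    ∃ M₀, ∀ M, M₀ ≤ M → ∃ a : D.level r M →ₐ[R] T, f.comp (toCompl D r z) = D.hat r M a :=
  hz.exists_hat hp hT _ (isNilpotent_divisor hf)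

end smallPoints

end PDivGroup.PushoutDiagram

/-! ### Sums of points -/

namespace PDivGroup.PushoutDiagram

open HopfGroup IsLocalRing FormalHopf AdicCompletion

section sums

variable {R : Type u} [CommRing R] [IsLocalRing R] {p : ℕ} {G₀ G G₀' : PDivGroup R p} {ι : Hom G₀ G}
  {ρ : Hom G₀ G₀'} {D : PushoutDiagram ι ρ} {r : ℕ} {z : D.coordRing'' r}

/-- `s` is the sum of `h₁` and `h₂` after any base change that makes these torsion points. -/
def IsSum {T : Type u} [CommRing T] [Algebra (D.base r) T]
    (h₁ h₂ s : D.productRing r →ₐ[D.base r] T) : Prop :=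
  ∀ (T' : Type u) [CommRing T'] [Algebra (D.base r) T'] [Algebra R T']
    [IsScalarTower R (D.base r) T'], IsSmall R T' → ∀ (π : T →ₐ[D.base r] T') (M : ℕ)
    (a b : WithConv (D.level r M →ₐ[R] T')), π.comp h₁ = D.hat r M a.ofConv →
      π.comp h₂ = D.hat r M b.ofConv → π.comp s = D.hat r M (a * b).ofConv

theorem IsSum.comp {T T' : Type u} [CommRing T] [Algebra (D.base r) T] [CommRing T']
    [Algebra (D.base r) T'] {h₁ h₂ s : D.productRing r →ₐ[D.base r] T} (h : IsSum h₁ h₂ s)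
    (φ : T →ₐ[D.base r] T') : IsSum (φ.comp h₁) (φ.comp h₂) (φ.comp s) := by
  intro T'' _ _ _ _ hT'' π M a b ha hb
  exact h T'' hT'' (π.comp φ) M a b ha hb

variable [IsNoetherianRing R] [IsAdicComplete (maximalIdeal R) R]

/-- A finite k-algebra is finite over the complete ring `R`, hence separated for powers of the
maximal ideal: its small quotients detect equality. -/
theorem hom_ext_of_small {T : Type u} [CommRing T] [Algebra (D.base r) T]
    [Module.Finite (D.base r) T] {A : Type u} [CommRing A] [Algebra (D.base r) A]
    {s s' : A →ₐ[D.base r] T}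
    (h : ∀ (T' : Type u) [CommRing T'] [Algebra (D.base r) T'] [Algebra R T']
      [IsScalarTower R (D.base r) T'], IsSmall R T' → ∀ (π : T →ₐ[D.base r] T'),
      π.comp s = π.comp s') : s = s' := by
  let _ : Algebra R T := Algebra.compHom T (algebraMap R (D.base r))
  have : IsScalarTower R (D.base r) T := IsScalarTower.of_algebraMap_eq fun _ => rfl
  have : Module.Finite R T := Module.Finite.trans (D.base r) T
  refine AlgHom.ext fun x => eq_of_forall_quotient (R := R) fun j => ?_
  exact DFunLike.congr_fun (h (T ⧸ maximalPow R T j) (isSmall_quotient R T j)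
    (Ideal.Quotient.mkₐ (D.base r) (maximalPow R T j))) x

variable [∀ v, IsLocalRing (G₀'.A v)] [NeZero (p ^ r)]

theorem IsParameter.exists_hat_pair (hz : D.IsParameter r z) (hp : (p : R) ∈ maximalIdeal R)
    {T : Type u} [CommRing T] [Algebra (D.base r) T] [Algebra R T]
    [IsScalarTower R (D.base r) T] (hT : IsSmall R T) (h₁ h₂ : D.productRing r →ₐ[D.base r] T)
    (hn₁ : IsNilpotent (h₁ (divisor D r z))) (hn₂ : IsNilpotent (h₂ (divisor D r z))) :
    ∃ (M : ℕ) (a b : WithConv (D.level r M →ₐ[R] T)), h₁ = D.hat r M a.ofConv ∧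
      h₂ = D.hat r M b.ofConv := by
  obtain ⟨M₁, h₁⟩ := hz.exists_hat hp hT h₁ hn₁
  obtain ⟨M₂, h₂⟩ := hz.exists_hat hp hT h₂ hn₂
  obtain ⟨a, ha⟩ := h₁ (max M₁ M₂) (le_max_left _ _)
  obtain ⟨b, hb⟩ := h₂ (max M₁ M₂) (le_max_right _ _)
  exact ⟨_, WithConv.toConv a, WithConv.toConv b, ha, hb⟩

variable {T : Type u} [CommRing T] [Algebra (D.base r) T]
  {h₁ h₂ s s' : D.productRing r →ₐ[D.base r] T}

theorem _root_.IsNilpotent.comp_hom {A T T' : Type u} [CommRing A] [CommRing T] [CommRing T']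
    {k : Type u} [CommRing k] [Algebra k A] [Algebra k T] [Algebra k T'] {h : A →ₐ[k] T} {x : A}
    (hx : IsNilpotent (h x)) (φ : T →ₐ[k] T') : IsNilpotent (φ.comp h x) := hx.map φ

/-- Over every small quotient both summands are points of one level, where the sum is prescribed. -/
theorem IsParameter.isSum_unique (hz : D.IsParameter r z) (hp : (p : R) ∈ maximalIdeal R)
    [Module.Finite (D.base r) T]
    (hn₁ : IsNilpotent (h₁ (divisor D r z))) (hn₂ : IsNilpotent (h₂ (divisor D r z)))
    (h : IsSum h₁ h₂ s) (h' : IsSum h₁ h₂ s') : s = s' := by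
  refine hom_ext_of_small fun T' _ _ _ _ hT' π => ?_
  obtain ⟨M, a, b, ha, hb⟩ := hz.exists_hat_pair hp hT' _ _ (hn₁.comp_hom π) (hn₂.comp_hom π)
  rw [h T' hT' π M a b ha hb, h' T' hT' π M a b ha hb]

omit [IsLocalRing R] [IsNoetherianRing R] [IsAdicComplete (maximalIdeal R) R]
  [∀ v, IsLocalRing (G₀'.A v)] [NeZero (p ^ r)] in
theorem comp_hat_mul {T T' : Type u} [CommRing T] [Algebra (D.base r) T] [Algebra R T]
    [IsScalarTower R (D.base r) T] [CommRing T'] [Algebra (D.base r) T'] [Algebra R T']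
    [IsScalarTower R (D.base r) T'] (π : T →ₐ[D.base r] T') {M N : ℕ}
    {a b : WithConv (D.level r M →ₐ[R] T)} {a' b' : WithConv (D.level r N →ₐ[R] T')}
    (ha : π.comp (D.hat r M a.ofConv) = D.hat r N a'.ofConv)
    (hb : π.comp (D.hat r M b.ofConv) = D.hat r N b'.ofConv) :
    π.comp (D.hat r M (a * b).ofConv) = D.hat r N (a' * b').ofConv := by
  have h1 : π.comp (D.hat r M (a * b).ofConv) = D.hat r M
      (postcomp (π.restrictScalars R) a * postcomp (π.restrictScalars R) b).ofConv := by
    rw [← map_mul, comp_hat]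
    rfl
  rw [comp_hat] at ha hb
  rw [h1]
  rcases le_total M N with h | h
  · exact hat_mul_unique h ha hb
  · exact (hat_mul_unique h ha.symm hb.symm).symm

/-- Modulo each power of the maximal ideal both points come from a level and can be added there;
independence of the level makes the sums compatible, and completeness of `T` provides their limit.
-/
theorem IsParameter.exists_isSum_of_finite [Algebra R T] [IsScalarTower R (D.base r) T]
    [Module.Finite R T] (hz : D.IsParameter r z) (hp : (p : R) ∈ maximalIdeal R)
    (hn₁ : IsNilpotent (h₁ (divisor D r z))) (hn₂ : IsNilpotent (h₂ (divisor D r z))) :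
    ∃ s, IsSum h₁ h₂ s := by
  have : IsAdicComplete ((maximalIdeal R).map (algebraMap R T)) T :=
    (IsAdicComplete.map_algebraMap_iff _ _).2 (isAdicComplete_of_finite (maximalIdeal R) T)
  have key := fun j => hz.exists_hat_pair hp (isSmall_quotient R T j) _ _
    (hn₁.comp_hom (Ideal.Quotient.mkₐ (D.base r) (maximalPow R T j)))
    (hn₂.comp_hom (Ideal.Quotient.mkₐ (D.base r) (maximalPow R T j)))
  choose M a b ha hb using key
  have hcompat : ∀ {i j : ℕ} (hij : i ≤ j),
      (Ideal.Quotient.factorₐ (D.base r) (Ideal.pow_le_pow_right hij)).comp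
        (D.hat r (M j) (a j * b j).ofConv) = D.hat r (M i) (a i * b i).ofConv := by
    intro i j hij
    refine comp_hat_mul _ ?_ ?_
    · rw [← ha j, ← ha i]
      rfl
    · rw [← hb j, ← hb i]
      rfl
  refine ⟨IsAdicComplete.liftAlgHom ((maximalIdeal R).map (algebraMap R T))
    (fun j => D.hat r (M j) (a j * b j).ofConv) hcompat, ?_⟩
  intro T' _ _ _ _ hT' π N a' b' ha' hb'
  obtain ⟨j, hj⟩ := hT'
  -- A map to a small algebra factors through some truncation, where the sum is the one chosen
  -- there.
  have hπ : ∀ x ∈ maximalPow R T j, π x = 0 := by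
    have h1 : maximalPow R T j ≤ RingHom.ker π := by
      rw [maximalPow, ← Ideal.map_pow]
      refine Ideal.map_le_iff_le_comap.2 fun c hc => ?_
      rw [Ideal.mem_comap, RingHom.mem_ker, IsScalarTower.algebraMap_apply R (D.base r) T,
        AlgHom.commutes, ← IsScalarTower.algebraMap_apply, hj c hc]
    exact fun x hx => h1 hx
  let π' : T ⧸ maximalPow R T j →ₐ[D.base r] T' := Ideal.Quotient.liftₐ _ π hπ
  have hπ' : π = π'.comp (Ideal.Quotient.mkₐ (D.base r) (maximalPow R T j)) := rfl
  rw [hπ', AlgHom.comp_assoc] at ha' hb' ⊢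
  rw [IsAdicComplete.mkₐ_comp_liftAlgHom]
  rw [ha] at ha'
  rw [hb] at hb'
  exact comp_hat_mul π' ha' hb'

theorem IsParameter.exists_isSum (hz : D.IsParameter r z) (hp : (p : R) ∈ maximalIdeal R)
    [Module.Finite (D.base r) T]
    (hn₁ : IsNilpotent (h₁ (divisor D r z))) (hn₂ : IsNilpotent (h₂ (divisor D r z))) :
    ∃ s, IsSum h₁ h₂ s := by
  let _ : Algebra R T := Algebra.compHom T (algebraMap R (D.base r))
  have : IsScalarTower R (D.base r) T := IsScalarTower.of_algebraMap_eq fun _ => rfl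
  have : Module.Finite R T := Module.Finite.trans (D.base r) T
  exact hz.exists_isSum_of_finite hp hn₁ hn₂

omit [IsLocalRing R] [IsNoetherianRing R] [IsAdicComplete (maximalIdeal R) R]
  [∀ v, IsLocalRing (G₀'.A v)] in
-- In a domain a nilpotent product of translates has a vanishing factor, and each translate
-- generates the kernel of an evaluation. So the only domain-valued points are the multiples of u.
theorem IsParameter.exists_evalAt [IsDomain T] (hz : D.IsParameter r z)
    (hn : IsNilpotent (s (divisor D r z))) : ∃ α, s = (Algebra.ofId (D.base r) T).comp (D.evalAt r α) := by
  have h1 := hn.eq_zero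
  rw [divisor, map_prod, Finset.prod_eq_zero_iff] at h1
  obtain ⟨α, -, hα⟩ := h1
  refine ⟨α, AlgHom.ext fun x => ?_⟩
  have h2 : D.evalAt r α (x - algebraMap _ _ (D.evalAt r α x)) = 0 := by
    rw [map_sub, AlgHom.commutes]
    exact sub_self _
  obtain ⟨y, hy⟩ := (hz.evalAt_eq_zero_iff α _).1 h2
  have h3 := congrArg s hy
  rw [map_mul, hα, zero_mul, map_sub, AlgHom.commutes, sub_eq_zero] at h3
  exact h3

omit [IsNoetherianRing R] [IsAdicComplete (maximalIdeal R) R] [∀ v, IsLocalRing (G₀'.A v)] in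
theorem isSum_evalAt (T : Type u) [CommRing T] [Algebra (D.base r) T] (α β : ZMod (p ^ r)) :
    IsSum ((Algebra.ofId (D.base r) T).comp (D.evalAt r α))
      ((Algebra.ofId (D.base r) T).comp (D.evalAt r β))
      ((Algebra.ofId (D.base r) T).comp (D.evalAt r (α + β))) := by
  intro T' _ _ _ _ hT' π M a b ha hb
  have h1 : ∀ α, π.comp ((Algebra.ofId (D.base r) T).comp (D.evalAt r α)) =
      D.hat r M (D.charPoint r T' α M).ofConv := fun α => by
    rw [← ofId_comp_evalAt, ← AlgHom.comp_assoc]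
    congr 1
    exact Subsingleton.elim _ _
  rw [h1] at ha hb ⊢
  rw [charPoint_add, WithConv.ofConv_injective (hat_injective ha),
    WithConv.ofConv_injective (hat_injective hb)]

/-- Modulo each prime the two points are α u and β u, so the sum is (α + β) u by uniqueness, and the
divisor vanishes there. -/
theorem IsParameter.isNilpotent_isSum (hz : D.IsParameter r z) (hp : (p : R) ∈ maximalIdeal R)
    [Module.Finite (D.base r) T]
    (hn₁ : IsNilpotent (h₁ (divisor D r z))) (hn₂ : IsNilpotent (h₂ (divisor D r z)))
    (h : IsSum h₁ h₂ s) : IsNilpotent (s (divisor D r z)) := by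
  rw [nilpotent_iff_mem_prime]
  intro Q hQ
  let ψ := Ideal.Quotient.mkₐ (D.base r) Q
  have hψ₁ := hn₁.comp_hom ψ
  have hψ₂ := hn₂.comp_hom ψ
  obtain ⟨α, hα⟩ := hz.exists_evalAt hψ₁
  obtain ⟨β, hβ⟩ := hz.exists_evalAt hψ₂
  have h1 := h.comp ψ
  have h2 := isSum_evalAt (D := D) (r := r) (T ⧸ Q) α β
  rw [← hα, ← hβ] at h2
  have h3 := hz.isSum_unique hp hψ₁ hψ₂ h1 h2
  have h4 := DFunLike.congr_fun h3 (divisor D r z)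
  rw [AlgHom.comp_apply, AlgHom.comp_apply, hz.evalAt_divisor, _root_.map_zero] at h4
  exact Ideal.Quotient.eq_zero_iff_mem.1 h4

end sums

end PDivGroup.PushoutDiagram

/-! ### The comultiplication -/

namespace FormalHopf

section tensorQuotient

variable {k B : Type u} [CommRing k] [CommRing B] [Algebra k B] (I : Ideal B)

/-- The first inclusion `B → (B ⊗ B) / (I ⊗ B + B ⊗ I) ^ n`. -/
def inl (n : ℕ) : B →ₐ[k] (B ⊗[k] B) ⧸ tensorIdeal k I ^ n :=
  (Ideal.Quotient.mkₐ k (tensorIdeal k I ^ n)).comp Algebra.TensorProduct.includeLeft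

/-- The second inclusion `B → (B ⊗ B) / (I ⊗ B + B ⊗ I) ^ n`. -/
def inr (n : ℕ) : B →ₐ[k] (B ⊗[k] B) ⧸ tensorIdeal k I ^ n :=
  (Ideal.Quotient.mkₐ k (tensorIdeal k I ^ n)).comp Algebra.TensorProduct.includeRight

theorem isContinuous_inl (n : ℕ) : IsContinuous I (inl (k := k) I n) := by
  refine ⟨n, fun b hb => Ideal.Quotient.eq_zero_iff_mem.2 ?_⟩
  refine Ideal.pow_right_mono (le_sup_left : _ ≤ tensorIdeal k I) n ?_
  rw [← Ideal.map_pow]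
  exact Ideal.mem_map_of_mem _ hb

theorem isContinuous_inr (n : ℕ) : IsContinuous I (inr (k := k) I n) := by
  refine ⟨n, fun b hb => Ideal.Quotient.eq_zero_iff_mem.2 ?_⟩
  refine Ideal.pow_right_mono (le_sup_right : _ ≤ tensorIdeal k I) n ?_
  rw [← Ideal.map_pow]
  exact Ideal.mem_map_of_mem _ hb

theorem tensorLift_inl_inr (n : ℕ) :
    tensorLift (inl (k := k) I n) (inr I n) = Ideal.Quotient.mkₐ k (tensorIdeal k I ^ n) := by
  ext <;> simp [tensorLift, inl, inr]

theorem finite_tensorQuotient (n : ℕ) (h₁ : Module.Finite k (inl (k := k) I n).range)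
    (h₂ : Module.Finite k (inr (k := k) I n).range) :
    Module.Finite k ((B ⊗[k] B) ⧸ tensorIdeal k I ^ n) := by
  have h := Subalgebra.finite_sup (inl (k := k) I n).range (inr (k := k) I n).range
  have htop : (inl (k := k) I n).range ⊔ (inr (k := k) I n).range = ⊤ := by
    rw [eq_top_iff]
    rintro x -
    obtain ⟨x, rfl⟩ := Ideal.Quotient.mk_surjective x
    induction x with
    | zero => rw [map_zero]; exact Subalgebra.zero_mem _
    | add x y hx hy => rw [map_add]; exact Subalgebra.add_mem _ hx hy
    | tmul a b =>
      have h1 : a ⊗ₜ[k] b = (a ⊗ₜ 1) * (1 ⊗ₜ b) := by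
        rw [Algebra.TensorProduct.tmul_mul_tmul, mul_one, one_mul]
      rw [h1, map_mul]
      exact Subalgebra.mul_mem _ (le_sup_left (a := (inl (k := k) I n).range) ⟨a, rfl⟩)
        (le_sup_right (b := (inr (k := k) I n).range) ⟨b, rfl⟩)
  rw [htop] at h
  exact Module.Finite.equiv (Subalgebra.topEquiv (R := k)).toLinearEquiv

theorem factor_comp_inl {m n : ℕ} (hle : m ≤ n) :
    (Ideal.Quotient.factorₐ k (Ideal.pow_le_pow_right hle)).comp (inl (k := k) I n) = inl I m := rfl

theorem factor_comp_inr {m n : ℕ} (hle : m ≤ n) :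
    (Ideal.Quotient.factorₐ k (Ideal.pow_le_pow_right hle)).comp (inr (k := k) I n) = inr I m := rfl

theorem exists_lift (Δ' : ∀ n, B →ₐ[k] (B ⊗[k] B) ⧸ tensorIdeal k I ^ n)
    (h : ∀ {m n : ℕ} (hle : m ≤ n),
      (Ideal.Quotient.factorₐ k (Ideal.pow_le_pow_right hle)).comp (Δ' n) = Δ' m) :
    ∃ Δ : B →ₐ[k] CompletedTensor k I, ∀ n,
      ((AdicCompletion.evalₐ (tensorIdeal k I) n).restrictScalars k).comp Δ = Δ' n :=
  ⟨AdicCompletion.liftAlgHom _ Δ' h, fun n => AlgHom.ext fun x =>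
    AdicCompletion.evalₐ_liftAlgHom _ Δ' h n x⟩

end tensorQuotient

end FormalHopf

namespace PDivGroup.PushoutDiagram

open HopfGroup IsLocalRing FormalHopf AdicCompletion

section comul

variable {R : Type u} [CommRing R] [IsLocalRing R] {p : ℕ} {G₀ G G₀' : PDivGroup R p} {ι : Hom G₀ G}
  {ρ : Hom G₀ G₀'} {D : PushoutDiagram ι ρ} {r : ℕ} {z : D.coordRing'' r}
  [NeZero (p ^ r)]

/-- The comultiplication `Δ` is the sum of the two inclusions. -/
def IsComul (Δ : D.completedRing r z →ₐ[D.base r] CompletedTensor (D.base r) (D.definingIdeal r z)) :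
    Prop :=
  ∀ n, IsSum ((inl (D.definingIdeal r z) n).comp (toCompl D r z))
    ((inr (D.definingIdeal r z) n).comp (toCompl D r z))
    ((((evalₐ (tensorIdeal (D.base r) (D.definingIdeal r z)) n).restrictScalars (D.base r)).comp
      Δ).comp (toCompl D r z))

/-- Any pair of continuous points is the image of the pair of inclusions under the map induced by
their tensor product, and sums are preserved by such maps. -/
theorem IsComul.isSum_conv {Δ : D.completedRing r z →ₐ[D.base r]
      CompletedTensor (D.base r) (D.definingIdeal r z)} (hΔ : IsComul Δ)
    {T : Type u} [CommRing T] [Algebra (D.base r) T] {f g : D.completedRing r z →ₐ[D.base r] T}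
    (hf : IsContinuous (D.definingIdeal r z) f) (hg : IsContinuous (D.definingIdeal r z) g) :
    IsSum (f.comp (toCompl D r z)) (g.comp (toCompl D r z))
      ((conv Δ f g).comp (toCompl D r z)) := by
  obtain ⟨n, hn⟩ := exists_pow_le_ker hf hg
  rw [conv_eq Δ f g n hn]
  have h := (hΔ n).comp (Ideal.Quotient.liftₐ (tensorIdeal (D.base r) (D.definingIdeal r z) ^ n)
    (tensorLift f g) fun _ ha => hn ha)
  have h1 : ∀ x, tensorLift f g (x ⊗ₜ 1) = f x := fun x => by simp [tensorLift]
  have h2 : ∀ x, tensorLift f g (1 ⊗ₜ x) = g x := fun x => by simp [tensorLift]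
  convert h using 1
  · exact AlgHom.ext fun x => (h1 _).symm
  · exact AlgHom.ext fun x => (h2 _).symm
  · rfl

variable [IsNoetherianRing R] [IsAdicComplete (maximalIdeal R) R] [∀ v, IsLocalRing (G₀'.A v)]

omit [IsLocalRing R] [IsNoetherianRing R] [IsAdicComplete (maximalIdeal R) R]
  [∀ (v : ℕ), IsLocalRing (G₀'.A v)] in
theorem IsParameter.finite_tensorQuotient (hz : D.IsParameter r z) (n : ℕ) :
    Module.Finite (D.base r) ((D.completedRing r z ⊗[D.base r] D.completedRing r z) ⧸
      tensorIdeal (D.base r) (D.definingIdeal r z) ^ n) :=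
  FormalHopf.finite_tensorQuotient _ n (hz.finite_range (isContinuous_inl _ n))
    (hz.finite_range (isContinuous_inr _ n))

/-- Each truncated tensor square is finite over k, so its two inclusions have a sum; nilpotence of
the divisor extends that sum continuously to the completion, and uniqueness of sums makes the
truncations compatible. -/
theorem IsParameter.exists_comul (hz : D.IsParameter r z) (hp : (p : R) ∈ maximalIdeal R) :
    ∃ Δ : D.completedRing r z →ₐ[D.base r] CompletedTensor (D.base r) (D.definingIdeal r z),
      IsComul Δ ∧ ∀ n : ℕ, ∃ m : ℕ, ∀ b ∈ D.definingIdeal r z ^ m,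
        evalₐ (tensorIdeal (D.base r) (D.definingIdeal r z)) n (Δ b) = 0 := by
  have hfin := hz.finite_tensorQuotient
  have hl := fun n => isNilpotent_divisor (isContinuous_inl (k := D.base r) (D.definingIdeal r z) n)
  have hr := fun n => isNilpotent_divisor (isContinuous_inr (k := D.base r) (D.definingIdeal r z) n)
  have h1 : ∀ n, ∃ Δ : D.completedRing r z →ₐ[D.base r]
      (D.completedRing r z ⊗[D.base r] D.completedRing r z) ⧸
        tensorIdeal (D.base r) (D.definingIdeal r z) ^ n,
      IsContinuous (D.definingIdeal r z) Δ ∧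
      IsSum ((inl (D.definingIdeal r z) n).comp (toCompl D r z))
        ((inr (D.definingIdeal r z) n).comp (toCompl D r z)) (Δ.comp (toCompl D r z)) := by
    intro n
    have := hfin n
    obtain ⟨s, hs⟩ := hz.exists_isSum hp (hl n) (hr n)
    obtain ⟨N, hN⟩ := hz.isNilpotent_isSum hp (hl n) (hr n) hs
    have hker := (translateIdeal_pow_le_ker_iff s N).2 hN
    refine ⟨extend (D.translateIdeal r z) s N hker,
      isContinuous_extend _ fg_translateIdeal _ _ _, ?_⟩
    rw [extend_comp]
    exact hs
  choose Δ' hcont hsum using h1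
  have hcompat : ∀ {m n : ℕ} (hle : m ≤ n),
      (Ideal.Quotient.factorₐ (D.base r) (Ideal.pow_le_pow_right hle)).comp (Δ' n) = Δ' m := by
    intro m n hle
    refine compl_hom_ext ((hcont n).comp _) (hcont m) ?_
    have h2 := (hsum n).comp (Ideal.Quotient.factorₐ (D.base r) (Ideal.pow_le_pow_right hle))
    rw [← AlgHom.comp_assoc, ← AlgHom.comp_assoc, ← AlgHom.comp_assoc, factor_comp_inl _ hle,
      factor_comp_inr _ hle] at h2
    have := hfin m
    exact hz.isSum_unique hp (hl m) (hr m) h2 (hsum m)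
  obtain ⟨Δ, hΔ⟩ := exists_lift (D.definingIdeal r z) Δ' hcompat
  refine ⟨Δ, fun n => ?_, fun n => ?_⟩
  · rw [hΔ]
    exact hsum n
  · obtain ⟨m, hm⟩ := hcont n
    exact ⟨m, fun b hb => (DFunLike.congr_fun (hΔ n) b).trans (hm hb)⟩

end comul

end PDivGroup.PushoutDiagram

/-! ### The group law -/

namespace PDivGroup.PushoutDiagram

open HopfGroup IsLocalRing FormalHopf AdicCompletion

section inversion

variable {R : Type u} [CommRing R] {p : ℕ} {G₀ G G₀' : PDivGroup R p} {ι : Hom G₀ G}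
  {ρ : Hom G₀ G₀'} (D : PushoutDiagram ι ρ) (r : ℕ)

/-- Inversion on `O_{G''} ⊗̂ k`. -/
def inversion : D.productRing r →ₐ[D.base r] D.productRing r :=
  D.ofLevels r (fun n => (Algebra.TensorProduct.includeRight :
      D.level r n →ₐ[R] D.base r ⊗[R] D.level r n).comp
        (invHom R (D.level r n) : D.level r n →ₐ[R] D.level r n)) fun n x => by
    rw [AlgHom.comp_apply, AlgHom.comp_apply, Algebra.TensorProduct.includeRight_apply,
      Algebra.TensorProduct.includeRight_apply, Algebra.TensorProduct.map_tmul, AlgHom.id_apply]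
    exact congrArg _ (invHom_natural (D.levelTrans r n) x)

theorem hat_comp_inversion {T : Type u} [CommRing T] [Algebra (D.base r) T] [Algebra R T]
    [IsScalarTower R (D.base r) T] (n : ℕ) (b : D.level r n →ₐ[R] T) :
    (D.hat r n b).comp (D.inversion r) =
      D.hat r n (b.comp (invHom R (D.level r n) : D.level r n →ₐ[R] D.level r n)) := by
  rw [inversion, hat_comp_ofLevels, ← AlgHom.comp_assoc]
  congr 2
  refine AlgHom.ext fun x => ?_
  change (Algebra.TensorProduct.lift (Algebra.ofId (D.base r) T) b (fun _ _ => Commute.all _ _))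
    (1 ⊗ₜ x) = b x
  rw [Algebra.TensorProduct.lift_tmul, map_one, one_mul]

variable [NeZero (p ^ r)]

theorem evalAt_comp_inversion (α : ZMod (p ^ r)) :
    (D.evalAt r α).comp (D.inversion r) = D.evalAt r (-α) := by
  rw [evalAt, hat_comp_inversion, evalAt]
  congr 1
  have h1 := mul_comp_invHom (D.charPoint r (D.base r) α 0).ofConv
  have h2 := D.charPoint_add r (D.base r) (-α) α 0
  rw [neg_add_cancel, charPoint_zero] at h2
  exact congrArg WithConv.ofConv (left_inv_eq_right_inv h2.symm h1).symm

variable {D r} {z : D.coordRing'' r}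

/-- The multiples of u are stable under negation, so modulo every prime containing the divisor its
inverse image vanishes too. This is all that is needed to extend inversion to the completion. -/
theorem IsParameter.exists_inversion_pow (hz : D.IsParameter r z) :
    ∃ N, D.inversion r (divisor D r z) ^ N ∈ D.translateIdeal r z := by
  let h := Ideal.Quotient.mkₐ (D.base r) (D.translateIdeal r z)
  have hn : IsNilpotent (h (D.inversion r (divisor D r z))) := by
    rw [nilpotent_iff_mem_prime]
    intro Q hQ
    let ψ := (Ideal.Quotient.mkₐ (D.base r) Q).comp h
    have h1 : ψ (divisor D r z) = 0 := by
      have h2 : h (divisor D r z) = 0 :=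
        Ideal.Quotient.eq_zero_iff_mem.2 (Ideal.mem_span_singleton_self _)
      rw [AlgHom.comp_apply, h2, _root_.map_zero]
    obtain ⟨α, hα⟩ := hz.exists_evalAt (s := ψ) (h1 ▸ IsNilpotent.zero)
    have h2 : ψ (D.inversion r (divisor D r z)) = 0 := by
      rw [hα, AlgHom.comp_apply]
      have h3 := DFunLike.congr_fun (D.evalAt_comp_inversion r α) (divisor D r z)
      rw [hz.evalAt_divisor] at h3
      exact (congrArg _ h3).trans (_root_.map_zero _)
    exact Ideal.Quotient.eq_zero_iff_mem.1 h2
  obtain ⟨N, hN⟩ := hn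
  refine ⟨N, Ideal.Quotient.eq_zero_iff_mem.1 ?_⟩
  rw [← map_pow] at hN
  exact hN

theorem IsParameter.exists_inversion (hz : D.IsParameter r z) :
    ∃ S : D.completedRing r z →ₐ[D.base r] D.completedRing r z,
      (∀ n : ℕ, ∃ m : ℕ, D.definingIdeal r z ^ m ≤ (D.definingIdeal r z ^ n).comap S) ∧
      S.comp (toCompl D r z) = (toCompl D r z).comp (D.inversion r) := by
  obtain ⟨N, hN⟩ := hz.exists_inversion_pow
  have hker : ∀ n, D.translateIdeal r z ^ (N * n) ≤ RingHom.ker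
      ((Ideal.Quotient.mkₐ (D.base r) (D.translateIdeal r z ^ n)).comp (D.inversion r)) := by
    intro n
    rw [translateIdeal_pow_le_ker_iff, ← map_pow, AlgHom.comp_apply]
    refine Ideal.Quotient.eq_zero_iff_mem.2 ?_
    rw [map_pow, pow_mul]
    exact Ideal.pow_mem_pow hN n
  let S' := fun n => extend (D.translateIdeal r z) _ (N * n) (hker n)
  have hcont : ∀ n, IsContinuous (D.definingIdeal r z) (S' n) := fun n =>
    isContinuous_extend _ fg_translateIdeal _ _ _
  have hcompat : ∀ {m n : ℕ} (hle : m ≤ n),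
      (Ideal.Quotient.factorₐ (D.base r) (Ideal.pow_le_pow_right hle)).comp (S' n) = S' m := by
    intro m n hle
    refine compl_hom_ext ((hcont n).comp _) (hcont m) ?_
    rw [AlgHom.comp_assoc, extend_comp, extend_comp]
    rfl
  refine ⟨liftAlgHom _ S' hcompat, fun n => ?_, AlgHom.ext fun x => ext_evalₐ fun n => ?_⟩
  · obtain ⟨m, hm⟩ := hcont n
    refine ⟨m, fun b hb => ?_⟩
    refine (mem_extendedIdeal_pow _ fg_translateIdeal n _).2 ?_
    exact (evalₐ_liftAlgHom _ S' hcompat n b).trans (hm hb)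
  · refine (evalₐ_liftAlgHom _ S' hcompat n _).trans ?_
    refine (extend_toCompletion _ _ _ _ x).trans ?_
    exact (evalₐ_toCompletion (k := D.base r) _ n _).symm

end inversion

/-! ### Associativity and commutativity, tested on small algebras. -/

section identities

variable {R : Type u} [CommRing R] [IsLocalRing R] {p : ℕ} {G₀ G G₀' : PDivGroup R p} {ι : Hom G₀ G}
  {ρ : Hom G₀ G₀'} {D : PushoutDiagram ι ρ} {r : ℕ} {z : D.coordRing'' r}
  [NeZero (p ^ r)]

section reduction

variable {T : Type u} [CommRing T] [Algebra (D.base r) T]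
  {f g h : D.completedRing r z →ₐ[D.base r] T}

omit [IsLocalRing R] in
-- Identities in arbitrary k-algebras are thereby reduced to finite ones, where small quotients
-- detect equality. The subalgebra is the join of the three images.
theorem IsParameter.exists_finite_factor (hz : D.IsParameter r z)
    (hf : IsContinuous (D.definingIdeal r z) f) (hg : IsContinuous (D.definingIdeal r z) g)
    (hh : IsContinuous (D.definingIdeal r z) h) :
    ∃ T₀ : Subalgebra (D.base r) T, Module.Finite (D.base r) T₀ ∧
      ∃ f₀ g₀ h₀ : D.completedRing r z →ₐ[D.base r] T₀,
        IsContinuous (D.definingIdeal r z) f₀ ∧ IsContinuous (D.definingIdeal r z) g₀ ∧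
        IsContinuous (D.definingIdeal r z) h₀ ∧ T₀.val.comp f₀ = f ∧ T₀.val.comp g₀ = g ∧
        T₀.val.comp h₀ = h := by
  have := hz.finite_range hf
  have := hz.finite_range hg
  have := hz.finite_range hh
  have := Subalgebra.finite_sup f.range g.range
  refine ⟨f.range ⊔ g.range ⊔ h.range, Subalgebra.finite_sup _ _, ?_⟩
  have key : ∀ {f : D.completedRing r z →ₐ[D.base r] T} (T₀ : Subalgebra (D.base r) T),
      IsContinuous (D.definingIdeal r z) f → f.range ≤ T₀ →
      ∃ f₀ : D.completedRing r z →ₐ[D.base r] T₀, IsContinuous (D.definingIdeal r z) f₀ ∧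
        T₀.val.comp f₀ = f := fun {f} T₀ hf hle => by
    have h1 : T₀.val.comp (f.codRestrict T₀ fun x => hle ⟨x, rfl⟩) = f := rfl
    exact ⟨_, IsContinuous.of_comp Subtype.val_injective (h1.symm ▸ hf), h1⟩
  obtain ⟨f₀, hf₀, hf'⟩ := key (f.range ⊔ g.range ⊔ h.range) hf (le_sup_left.trans le_sup_left)
  obtain ⟨g₀, hg₀, hg'⟩ := key (f.range ⊔ g.range ⊔ h.range) hg (le_sup_right.trans le_sup_left)
  obtain ⟨h₀, hh₀, hh'⟩ := key (f.range ⊔ g.range ⊔ h.range) hh le_sup_right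
  exact ⟨f₀, g₀, h₀, hf₀, hg₀, hh₀, hf', hg', hh'⟩

end reduction

variable {Δ : D.completedRing r z →ₐ[D.base r] CompletedTensor (D.base r) (D.definingIdeal r z)}

theorem IsComul.conv_hat {T : Type u} [CommRing T] [Algebra (D.base r) T] [Algebra R T]
    [IsScalarTower R (D.base r) T] (hT : IsSmall R T) (hΔ : IsComul Δ)
    {f g : D.completedRing r z →ₐ[D.base r] T} (hf : IsContinuous (D.definingIdeal r z) f)
    (hg : IsContinuous (D.definingIdeal r z) g) {M : ℕ} {a b : WithConv (D.level r M →ₐ[R] T)}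
    (ha : f.comp (toCompl D r z) = D.hat r M a.ofConv)
    (hb : g.comp (toCompl D r z) = D.hat r M b.ofConv) :
    (conv Δ f g).comp (toCompl D r z) = D.hat r M (a * b).ofConv := by
  have h := hΔ.isSum_conv hf hg T hT (AlgHom.id _ _) M a b
  rw [AlgHom.id_comp, AlgHom.id_comp, AlgHom.id_comp] at h
  exact h ha hb

variable (hΔ : IsComul Δ) (hcont : ∀ n : ℕ, ∃ m : ℕ, ∀ b ∈ D.definingIdeal r z ^ m,
        evalₐ (tensorIdeal (D.base r) (D.definingIdeal r z)) n (Δ b) = 0)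
  [IsNoetherianRing R] [IsAdicComplete (maximalIdeal R) R] [∀ v, IsLocalRing (G₀'.A v)]
  (hz : D.IsParameter r z) (hp : (p : R) ∈ maximalIdeal R)
  {T : Type u} [CommRing T] [Algebra (D.base r) T]
  {f g h : D.completedRing r z →ₐ[D.base r] T}
  (hf : IsContinuous (D.definingIdeal r z) f) (hg : IsContinuous (D.definingIdeal r z) g)
  (hh : IsContinuous (D.definingIdeal r z) h)

include hz hp hf hg hh in
theorem IsParameter.exists_hat_triple [Algebra R T] [IsScalarTower R (D.base r) T]
    (hT : IsSmall R T) :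
    ∃ (M : ℕ) (a b c : WithConv (D.level r M →ₐ[R] T)),
      f.comp (toCompl D r z) = D.hat r M a.ofConv ∧ g.comp (toCompl D r z) = D.hat r M b.ofConv ∧
      h.comp (toCompl D r z) = D.hat r M c.ofConv := by
  obtain ⟨M₁, h₁⟩ := hz.exists_hat_compl hp hT hf
  obtain ⟨M₂, h₂⟩ := hz.exists_hat_compl hp hT hg
  obtain ⟨M₃, h₃⟩ := hz.exists_hat_compl hp hT hh
  obtain ⟨a, ha⟩ := h₁ (max (max M₁ M₂) M₃) (le_trans (le_max_left _ _) (le_max_left _ _))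
  obtain ⟨b, hb⟩ := h₂ (max (max M₁ M₂) M₃) (le_trans (le_max_right _ _) (le_max_left _ _))
  obtain ⟨c, hc⟩ := h₃ (max (max M₁ M₂) M₃) (le_max_right _ _)
  exact ⟨_, WithConv.toConv a, WithConv.toConv b, WithConv.toConv c, ha, hb, hc⟩

include hΔ hcont hz hp hf hg hh in
theorem IsComul.conv_assoc_of_small [Algebra R T] [IsScalarTower R (D.base r) T]
    (hT : IsSmall R T) : conv Δ (conv Δ f g) h = conv Δ f (conv Δ g h) := by
  obtain ⟨M, a, b, c, ha, hb, hc⟩ := hz.exists_hat_triple hp hf hg hh hT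
  refine compl_hom_ext (isContinuous_conv hcont (isContinuous_conv hcont hf hg) hh)
    (isContinuous_conv hcont hf (isContinuous_conv hcont hg hh)) ?_
  rw [hΔ.conv_hat hT (isContinuous_conv hcont hf hg) hh (hΔ.conv_hat hT hf hg ha hb) hc,
    hΔ.conv_hat hT hf (isContinuous_conv hcont hg hh) ha (hΔ.conv_hat hT hg hh hb hc), mul_assoc]

include hΔ hcont hz hp hf hg in
theorem IsComul.conv_comm_of_small [Algebra R T] [IsScalarTower R (D.base r) T]
    (hT : IsSmall R T) : conv Δ f g = conv Δ g f := by
  obtain ⟨M, a, b, -, ha, hb, -⟩ := hz.exists_hat_triple hp hf hg hg hT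
  refine compl_hom_ext (isContinuous_conv hcont hf hg) (isContinuous_conv hcont hg hf) ?_
  rw [hΔ.conv_hat hT hf hg ha hb, hΔ.conv_hat hT hg hf hb ha, mul_comm]

include hΔ hcont hz hp hf hg hh in
theorem IsComul.conv_assoc : conv Δ (conv Δ f g) h = conv Δ f (conv Δ g h) := by
  obtain ⟨T₀, _, f₀, g₀, h₀, hf₀, hg₀, hh₀, rfl, rfl, rfl⟩ := hz.exists_finite_factor hf hg hh
  rw [← comp_conv Δ hf₀ hg₀, ← comp_conv Δ (isContinuous_conv hcont hf₀ hg₀) hh₀,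
    ← comp_conv Δ hg₀ hh₀, ← comp_conv Δ hf₀ (isContinuous_conv hcont hg₀ hh₀)]
  congr 1
  refine hom_ext_of_small fun T' _ _ _ _ hT' π => ?_
  rw [comp_conv Δ (isContinuous_conv hcont hf₀ hg₀) hh₀, comp_conv Δ hf₀ hg₀,
    comp_conv Δ hf₀ (isContinuous_conv hcont hg₀ hh₀), comp_conv Δ hg₀ hh₀]
  exact hΔ.conv_assoc_of_small hcont hz hp (hf₀.comp π) (hg₀.comp π) (hh₀.comp π) hT'

include hΔ hcont hz hp hf hg in
theorem IsComul.conv_comm : conv Δ f g = conv Δ g f := by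
  obtain ⟨T₀, _, f₀, g₀, -, hf₀, hg₀, -, rfl, rfl, -⟩ := hz.exists_finite_factor hf hg hg
  rw [← comp_conv Δ hf₀ hg₀, ← comp_conv Δ hg₀ hf₀]
  congr 1
  refine hom_ext_of_small fun T' _ _ _ _ hT' π => ?_
  rw [comp_conv Δ hf₀ hg₀, comp_conv Δ hg₀ hf₀]
  exact hΔ.conv_comm_of_small hcont hz hp (hf₀.comp π) (hg₀.comp π) hT'

end identities

end PDivGroup.PushoutDiagram

/-! ### Evaluation at the characters, and the remaining identities -/

namespace PDivGroup.PushoutDiagram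

open HopfGroup IsLocalRing FormalHopf AdicCompletion

variable {R : Type u} [CommRing R] {p : ℕ} {G₀ G G₀' : PDivGroup R p} {ι : Hom G₀ G}
  {ρ : Hom G₀ G₀'} {D : PushoutDiagram ι ρ} {r : ℕ} {z : D.coordRing'' r}
  [NeZero (p ^ r)]

section theta

theorem IsParameter.translateIdeal_le_ker_evalAt (hz : D.IsParameter r z) (α : ZMod (p ^ r)) :
    D.translateIdeal r z ^ 1 ≤ RingHom.ker (D.evalAt r α) := by
  rw [translateIdeal_pow_le_ker_iff, hz.evalAt_divisor, pow_one]

/-- Evaluation at `α` times the tautological point, on the completion. -/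
def IsParameter.theta (hz : D.IsParameter r z) (α : ZMod (p ^ r)) :
    D.completedRing r z →ₐ[D.base r] D.base r :=
  extend (D.translateIdeal r z) (D.evalAt r α) 1 (hz.translateIdeal_le_ker_evalAt α)

theorem IsParameter.theta_comp (hz : D.IsParameter r z) (α : ZMod (p ^ r)) :
    (hz.theta α).comp (toCompl D r z) = D.evalAt r α := extend_comp _ _ _ _

theorem IsParameter.theta_toCompl (hz : D.IsParameter r z) (α : ZMod (p ^ r))
    (x : D.productRing r) : hz.theta α (toCompl D r z x) = D.evalAt r α x :=
  DFunLike.congr_fun (hz.theta_comp α) x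

theorem IsParameter.isContinuous_theta (hz : D.IsParameter r z) (α : ZMod (p ^ r)) :
    IsContinuous (D.definingIdeal r z) (hz.theta α) :=
  isContinuous_extend _ fg_translateIdeal _ _ _

theorem IsParameter.ofId_comp_theta_comp (hz : D.IsParameter r z) {T : Type u} [CommRing T]
    [Algebra (D.base r) T] [Algebra R T] [IsScalarTower R (D.base r) T] (α : ZMod (p ^ r)) (n : ℕ) :
    ((Algebra.ofId (D.base r) T).comp (hz.theta α)).comp (toCompl D r z) =
      D.hat r n (D.charPoint r T α n).ofConv := by
  rw [AlgHom.comp_assoc, theta_comp, ofId_comp_evalAt]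

theorem comp_ofId {k B T T' : Type u} [CommRing k] [CommRing B] [Algebra k B] [CommRing T]
    [Algebra k T] [CommRing T'] [Algebra k T'] (φ : T →ₐ[k] T') (θ : B →ₐ[k] k) :
    φ.comp ((Algebra.ofId k T).comp θ) = (Algebra.ofId k T').comp θ :=
  AlgHom.ext fun x => φ.commutes (θ x)

omit [NeZero (p ^ r)] in
-- O_{G''} surjects onto each level, so the point of the level takes its values wherever the point
-- of the completed product does.
theorem exists_factor_hat {T : Type u} [CommRing T] [Algebra (D.base r) T] [Algebra R T]
    [IsScalarTower R (D.base r) T] (T₀ : Subalgebra (D.base r) T)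
    {h₀ : D.productRing r →ₐ[D.base r] T₀} {n : ℕ} {f : D.level r n →ₐ[R] T}
    (hf : T₀.val.comp h₀ = D.hat r n f) :
    ∃ f₀ : D.level r n →ₐ[R] T₀, (T₀.val.restrictScalars R).comp f₀ = f ∧ h₀ = D.hat r n f₀ := by
  have h1 : ∀ y, f y ∈ T₀.restrictScalars R := fun y => by
    obtain ⟨x, rfl⟩ := D.ev_surjective r n y
    rw [← hat_toProductRing, ← hf]
    exact (h₀ _).2
  let f₀ : D.level r n →ₐ[R] T₀ := f.codRestrict (T₀.restrictScalars R) h1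
  have h2 : (T₀.val.restrictScalars R).comp f₀ = f := rfl
  refine ⟨f₀, h2, AlgHom.ext fun x => Subtype.ext ?_⟩
  have h3 := DFunLike.congr_fun (hf.trans ((comp_hat D r T₀.val n f₀).trans
    (congrArg _ h2)).symm) x
  exact h3

end theta

section identities

variable [IsLocalRing R] [IsNoetherianRing R] [IsAdicComplete (maximalIdeal R) R]
  {Δ : D.completedRing r z →ₐ[D.base r] CompletedTensor (D.base r) (D.definingIdeal r z)}
  (hΔ : IsComul Δ)

include hΔ in
theorem IsComul.conv_level_of_finite {T : Type u} [CommRing T] [Algebra (D.base r) T] [Algebra R T]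
    [IsScalarTower R (D.base r) T] [Module.Finite (D.base r) T]
    {f' g' : D.completedRing r z →ₐ[D.base r] T} (hf : IsContinuous (D.definingIdeal r z) f')
    (hg : IsContinuous (D.definingIdeal r z) g') {n : ℕ} {a b : WithConv (D.level r n →ₐ[R] T)}
    (ha : f'.comp (toCompl D r z) = D.hat r n a.ofConv)
    (hb : g'.comp (toCompl D r z) = D.hat r n b.ofConv) :
    (conv Δ f' g').comp (toCompl D r z) = D.hat r n (a * b).ofConv := by
  refine hom_ext_of_small fun T' _ _ _ _ hT' π => ?_
  have h1 := comp_hat D r π n a.ofConv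
  have h2 := comp_hat D r π n b.ofConv
  refine (hΔ.isSum_conv hf hg T' hT' π n (WithConv.toConv _) (WithConv.toConv _)
    ((congrArg _ ha).trans h1) ((congrArg _ hb).trans h2)).trans ?_
  exact (comp_hat_mul π h1 h2).symm

include hΔ in
theorem IsComul.conv_level (hz : D.IsParameter r z) {T : Type u} [CommRing T] [Algebra (D.base r) T]
    [Algebra R T] [IsScalarTower R (D.base r) T]
    {f' g' : D.completedRing r z →ₐ[D.base r] T} (hf : IsContinuous (D.definingIdeal r z) f')
    (hg : IsContinuous (D.definingIdeal r z) g') {n : ℕ} {f g : D.level r n →ₐ[R] T}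
    (ha : f'.comp (toCompl D r z) = D.hat r n f)
    (hb : g'.comp (toCompl D r z) = D.hat r n g) :
    (conv Δ f' g').comp (toCompl D r z) =
      D.hat r n (WithConv.toConv f * WithConv.toConv g).ofConv := by
  obtain ⟨T₀, _, f₀', g₀', -, hf₀, hg₀, -, rfl, rfl, -⟩ := hz.exists_finite_factor hf hg hg
  rw [AlgHom.comp_assoc] at ha hb
  obtain ⟨f₀, rfl, hf'⟩ := exists_factor_hat T₀ ha
  obtain ⟨g₀, rfl, hg'⟩ := exists_factor_hat T₀ hb
  rw [← comp_conv Δ hf₀ hg₀, AlgHom.comp_assoc,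
    hΔ.conv_level_of_finite hf₀ hg₀ (a := WithConv.toConv f₀) (b := WithConv.toConv g₀) hf' hg']
  exact comp_hat_mul T₀.val (comp_hat D r T₀.val n f₀) (comp_hat D r T₀.val n g₀)

variable (hcont : ∀ n : ℕ, ∃ m : ℕ, ∀ b ∈ D.definingIdeal r z ^ m,
        evalₐ (tensorIdeal (D.base r) (D.definingIdeal r z)) n (Δ b) = 0)
  [∀ v, IsLocalRing (G₀'.A v)]
  (hz : D.IsParameter r z) (hp : (p : R) ∈ maximalIdeal R)
  {T : Type u} [CommRing T] [Algebra (D.base r) T]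
  {f : D.completedRing r z →ₐ[D.base r] T} (hf : IsContinuous (D.definingIdeal r z) f)

include hΔ hp hf in
-- Adding α u is translation by α u: both sides agree on small algebras by the group law of a level.
-- The counit law, additivity of θ and the translation rule for the coordinates are all special
-- cases.
theorem IsComul.conv_theta (α : ZMod (p ^ r)) :
    (conv Δ ((Algebra.ofId (D.base r) T).comp (hz.theta α)) f).comp (toCompl D r z) =
      (f.comp (toCompl D r z)).comp (D.shift r α) := by
  obtain ⟨T₀, _, f₀, -, -, hf₀, -, -, rfl, -, -⟩ := hz.exists_finite_factor hf hf hf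
  have hc := (hz.isContinuous_theta α).comp (Algebra.ofId (D.base r) T₀)
  rw [← comp_ofId T₀.val, ← comp_conv Δ hc hf₀, AlgHom.comp_assoc, AlgHom.comp_assoc,
    AlgHom.comp_assoc]
  congr 1
  refine hom_ext_of_small fun T' _ _ _ _ hT' π => ?_
  rw [← AlgHom.comp_assoc, ← AlgHom.comp_assoc, ← AlgHom.comp_assoc, comp_conv Δ hc hf₀, comp_ofId]
  obtain ⟨M, hM⟩ := hz.exists_hat_compl hp hT' (hf₀.comp π)
  obtain ⟨a, ha⟩ := hM M le_rfl
  rw [hΔ.conv_hat hT' ((hz.isContinuous_theta α).comp _) (hf₀.comp π)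
    (hz.ofId_comp_theta_comp α M) (b := WithConv.toConv a) ha, ha, mul_comm]
  exact (D.hat_comp_shift r α M (WithConv.toConv a)).symm

include hΔ hp hf hcont in
theorem IsComul.conv_theta_zero :
    conv Δ ((Algebra.ofId (D.base r) T).comp (hz.theta 0)) f = f := by
  refine compl_hom_ext (isContinuous_conv hcont ((hz.isContinuous_theta 0).comp _) hf) hf ?_
  rw [hΔ.conv_theta hz hp hf, shift_zero, AlgHom.comp_id]

include hΔ hp hcont in
theorem IsComul.conv_theta_theta (α β : ZMod (p ^ r)) :
    conv Δ (hz.theta α) (hz.theta β) = hz.theta (α + β) := by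
  have h := hΔ.conv_theta hz hp (hz.isContinuous_theta β) α
  rw [show (Algebra.ofId (D.base r) (D.base r)).comp (hz.theta α) = hz.theta α from rfl] at h
  refine compl_hom_ext (isContinuous_conv hcont (hz.isContinuous_theta α) (hz.isContinuous_theta β))
    (hz.isContinuous_theta _) (h.trans (AlgHom.ext fun x => ?_))
  rw [hz.theta_comp, hz.theta_comp, add_comm]
  exact D.evalAt_shift r β α x

include hΔ hp hf in
theorem IsComul.conv_theta_translate (α β : ZMod (p ^ r)) :
    conv Δ ((Algebra.ofId (D.base r) T).comp (hz.theta α)) f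
      (toCompl D r z (D.translate r z β)) = f (toCompl D r z (D.translate r z (β - α))) := by
  refine (DFunLike.congr_fun (hΔ.conv_theta hz hp hf α) _).trans ?_
  rw [AlgHom.comp_apply, shift_toProductRing, shift_shift, shift_toProductRing, neg_sub,
    sub_eq_add_neg]
  rfl

include hΔ hp hf hcont in
theorem IsComul.conv_antipode {S : D.completedRing r z →ₐ[D.base r] D.completedRing r z}
    (hS : ∀ n : ℕ, ∃ m : ℕ, D.definingIdeal r z ^ m ≤ (D.definingIdeal r z ^ n).comap S)
    (hS' : S.comp (toCompl D r z) = (toCompl D r z).comp (D.inversion r)) :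
    conv Δ (f.comp S) f = (Algebra.ofId (D.base r) T).comp (hz.theta 0) := by
  have hfS : ∀ {T : Type u} [CommRing T] [Algebra (D.base r) T]
      {f : D.completedRing r z →ₐ[D.base r] T}, IsContinuous (D.definingIdeal r z) f →
      IsContinuous (D.definingIdeal r z) (f.comp S) := fun {T} _ _ f hf => by
    obtain ⟨n, hn⟩ := hf
    obtain ⟨m, hm⟩ := hS n
    exact ⟨m, fun b hb => hn (hm hb)⟩
  obtain ⟨T₀, _, f₀, -, -, hf₀, -, -, rfl, -, -⟩ := hz.exists_finite_factor hf hf hf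
  rw [← comp_ofId T₀.val, AlgHom.comp_assoc, ← comp_conv Δ (hfS hf₀) hf₀]
  congr 1
  refine hom_ext_of_small fun T' _ _ _ _ hT' π => ?_
  rw [comp_conv Δ (hfS hf₀) hf₀, comp_ofId, ← AlgHom.comp_assoc]
  obtain ⟨M, hM⟩ := hz.exists_hat_compl hp hT' (hf₀.comp π)
  obtain ⟨a, ha⟩ := hM M le_rfl
  have ha' : ((π.comp f₀).comp S).comp (toCompl D r z) = D.hat r M
      (a.comp (invHom R (D.level r M) : D.level r M →ₐ[R] D.level r M)) := by
    rw [AlgHom.comp_assoc, hS', ← AlgHom.comp_assoc, ha, hat_comp_inversion]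
  refine compl_hom_ext (isContinuous_conv hcont (hfS (hf₀.comp π)) (hf₀.comp π))
    ((hz.isContinuous_theta 0).comp _) ?_
  rw [hΔ.conv_hat hT' (hfS (hf₀.comp π)) (hf₀.comp π)
    (a := WithConv.toConv (a.comp (invHom R (D.level r M) : D.level r M →ₐ[R] D.level r M)))
    (b := WithConv.toConv a) ha' ha, mul_comm, mul_comp_invHom, hz.ofId_comp_theta_comp 0 M,
    charPoint_zero]

end identities

end PDivGroup.PushoutDiagram

/-! ### The equivariant formal group law -/

theorem EquivariantFGL.ext {A : Type} [AddCommGroup A] [Fintype A] {k : Type u} [CommRing k]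
    {B : Type u} [CommRing B] [Algebra k B] {I : Ideal B} {F F' : EquivariantFGL A k I}
    (h : F.comul = F'.comul) (hθ : F.θ = F'.θ) (hx : F.x = F'.x) : F = F' := by
  cases F
  cases F'
  cases h
  cases hθ
  cases hx
  rfl

namespace PDivGroup.PushoutDiagram

open HopfGroup IsLocalRing FormalHopf AdicCompletion

variable {R : Type u} [CommRing R] {p : ℕ} {G₀ G G₀' : PDivGroup R p} {ι : Hom G₀ G}
  {ρ : Hom G₀ G₀'} {D : PushoutDiagram ι ρ} {r : ℕ} {z : D.coordRing'' r}
  [NeZero (p ^ r)]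

theorem definingIdeal_eq :
    D.definingIdeal r z = Ideal.span {∏ α, toCompl D r z (D.translate r z α)} := by
  refine (Ideal.map_span _ _).trans ?_
  rw [Set.image_singleton]
  exact congrArg (fun y => Ideal.span {y}) (map_prod (toCompl D r z) _ _)

theorem comp_toCompl_eq_hat {T : Type u} [CommRing T] [Algebra (D.base r) T] [Algebra R T]
    [IsScalarTower R (D.base r) T] {f' : D.completedRing r z →ₐ[D.base r] T} {n : ℕ}
    {f : D.level r n →ₐ[R] T} (h : ∀ a, f' (D.toCompletedRing r z a) = f (a.1 n)) :
    f'.comp (toCompl D r z) = D.hat r n f :=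
  productRing_hom_ext fun a => (h a).trans (D.hat_toProductRing r n f a).symm

/-- The ideal of definition is contained in the span of the α-th translate, so an element of the
completion may be replaced by one of the uncompleted ring, where the kernel is known. -/
theorem IsParameter.ker_theta (hz : D.IsParameter r z) (α : ZMod (p ^ r)) :
    RingHom.ker (hz.theta α) = Ideal.span {toCompl D r z (D.translate r z α)} := by
  refine le_antisymm (fun b hb => ?_) ?_
  · obtain ⟨s, hs⟩ := exists_sub_mem (k := D.base r) (D.translateIdeal r z) fg_translateIdeal 1 b
    have hI : D.definingIdeal r z ≤ Ideal.span {toCompl D r z (D.translate r z α)} := by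
      rw [definingIdeal_eq, Ideal.span_singleton_le_span_singleton]
      exact Finset.dvd_prod_of_mem _ (Finset.mem_univ α)
    rw [pow_one] at hs
    have h1 : hz.theta α (b - toCompl D r z s) = 0 := by
      have h2 := Ideal.mem_span_singleton.1 (hI hs)
      obtain ⟨c, hc⟩ := h2
      refine (congrArg _ hc).trans ?_
      rw [map_mul, hz.theta_toCompl, hz.evalAt_translate, zero_mul]
    have h3 : D.evalAt r α s = 0 := by
      rw [map_sub, RingHom.mem_ker.1 hb, zero_sub, neg_eq_zero, hz.theta_toCompl] at h1
      exact h1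
    obtain ⟨c, rfl⟩ := (hz.evalAt_eq_zero_iff α s).1 h3
    have h4 := Ideal.add_mem _ (hI hs) (Ideal.mem_span_singleton.2
      ((map_dvd (toCompl D r z) (dvd_mul_right (D.translate r z α) c))))
    have h5 := sub_add_cancel b (toCompl D r z (D.translate r z α * c))
    exact h5 ▸ h4
  · rw [Ideal.span_singleton_le_iff_mem, RingHom.mem_ker, hz.theta_toCompl, hz.evalAt_translate]

/-- The translate is one factor of the divisor, so cancelling it costs a single power: the product
is read modulo the (n+1)-st power to conclude vanishing modulo the n-th. -/
theorem IsParameter.toCompl_translate_regular [IsLocalRing R] [IsNoetherianRing R]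
    [IsAdicComplete (maximalIdeal R) R] (hdim : G₀'.IsOneDimensional) (hz : D.IsParameter r z)
    (α : ZMod (p ^ r)) : toCompl D r z (D.translate r z α) ∈ nonZeroDivisors (D.completedRing r z) := by
  refine mem_nonZeroDivisors_iff_right.2 fun b hb => ext_evalₐ fun n => ?_
  obtain ⟨s, rfl⟩ := mk_surjective (D.translateIdeal r z) (D.productRing r) b
  have h1 := congrArg (evalₐ (D.translateIdeal r z) (n + 1)) hb
  rw [map_mul, evalₐ_toCompletion, evalₐ_mk, ← map_mul, _root_.map_zero,
    Ideal.Quotient.eq_zero_iff_mem, mem_translateIdeal_pow] at h1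
  obtain ⟨c, hc⟩ := h1
  obtain ⟨g, hg⟩ := translate_dvd_divisor (z := z) α
  have h2 : D.translate r z α * (s.val (n + 1) - divisor D r z ^ n * g * c) = 0 := by
    rw [mul_sub, mul_comm _ (s.val (n + 1)), hc, pow_succ]
    nth_rw 2 [hg]
    ring
  have h3 := sub_eq_zero.1 (hz.translate_regular hdim α h2)
  rw [evalₐ_mk, _root_.map_zero, ← AdicCompletion.Ideal.mk_eq_mk _ (Nat.le_succ n) s,
    Ideal.Quotient.eq_zero_iff_mem, mem_translateIdeal_pow]
  exact ⟨g * c, by rw [h3, mul_assoc]⟩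

section existence

variable [IsLocalRing R] [IsNoetherianRing R] [IsAdicComplete (maximalIdeal R) R]
  [∀ v, IsLocalRing (G₀'.A v)]

theorem IsParameter.exists_equivariantFGL (hdim : G₀'.IsOneDimensional) (hz : D.IsParameter r z)
    (hp : (p : R) ∈ maximalIdeal R) :
    ∃ F : EquivariantFGL (ZMod (p ^ r)) (D.base r) (D.definingIdeal r z), D.IsInduced r F := by
  obtain ⟨Δ, hΔ, hcont⟩ := hz.exists_comul hp
  obtain ⟨S, hS, hS'⟩ := hz.exists_inversion
  refine ⟨{
    comul := Δ
    θ := hz.theta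
    x := fun α => toCompl D r z (D.translate r z α)
    isAdicComplete := isAdicComplete_extendedIdeal _ fg_translateIdeal
    ideal_eq := definingIdeal_eq
    regular := hz.toCompl_translate_regular hdim
    ker_θ := hz.ker_theta
    continuous_comul := hcont
    coassoc := fun T _ _ f g h hf hg hh => hΔ.conv_assoc hcont hz hp hf hg hh
    cocomm := fun T _ _ f g hf hg => hΔ.conv_comm hcont hz hp hf hg
    counit := fun T _ _ f hf => hΔ.conv_theta_zero hcont hz hp hf
    antipode := ⟨S, hS, fun T _ _ f hf => hΔ.conv_antipode hcont hz hp hf hS hS'⟩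
    θ_add := hΔ.conv_theta_theta hcont hz hp
    x_translate := fun T _ _ f hf α β => hΔ.conv_theta_translate hz hp hf α β }, ?_⟩
  refine ⟨fun T _ _ _ _ f' g' hf' hg' n f g hf hg a => ?_, fun α n a => ?_, fun α => rfl, ?_⟩
  · have h := hΔ.conv_level hz hf' hg' (comp_toCompl_eq_hat hf) (comp_toCompl_eq_hat hg)
    exact (DFunLike.congr_fun h _).trans (D.hat_toProductRing r n _ a)
  · exact (hz.theta_toCompl α _).trans (D.evalAt_toProductRing r α n a)
  · change toCompl D r z (D.translate r z 0) = toCompl D r z (D.toProductRing r z)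
    rw [shift_toProductRing, neg_zero, shift_zero]
    rfl

end existence

/-! ### Uniqueness of the induced structure. -/

section uniqueness

variable {F F' : EquivariantFGL (ZMod (p ^ r)) (D.base r) (D.definingIdeal r z)}

theorem IsInduced.isContinuous_θ (F : EquivariantFGL (ZMod (p ^ r)) (D.base r) (D.definingIdeal r z))
    (α : ZMod (p ^ r)) : IsContinuous (D.definingIdeal r z) (F.θ α) := by
  refine ⟨1, ?_⟩
  rw [pow_one, F.ker_θ]
  refine F.ideal_eq.le.trans ?_
  rw [Ideal.span_singleton_le_span_singleton]
  exact Finset.dvd_prod_of_mem _ (Finset.mem_univ α)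

theorem IsInduced.θ_eq_θ (h : D.IsInduced r F) (h' : D.IsInduced r F') : F.θ = F'.θ :=
  funext fun α => compl_hom_ext (isContinuous_θ F α) (isContinuous_θ F' α)
    (productRing_hom_ext fun a => (h.θ_eq α 0 a).trans (h'.θ_eq α 0 a).symm)

variable [IsLocalRing R]

/-- The condition on sums of level points is applied to the images of the two universal inclusions,
whose convolution is a truncation of the comultiplication. -/
theorem IsInduced.isComul (h : D.IsInduced r F) : IsComul F.comul := by
  intro n T' _ _ _ _ hT' π M a b ha hb
  have hl := isContinuous_inl (k := D.base r) (D.definingIdeal r z) n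
  have hr := isContinuous_inr (k := D.base r) (D.definingIdeal r z) n
  have h1 : tensorLift (π.comp (inl (D.definingIdeal r z) n))
      (π.comp (inr (D.definingIdeal r z) n)) = π.comp (Ideal.Quotient.mkₐ _ _) := by
    rw [← tensorLift_inl_inr]
    ext <;> simp [tensorLift]
  have hn : tensorIdeal (D.base r) (D.definingIdeal r z) ^ n ≤ RingHom.ker
      (tensorLift (π.comp (inl (D.definingIdeal r z) n)) (π.comp (inr (D.definingIdeal r z) n))) := by
    intro y hy
    rw [h1, RingHom.mem_ker, AlgHom.comp_apply]
    exact (congrArg π (Ideal.Quotient.eq_zero_iff_mem.2 hy)).trans (_root_.map_zero π)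
  have h2 : π.comp (((evalₐ (tensorIdeal (D.base r) (D.definingIdeal r z)) n).restrictScalars
      (D.base r)).comp F.comul) =
      conv F.comul (π.comp (inl (D.definingIdeal r z) n)) (π.comp (inr (D.definingIdeal r z) n)) := by
    rw [conv_eq _ _ _ n hn, ← AlgHom.comp_assoc]
    congr 1
    refine AlgHom.ext fun y => ?_
    obtain ⟨y', hy'⟩ := Ideal.Quotient.mk_surjective
      (evalₐ (tensorIdeal (D.base r) (D.definingIdeal r z)) n y)
    change π (evalₐ _ n y) = Ideal.Quotient.liftₐ _ _ (fun _ ha => hn ha) (evalₐ _ n y)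
    rw [← hy']
    change _ = tensorLift _ _ y'
    rw [h1]
    rfl
  rw [← AlgHom.comp_assoc, h2]
  refine comp_toCompl_eq_hat fun x => h.comul_eq T' _ _ (hl.comp π) (hr.comp π) M a.ofConv b.ofConv
    (fun y => ?_) (fun y => ?_) x
  · exact (DFunLike.congr_fun ha (D.toProductRing r y)).trans (D.hat_toProductRing r M _ y)
  · exact (DFunLike.congr_fun hb (D.toProductRing r y)).trans (D.hat_toProductRing r M _ y)

variable [IsNoetherianRing R] [IsAdicComplete (maximalIdeal R) R] [∀ v, IsLocalRing (G₀'.A v)]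

/-- Each truncation of either comultiplication is continuous and is the sum of the two inclusions in
a finite k-algebra, and such a sum is unique. -/
theorem IsInduced.eq (hz : D.IsParameter r z) (hp : (p : R) ∈ maximalIdeal R)
    (h : D.IsInduced r F) (h' : D.IsInduced r F') : F = F' := by
  refine EquivariantFGL.ext (AlgHom.ext fun b => ext_evalₐ fun n => ?_) (h.θ_eq_θ h')
    (funext fun α => (h.x_eq α).trans (h'.x_eq α).symm)
  have hc : ∀ F : EquivariantFGL (ZMod (p ^ r)) (D.base r) (D.definingIdeal r z),
      IsContinuous (D.definingIdeal r z)
        (((evalₐ (tensorIdeal (D.base r) (D.definingIdeal r z)) n).restrictScalars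
          (D.base r)).comp F.comul) := fun F => F.continuous_comul n
  have := hz.finite_tensorQuotient n
  exact DFunLike.congr_fun (compl_hom_ext (hc F) (hc F') (hz.isSum_unique hp
    (isNilpotent_divisor (isContinuous_inl _ n)) (isNilpotent_divisor (isContinuous_inr _ n))
    (h.isComul n) (h'.isComul n))) b

end uniqueness

end PDivGroup.PushoutDiagram

/-- The section of the projection makes O(G₀') a quotient of the local ring O(G₀); the counit shows
that it is nonzero. -/
theorem PDivGroup.IsIdentityComponent.isLocalRing_summand {R : Type u} [CommRing R] [Nontrivial R]
    {p : ℕ} {G G₀ G₀' : PDivGroup R p} {ι : Hom G₀ G} (hι : IsIdentityComponent ι) {ρ : Hom G₀ G₀'}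
    (hρ : IsSummandProj ρ) (v : ℕ) : IsLocalRing (G₀'.A v) := by
  obtain ⟨s, hs⟩ := hρ
  have := hι.isLocalRing v
  have : Nontrivial (G₀'.A v) := (Bialgebra.counitAlgHom R (G₀'.A v)).toRingHom.domain_nontrivial
  exact IsLocalRing.of_surjective' (s.app v : G₀.A v →+* G₀'.A v) fun a => ⟨_, hs v a⟩

theorem IsLocalRing.natCast_mem_maximalIdeal (R : Type u) [CommRing R] [IsLocalRing R] (p : ℕ)
    [CharP (ResidueField R) p] : (p : R) ∈ maximalIdeal R := by
  rw [← residue_eq_zero_iff, map_natCast, CharP.cast_eq_zero]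
end

theorem mainTheorem4 {R : Type u} [CommRing R] [IsLocalRing R] [IsNoetherianRing R]
    [IsAdicComplete (IsLocalRing.maximalIdeal R) R] (p : ℕ) [Fact p.Prime]
    [CharP (IsLocalRing.ResidueField R) p] [PerfectField (IsLocalRing.ResidueField R)]
    {G G₀ G₀' : PDivGroup R p}
    (ι : PDivGroup.Hom G₀ G) (hι : PDivGroup.IsIdentityComponent ι)
    (ρ : PDivGroup.Hom G₀ G₀') (hρ : PDivGroup.IsSummandProj ρ)
    (hdim : G₀'.IsOneDimensional) (r : ℕ) :
    Nonempty (PDivGroup.PushoutDiagram ι ρ) ∧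
    ∀ D : PDivGroup.PushoutDiagram ι ρ,
      (∃ z : D.coordRing'' r, D.IsParameter r z) ∧
      ∀ z : D.coordRing'' r, D.IsParameter r z →
        ∃! F : EquivariantFGL (ZMod (p ^ r)) (D.base r) (D.definingIdeal r z),
          D.IsInduced r F := by
  refine ⟨?_, fun D => ?_⟩
  · obtain ⟨s, hs⟩ := hρ
    exact ⟨PDivGroup.pushoutDiagram hι ρ s hs⟩
  · refine ⟨?_, fun z hz => ?_⟩
    · obtain ⟨t, -, ht⟩ := D.exists_parameter r hdim
      exact ⟨_, ht⟩
    · have := hι.isLocalRing_summand hρ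
      have : NeZero (p ^ r) := ⟨pow_ne_zero r (Fact.out : p.Prime).ne_zero⟩
      have hp := IsLocalRing.natCast_mem_maximalIdeal R p
      obtain ⟨F, hF⟩ := hz.exists_equivariantFGL hdim hp
      exact ⟨F, hF, fun F' hF' => hF'.eq hz hp hF⟩
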